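/- **Conventions.** All spaces $|\cdot|$ are classical geometric realisations. A (strict) double category $\mathscr C=[C_1\rightrightarrows C_0]$ is a category internal to small categories; its double nerve is the bisimplicial set $N_{nk}=N_k(N^v_n\mathscr C)$, where $N^v_n\mathscr C$ is the category of strings of $n$ vertically composable vertical morphisms and of vertically composable strings of $n$ 2-cells, and $|\mathscr C|$ is the total realisation of the double nerve (realisation of its diagonal). A small strict 2-category is regarded as a double category with only identity horizontal morphisms, and $|\cdot|$ is defined accordingly. Let $M$ be a small strict monoidal category (product written by juxtaposition, unit $e$) acting strictly on a small category $X$. * $\mathscr M\times X=[M\times X\rightrightarrows X]$ is the double category with source the projection, target the action, and vertical composition and identities given by the product and unit of $M$: its objects and horizontal morphisms are those of $X$, its vertical morphisms are $m\colon x\to mx$, and its 2-cells are the morphisms $(\alpha,f)\colon(m,x)\to(m',x')$ of $M\times X$. * $\mathscr M\ltimes X$ is the double category with the objects and horizontal morphisms of $X$, with vertical morphisms $x\to y$ the pairs $(m,\phi\colon mx\to y)$, and with 2-cells $(m,\phi)\to(m',\phi')$ the triples $(f\colon x\to x',\,g\colon y\to y',\,\alpha\colon m\to m')$ such that $\phi'\circ\alpha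 f=g\circ\phi$. Horizontal composition is coordinatewise; vertical composition is $(n,\psi)\circ(m,\phi)=(nm,\psi\circ n\phi)$ and $(g,h,\beta)\circ(f,g,\alpha)=(f,h,\beta\alpha)$; vertical identities are $(e,\mathrm{id}_x)$. * $\Phi\colon\mathscr M\times X\to\mathscr M\ltimes X$ is the double functor that is the identity on $X$ and sends $m\colon x\to mx$ to $(m,\mathrm{id}_{mx})$ and $(\alpha,f)$ to $(f,\alpha f,\alpha)$. * $Q(M,X)$ is the vertical 2-category of $\mathscr M\ltimes X$: the objects of $X$, the vertical morphisms of $\mathscr M\ltimes X$, and the 2-cells of $\mathscr M\ltimes X$ whose horizontal source and target are identities. * $|X|_{|M|}$ is the homotopy quotient of the induced action of the topological monoid $|M|$ on $|X|$, i.e. the geometric realisation of the simplicial space $[n]\mapsto|M|^n\times|X|$ (products of compactly generated spaces). * $B|M|$ is the classifying space of the topological monoid $|M|$: the geometric realisation of $[n]\mapsto|M|^n$, or equally the total realisation of the bar construction $B_\bullet M$, the simplicial category whose category of $n$-simplices is $M^n$; the statements below hold for both models. * $Q_2(M)=Q(M\times M^{\otimes\mathrm{op}},M)$ for the action $(a,b).m=a\otimes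 m\otimes b$, where $M^{\otimes\mathrm{op}}$ is $M$ with the reversed product. The 2-category $Q_2(M)$ is also defined if $M$ is not small. **Theorem.** 1. Let $M$ be a small strict monoidal category acting strictly on a small category $X$. Then $\Phi$ and the inclusion $Q(M,X)\to\mathscr M\ltimes X$ induce homotopy equivalences $$|\mathscr M\times X|\xrightarrow{\ \simeq\ }|\mathscr M\ltimes X|\xleftarrow{\ \simeq\ }|Q(M,X)|,$$ and $|X|_{|M|}$ is homotopy equivalent to $|Q(M,X)|$. 2. For every small strict monoidal category $M$, $B|M|$ is homotopy equivalent to $|Q_2(M)|$. 3. Let $M$ be an essentially small strict monoidal category. Then $M$ is monoidally equivalent to a small strict monoidal category and $Q_2(M)$ is equivalent (through a pseudofunctor which is an equivalence on hom-categories and essentially surjective up to equivalence) to a small strict 2-category; and for every small strict monoidal category $M'$ with a monoidal equivalence $M'\to M$ and every small strict 2-category $Q'$ with such an equivalence $Q'\to Q_2(M)$, $B|M'|$ is homotopy equivalent to $|Q'|$. In other words, $B|M|\simeq|Q_2(M)|$, where both sides are defined by the choice of equivalent small models. -/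

import Mathlib

set_option linter.unusedVariables false

open CategoryTheory MonoidalCategory Opposite

universe u v w wt

/-- A (small, strict) double category, i.e. a category internal to categories.  `Obj` with its
category structure is the category of objects and horizontal morphisms, `Ver a b` is the set of
vertical morphisms and `Sq f p q g` is the set of 2-cells with top `f`, left side `p`, right side `q`
and bottom `g`, so that the category of morphisms has the vertical morphisms as objects and the
2-cells `p ⟶ q` as morphisms (composition `hcomp`). Laws relating 2-cells whose boundaries are only
propositionally equal are stated with `HEq`. -/
structure DoubleCat where
  Obj : Type u
  [horCat : Category.{u} Obj]
  Ver : Obj → Obj → Type u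
  vid (a : Obj) : Ver a a
  vcomp {a b c : Obj} (p : Ver a b) (q : Ver b c) : Ver a c
  vid_vcomp {a b : Obj} (p : Ver a b) : vcomp (vid a) p = p
  vcomp_vid {a b : Obj} (p : Ver a b) : vcomp p (vid b) = p
  vassoc {a b c d : Obj} (p : Ver a b) (q : Ver b c) (r : Ver c d) :
    vcomp (vcomp p q) r = vcomp p (vcomp q r)
  Sq {a b c d : Obj} (f : a ⟶ b) (p : Ver a c) (q : Ver b d) (g : c ⟶ d) : Type u
  hid {a c : Obj} (p : Ver a c) : Sq (𝟙 a) p p (𝟙 c)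
  hcomp {a b e c d k : Obj} {f : a ⟶ b} {f' : b ⟶ e} {p : Ver a c} {q : Ver b d} {r : Ver e k}
    {g : c ⟶ d} {g' : d ⟶ k} (α : Sq f p q g) (β : Sq f' q r g') : Sq (f ≫ f') p r (g ≫ g')
  sqVid {a b : Obj} (f : a ⟶ b) : Sq f (vid a) (vid b) f
  sqVcomp {a b c d e k : Obj} {f : a ⟶ b} {p : Ver a c} {q : Ver b d} {g : c ⟶ d}
    {p' : Ver c e} {q' : Ver d k} {h : e ⟶ k} (α : Sq f p q g) (β : Sq g p' q' h) :
    Sq f (vcomp p p') (vcomp q q') h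
  hid_hcomp {a b c d : Obj} {f : a ⟶ b} {p : Ver a c} {q : Ver b d} {g : c ⟶ d}
    (α : Sq f p q g) : HEq (hcomp (hid p) α) α
  hcomp_hid {a b c d : Obj} {f : a ⟶ b} {p : Ver a c} {q : Ver b d} {g : c ⟶ d}
    (α : Sq f p q g) : HEq (hcomp α (hid q)) α
  hassoc {a₁ a₂ a₃ a₄ b₁ b₂ b₃ b₄ : Obj} {f₁ : a₁ ⟶ a₂} {f₂ : a₂ ⟶ a₃} {f₃ : a₃ ⟶ a₄}
    {p₁ : Ver a₁ b₁} {p₂ : Ver a₂ b₂} {p₃ : Ver a₃ b₃} {p₄ : Ver a₄ b₄}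
    {g₁ : b₁ ⟶ b₂} {g₂ : b₂ ⟶ b₃} {g₃ : b₃ ⟶ b₄}
    (α : Sq f₁ p₁ p₂ g₁) (β : Sq f₂ p₂ p₃ g₂) (γ : Sq f₃ p₃ p₄ g₃) :
    HEq (hcomp (hcomp α β) γ) (hcomp α (hcomp β γ))
  sqVid_sqVcomp {a b c d : Obj} {f : a ⟶ b} {p : Ver a c} {q : Ver b d} {g : c ⟶ d}
    (α : Sq f p q g) : HEq (sqVcomp (sqVid f) α) α
  sqVcomp_sqVid {a b c d : Obj} {f : a ⟶ b} {p : Ver a c} {q : Ver b d} {g : c ⟶ d}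
    (α : Sq f p q g) : HEq (sqVcomp α (sqVid g)) α
  sqVassoc {a₁ a₂ a₃ a₄ b₁ b₂ b₃ b₄ : Obj} {p₁ : Ver a₁ a₂} {p₂ : Ver a₂ a₃} {p₃ : Ver a₃ a₄}
    {q₁ : Ver b₁ b₂} {q₂ : Ver b₂ b₃} {q₃ : Ver b₃ b₄}
    {f₁ : a₁ ⟶ b₁} {f₂ : a₂ ⟶ b₂} {f₃ : a₃ ⟶ b₃} {f₄ : a₄ ⟶ b₄}
    (α : Sq f₁ p₁ q₁ f₂) (β : Sq f₂ p₂ q₂ f₃) (γ : Sq f₃ p₃ q₃ f₄) :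
    HEq (sqVcomp (sqVcomp α β) γ) (sqVcomp α (sqVcomp β γ))
  sqVid_id (a : Obj) : sqVid (𝟙 a) = hid (vid a)
  sqVid_comp {a b c : Obj} (f : a ⟶ b) (g : b ⟶ c) :
    sqVid (f ≫ g) = hcomp (sqVid f) (sqVid g)
  hid_vcomp {a b c : Obj} (p : Ver a b) (q : Ver b c) :
    hid (vcomp p q) = sqVcomp (hid p) (hid q)
  interchange {a₁ a₂ a₃ b₁ b₂ b₃ c₁ c₂ c₃ : Obj}
    {f₁ : a₁ ⟶ a₂} {f₂ : a₂ ⟶ a₃} {g₁ : b₁ ⟶ b₂} {g₂ : b₂ ⟶ b₃} {h₁ : c₁ ⟶ c₂} {h₂ : c₂ ⟶ c₃}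
    {p₁ : Ver a₁ b₁} {p₂ : Ver a₂ b₂} {p₃ : Ver a₃ b₃}
    {q₁ : Ver b₁ c₁} {q₂ : Ver b₂ c₂} {q₃ : Ver b₃ c₃}
    (α : Sq f₁ p₁ p₂ g₁) (β : Sq f₂ p₂ p₃ g₂) (γ : Sq g₁ q₁ q₂ h₁) (δ : Sq g₂ q₂ q₃ h₂) :
    sqVcomp (hcomp α β) (hcomp γ δ) = hcomp (sqVcomp α γ) (sqVcomp β δ)

namespace DoubleCat

attribute [instance] DoubleCat.horCat

/-- The objects of a double category, with the vertical morphisms as morphisms. -/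
def VCat (C : DoubleCat.{u}) : Type u := C.Obj

instance (C : DoubleCat.{u}) : Category.{u} C.VCat where
  Hom a b := C.Ver a b
  id a := C.vid a
  comp p q := C.vcomp p q
  id_comp p := C.vid_vcomp p
  comp_id p := C.vcomp_vid p
  assoc p q r := C.vassoc p q r

variable {C : DoubleCat.{u}}

/-- Objects of the `n`-th category of the vertical nerve: strings of `n` composable vertical
morphisms. -/
structure VNerveObj (C : DoubleCat.{u}) (n : ℕ) : Type u where
  chain : ComposableArrows C.VCat n

/-- The `i`-th object in a string of vertical morphisms. -/
def VNerveObj.pt {n : ℕ} (F : VNerveObj C n) (i : Fin (n + 1)) : C.Obj := F.chain.obj i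

/-- The vertical morphism from the `i`-th to the `j`-th object in a string. -/
def VNerveObj.ver {n : ℕ} (F : VNerveObj C n) {i j : Fin (n + 1)} (h : i ⟶ j) :
    C.Ver (F.pt i) (F.pt j) := F.chain.map h

lemma VNerveObj.ver_id {n : ℕ} (F : VNerveObj C n) (i : Fin (n + 1)) :
    F.ver (𝟙 i) = C.vid (F.pt i) := F.chain.map_id i

lemma VNerveObj.ver_comp {n : ℕ} (F : VNerveObj C n) {i j k : Fin (n + 1)}
    (h : i ⟶ j) (h' : j ⟶ k) : F.ver (h ≫ h') = C.vcomp (F.ver h) (F.ver h') :=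
  F.chain.map_comp _ _

/-- Morphisms in the `n`-th category of the vertical nerve: vertically composable strings of
2-cells (given together with all their vertical composites). -/
structure VNerveHom {n : ℕ} (F G : VNerveObj C n) : Type u where
  app (i : Fin (n + 1)) : F.pt i ⟶ G.pt i
  sq {i j : Fin (n + 1)} (h : i ⟶ j) : C.Sq (app i) (F.ver h) (G.ver h) (app j)
  sq_id (i : Fin (n + 1)) : HEq (sq (𝟙 i)) (C.sqVid (app i))
  sq_comp {i j k : Fin (n + 1)} (h : i ⟶ j) (h' : j ⟶ k) :
    HEq (sq (h ≫ h')) (C.sqVcomp (sq h) (sq h'))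

lemma VNerveHom.ext {n : ℕ} {F G : VNerveObj C n} {s t : VNerveHom F G}
    (h₁ : ∀ i, s.app i = t.app i)
    (h₂ : ∀ {i j : Fin (n + 1)} (h : i ⟶ j), HEq (s.sq h) (t.sq h)) : s = t := by
  obtain ⟨a, b, _, _⟩ := s
  obtain ⟨a', b', _, _⟩ := t
  obtain rfl : a = a' := funext h₁
  obtain rfl : @b = @b' := by
    funext i j h
    exact eq_of_heq (h₂ h)
  rfl

lemma hcomp_heq {a b e c d k : C.Obj} {f : a ⟶ b} {f' : b ⟶ e} {g : c ⟶ d} {g' : d ⟶ k}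
    {p p₁ : C.Ver a c} {q q₁ : C.Ver b d} {r r₁ : C.Ver e k}
    {α : C.Sq f p q g} {α₁ : C.Sq f p₁ q₁ g} {β : C.Sq f' q r g'} {β₁ : C.Sq f' q₁ r₁ g'}
    (hp : p = p₁) (hq : q = q₁) (hr : r = r₁) (hα : HEq α α₁) (hβ : HEq β β₁) :
    HEq (C.hcomp α β) (C.hcomp α₁ β₁) := by
  subst hp hq hr
  obtain rfl := eq_of_heq hα
  obtain rfl := eq_of_heq hβ
  rfl

lemma hid_heq {a c : C.Obj} {p p₁ : C.Ver a c} (hp : p = p₁) : HEq (C.hid p) (C.hid p₁) := by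
  subst hp; rfl

instance (n : ℕ) : Category.{u} (VNerveObj C n) where
  Hom F G := VNerveHom F G
  id F :=
    { app i := 𝟙 (F.pt i)
      sq h := C.hid (F.ver h)
      sq_id i := by rw [C.sqVid_id]; exact hid_heq (F.ver_id i)
      sq_comp h h' := by rw [← C.hid_vcomp]; exact hid_heq (F.ver_comp h h') }
  comp s t :=
    { app i := s.app i ≫ t.app i
      sq h := C.hcomp (s.sq h) (t.sq h)
      sq_id i := by
        rw [C.sqVid_comp]
        exact hcomp_heq (VNerveObj.ver_id _ i) (VNerveObj.ver_id _ i) (VNerveObj.ver_id _ i)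
          (s.sq_id i) (t.sq_id i)
      sq_comp h h' := by
        rw [C.interchange]
        exact hcomp_heq (VNerveObj.ver_comp _ h h') (VNerveObj.ver_comp _ h h')
          (VNerveObj.ver_comp _ h h') (s.sq_comp h h') (t.sq_comp h h') }
  id_comp s := VNerveHom.ext (fun i ↦ Category.id_comp _) (fun h ↦ C.hid_hcomp _)
  comp_id s := VNerveHom.ext (fun i ↦ Category.comp_id _) (fun h ↦ C.hcomp_hid _)
  assoc s t r := VNerveHom.ext (fun i ↦ Category.assoc _ _ _) (fun h ↦ C.hassoc _ _ _)

/-- The simplicial structure maps of the vertical nerve. -/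
def vNerveMap (C : DoubleCat.{u}) {n k : SimplexCategory} (θ : k ⟶ n) :
    VNerveObj C n.len ⥤ VNerveObj C k.len where
  obj F := ⟨(SimplexCategory.toCat.map θ).toFunctor ⋙ F.chain⟩
  map s :=
    { app i := s.app (θ.toOrderHom i)
      sq h := s.sq ((SimplexCategory.toCat.map θ).toFunctor.map h)
      sq_id _ := s.sq_id _
      sq_comp _ _ := s.sq_comp _ _ }

/-- The vertical nerve of a double category, a simplicial category. -/
def verticalNerve (C : DoubleCat.{u}) : SimplexCategoryᵒᵖ ⥤ Cat.{u, u} where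
  obj n := Cat.of (VNerveObj C n.unop.len)
  map θ := (C.vNerveMap θ.unop).toCatHom

/-- The double nerve of a double category: the bisimplicial set obtained by applying the nerve
levelwise to the vertical nerve. -/
def doubleNerve (C : DoubleCat.{u}) : SimplexCategoryᵒᵖ ⥤ SSet.{u} :=
  C.verticalNerve ⋙ nerveFunctor.{u, u}

end DoubleCat

/-- The diagonal of a bisimplicial set. -/
def bisimplicialDiagonal : (SimplexCategoryᵒᵖ ⥤ SSet.{u}) ⥤ SSet.{u} where
  obj X :=
    { obj n := (X.obj n).obj n
      map θ := (X.map θ).app _ ≫ (X.obj _).map θ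
      map_id n := by simp
      map_comp θ ψ := by simp }
  map f :=
    { app n := (f.app n).app n
      naturality n k θ := by
        have h := congr_arg (fun t ↦ NatTrans.app t n) (f.naturality θ)
        simp only [NatTrans.comp_app] at h
        simp only [Category.assoc, reassoc_of% h, (f.app k).naturality] }

/-- The total geometric realisation of a bisimplicial set (realisation of the diagonal). -/
noncomputable def totalRealisation : (SimplexCategoryᵒᵖ ⥤ SSet.{u}) ⥤ TopCat.{u} :=
  bisimplicialDiagonal ⋙ SSet.toTop

/-- A (strict) double functor. -/
structure DoubleFunctor (C D : DoubleCat.{u}) where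
  hor : C.Obj ⥤ D.Obj
  ver {a b : C.Obj} (p : C.Ver a b) : D.Ver (hor.obj a) (hor.obj b)
  ver_vid (a : C.Obj) : ver (C.vid a) = D.vid (hor.obj a)
  ver_vcomp {a b c : C.Obj} (p : C.Ver a b) (q : C.Ver b c) :
    ver (C.vcomp p q) = D.vcomp (ver p) (ver q)
  sq {a b c d : C.Obj} {f : a ⟶ b} {p : C.Ver a c} {q : C.Ver b d} {g : c ⟶ d}
    (α : C.Sq f p q g) : D.Sq (hor.map f) (ver p) (ver q) (hor.map g)
  sq_hid {a c : C.Obj} (p : C.Ver a c) : HEq (sq (C.hid p)) (D.hid (ver p))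
  sq_hcomp {a b e c d k : C.Obj} {f : a ⟶ b} {f' : b ⟶ e} {p : C.Ver a c} {q : C.Ver b d}
    {r : C.Ver e k} {g : c ⟶ d} {g' : d ⟶ k} (α : C.Sq f p q g) (β : C.Sq f' q r g') :
    HEq (sq (C.hcomp α β)) (D.hcomp (sq α) (sq β))
  sq_sqVid {a b : C.Obj} (f : a ⟶ b) : HEq (sq (C.sqVid f)) (D.sqVid (hor.map f))
  sq_sqVcomp {a b c d e k : C.Obj} {f : a ⟶ b} {p : C.Ver a c} {q : C.Ver b d} {g : c ⟶ d}
    {p' : C.Ver c e} {q' : C.Ver d k} {h : e ⟶ k} (α : C.Sq f p q g) (β : C.Sq g p' q' h) :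
    HEq (sq (C.sqVcomp α β)) (D.sqVcomp (sq α) (sq β))

namespace DoubleFunctor

variable {C D : DoubleCat.{u}} (Φ : DoubleFunctor C D)

/-- The functor on vertical categories underlying a double functor. -/
def vFunctor : C.VCat ⥤ D.VCat where
  obj a := Φ.hor.obj a
  map p := Φ.ver p
  map_id a := Φ.ver_vid a
  map_comp p q := Φ.ver_vcomp p q

lemma sq_heq {a b c d : C.Obj} {f : a ⟶ b} {g : c ⟶ d} {p p₁ : C.Ver a c} {q q₁ : C.Ver b d}
    {α : C.Sq f p q g} {α₁ : C.Sq f p₁ q₁ g} (hp : p = p₁) (hq : q = q₁) (hα : HEq α α₁) :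
    HEq (Φ.sq α) (Φ.sq α₁) := by
  subst hp hq
  obtain rfl := eq_of_heq hα
  rfl

/-- The functor induced by a double functor on the `n`-th categories of the vertical nerves. -/
def vNerveFunctor (n : ℕ) : DoubleCat.VNerveObj C n ⥤ DoubleCat.VNerveObj D n where
  obj F := ⟨F.chain ⋙ Φ.vFunctor⟩
  map {F G} s :=
    { app i := Φ.hor.map (s.app i)
      sq h := Φ.sq (s.sq h)
      sq_id i := (Φ.sq_heq (F.ver_id i) (G.ver_id i) (s.sq_id i)).trans (Φ.sq_sqVid _)
      sq_comp h h' :=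
        (Φ.sq_heq (F.ver_comp h h') (G.ver_comp h h') (s.sq_comp h h')).trans
          (Φ.sq_sqVcomp _ _) }
  map_id F := DoubleCat.VNerveHom.ext (fun i ↦ Φ.hor.map_id _) (fun h ↦ Φ.sq_hid _)
  map_comp s t := DoubleCat.VNerveHom.ext (fun i ↦ Φ.hor.map_comp _ _) (fun h ↦ Φ.sq_hcomp _ _)

/-- The map induced by a double functor on vertical nerves. -/
def verticalNerveMap : C.verticalNerve ⟶ D.verticalNerve where
  app n := (Φ.vNerveFunctor n.unop.len).toCatHom

/-- The map induced by a double functor on double nerves. -/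
def doubleNerveMap : C.doubleNerve ⟶ D.doubleNerve :=
  Functor.whiskerRight Φ.verticalNerveMap nerveFunctor.{u, u}

end DoubleFunctor

/-- The geometric realisation of a double category. -/
noncomputable def DoubleCat.realisation (C : DoubleCat.{u}) : TopCat.{u} :=
  totalRealisation.obj C.doubleNerve

/-- The continuous map of geometric realisations induced by a double functor. -/
noncomputable def DoubleFunctor.realisationMap {C D : DoubleCat.{u}} (Φ : DoubleFunctor C D) :
    C.realisation ⟶ D.realisation :=
  totalRealisation.map Φ.doubleNerveMap

/-- A continuous map is a homotopy equivalence if it is the forward map of one. -/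
def IsHomotopyEquivalence {Y Z : TopCat.{u}} (f : Y ⟶ Z) : Prop :=
  ∃ e : ContinuousMap.HomotopyEquiv Y Z, e.toFun = f.hom

open scoped MonoidalLeftAction

/-- A monoidal category is strict if its associators and unitors are identities. -/
class StrictMonoidal (M : Type u) [Category.{v} M] [MonoidalCategory M] : Prop where
  tensor_assoc (a b c : M) : (a ⊗ b) ⊗ c = a ⊗ (b ⊗ c)
  unit_tensor (a : M) : 𝟙_ M ⊗ a = a
  tensor_unit (a : M) : a ⊗ 𝟙_ M = a
  associator_eq (a b c : M) : α_ a b c = eqToIso (tensor_assoc a b c)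
  leftUnitor_eq (a : M) : λ_ a = eqToIso (unit_tensor a)
  rightUnitor_eq (a : M) : ρ_ a = eqToIso (tensor_unit a)

/-- An action of a monoidal category on a category is strict if its structural isomorphisms
are identities. -/
class StrictAction (M : Type u) [Category.{v} M] [MonoidalCategory M] (X : Type w)
    [Category.{wt} X] [MonoidalLeftAction M X] : Prop where
  tensor_act (a b : M) (x : X) : (a ⊗ b) ⊙ₗ x = a ⊙ₗ (b ⊙ₗ x)
  unit_act (x : X) : 𝟙_ M ⊙ₗ x = x
  actionAssocIso_eq (a b : M) (x : X) : αₗ a b x = eqToIso (tensor_act a b x)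
  actionUnitIso_eq (x : X) : λₗ x = eqToIso (unit_act x)

section lemmas

variable {M : Type u} [Category.{v} M]

lemma heq_of_comp_eqToHom {a b a' b' : M} {f : a ⟶ b} {g : a' ⟶ b'} (ha : a = a') (hb : b = b')
    (h : f ≫ eqToHom hb = eqToHom ha ≫ g) : HEq f g := by
  subst ha hb
  simpa using h

lemma eq_conj_of_heq {a b a' b' : M} {f : a ⟶ b} {g : a' ⟶ b'} (ha : a = a') (hb : b' = b)
    (h : HEq f g) : f = eqToHom ha ≫ g ≫ eqToHom hb := by
  subst ha hb
  simpa using h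

variable [MonoidalCategory M] [StrictMonoidal M]

lemma tensorHom_assoc_heq {a a' b b' c c' : M} (f : a ⟶ a') (g : b ⟶ b') (h : c ⟶ c') :
    HEq ((f ⊗ₘ g) ⊗ₘ h) (f ⊗ₘ (g ⊗ₘ h)) := by
  refine heq_of_comp_eqToHom (StrictMonoidal.tensor_assoc _ _ _)
    (StrictMonoidal.tensor_assoc _ _ _) ?_
  simp [← eqToIso.hom, ← StrictMonoidal.associator_eq]

lemma id_unit_tensorHom_heq {a a' : M} (f : a ⟶ a') : HEq (𝟙 (𝟙_ M) ⊗ₘ f) f := by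
  refine heq_of_comp_eqToHom (StrictMonoidal.unit_tensor _) (StrictMonoidal.unit_tensor _) ?_
  simp [← eqToIso.hom, ← StrictMonoidal.leftUnitor_eq]

lemma tensorHom_id_unit_heq {a a' : M} (f : a ⟶ a') : HEq (f ⊗ₘ 𝟙 (𝟙_ M)) f := by
  refine heq_of_comp_eqToHom (StrictMonoidal.tensor_unit _) (StrictMonoidal.tensor_unit _) ?_
  simp [← eqToIso.hom, ← StrictMonoidal.rightUnitor_eq]

end lemmas

/-- The vertical morphisms `x → y` of `𝓜 ⋉ X`: pairs of an object `m` of `M` and a morphism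
`m x ⟶ y` of `X`. -/
structure LaxVer (M : Type u) [Category.{v} M] [MonoidalCategory M] {X : Type w}
    [Category.{wt} X] [MonoidalLeftAction M X] (x y : X) where
  obj : M
  hom : obj ⊙ₗ x ⟶ y

namespace LaxVer

variable {M : Type u} [Category.{v} M] [MonoidalCategory M] {X : Type w} [Category.{wt} X]
  [MonoidalLeftAction M X]

lemma ext_of_eq {x y : X} {p q : LaxVer M x y} (h : p.obj = q.obj)
    (h' : p.hom = eqToHom (by rw [h]) ≫ q.hom) : p = q := by
  obtain ⟨m, φ⟩ := p
  obtain ⟨n, ψ⟩ := q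
  obtain rfl : m = n := h
  obtain rfl : φ = ψ := by simpa using h'
  rfl

variable (M) in
/-- The vertical identity `(e, id_x)`. -/
def id (x : X) : LaxVer M x x := ⟨𝟙_ M, (λₗ x).hom⟩

/-- Vertical composition, `(n, ψ) ∘ (m, φ) = (n m, ψ ∘ n φ)`; the composite of `p` and then `q`. -/
def comp {x y z : X} (p : LaxVer M x y) (q : LaxVer M y z) : LaxVer M x z :=
  ⟨q.obj ⊗ p.obj, (αₗ q.obj p.obj x).hom ≫ q.obj ⊴ₗ p.hom ≫ q.hom⟩

lemma eqToHom_actionHomLeft {a b : M} (h : a = b) (x : X) :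
    eqToHom h ⊵ₗ x = eqToHom (by rw [h]) := by
  subst h; simp

variable [StrictMonoidal M]

lemma id_comp {x y : X} (p : LaxVer M x y) : (id M x).comp p = p := by
  refine ext_of_eq (StrictMonoidal.tensor_unit p.obj) ?_
  have h := MonoidalLeftAction.rightUnitor_actionHom p.obj x
  rw [StrictMonoidal.rightUnitor_eq, eqToIso.hom, eqToHom_actionHomLeft] at h
  simp [id, comp, h]

lemma comp_id {x y : X} (p : LaxVer M x y) : p.comp (id M y) = p := by
  refine ext_of_eq (StrictMonoidal.unit_tensor p.obj) ?_
  have h := MonoidalLeftAction.leftUnitor_actionHom p.obj x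
  rw [StrictMonoidal.leftUnitor_eq, eqToIso.hom, eqToHom_actionHomLeft] at h
  simp [id, comp, h]

lemma assoc {x y z t : X} (p : LaxVer M x y) (q : LaxVer M y z) (r : LaxVer M z t) :
    (p.comp q).comp r = p.comp (q.comp r) := by
  symm
  refine ext_of_eq (StrictMonoidal.tensor_assoc r.obj q.obj p.obj) ?_
  have h := MonoidalLeftAction.associator_actionHom r.obj q.obj p.obj x
  rw [StrictMonoidal.associator_eq, eqToIso.hom, eqToHom_actionHomLeft] at h
  simp only [comp, MonoidalLeftAction.actionHomRight_comp, Category.assoc,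
    MonoidalLeftAction.tensor_actionHomRight, Iso.inv_hom_id_assoc]
  rw [← reassoc_of% h]

end LaxVer

/-- The 2-cells of `𝓜 ⋉ X` with horizontal boundary `f : x ⟶ x'`, `g : y ⟶ y'` and vertical
boundary `p = (m, φ)`, `q = (m', φ')`: morphisms `α : m ⟶ m'` with `φ' ∘ α f = g ∘ φ`. -/
structure LaxSq {M : Type u} [Category.{v} M] [MonoidalCategory M] {X : Type w}
    [Category.{wt} X] [MonoidalLeftAction M X] {x x' y y' : X} (f : x ⟶ x') (p : LaxVer M x y)
    (q : LaxVer M x' y') (g : y ⟶ y') where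
  hom : p.obj ⟶ q.obj
  comm : (hom ⊙ₗₘ f) ≫ q.hom = p.hom ≫ g

namespace LaxSq

variable {M : Type u} [Category.{v} M] [MonoidalCategory M] {X : Type w} [Category.{wt} X]
  [MonoidalLeftAction M X]

lemma heq_of_hom {x x' y y' : X} {f f' : x ⟶ x'} {p p' : LaxVer M x y} {q q' : LaxVer M x' y'}
    {g g' : y ⟶ y'} {α : LaxSq f p q g} {β : LaxSq f' p' q' g'} (hf : f = f') (hp : p = p')
    (hq : q = q') (hg : g = g') (h : HEq α.hom β.hom) : HEq α β := by
  subst hf hp hq hg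
  obtain ⟨a, _⟩ := α
  obtain ⟨b, _⟩ := β
  obtain rfl : a = b := eq_of_heq h
  rfl

lemma ext_hom {x x' y y' : X} {f : x ⟶ x'} {p : LaxVer M x y} {q : LaxVer M x' y'}
    {g : y ⟶ y'} {α β : LaxSq f p q g} (h : α.hom = β.hom) : α = β :=
  eq_of_heq (heq_of_hom rfl rfl rfl rfl (heq_of_eq h))

/-- The horizontal identity of a vertical morphism. -/
def hid {x y : X} (p : LaxVer M x y) : LaxSq (𝟙 x) p p (𝟙 y) := ⟨𝟙 _, by simp⟩

/-- Horizontal composition of 2-cells, by composition in `M`. -/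
def hcomp {x x' x'' y y' y'' : X} {f : x ⟶ x'} {f' : x' ⟶ x''} {p : LaxVer M x y}
    {q : LaxVer M x' y'} {r : LaxVer M x'' y''} {g : y ⟶ y'} {g' : y' ⟶ y''}
    (α : LaxSq f p q g) (β : LaxSq f' q r g') : LaxSq (f ≫ f') p r (g ≫ g') :=
  ⟨α.hom ≫ β.hom, by
    rw [MonoidalLeftAction.actionHom_comp, Category.assoc, β.comm, reassoc_of% α.comm]⟩

/-- The vertical identity of a horizontal morphism. -/
def vid {x x' : X} (f : x ⟶ x') : LaxSq f (LaxVer.id M x) (LaxVer.id M x') f :=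
  ⟨𝟙 _, by simp [LaxVer.id]⟩

/-- Vertical composition of 2-cells, by the monoidal product of `M`. -/
def vcomp {x x' y y' z z' : X} {f : x ⟶ x'} {g : y ⟶ y'} {h : z ⟶ z'} {p : LaxVer M x y}
    {q : LaxVer M x' y'} {p' : LaxVer M y z} {q' : LaxVer M y' z'} (α : LaxSq f p q g)
    (β : LaxSq g p' q' h) : LaxSq f (p.comp p') (q.comp q') h :=
  ⟨β.hom ⊗ₘ α.hom, by
    have e : (β.hom ⊙ₗₘ (α.hom ⊙ₗₘ f)) ≫ q'.obj ⊴ₗ q.hom ≫ q'.hom =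
        p'.obj ⊴ₗ p.hom ≫ p'.hom ≫ h := by
      rw [← MonoidalLeftAction.id_actionHom, ← MonoidalLeftAction.id_actionHom, ← β.comm,
        ← Category.assoc, ← Category.assoc, ← MonoidalLeftAction.actionHom_comp,
        ← MonoidalLeftAction.actionHom_comp, α.comm]
      simp
    simp only [LaxVer.comp, Category.assoc]
    rw [MonoidalLeftAction.actionAssocIso_hom_naturality_assoc, e]⟩

end LaxSq

/-- The double category `𝓜 ⋉ X` of a strict action of `M` on `X`. -/
def laxActionDoubleCat (M X : Type u) [SmallCategory M] [MonoidalCategory M] [StrictMonoidal M]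
    [SmallCategory X] [MonoidalLeftAction M X] : DoubleCat.{u} where
  Obj := X
  Ver x y := LaxVer M x y
  vid x := LaxVer.id M x
  vcomp p q := p.comp q
  vid_vcomp p := p.id_comp
  vcomp_vid p := p.comp_id
  vassoc p q r := p.assoc q r
  Sq f p q g := LaxSq f p q g
  hid p := LaxSq.hid p
  hcomp α β := α.hcomp β
  sqVid f := LaxSq.vid f
  sqVcomp α β := α.vcomp β
  hid_hcomp α := LaxSq.heq_of_hom (Category.id_comp _) rfl rfl (Category.id_comp _)
    (heq_of_eq (Category.id_comp _))
  hcomp_hid α := LaxSq.heq_of_hom (Category.comp_id _) rfl rfl (Category.comp_id _)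
    (heq_of_eq (Category.comp_id _))
  hassoc α β γ := LaxSq.heq_of_hom (Category.assoc _ _ _) rfl rfl (Category.assoc _ _ _)
    (heq_of_eq (Category.assoc _ _ _))
  sqVid_sqVcomp α := LaxSq.heq_of_hom rfl (LaxVer.id_comp _) (LaxVer.id_comp _) rfl
    (tensorHom_id_unit_heq _)
  sqVcomp_sqVid α := LaxSq.heq_of_hom rfl (LaxVer.comp_id _) (LaxVer.comp_id _) rfl
    (id_unit_tensorHom_heq _)
  sqVassoc α β γ := LaxSq.heq_of_hom rfl (LaxVer.assoc _ _ _) (LaxVer.assoc _ _ _) rfl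
    (tensorHom_assoc_heq _ _ _).symm
  sqVid_id x := rfl
  sqVid_comp f g := LaxSq.ext_hom (Category.comp_id _).symm
  hid_vcomp p q := LaxSq.ext_hom (id_tensorHom_id _ _).symm
  interchange α β γ δ := LaxSq.ext_hom (tensorHom_comp_tensorHom _ _ _ _).symm

/-- The vertical morphisms `x → y` of `𝓜 × X`: objects `m` of `M` with `m x = y`. Altogether these
are the pairs `(m, x)`, i.e. the objects of `M × X`, with source `x` and target `m x`. -/
structure StrictVer (M : Type u) [Category.{v} M] [MonoidalCategory M] {X : Type w}
    [Category.{wt} X] [MonoidalLeftAction M X] (x y : X) where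
  obj : M
  eq : obj ⊙ₗ x = y

namespace StrictVer

variable {M : Type u} [Category.{v} M] [MonoidalCategory M] {X : Type w} [Category.{wt} X]
  [MonoidalLeftAction M X]

/-- The vertical morphism `(m, id_{m x})` of `𝓜 ⋉ X` associated with `m : x → m x`. -/
def toLax {x y : X} (p : StrictVer M x y) : LaxVer M x y := ⟨p.obj, eqToHom p.eq⟩

lemma ext_obj {x y : X} {p q : StrictVer M x y} (h : p.obj = q.obj) : p = q := by
  obtain ⟨m, _⟩ := p
  obtain ⟨n, _⟩ := q
  obtain rfl : m = n := h
  rfl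

lemma actionHomRight_eqToHom (m : M) {x y : X} (h : x = y) :
    m ⊴ₗ eqToHom h = eqToHom (by rw [h]) := by
  subst h; simp

variable [StrictAction M X]

variable (M) in
/-- The vertical identity `e : x → e x = x`. -/
def id (x : X) : StrictVer M x x := ⟨𝟙_ M, StrictAction.unit_act x⟩

/-- Vertical composition, by the monoidal product. -/
def comp {x y z : X} (p : StrictVer M x y) (q : StrictVer M y z) : StrictVer M x z :=
  ⟨q.obj ⊗ p.obj, by rw [StrictAction.tensor_act, p.eq, q.eq]⟩

lemma toLax_id (x : X) : (id M x).toLax = LaxVer.id M x := by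
  simp [id, toLax, LaxVer.id, StrictAction.actionUnitIso_eq]

lemma toLax_comp {x y z : X} (p : StrictVer M x y) (q : StrictVer M y z) :
    (p.comp q).toLax = p.toLax.comp q.toLax := by
  simp [comp, toLax, LaxVer.comp, StrictAction.actionAssocIso_eq, actionHomRight_eqToHom]

end StrictVer

/-- The 2-cells of `𝓜 × X`: the morphisms `(α, f) : (m, x) ⟶ (m', x')` of `M × X`, with source
`f : x ⟶ x'` and target `g = α f : m x ⟶ m' x'`. -/
structure StrictSq {M : Type u} [Category.{v} M] [MonoidalCategory M] {X : Type w}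
    [Category.{wt} X] [MonoidalLeftAction M X] {x x' y y' : X} (f : x ⟶ x') (p : StrictVer M x y)
    (q : StrictVer M x' y') (g : y ⟶ y') where
  hom : p.obj ⟶ q.obj
  comm : (hom ⊙ₗₘ f) ≫ eqToHom q.eq = eqToHom p.eq ≫ g

namespace StrictSq

variable {M : Type u} [Category.{v} M] [MonoidalCategory M] {X : Type w} [Category.{wt} X]
  [MonoidalLeftAction M X]

/-- A 2-cell of `𝓜 × X` as a 2-cell of `𝓜 ⋉ X`. -/
def toLax {x x' y y' : X} {f : x ⟶ x'} {p : StrictVer M x y} {q : StrictVer M x' y'}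
    {g : y ⟶ y'} (α : StrictSq f p q g) : LaxSq f p.toLax q.toLax g := ⟨α.hom, α.comm⟩

lemma heq_of_hom {x x' y y' : X} {f f' : x ⟶ x'} {p p' : StrictVer M x y}
    {q q' : StrictVer M x' y'} {g g' : y ⟶ y'} {α : StrictSq f p q g} {β : StrictSq f' p' q' g'}
    (hf : f = f') (hp : p = p') (hq : q = q') (hg : g = g') (h : HEq α.hom β.hom) :
    HEq α β := by
  subst hf hp hq hg
  obtain ⟨a, _⟩ := α
  obtain ⟨b, _⟩ := β
  obtain rfl : a = b := eq_of_heq h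
  rfl

lemma ext_hom {x x' y y' : X} {f : x ⟶ x'} {p : StrictVer M x y} {q : StrictVer M x' y'}
    {g : y ⟶ y'} {α β : StrictSq f p q g} (h : α.hom = β.hom) : α = β :=
  eq_of_heq (heq_of_hom rfl rfl rfl rfl (heq_of_eq h))

/-- The horizontal identity of a vertical morphism. -/
def hid {x y : X} (p : StrictVer M x y) : StrictSq (𝟙 x) p p (𝟙 y) := ⟨𝟙 _, by simp⟩

/-- Horizontal composition of 2-cells: composition in `M × X`. -/
def hcomp {x x' x'' y y' y'' : X} {f : x ⟶ x'} {f' : x' ⟶ x''} {p : StrictVer M x y}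
    {q : StrictVer M x' y'} {r : StrictVer M x'' y''} {g : y ⟶ y'} {g' : y' ⟶ y''}
    (α : StrictSq f p q g) (β : StrictSq f' q r g') : StrictSq (f ≫ f') p r (g ≫ g') :=
  ⟨α.hom ≫ β.hom, (α.toLax.hcomp β.toLax).comm⟩

variable [StrictAction M X]

/-- The vertical identity of a horizontal morphism. -/
def vid {x x' : X} (f : x ⟶ x') : StrictSq f (StrictVer.id M x) (StrictVer.id M x') f :=
  ⟨𝟙 _, by
    have h := MonoidalLeftAction.actionUnitIso_hom_naturality (C := M) f
    rw [StrictAction.actionUnitIso_eq, StrictAction.actionUnitIso_eq] at h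
    exact (congr_arg (· ≫ _) (MonoidalLeftAction.id_actionHom (𝟙_ M) f)).trans h.symm⟩

/-- Vertical composition of 2-cells, by the monoidal product of `M`. -/
def vcomp {x x' y y' z z' : X} {f : x ⟶ x'} {g : y ⟶ y'} {h : z ⟶ z'} {p : StrictVer M x y}
    {q : StrictVer M x' y'} {p' : StrictVer M y z} {q' : StrictVer M y' z'}
    (α : StrictSq f p q g) (β : StrictSq g p' q' h) :
    StrictSq f (p.comp p') (q.comp q') h :=
  ⟨β.hom ⊗ₘ α.hom, by
    have e := (α.toLax.vcomp β.toLax).comm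
    have e₁ := congr_arg_heq LaxVer.hom (StrictVer.toLax_comp p p')
    have e₂ := congr_arg_heq LaxVer.hom (StrictVer.toLax_comp q q')
    have e₁' := eq_of_heq e₁
    have e₂' := eq_of_heq e₂
    dsimp only [StrictVer.toLax] at e₁' e₂'
    rw [e₁', e₂']
    exact e⟩

end StrictSq

/-- The double category `𝓜 × X = [M × X ⇉ X]` of a strict action of `M` on `X`. -/
def strictActionDoubleCat (M X : Type u) [SmallCategory M] [MonoidalCategory M] [StrictMonoidal M]
    [SmallCategory X] [MonoidalLeftAction M X] [StrictAction M X] : DoubleCat.{u} where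
  Obj := X
  Ver x y := StrictVer M x y
  vid x := StrictVer.id M x
  vcomp p q := p.comp q
  vid_vcomp p := StrictVer.ext_obj (StrictMonoidal.tensor_unit p.obj)
  vcomp_vid p := StrictVer.ext_obj (StrictMonoidal.unit_tensor p.obj)
  vassoc p q r := StrictVer.ext_obj (StrictMonoidal.tensor_assoc r.obj q.obj p.obj).symm
  Sq f p q g := StrictSq f p q g
  hid p := StrictSq.hid p
  hcomp α β := α.hcomp β
  sqVid f := StrictSq.vid f
  sqVcomp α β := α.vcomp β
  hid_hcomp α := StrictSq.heq_of_hom (Category.id_comp _) rfl rfl (Category.id_comp _)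
    (heq_of_eq (Category.id_comp _))
  hcomp_hid α := StrictSq.heq_of_hom (Category.comp_id _) rfl rfl (Category.comp_id _)
    (heq_of_eq (Category.comp_id _))
  hassoc α β γ := StrictSq.heq_of_hom (Category.assoc _ _ _) rfl rfl (Category.assoc _ _ _)
    (heq_of_eq (Category.assoc _ _ _))
  sqVid_sqVcomp α := StrictSq.heq_of_hom rfl
    (StrictVer.ext_obj (StrictMonoidal.tensor_unit _))
    (StrictVer.ext_obj (StrictMonoidal.tensor_unit _)) rfl (tensorHom_id_unit_heq _)
  sqVcomp_sqVid α := StrictSq.heq_of_hom rfl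
    (StrictVer.ext_obj (StrictMonoidal.unit_tensor _))
    (StrictVer.ext_obj (StrictMonoidal.unit_tensor _)) rfl (id_unit_tensorHom_heq _)
  sqVassoc α β γ := StrictSq.heq_of_hom rfl
    (StrictVer.ext_obj (StrictMonoidal.tensor_assoc _ _ _).symm)
    (StrictVer.ext_obj (StrictMonoidal.tensor_assoc _ _ _).symm) rfl
    (tensorHom_assoc_heq _ _ _).symm
  sqVid_id x := rfl
  sqVid_comp f g := StrictSq.ext_hom (Category.comp_id _).symm
  hid_vcomp p q := StrictSq.ext_hom (id_tensorHom_id _ _).symm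
  interchange α β γ δ := StrictSq.ext_hom (tensorHom_comp_tensorHom _ _ _ _).symm

/-- The double functor `Φ : 𝓜 × X → 𝓜 ⋉ X`, the identity on `X`, sending `m : x → m x` to
`(m, id_{m x})` and `(α, f)` to `(f, α f, α)`. -/
def strictToLax (M X : Type u) [SmallCategory M] [MonoidalCategory M] [StrictMonoidal M]
    [SmallCategory X] [MonoidalLeftAction M X] [StrictAction M X] :
    DoubleFunctor (strictActionDoubleCat M X) (laxActionDoubleCat M X) where
  hor := 𝟭 X
  ver p := StrictVer.toLax (M := M) (X := X) p
  ver_vid x := StrictVer.toLax_id (M := M) (X := X) x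
  ver_vcomp p q := StrictVer.toLax_comp (M := M) (X := X) p q
  sq α := StrictSq.toLax (M := M) (X := X) α
  sq_hid p := HEq.rfl
  sq_hcomp α β := HEq.rfl
  sq_sqVid f := LaxSq.heq_of_hom (M := M) (X := X) rfl (StrictVer.toLax_id _)
    (StrictVer.toLax_id _) rfl HEq.rfl
  sq_sqVcomp α β := LaxSq.heq_of_hom (M := M) (X := X) rfl (StrictVer.toLax_comp _ _)
    (StrictVer.toLax_comp _ _) rfl HEq.rfl

/-- The 2-cells of the double category associated with a strict 2-category: only identity
horizontal morphisms are allowed, and the 2-cells with identity horizontal boundary are the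
2-cells of the 2-category. -/
inductive IdSq {B : Type u} [Bicategory.{w, v} B] :
    {a b c d : B} → a = b → (a ⟶ c) → (b ⟶ d) → c = d → Type (max u v w)
  | mk {a c : B} {p q : a ⟶ c} (η : p ⟶ q) : IdSq rfl p q rfl

namespace IdSq

variable {B : Type u} [Bicategory.{w, v} B]

/-- Horizontal composition: composition of 2-cells in the hom-categories. -/
def hcomp : {a b e c d k : B} → {f : a = b} → {f' : b = e} → {p : a ⟶ c} → {q : b ⟶ d} →
    {r : e ⟶ k} → {g : c = d} → {g' : d = k} → IdSq f p q g → IdSq f' q r g' →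
    IdSq (f.trans f') p r (g.trans g')
  | _, _, _, _, _, _, _, _, _, _, _, _, _, .mk η, .mk θ => .mk (η ≫ θ)

open Bicategory in
/-- Vertical composition: horizontal composition of 2-cells along objects. -/
def vcomp : {a b c d e k : B} → {f : a = b} → {p : a ⟶ c} → {q : b ⟶ d} → {g : c = d} →
    {p' : c ⟶ e} → {q' : d ⟶ k} → {h : e = k} → IdSq f p q g → IdSq g p' q' h →
    IdSq f (p ≫ p') (q ≫ q') h
  | _, _, _, _, _, _, _, _, q, _, p', _, _, .mk η, .mk θ => .mk (η ▷ p' ≫ q ◁ θ)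

/-- The vertical identity of an identity horizontal morphism. -/
def vid : {a b : B} → (f : a = b) → IdSq f (𝟙 a) (𝟙 b) f
  | a, _, rfl => .mk (𝟙 (𝟙 a))

end IdSq

lemma IdSq.heq_of_eq {B : Type u} [Bicategory.{w, v} B] {a c : B} {p p' q q' : a ⟶ c}
    {η : p ⟶ q} {η' : p' ⟶ q'} (hp : p = p') (hq : q = q') (h : HEq η η') :
    HEq (IdSq.mk η) (IdSq.mk η') := by
  subst hp hq
  obtain rfl := eq_of_heq h
  rfl

lemma IdSq.vid_trans {B : Type u} [Bicategory.{w, v} B] {a b c : B} (f : a = b) (g : b = c) :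
    IdSq.vid (f.trans g) = (IdSq.vid f).hcomp (IdSq.vid g) := by
  subst f g
  simp [IdSq.vid, IdSq.hcomp]

/-- A small strict 2-category, viewed as a double category with only identity horizontal
morphisms. -/
def strictBicategoryDoubleCat (B : Type u) [Bicategory.{u, u} B] [Bicategory.Strict B] :
    DoubleCat.{u} where
  Obj := Discrete B
  Ver a b := a.as ⟶ b.as
  vid a := 𝟙 a.as
  vcomp p q := p ≫ q
  vid_vcomp p := Bicategory.Strict.id_comp p
  vcomp_vid p := Bicategory.Strict.comp_id p
  vassoc p q r := Bicategory.Strict.assoc p q r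
  Sq f p q g := IdSq (Discrete.eq_of_hom f) p q (Discrete.eq_of_hom g)
  hid p := IdSq.mk (𝟙 p)
  hcomp α β := IdSq.hcomp α β
  sqVid f := IdSq.vid (Discrete.eq_of_hom f)
  sqVcomp α β := IdSq.vcomp α β
  hid_hcomp := by
    rintro ⟨a⟩ ⟨b⟩ ⟨c⟩ ⟨d⟩ ⟨⟨f⟩⟩ p q ⟨⟨g⟩⟩ ⟨η⟩
    simp [IdSq.hcomp]
  hcomp_hid := by
    rintro ⟨a⟩ ⟨b⟩ ⟨c⟩ ⟨d⟩ ⟨⟨f⟩⟩ p q ⟨⟨g⟩⟩ ⟨η⟩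
    simp [IdSq.hcomp]
  hassoc := by
    rintro ⟨_⟩ ⟨_⟩ ⟨_⟩ ⟨_⟩ ⟨_⟩ ⟨_⟩ ⟨_⟩ ⟨_⟩ ⟨⟨_⟩⟩ ⟨⟨_⟩⟩ ⟨⟨_⟩⟩ _ _ _ _ ⟨⟨_⟩⟩ ⟨⟨_⟩⟩ ⟨⟨_⟩⟩ ⟨α⟩ ⟨β⟩ ⟨γ⟩
    simp [IdSq.hcomp]
  sqVid_sqVcomp := by
    rintro ⟨a⟩ ⟨b⟩ ⟨c⟩ ⟨d⟩ ⟨⟨f⟩⟩ p q ⟨⟨g⟩⟩ ⟨η⟩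
    refine IdSq.heq_of_eq (Bicategory.Strict.id_comp _) (Bicategory.Strict.id_comp _) ?_
    simp [Bicategory.Strict.leftUnitor_eqToIso]
  sqVcomp_sqVid := by
    rintro ⟨a⟩ ⟨b⟩ ⟨c⟩ ⟨d⟩ ⟨⟨f⟩⟩ p q ⟨⟨g⟩⟩ ⟨η⟩
    refine IdSq.heq_of_eq (Bicategory.Strict.comp_id _) (Bicategory.Strict.comp_id _) ?_
    simp [Bicategory.Strict.rightUnitor_eqToIso]
  sqVassoc := by
    rintro ⟨_⟩ ⟨_⟩ ⟨_⟩ ⟨_⟩ ⟨_⟩ ⟨_⟩ ⟨_⟩ ⟨_⟩ _ _ _ _ _ _ ⟨⟨_⟩⟩ ⟨⟨_⟩⟩ ⟨⟨_⟩⟩ ⟨⟨_⟩⟩ ⟨α⟩ ⟨β⟩ ⟨γ⟩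
    refine IdSq.heq_of_eq (Bicategory.Strict.assoc _ _ _) (Bicategory.Strict.assoc _ _ _) ?_
    refine heq_of_comp_eqToHom (Bicategory.Strict.assoc _ _ _) (Bicategory.Strict.assoc _ _ _) ?_
    rw [← eqToIso.hom, ← eqToIso.hom, ← Bicategory.Strict.associator_eqToIso,
      ← Bicategory.Strict.associator_eqToIso]
    simp
  sqVid_id a := rfl
  sqVid_comp f g := IdSq.vid_trans _ _
  hid_vcomp p q := by simp [IdSq.vcomp]
  interchange := by
    rintro ⟨_⟩ ⟨_⟩ ⟨_⟩ ⟨_⟩ ⟨_⟩ ⟨_⟩ ⟨_⟩ ⟨_⟩ ⟨_⟩ ⟨⟨_⟩⟩ ⟨⟨_⟩⟩ ⟨⟨_⟩⟩ ⟨⟨_⟩⟩ ⟨⟨_⟩⟩ ⟨⟨_⟩⟩ _ _ _ _ _ _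
      ⟨α⟩ ⟨β⟩ ⟨γ⟩ ⟨δ⟩
    simp [IdSq.vcomp, IdSq.hcomp, Bicategory.whisker_exchange_assoc]

/-- The geometric realisation of a small strict 2-category. -/
noncomputable def twoCatRealisation (B : Type u) [Bicategory.{u, u} B] [Bicategory.Strict B] :
    TopCat.{u} :=
  (strictBicategoryDoubleCat B).realisation

/-- The objects of the action Q-construction `Q(M, X)`: the objects of `X`. -/
structure ActionQ (M : Type u) (X : Type w) where
  pt : X

namespace ActionQ

variable {M : Type u} [Category.{v} M] [MonoidalCategory M] {X : Type w} [Category.{wt} X]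
  [MonoidalLeftAction M X]

/-- The 2-cells `(m, φ) ⟶ (m', φ')` of `Q(M, X)`: morphisms `α : m ⟶ m'` with
`φ' ∘ α id_x = φ`, i.e. the 2-cells of `𝓜 ⋉ X` with identity horizontal boundary. -/
structure Cell {x y : X} (p q : LaxVer M x y) where
  hom : p.obj ⟶ q.obj
  comm : hom ⊵ₗ x ≫ q.hom = p.hom

lemma Cell.ext_hom {x y : X} {p q : LaxVer M x y} {α β : Cell p q} (h : α.hom = β.hom) :
    α = β := by
  obtain ⟨a, _⟩ := α
  obtain ⟨b, _⟩ := β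
  obtain rfl : a = b := h
  rfl

instance homCategory (x y : X) : Category.{v} (LaxVer M x y) where
  Hom p q := Cell p q
  id p := ⟨𝟙 _, by simp⟩
  comp α β := ⟨α.hom ≫ β.hom, by simp [α.comm, β.comm]⟩
  id_comp α := Cell.ext_hom (Category.id_comp _)
  comp_id α := Cell.ext_hom (Category.comp_id _)
  assoc α β γ := Cell.ext_hom (Category.assoc _ _ _)

@[simp] lemma id_hom {x y : X} (p : LaxVer M x y) : Cell.hom (𝟙 p) = 𝟙 p.obj := rfl

@[simp] lemma comp_hom {x y : X} {p q r : LaxVer M x y} (α : p ⟶ q) (β : q ⟶ r) :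
    Cell.hom (α ≫ β) = Cell.hom α ≫ Cell.hom β := rfl

@[simp] lemma eqToHom_hom {x y : X} {p q : LaxVer M x y} (h : p = q) :
    Cell.hom (eqToHom h) = eqToHom (congr_arg LaxVer.obj h) := by
  subst h; rfl

/-- A 2-cell of `Q(M, X)` as a 2-cell of `𝓜 ⋉ X`. -/
def Cell.toSq {x y : X} {p q : LaxVer M x y} (α : p ⟶ q) : LaxSq (𝟙 x) p q (𝟙 y) :=
  ⟨Cell.hom α, by simpa using Cell.comm α⟩

/-- A 2-cell of `𝓜 ⋉ X` with identity horizontal boundary as a 2-cell of `Q(M, X)`. -/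
def Cell.ofSq {x y : X} {p q : LaxVer M x y} (α : LaxSq (𝟙 x) p q (𝟙 y)) : p ⟶ q :=
  ⟨α.hom, by simpa using α.comm⟩

/-- Whiskering in `Q(M, X)`: vertical composition with an identity 2-cell in `𝓜 ⋉ X`. -/
def whiskerL {x y z : X} (p : LaxVer M x y) {q r : LaxVer M y z} (β : q ⟶ r) :
    p.comp q ⟶ p.comp r :=
  Cell.ofSq ((LaxSq.hid p).vcomp (Cell.toSq β))

/-- Whiskering in `Q(M, X)`: vertical composition with an identity 2-cell in `𝓜 ⋉ X`. -/
def whiskerR {x y z : X} {p q : LaxVer M x y} (α : p ⟶ q) (r : LaxVer M y z) :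
    p.comp r ⟶ q.comp r :=
  Cell.ofSq ((Cell.toSq α).vcomp (LaxSq.hid r))

@[simp] lemma whiskerL_hom {x y z : X} (p : LaxVer M x y) {q r : LaxVer M y z} (β : q ⟶ r) :
    Cell.hom (whiskerL p β) = Cell.hom β ⊗ₘ 𝟙 p.obj := rfl

@[simp] lemma whiskerR_hom {x y z : X} {p q : LaxVer M x y} (α : p ⟶ q) (r : LaxVer M y z) :
    Cell.hom (whiskerR α r) = 𝟙 r.obj ⊗ₘ Cell.hom α := rfl

lemma whiskerL_comp {x y z : X} (p : LaxVer M x y) {q r s : LaxVer M y z} (α : q ⟶ r) (β : r ⟶ s) :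
    whiskerL p (α ≫ β) = whiskerL p α ≫ whiskerL p β := by
  have h : (Cell.hom α ≫ Cell.hom β) ⊗ₘ 𝟙 p.obj =
      (Cell.hom α ⊗ₘ 𝟙 p.obj) ≫ (Cell.hom β ⊗ₘ 𝟙 p.obj) := by simp
  exact Cell.ext_hom h

lemma whiskerR_comp {x y z : X} {p q r : LaxVer M x y} (α : p ⟶ q) (β : q ⟶ r) (s : LaxVer M y z) :
    whiskerR (α ≫ β) s = whiskerR α s ≫ whiskerR β s := by
  have h : 𝟙 s.obj ⊗ₘ (Cell.hom α ≫ Cell.hom β) =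
      (𝟙 s.obj ⊗ₘ Cell.hom α) ≫ (𝟙 s.obj ⊗ₘ Cell.hom β) := by simp
  exact Cell.ext_hom h

lemma whisker_exch {x y z : X} {p q : LaxVer M x y} {r s : LaxVer M y z} (α : p ⟶ q) (β : r ⟶ s) :
    whiskerL p β ≫ whiskerR α s = whiskerR α r ≫ whiskerL q β := by
  have h : (Cell.hom β ⊗ₘ 𝟙 p.obj) ≫ (𝟙 s.obj ⊗ₘ Cell.hom α) =
      (𝟙 r.obj ⊗ₘ Cell.hom α) ≫ (Cell.hom β ⊗ₘ 𝟙 q.obj) := by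
    simp only [tensorHom_comp_tensorHom, Category.comp_id, Category.id_comp]
  exact Cell.ext_hom h

lemma whiskerL_eqToHom {x y z : X} (p : LaxVer M x y) {q r : LaxVer M y z} (h : q = r) :
    whiskerL p (eqToHom h) = eqToHom (by rw [h]) := by
  subst h
  exact Cell.ext_hom (id_tensorHom_id _ _)

lemma eqToHom_whiskerR {x y z : X} {p q : LaxVer M x y} (h : p = q) (r : LaxVer M y z) :
    whiskerR (eqToHom h) r = eqToHom (by rw [h]) := by
  subst h
  exact Cell.ext_hom (id_tensorHom_id _ _)

variable [StrictMonoidal M]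

section coherence

variable {x y z t s : X}

lemma id_whiskerL {p q : LaxVer M x y} (α : p ⟶ q) :
    whiskerL (LaxVer.id M x) α = eqToHom p.id_comp ≫ α ≫ eqToHom q.id_comp.symm :=
  Cell.ext_hom (by
    simp only [comp_hom, eqToHom_hom, whiskerL_hom]
    exact eq_conj_of_heq _ _ (tensorHom_id_unit_heq _))

lemma whiskerR_id {p q : LaxVer M x y} (α : p ⟶ q) :
    whiskerR α (LaxVer.id M y) = eqToHom p.comp_id ≫ α ≫ eqToHom q.comp_id.symm :=
  Cell.ext_hom (by
    simp only [comp_hom, eqToHom_hom, whiskerR_hom]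
    exact eq_conj_of_heq _ _ (id_unit_tensorHom_heq _))

lemma comp_whiskerL (p : LaxVer M x y) (q : LaxVer M y z) {r s : LaxVer M z t} (α : r ⟶ s) :
    whiskerL (p.comp q) α =
      eqToHom (p.assoc q r) ≫ whiskerL p (whiskerL q α) ≫ eqToHom (p.assoc q s).symm :=
  Cell.ext_hom (by
    simp only [comp_hom, eqToHom_hom, whiskerL_hom]
    refine eq_conj_of_heq _ _ (HEq.trans ?_ (tensorHom_assoc_heq _ _ _).symm)
    rw [id_tensorHom_id]; rfl)

lemma whiskerR_comp' {p q : LaxVer M x y} (α : p ⟶ q) (r : LaxVer M y z) (s : LaxVer M z t) :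
    whiskerR α (r.comp s) =
      eqToHom (p.assoc r s).symm ≫ whiskerR (whiskerR α r) s ≫ eqToHom (q.assoc r s) :=
  Cell.ext_hom (by
    simp only [comp_hom, eqToHom_hom, whiskerR_hom]
    refine eq_conj_of_heq _ _ (HEq.trans ?_ (tensorHom_assoc_heq _ _ _))
    rw [id_tensorHom_id]; rfl)

lemma whisker_assoc' (p : LaxVer M x y) {q r : LaxVer M y z} (α : q ⟶ r) (s : LaxVer M z t) :
    whiskerR (whiskerL p α) s =
      eqToHom (p.assoc q s) ≫ whiskerL p (whiskerR α s) ≫ eqToHom (p.assoc r s).symm :=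
  Cell.ext_hom (by
    simp only [comp_hom, eqToHom_hom, whiskerR_hom, whiskerL_hom]
    exact eq_conj_of_heq _ _ (tensorHom_assoc_heq _ _ _).symm)

lemma pentagon' (p : LaxVer M x y) (q : LaxVer M y z) (r : LaxVer M z t) (w : LaxVer M t s) :
    whiskerR (eqToHom (p.assoc q r)) w ≫ eqToHom (p.assoc (q.comp r) w) ≫
      whiskerL p (eqToHom (q.assoc r w)) =
    eqToHom ((p.comp q).assoc r w) ≫ eqToHom (p.assoc q (r.comp w)) := by
  simp [whiskerL_eqToHom, eqToHom_whiskerR]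

lemma triangle' (p : LaxVer M x y) (q : LaxVer M y z) :
    eqToHom (p.assoc (LaxVer.id M y) q) ≫ whiskerL p (eqToHom q.id_comp) =
      whiskerR (eqToHom p.comp_id) q := by
  simp [whiskerL_eqToHom, eqToHom_whiskerR]

end coherence

/-- The action Q-construction `Q(M, X)`: the vertical 2-category of `𝓜 ⋉ X`. Its objects are those
of `X`, its morphisms are the vertical morphisms of `𝓜 ⋉ X`, its 2-cells are the 2-cells of
`𝓜 ⋉ X` with identity horizontal boundary. -/
instance : Bicategory.{v, max u wt} (ActionQ M X) where
  Hom x y := LaxVer M x.pt y.pt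
  id x := LaxVer.id M x.pt
  comp p q := p.comp q
  homCategory x y := homCategory x.pt y.pt
  whiskerLeft p _ _ β := whiskerL p β
  whiskerRight α q := whiskerR α q
  associator p q r := eqToIso (p.assoc q r)
  leftUnitor p := eqToIso p.id_comp
  rightUnitor p := eqToIso p.comp_id
  whiskerLeft_id _ _ := Cell.ext_hom (id_tensorHom_id _ _)
  whiskerLeft_comp p _ _ _ α β := whiskerL_comp p α β
  id_whiskerLeft α := id_whiskerL α
  comp_whiskerLeft p q _ _ α := comp_whiskerL p q α
  id_whiskerRight _ _ := Cell.ext_hom (id_tensorHom_id _ _)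
  comp_whiskerRight α β q := whiskerR_comp α β q
  whiskerRight_id α := whiskerR_id α
  whiskerRight_comp α q r := whiskerR_comp' α q r
  whisker_assoc p _ _ α r := whisker_assoc' p α r
  whisker_exchange α β := whisker_exch α β
  pentagon p q r s := pentagon' p q r s
  triangle p q := triangle' p q

instance : Bicategory.Strict (ActionQ M X) where
  id_comp p := LaxVer.id_comp p
  comp_id p := LaxVer.comp_id p
  assoc p q r := LaxVer.assoc p q r

end ActionQ

namespace ActionQ

variable {M X : Type u} [SmallCategory M] [MonoidalCategory M] [StrictMonoidal M]
  [SmallCategory X] [MonoidalLeftAction M X]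

/-- The 2-cells of `Q(M, X)`, viewed as a double category, as 2-cells of `𝓜 ⋉ X`. -/
def idSqToLaxSq : {a b c d : ActionQ M X} → {f : a = b} → {p : a ⟶ c} → {q : b ⟶ d} →
    {g : c = d} → IdSq f p q g →
    LaxSq (eqToHom (congr_arg pt f)) p q (eqToHom (congr_arg pt g))
  | _, _, _, _, _, _, _, _, .mk η => Cell.toSq η

lemma idSqToLaxSq_hcomp {a b e c d k : ActionQ M X} {f : a = b} {f' : b = e} {p : a ⟶ c}
    {q : b ⟶ d} {r : e ⟶ k} {g : c = d} {g' : d = k} (α : IdSq f p q g) (β : IdSq f' q r g') :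
    HEq (idSqToLaxSq (α.hcomp β)) ((idSqToLaxSq α).hcomp (idSqToLaxSq β)) := by
  cases α; cases β
  exact LaxSq.heq_of_hom (eqToHom_trans _ _).symm rfl rfl (eqToHom_trans _ _).symm HEq.rfl

lemma idSqToLaxSq_vid {a b : ActionQ M X} (f : a = b) :
    HEq (idSqToLaxSq (IdSq.vid f)) (LaxSq.vid (M := M) (eqToHom (congr_arg pt f))) := by
  subst f
  exact LaxSq.heq_of_hom rfl rfl rfl rfl HEq.rfl

lemma idSqToLaxSq_vcomp {a b c d e k : ActionQ M X} {f : a = b} {p : a ⟶ c} {q : b ⟶ d}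
    {g : c = d} {p' : c ⟶ e} {q' : d ⟶ k} {h : e = k} (α : IdSq f p q g) (β : IdSq g p' q' h) :
    HEq (idSqToLaxSq (α.vcomp β)) ((idSqToLaxSq α).vcomp (idSqToLaxSq β)) := by
  cases α with | mk η => cases β with | mk θ =>
  refine LaxSq.heq_of_hom rfl rfl rfl rfl (heq_of_eq ?_)
  exact (tensorHom_comp_tensorHom (𝟙 _) (Cell.hom η) (Cell.hom θ) (𝟙 _)).trans
    (by rw [Category.id_comp, Category.comp_id]; rfl)

end ActionQ

/-- The inclusion of `Q(M, X)`, viewed as a double category, into `𝓜 ⋉ X`: the identity on objects,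
vertical morphisms and 2-cells. -/
def qInclusion (M X : Type u) [SmallCategory M] [MonoidalCategory M] [StrictMonoidal M]
    [SmallCategory X] [MonoidalLeftAction M X] :
    DoubleFunctor (strictBicategoryDoubleCat (ActionQ M X)) (laxActionDoubleCat M X) where
  hor :=
    { obj a := ActionQ.pt a.as
      map f := eqToHom (congr_arg ActionQ.pt (Discrete.eq_of_hom f))
      map_id _ := rfl
      map_comp _ _ := (eqToHom_trans _ _).symm }
  ver p := p
  ver_vid _ := rfl
  ver_vcomp _ _ := rfl
  sq α := ActionQ.idSqToLaxSq α
  sq_hid _ := HEq.rfl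
  sq_hcomp α β := ActionQ.idSqToLaxSq_hcomp α β
  sq_sqVid f := ActionQ.idSqToLaxSq_vid (M := M) (X := X) (Discrete.eq_of_hom f)
  sq_sqVcomp α β := ActionQ.idSqToLaxSq_vcomp α β

section selfAction

lemma mop_eqToHom {M : Type u} [Category.{v} M] {a b : M} (h : a = b) :
    (eqToHom h).mop = eqToHom (congr_arg MonoidalOpposite.mop h) := by
  subst h; rfl

lemma prod_eqToHom {M : Type u} [Category.{v} M] {N : Type w} [Category.{wt} N] {a b : M × N}
    (h : a = b) :
    eqToHom h = Prod.mkHom (eqToHom (congr_arg Prod.fst h)) (eqToHom (congr_arg Prod.snd h)) := by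
  subst h; rfl

variable (M : Type u) [Category.{v} M] [MonoidalCategory M]

instance [StrictMonoidal M] : StrictMonoidal Mᴹᵒᵖ where
  tensor_assoc a b c :=
    congr_arg MonoidalOpposite.mop (StrictMonoidal.tensor_assoc c.unmop b.unmop a.unmop).symm
  unit_tensor a := congr_arg MonoidalOpposite.mop (StrictMonoidal.tensor_unit a.unmop)
  tensor_unit a := congr_arg MonoidalOpposite.mop (StrictMonoidal.unit_tensor a.unmop)
  associator_eq a b c := by
    ext1
    refine Eq.trans ?_ (mop_eqToHom (StrictMonoidal.tensor_assoc c.unmop b.unmop a.unmop).symm)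
    change ((α_ c.unmop b.unmop a.unmop).inv).mop = _
    rw [StrictMonoidal.associator_eq]; rfl
  leftUnitor_eq a := by
    ext1
    refine Eq.trans ?_ (mop_eqToHom (StrictMonoidal.tensor_unit a.unmop))
    change ((ρ_ a.unmop).hom).mop = _
    rw [StrictMonoidal.rightUnitor_eq]; rfl
  rightUnitor_eq a := by
    ext1
    refine Eq.trans ?_ (mop_eqToHom (StrictMonoidal.unit_tensor a.unmop))
    change ((λ_ a.unmop).hom).mop = _
    rw [StrictMonoidal.leftUnitor_eq]; rfl

instance (N : Type w) [Category.{wt} N] [MonoidalCategory N] [StrictMonoidal M]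
    [StrictMonoidal N] : StrictMonoidal (M × N) where
  tensor_assoc a b c :=
    Prod.ext (StrictMonoidal.tensor_assoc _ _ _) (StrictMonoidal.tensor_assoc _ _ _)
  unit_tensor a := Prod.ext (StrictMonoidal.unit_tensor _) (StrictMonoidal.unit_tensor _)
  tensor_unit a := Prod.ext (StrictMonoidal.tensor_unit _) (StrictMonoidal.tensor_unit _)
  associator_eq a b c := by
    ext1
    change Prod.mkHom (α_ a.1 b.1 c.1).hom (α_ a.2 b.2 c.2).hom = _
    refine Eq.trans ?_ (prod_eqToHom (a := (a ⊗ b) ⊗ c) (b := a ⊗ (b ⊗ c))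
      (Prod.ext (StrictMonoidal.tensor_assoc _ _ _) (StrictMonoidal.tensor_assoc _ _ _))).symm
    exact Prod.ext (congr_arg Iso.hom (StrictMonoidal.associator_eq _ _ _))
      (congr_arg Iso.hom (StrictMonoidal.associator_eq _ _ _))
  leftUnitor_eq a := by
    ext1
    change Prod.mkHom (λ_ a.1).hom (λ_ a.2).hom = _
    refine Eq.trans ?_ (prod_eqToHom (a := 𝟙_ (M × N) ⊗ a) (b := a)
      (Prod.ext (StrictMonoidal.unit_tensor _) (StrictMonoidal.unit_tensor _))).symm
    exact Prod.ext (congr_arg Iso.hom (StrictMonoidal.leftUnitor_eq _))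
      (congr_arg Iso.hom (StrictMonoidal.leftUnitor_eq _))
  rightUnitor_eq a := by
    ext1
    change Prod.mkHom (ρ_ a.1).hom (ρ_ a.2).hom = _
    refine Eq.trans ?_ (prod_eqToHom (a := a ⊗ 𝟙_ (M × N)) (b := a)
      (Prod.ext (StrictMonoidal.tensor_unit _) (StrictMonoidal.tensor_unit _))).symm
    exact Prod.ext (congr_arg Iso.hom (StrictMonoidal.rightUnitor_eq _))
      (congr_arg Iso.hom (StrictMonoidal.rightUnitor_eq _))

/-- The structural isomorphism `(a b) m (b' a') ≅ a (b m b') a'`. -/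
def twoSidedAssoc (a b m b' a' : M) :
    (a ⊗ b) ⊗ (m ⊗ (b' ⊗ a')) ≅ a ⊗ ((b ⊗ (m ⊗ b')) ⊗ a') :=
  α_ _ _ _ ≪≫ whiskerLeftIso a (whiskerLeftIso b (α_ _ _ _).symm ≪≫ (α_ _ _ _).symm)

lemma twoSidedAssoc_naturality {a₁ b₁ m₁ b₁' a₁' a₂ b₂ m₂ b₂' a₂' : M} (f : a₁ ⟶ a₂)
    (g : b₁ ⟶ b₂) (h : m₁ ⟶ m₂) (g' : b₁' ⟶ b₂') (f' : a₁' ⟶ a₂') :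
    ((f ⊗ₘ g) ⊗ₘ (h ⊗ₘ (g' ⊗ₘ f'))) ≫ (twoSidedAssoc M a₂ b₂ m₂ b₂' a₂').hom =
      (twoSidedAssoc M a₁ b₁ m₁ b₁' a₁').hom ≫ (f ⊗ₘ ((g ⊗ₘ (h ⊗ₘ g')) ⊗ₘ f')) := by
  simp only [twoSidedAssoc, Iso.trans_hom, whiskerLeftIso_hom, Iso.symm_hom, Category.assoc,
    associator_naturality_assoc]
  congr 1
  rw [tensorHom_comp_whiskerLeft, whiskerLeft_comp_tensorHom]
  congr 1
  rw [Category.assoc, ← associator_inv_naturality, ← Category.assoc, ← Category.assoc]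
  congr 1
  rw [tensorHom_comp_whiskerLeft, whiskerLeft_comp_tensorHom, associator_inv_naturality]

/-- The action of `M × M^{⊗op}` on `M` by left and right multiplication, `(a, b).m = a m b`. -/
instance twoSidedAction : MonoidalLeftAction (M × Mᴹᵒᵖ) M where
  actionObj a m := a.1 ⊗ (m ⊗ a.2.unmop)
  actionHomLeft f m := f.1 ⊗ₘ (𝟙 m ⊗ₘ f.2.unmop)
  actionHomRight a _ _ g := 𝟙 a.1 ⊗ₘ (g ⊗ₘ 𝟙 a.2.unmop)
  actionHom f g := f.1 ⊗ₘ (g ⊗ₘ f.2.unmop)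
  actionAssocIso a b m := twoSidedAssoc M a.1 b.1 m b.2.unmop a.2.unmop
  actionUnitIso m := λ_ _ ≪≫ ρ_ m
  actionHom_def f g := by simp only [tensorHom_comp_tensorHom, Category.id_comp, Category.comp_id]
  actionHomRight_id a m := by simp only [id_tensorHom_id]
  id_actionHomLeft a m := by
    change 𝟙 a.1 ⊗ₘ (𝟙 m ⊗ₘ 𝟙 a.2.unmop) = _
    simp only [id_tensorHom_id]
  actionHom_comp f₁ f₂ g₁ g₂ := by
    change (f₁.1 ≫ f₂.1) ⊗ₘ ((g₁ ≫ g₂) ⊗ₘ (f₁.2.unmop ≫ f₂.2.unmop)) = _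
    simp only [tensorHom_comp_tensorHom]
  actionAssocIso_hom_naturality f g h := twoSidedAssoc_naturality M _ _ _ _ _
  actionUnitIso_hom_naturality f := by
    change ((λ_ _).hom ≫ (ρ_ _).hom) ≫ f =
      (𝟙 (𝟙_ M) ⊗ₘ (f ⊗ₘ 𝟙 (𝟙_ M))) ≫ (λ_ _).hom ≫ (ρ_ _).hom
    rw [id_tensorHom, tensorHom_id, leftUnitor_naturality_assoc, rightUnitor_naturality,
      Category.assoc]
  whiskerLeft_actionHomLeft c c' c'' f d := by
    change (c.1 ◁ f.1) ⊗ₘ (𝟙 d ⊗ₘ (f.2.unmop ▷ c.2.unmop)) = (twoSidedAssoc M _ _ _ _ _).hom ≫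
      (𝟙 c.1 ⊗ₘ ((f.1 ⊗ₘ (𝟙 d ⊗ₘ f.2.unmop)) ⊗ₘ 𝟙 c.2.unmop)) ≫ (twoSidedAssoc M _ _ _ _ _).inv
    rw [← reassoc_of% twoSidedAssoc_naturality M]
    simp
  whiskerRight_actionHomLeft {c c'} c'' f d := by
    change (f.1 ▷ c''.1) ⊗ₘ (𝟙 d ⊗ₘ (c''.2.unmop ◁ f.2.unmop)) =
      (twoSidedAssoc M _ _ _ _ _).hom ≫
      (f.1 ⊗ₘ (𝟙 (c''.1 ⊗ (d ⊗ c''.2.unmop)) ⊗ₘ f.2.unmop)) ≫ (twoSidedAssoc M _ _ _ _ _).inv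
    rw [← id_tensorHom_id, ← id_tensorHom_id, ← reassoc_of% twoSidedAssoc_naturality M]
    simp
  associator_actionHom c₁ c₂ c₃ d := by
    change ((α_ c₁.1 c₂.1 c₃.1).hom ⊗ₘ (𝟙 d ⊗ₘ (α_ c₃.2.unmop c₂.2.unmop c₁.2.unmop).inv)) ≫
      (twoSidedAssoc M _ _ _ _ _).hom ≫ (𝟙 _ ⊗ₘ ((twoSidedAssoc M _ _ _ _ _).hom ⊗ₘ 𝟙 _)) =
      (twoSidedAssoc M _ _ _ _ _).hom ≫ (twoSidedAssoc M _ _ _ _ _).hom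
    simp only [twoSidedAssoc, Iso.trans_hom, whiskerLeftIso_hom, Iso.symm_hom]
    monoidal
  leftUnitor_actionHom c d := by
    change ((λ_ c.1).hom ⊗ₘ (𝟙 d ⊗ₘ (ρ_ c.2.unmop).hom)) =
      (twoSidedAssoc M _ _ _ _ _).hom ≫ (λ_ _).hom ≫ (ρ_ _).hom
    simp only [twoSidedAssoc, Iso.trans_hom, whiskerLeftIso_hom, Iso.symm_hom]
    monoidal
  rightUnitor_actionHom c d := by
    change ((ρ_ c.1).hom ⊗ₘ (𝟙 d ⊗ₘ (λ_ c.2.unmop).hom)) =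
      (twoSidedAssoc M _ _ _ _ _).hom ≫ (𝟙 _ ⊗ₘ (((λ_ _).hom ≫ (ρ_ _).hom) ⊗ₘ 𝟙 _))
    simp only [twoSidedAssoc, Iso.trans_hom, whiskerLeftIso_hom, Iso.symm_hom]
    monoidal

instance [StrictMonoidal M] : StrictAction (M × Mᴹᵒᵖ) M where
  tensor_act a b m := by
    change (a.1 ⊗ b.1) ⊗ (m ⊗ (b.2.unmop ⊗ a.2.unmop)) =
      a.1 ⊗ ((b.1 ⊗ (m ⊗ b.2.unmop)) ⊗ a.2.unmop)
    simp only [StrictMonoidal.tensor_assoc]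
  unit_act m := by
    change 𝟙_ M ⊗ (m ⊗ 𝟙_ M) = m
    simp only [StrictMonoidal.unit_tensor, StrictMonoidal.tensor_unit]
  actionAssocIso_eq a b m := by
    ext1
    change (twoSidedAssoc M _ _ _ _ _).hom = _
    simp [twoSidedAssoc, StrictMonoidal.associator_eq]
  actionUnitIso_eq m := by
    ext1
    change (λ_ _).hom ≫ (ρ_ _).hom = _
    simp [StrictMonoidal.leftUnitor_eq, StrictMonoidal.rightUnitor_eq]

/-- The 2-category `Q₂(M) = Q(M × M^{⊗op}, M)`. -/
abbrev QTwo : Type u := ActionQ (M × Mᴹᵒᵖ) M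

end selfAction

/-- A strict monoidal category `M`, viewed as a double category with one object and one horizontal
morphism. Its vertical nerve is the standard bar construction `B_• M`, with `M^n` as category of
`n`-simplices. -/
def barDoubleCat (M : Type u) [SmallCategory M] [MonoidalCategory M] [StrictMonoidal M] :
    DoubleCat.{u} where
  Obj := Discrete PUnit.{u + 1}
  Ver _ _ := M
  vid _ := 𝟙_ M
  vcomp p q := p ⊗ q
  vid_vcomp p := StrictMonoidal.unit_tensor p
  vcomp_vid p := StrictMonoidal.tensor_unit p
  vassoc p q r := StrictMonoidal.tensor_assoc p q r
  Sq _ p q _ := p ⟶ q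
  hid p := 𝟙 p
  hcomp α β := α ≫ β
  sqVid _ := 𝟙 (𝟙_ M)
  sqVcomp α β := α ⊗ₘ β
  hid_hcomp α := heq_of_eq (Category.id_comp α)
  hcomp_hid α := heq_of_eq (Category.comp_id α)
  hassoc α β γ := heq_of_eq (Category.assoc α β γ)
  sqVid_sqVcomp α := id_unit_tensorHom_heq α
  sqVcomp_sqVid α := tensorHom_id_unit_heq α
  sqVassoc α β γ := tensorHom_assoc_heq α β γ
  sqVid_id _ := rfl
  sqVid_comp _ _ := (Category.comp_id _).symm
  hid_vcomp p q := (id_tensorHom_id p q).symm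
  interchange α β γ δ := (tensorHom_comp_tensorHom α γ β δ).symm

/-- The total geometric realisation of the standard bar construction `B_• M`. -/
noncomputable def barRealisation (M : Type u) [SmallCategory M] [MonoidalCategory M]
    [StrictMonoidal M] : TopCat.{u} :=
  (barDoubleCat M).realisation

/-- The geometric realisation of a small category. -/
noncomputable abbrev catRealisation (C : Type u) [SmallCategory C] : TopCat.{u} :=
  SSet.toTop.obj (nerve C)

/-- The canonical comparison `|C × D| → |C| × |D|`. -/
noncomputable def prodComparison (C D : Type u) [SmallCategory C] [SmallCategory D]
    (z : catRealisation (C × D)) : catRealisation C × catRealisation D :=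
  (SSet.toTop.map (nerveMap (CategoryTheory.Prod.fst C D)) z,
    SSet.toTop.map (nerveMap (CategoryTheory.Prod.snd C D)) z)

section realisationOfAction

variable (M : Type u) [SmallCategory M] [MonoidalCategory M]

/-- The functor `M × X ⥤ X` given by an action. -/
def actionFunctor (X : Type u) [SmallCategory X] [MonoidalLeftAction M X] : M × X ⥤ X where
  obj z := z.1 ⊙ₗ z.2
  map f := f.1 ⊙ₗₘ f.2
  map_id z := by simp
  map_comp f g := MonoidalLeftAction.actionHom_comp f.1 g.1 f.2 g.2

/-- The action of `|M|` on `|X|`: the inverse of the canonical bijection `|M × X| → |M| × |X|`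
followed by the realisation of the action functor `M × X ⥤ X`. (Since the comparison map is a
bijection, the default value in `Function.extend` is never taken.) -/
noncomputable def realisationAct (X : Type u) [SmallCategory X] [MonoidalLeftAction M X]
    (a : catRealisation M) (x : catRealisation X) : catRealisation X :=
  Function.extend (prodComparison M X)
    (SSet.toTop.map (nerveMap (actionFunctor M X))) (fun z ↦ z.2) (a, x)

/-- The multiplication of the topological monoid `|M|`: the inverse of the canonical bijection
`|M × M| → |M| × |M|` followed by the realisation of the monoidal product `M × M ⥤ M`. -/
noncomputable def realisationMul (a b : catRealisation M) : catRealisation M :=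
  Function.extend (prodComparison M M) (SSet.toTop.map (nerveMap (tensor M))) (fun z ↦ z.2) (a, b)

/-- The unit of the topological monoid `|M|`: the vertex given by the monoidal unit. -/
noncomputable def realisationOne : catRealisation M :=
  TopCat.toSSetObjEquiv (catRealisation M) (op (SimplexCategory.mk 0))
    ((sSetTopAdj.unit.app (nerve M)).app (op (SimplexCategory.mk 0))
      (ComposableArrows.mk₀ (𝟙_ M))) (stdSimplex.vertex 0)

end realisationOfAction

namespace TopBar

variable (G Y : Type u) [TopologicalSpace G] [TopologicalSpace Y]

/-- The space `G^n × Y`, where the product is formed in the convenient category of Δ-generated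
spaces. -/
abbrev Level (n : ℕ) : Type u :=
  Topology.WithGeneratedByTopology (fun k : ℕ ↦ Fin k → ℝ) ((Fin n → G) × Y)

variable {G Y}

/-- The product of the `g i` with `a ≤ i < b`, later factors to the left. -/
def segment (one : G) (mul : G → G → G) {n : ℕ} (g : Fin n → G) (a b : Fin (n + 1)) : G :=
  ((List.finRange n).filter fun i ↦ a ≤ i.castSucc ∧ i.castSucc < b).foldl
    (fun h i ↦ mul (g i) h) one

/-- The simplicial structure maps of the bar construction of a monoid `G` acting on `Y`: the
`n`-simplex `(g, y)` stands for the string `y → g₀ y → g₁ g₀ y → ⋯`, and `θ` acts by restriction. -/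
def pull (one : G) (mul : G → G → G) (act : G → Y → Y) {k n : ℕ} (θ : Fin (k + 1) →o Fin (n + 1))
    (e : Level G Y n) : Level G Y k :=
  let z := Topology.WithGeneratedByTopology.equiv e
  Topology.WithGeneratedByTopology.equiv.symm
    (fun j ↦ segment one mul z.1 (θ j.castSucc) (θ j.succ),
      act (segment one mul z.1 0 (θ 0)) z.2)

/-- The relation `(e, θ_* t) ∼ (θ^* e, t)` defining the geometric realisation. -/
def Rel (one : G) (mul : G → G → G) (act : G → Y → Y)
    (p q : Σ n : ℕ, Level G Y n × stdSimplex ℝ (Fin (n + 1))) : Prop :=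
  ∃ θ : Fin (q.1 + 1) →o Fin (p.1 + 1),
    pull one mul act θ p.2.1 = q.2.1 ∧ p.2.2 = stdSimplex.map θ q.2.2

end TopBar

/-- The geometric realisation of the bar construction `[n] ↦ G^n × Y` of a topological monoid `G`
(with unit `one` and product `mul`) acting on a space `Y`. -/
def TopBar {G Y : Type u} [TopologicalSpace G] [TopologicalSpace Y] (one : G) (mul : G → G → G)
    (act : G → Y → Y) : Type u :=
  Quot (TopBar.Rel one mul act)

instance {G Y : Type u} [TopologicalSpace G] [TopologicalSpace Y] (one : G) (mul : G → G → G)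
    (act : G → Y → Y) : TopologicalSpace (TopBar one mul act) :=
  inferInstanceAs (TopologicalSpace (Quot _))

/-- The homotopy quotient `|X|_{|M|}` of the action of the topological monoid `|M|` on `|X|`. -/
abbrev HomotopyQuotient (M X : Type u) [SmallCategory M] [MonoidalCategory M] [SmallCategory X]
    [MonoidalLeftAction M X] : Type u :=
  TopBar (realisationOne M) (realisationMul M) (realisationAct M X)

/-- The classifying space `B|M|` of the topological monoid `|M|`: the realisation of its standard
bar construction `[n] ↦ |M|^n`, whose inner faces multiply neighbouring factors in the given
order. -/
abbrev ClassifyingSpace (M : Type u) [SmallCategory M] [MonoidalCategory M] : Type u :=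
  TopBar (Y := PUnit.{u + 1}) (realisationOne M) (fun a b ↦ realisationMul M b a) (fun _ y ↦ y)

/-- A pseudofunctor is a biequivalence if it is an equivalence on hom-categories and every object
of the target is equivalent to an object in the image. -/
def IsBiequivalence {B : Type u} [Bicategory.{w, v} B] {C : Type*} [Bicategory C]
    (F : Pseudofunctor B C) : Prop :=
  (∀ a b : B, (F.mapFunctor a b).IsEquivalence) ∧
    ∀ c : C, ∃ b : B, Nonempty (Bicategory.Equivalence (F.obj b) c)

/-- The small monoidal category `M'` is (monoidally) equivalent to `M`. -/
def IsMonoidalModel (M' : Type u) [SmallCategory M'] [MonoidalCategory M'] (M : Type w)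
    [Category.{v} M] [MonoidalCategory M] : Prop :=
  ∃ F : M' ⥤ M, Nonempty F.Monoidal ∧ F.IsEquivalence

/-- The small 2-category `B` is equivalent to the 2-category `C`. -/
def IsTwoCatModel (B : Type u) [Bicategory.{u, u} B] (C : Type wt) [Bicategory.{v, w} C] : Prop :=
  ∃ F : Pseudofunctor B C, IsBiequivalence F

/-!
The double categories in the theorem are compared one direction at a time. A double functor induces
a functor between the categories of strings of each vertical length, and another one between the
categories of strings of each horizontal length. If all functors of one of the two families have
inverses up to natural transformations, then the double functor is a homotopy equivalence. Three
general facts give this principle.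

* Weak equivalences of simplicial sets are defined by mapping into Kan complexes (`SSet.WEq`). A
  natural transformation is a homotopy of maps of nerves (`SSet.htpy_nerveMap`), so that functors
  with an inverse up to natural transformations induce weak equivalences.
* A levelwise weak equivalence of bisimplicial sets is a weak equivalence on diagonals
  (`SSet.wEq_bisimplicialDiagonal_map`). Monic weak equivalences are characterised by a lifting
  property, hence closed under pushouts and transfinite compositions, and the diagonal is filtered
  by the outer degree.
* A weak equivalence realises to a homotopy equivalence (`Geometric.isHomotopyEquivalence_of_wEq`),
  because singular simplicial sets are Kan complexes and simplicial homotopies realise to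
  homotopies. The latter needs the realisation of a product, which rests on the fact that a pair of
  distributions on two finite chains has exactly one coupling supported on a chain of the product.

For the double functor `Φ`, the vertical length is fixed. A string of vertical morphisms of `𝓜 ⋉ X`
receives a natural map from the string of `𝓜 × X` with the same objects of `M` and the same first
object (`LaxString.rectify`). For the inclusion of `Q(M, X)`, the horizontal length is fixed. A
string of horizontal morphisms maps to the constant string on its last object
(`LaxRow.collapse`). The homotopy quotient is homeomorphic to the realisation of `𝓜 × X`
(`StrictString.homotopyQuotientHomeo`): a bisimplicial set whose levels are products `A^n × B`, with
the operators of a bar construction, realises to the bar construction of the realisations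
(`Geometric.topBarHomeo`).

For the classifying space, the two-sided action of `M` on itself is compared with the bar
construction by forgetting the left factors (`TwoSided.toBar`). For strings of horizontal length
`l`, this is the projection from the two-sided action of a monoid `T` on itself to `T`, where `T` is
the monoid of strings of `l` morphisms of `M`. The category of a two-sided action is the diagonal of
a double category whose two directions are the left and the right multiplications
(`BiAct.diagonalIso`), and for a fixed string of right factors the left multiplications form a
category with an initial object (`BiAct.wEq_nerveMap_proj`).

For essentially small `M`, a small strict model is given by the words in a small set of
representatives of the objects (`WordModel`). A monoidal equivalence induces a biequivalence of
two-sided Q-constructions (`exists_isBiequivalence_qTwo`), so that both small 2-categories which are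
to be compared have biequivalences to `Q₂(M)`. Two small strict 2-categories with biequivalences to
a common bicategory are compared through the strict 2-category of pairs of objects with equivalent
images (`Comparison`), whose projections are surjective on objects, full on morphisms and fully
faithful on 2-cells. Such strict 2-functors are homotopy equivalences by the principle above
(`TwoFunctor.nonempty_homotopyEquiv`).
-/

/-! ### Homotopies and weak equivalences of simplicial sets -/

namespace SSet

open CategoryTheory MonoidalCategory CartesianMonoidalCategory Simplicial HomotopicalAlgebra
  Limits Opposite modelCategoryQuillen

lemma whiskerLeft_δ_one (X : SSet.{u}) :
    X ◁ stdSimplex.δ (1 : Fin 2) = fst X Δ[0] ≫ ι₀ := by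
  ext n ⟨x, y⟩
  · rfl
  · apply stdSimplex.objEquiv.injective
    ext i
    have : (stdSimplex.objEquiv y).toOrderHom i = (0 : Fin 1) :=
      Subsingleton.elim (α := Fin 1) _ _
    have h2 : (stdSimplex.objEquiv ((stdSimplex.δ (1 : Fin 2)).app _ y)).toOrderHom i =
      ((SimplexCategory.δ (1 : Fin 2)).toOrderHom ((stdSimplex.objEquiv y).toOrderHom i)) := rfl
    erw [h2, this]
    rfl

lemma whiskerLeft_δ_zero (X : SSet.{u}) :
    X ◁ stdSimplex.δ (0 : Fin 2) = fst X Δ[0] ≫ ι₁ := by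
  ext n ⟨x, y⟩
  · rfl
  · apply stdSimplex.objEquiv.injective
    ext i
    have : (stdSimplex.objEquiv y).toOrderHom i = (0 : Fin 1) :=
      Subsingleton.elim (α := Fin 1) _ _
    have h2 : (stdSimplex.objEquiv ((stdSimplex.δ (0 : Fin 2)).app _ y)).toOrderHom i =
      ((SimplexCategory.δ (0 : Fin 2)).toOrderHom ((stdSimplex.objEquiv y).toOrderHom i)) := rfl
    erw [h2, this]
    rfl

lemma δ_one_comp_curry {X Y : SSet.{u}} (h : X ⊗ Δ[1] ⟶ Y) :
    stdSimplex.δ (1 : Fin 2) ≫ MonoidalClosed.curry h =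
      MonoidalClosed.curry (fst X Δ[0] ≫ ι₀ ≫ h) := by
  rw [← MonoidalClosed.curry_natural_left, whiskerLeft_δ_one, Category.assoc]

lemma δ_zero_comp_curry {X Y : SSet.{u}} (h : X ⊗ Δ[1] ⟶ Y) :
    stdSimplex.δ (0 : Fin 2) ≫ MonoidalClosed.curry h =
      MonoidalClosed.curry (fst X Δ[0] ≫ ι₁ ≫ h) := by
  rw [← MonoidalClosed.curry_natural_left, whiskerLeft_δ_zero, Category.assoc]

lemma fst_stdSimplex_zero_cancel {X Y : SSet.{u}} {f g : X ⟶ Y}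
    (h : fst X Δ[0] ≫ f = fst X Δ[0] ≫ g) : f = g := by
  have : lift (𝟙 X) (const (stdSimplex.obj₀Equiv.{u}.symm 0)) ≫ fst X Δ[0] = 𝟙 X := by simp
  rw [← Category.id_comp f, ← Category.id_comp g, ← this, Category.assoc, h, Category.assoc]

lemma stdSimplex_δ_one_δ_zero : (stdSimplex.δ (1 : Fin 2) ≫ stdSimplex.δ (0 : Fin 3) :
    Δ[0] ⟶ (Δ[2] : SSet.{u})) = stdSimplex.δ (0 : Fin 2) ≫ stdSimplex.δ (2 : Fin 3) :=
  (CosimplicialObject.δ_comp_δ stdSimplex (i := (0 : Fin 2)) (j := 1) (by simp)).symm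

lemma stdSimplex_δ_zero_δ_zero : (stdSimplex.δ (0 : Fin 2) ≫ stdSimplex.δ (0 : Fin 3) :
    Δ[0] ⟶ (Δ[2] : SSet.{u})) = stdSimplex.δ (0 : Fin 2) ≫ stdSimplex.δ (1 : Fin 3) :=
  (CosimplicialObject.δ_comp_δ stdSimplex (i := (0 : Fin 2)) (j := 0) (by simp)).symm

lemma stdSimplex_δ_zero_σ_one : (stdSimplex.δ (0 : Fin 3) ≫ stdSimplex.σ (1 : Fin 2) :
    Δ[1] ⟶ (Δ[1] : SSet.{u})) = stdSimplex.σ (0 : Fin 1) ≫ stdSimplex.δ (0 : Fin 2) :=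
  (CosimplicialObject.δ_comp_σ_of_le stdSimplex (i := (0 : Fin 2)) (j := 0) (by simp))

lemma stdSimplex_δ_one_σ_one : (stdSimplex.δ (1 : Fin 3) ≫ stdSimplex.σ (1 : Fin 2) :
    Δ[1] ⟶ (Δ[1] : SSet.{u})) = 𝟙 _ :=
  (CosimplicialObject.δ_comp_σ_self stdSimplex (i := (1 : Fin 2)))

lemma stdSimplex_δ_two_σ_one : (stdSimplex.δ (2 : Fin 3) ≫ stdSimplex.σ (1 : Fin 2) :
    Δ[1] ⟶ (Δ[1] : SSet.{u})) = 𝟙 _ :=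
  (CosimplicialObject.δ_comp_σ_succ stdSimplex (i := (1 : Fin 2)))

/-- Two homotopies with a common source and the same image under a fibration differ by a homotopy
between their targets which is constant in the base: the horn `Λ[2, 0]` which they form in the
function complex is filled over a degenerate simplex. -/
lemma exists_homotopy_of_fibration {X E F : SSet.{u}} (p : E ⟶ F) [Fibration p]
    (a b : X ⊗ Δ[1] ⟶ E) (h₀ : ι₀ ≫ a = ι₀ ≫ b) (h : a ≫ p = b ≫ p) :
    ∃ V : X ⊗ Δ[1] ⟶ E, ι₀ ≫ V = ι₁ ≫ a ∧ ι₁ ≫ V = ι₁ ≫ b ∧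
      V ≫ p = fst _ _ ≫ ι₁ ≫ a ≫ p := by
  let f : ∀ (j : Fin 3) (_ : j ≠ 0), Δ[1] ⟶ (ihom X).obj E := fun j _ ↦
    if j = 1 then MonoidalClosed.curry b else MonoidalClosed.curry a
  have hf : horn.IsCompatible f := by
    rw [horn.isCompatible_iff]
    intro j k hj hk hjk
    obtain ⟨rfl, rfl⟩ : j = 1 ∧ k = 2 := by revert j k; decide
    change stdSimplex.δ 1 ≫ MonoidalClosed.curry b = stdSimplex.δ 1 ≫ MonoidalClosed.curry a
    rw [δ_one_comp_curry, δ_one_comp_curry, h₀]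
  have hδ₁ : stdSimplex.δ (1 : Fin 3) ≫ stdSimplex.σ (1 : Fin 2) ≫
      MonoidalClosed.curry (a ≫ p) = MonoidalClosed.curry (a ≫ p) := by
    rw [← Category.assoc, stdSimplex_δ_one_σ_one, Category.id_comp]
  have hδ₂ : stdSimplex.δ (2 : Fin 3) ≫ stdSimplex.σ (1 : Fin 2) ≫
      MonoidalClosed.curry (a ≫ p) = MonoidalClosed.curry (a ≫ p) := by
    rw [← Category.assoc, stdSimplex_δ_two_σ_one, Category.id_comp]
  obtain ⟨φ, hφ, hφ'⟩ := hf.exists_lift ((ihom X).map p)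
    (stdSimplex.σ (1 : Fin 2) ≫ MonoidalClosed.curry (a ≫ p)) (by
      intro j hj
      obtain rfl | rfl : j = 1 ∨ j = 2 := by revert j; decide
      · change MonoidalClosed.curry b ≫ _ = _
        rw [← MonoidalClosed.curry_natural_right, ← h]
        exact hδ₁.symm
      · change MonoidalClosed.curry a ≫ _ = _
        rw [← MonoidalClosed.curry_natural_right]
        exact hδ₂.symm)
  have h1 : stdSimplex.δ (1 : Fin 3) ≫ φ = MonoidalClosed.curry b := hφ 1 (by simp)
  have h2 : stdSimplex.δ (2 : Fin 3) ≫ φ = MonoidalClosed.curry a := hφ 2 (by simp)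
  have hV : MonoidalClosed.curry (MonoidalClosed.uncurry (stdSimplex.δ (0 : Fin 3) ≫ φ)) =
    stdSimplex.δ (0 : Fin 3) ≫ φ := MonoidalClosed.curry_uncurry _
  refine ⟨MonoidalClosed.uncurry (stdSimplex.δ (0 : Fin 3) ≫ φ), ?_, ?_, ?_⟩
  · apply fst_stdSimplex_zero_cancel
    apply MonoidalClosed.curry_injective
    rw [← δ_one_comp_curry, ← δ_zero_comp_curry, hV, ← h2, ← Category.assoc, ← Category.assoc,
      stdSimplex_δ_one_δ_zero]
  · apply fst_stdSimplex_zero_cancel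
    apply MonoidalClosed.curry_injective
    rw [← δ_zero_comp_curry, ← δ_zero_comp_curry, hV, ← h1, ← Category.assoc, ← Category.assoc,
      stdSimplex_δ_zero_δ_zero]
  · apply MonoidalClosed.curry_injective
    rw [MonoidalClosed.curry_natural_right, hV, Category.assoc, hφ', ← Category.assoc,
      stdSimplex_δ_zero_σ_one, Category.assoc, δ_zero_comp_curry,
      ← MonoidalClosed.curry_natural_left]
    rfl

/-- Two maps of simplicial sets are elementarily homotopic if they are the two ends of a
cylinder. -/
def Htpy {X Y : SSet.{u}} (f g : X ⟶ Y) : Prop :=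
  ∃ h : X ⊗ Δ[1] ⟶ Y, ι₀ ≫ h = f ∧ ι₁ ≫ h = g

namespace Htpy

variable {X Y Z : SSet.{u}}

lemma refl (f : X ⟶ Y) : Htpy f f := ⟨fst _ _ ≫ f, by simp, by simp⟩

lemma comp_right {f g : X ⟶ Y} (h : Htpy f g) (k : Y ⟶ Z) : Htpy (f ≫ k) (g ≫ k) := by
  obtain ⟨H, rfl, rfl⟩ := h
  exact ⟨H ≫ k, by simp, by simp⟩

lemma comp_left {f g : Y ⟶ Z} (h : Htpy f g) (k : X ⟶ Y) : Htpy (k ≫ f) (k ≫ g) := by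
  obtain ⟨H, rfl, rfl⟩ := h
  exact ⟨k ▷ _ ≫ H, by rw [ι₀_comp_assoc], by rw [ι₁_comp_assoc]⟩

lemma whiskerLeft {f g : X ⟶ Y} (h : Htpy f g) (Z : SSet.{u}) : Htpy (Z ◁ f) (Z ◁ g) := by
  obtain ⟨H, rfl, rfl⟩ := h
  exact ⟨(α_ _ _ _).hom ≫ Z ◁ H, rfl, rfl⟩

/-- Homotopy of maps to a Kan complex is a Euclidean relation, by filling the horn `Λ[2, 0]` in the
function complex. Symmetry and transitivity follow. -/
lemma euclidean [KanComplex Y] {f g k : X ⟶ Y} (h : Htpy f g) (h' : Htpy f k) : Htpy g k := by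
  obtain ⟨a, rfl, rfl⟩ := h
  obtain ⟨b, hb, rfl⟩ := h'
  obtain ⟨V, h₀, h₁, -⟩ := exists_homotopy_of_fibration (terminal.from Y) a b hb.symm
    (Subsingleton.elim _ _)
  exact ⟨V, h₀, h₁⟩

lemma symm [KanComplex Y] {f g : X ⟶ Y} (h : Htpy f g) : Htpy g f := h.euclidean (refl f)

lemma trans [KanComplex Y] {f g k : X ⟶ Y} (h : Htpy f g) (h' : Htpy g k) : Htpy f k :=
  h.symm.euclidean h'

lemma curry {A : SSet.{u}} {f g : A ⊗ X ⟶ Y} (h : Htpy f g) :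
    Htpy (MonoidalClosed.curry f) (MonoidalClosed.curry g) := by
  obtain ⟨H, rfl, rfl⟩ := h
  refine ⟨MonoidalClosed.curry ((α_ _ _ _).inv ≫ H), ?_, ?_⟩
  · rw [← MonoidalClosed.curry_natural_left]
    rfl
  · rw [← MonoidalClosed.curry_natural_left]
    rfl

lemma uncurry {A : SSet.{u}} {f g : X ⟶ (ihom A).obj Y} (h : Htpy f g) :
    Htpy (MonoidalClosed.uncurry f) (MonoidalClosed.uncurry g) := by
  obtain ⟨H, rfl, rfl⟩ := h
  refine ⟨(α_ _ _ _).hom ≫ MonoidalClosed.uncurry H, ?_, ?_⟩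
  · rw [MonoidalClosed.uncurry_natural_left]
    rfl
  · rw [MonoidalClosed.uncurry_natural_left]
    rfl

end Htpy

/-- A weak equivalence of simplicial sets, defined by mapping into Kan complexes: precomposition
is bijective on homotopy classes. -/
structure WEq {X Y : SSet.{u}} (f : X ⟶ Y) : Prop where
  exists_extension (K : SSet.{u}) [KanComplex K] (g : X ⟶ K) : ∃ g' : Y ⟶ K, Htpy (f ≫ g') g
  htpy_of_comp (K : SSet.{u}) [KanComplex K] (g g' : Y ⟶ K) (h : Htpy (f ≫ g) (f ≫ g')) :
    Htpy g g'

namespace WEq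

variable {X Y Z : SSet.{u}}

lemma comp {f : X ⟶ Y} {g : Y ⟶ Z} (hf : WEq f) (hg : WEq g) : WEq (f ≫ g) where
  exists_extension K _ k := by
    obtain ⟨k', h'⟩ := hf.exists_extension K k
    obtain ⟨k'', h''⟩ := hg.exists_extension K k'
    exact ⟨k'', by simpa using (h''.comp_left f).trans h'⟩
  htpy_of_comp K _ k k' h := hg.htpy_of_comp K _ _ (hf.htpy_of_comp K _ _ (by simpa using h))

lemma of_comp_left {f : X ⟶ Y} {g : Y ⟶ Z} (hf : WEq f) (hfg : WEq (f ≫ g)) : WEq g where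
  exists_extension K _ k := by
    obtain ⟨k', h'⟩ := hfg.exists_extension K (f ≫ k)
    exact ⟨k', hf.htpy_of_comp _ _ _ (by simpa using h')⟩
  htpy_of_comp K _ k k' h := hfg.htpy_of_comp K _ _ (by simpa using h.comp_left f)

/-- The maps into Kan complexes produced by `exists_extension` extend only up to homotopy, so that
uniqueness for `f` is obtained by comparing extensions along `g`. -/
lemma of_comp_right {f : X ⟶ Y} {g : Y ⟶ Z} (hg : WEq g) (hfg : WEq (f ≫ g)) : WEq f where
  exists_extension K _ k := by
    obtain ⟨k', h'⟩ := hfg.exists_extension K k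
    exact ⟨g ≫ k', by simpa using h'⟩
  htpy_of_comp K _ k k' h := by
    obtain ⟨l, hl⟩ := hg.exists_extension K k
    obtain ⟨l', hl'⟩ := hg.exists_extension K k'
    refine hl.symm.trans (Htpy.trans ((hfg.htpy_of_comp K _ _ ?_).comp_left g) hl')
    simpa using ((hl.comp_left f).trans h).trans (hl'.comp_left f).symm

/-- Homotopies are allowed to go in either direction. -/
lemma of_htpy_inverse {f : X ⟶ Y} (g : Y ⟶ X) (h : Htpy (f ≫ g) (𝟙 X) ∨ Htpy (𝟙 X) (f ≫ g))
    (h' : Htpy (g ≫ f) (𝟙 Y) ∨ Htpy (𝟙 Y) (g ≫ f)) : WEq f where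
  exists_extension K _ k := by
    refine ⟨g ≫ k, ?_⟩
    obtain h | h := h
    · simpa using h.comp_right k
    · simpa using (h.comp_right k).symm
  htpy_of_comp K _ k k' hk := by
    have hk' := hk.comp_left g
    obtain h' | h' := h'
    · refine ((?_ : Htpy (g ≫ f ≫ k) k).symm.trans hk').trans ?_
      · simpa using h'.comp_right k
      · simpa using h'.comp_right k'
    · refine ((?_ : Htpy k (g ≫ f ≫ k)).trans hk').trans (Htpy.symm ?_)
      · simpa using h'.comp_right k
      · simpa using h'.comp_right k'

lemma of_iso (e : X ≅ Y) : WEq e.hom :=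
  of_htpy_inverse e.inv (Or.inl (by simpa using Htpy.refl _)) (Or.inl (by simpa using Htpy.refl _))

lemma of_isIso (f : X ⟶ Y) [IsIso f] : WEq f := of_iso (asIso f)

lemma whiskerLeft {f : X ⟶ Y} (hf : WEq f) (Z : SSet.{u}) : WEq (Z ◁ f) where
  exists_extension K _ k := by
    obtain ⟨k', h'⟩ := hf.exists_extension _ (MonoidalClosed.curry k)
    refine ⟨MonoidalClosed.uncurry k', ?_⟩
    simpa [MonoidalClosed.uncurry_natural_left] using h'.uncurry
  htpy_of_comp K _ k k' hk := by
    have := hk.curry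
    rw [MonoidalClosed.curry_natural_left, MonoidalClosed.curry_natural_left] at this
    simpa using (hf.htpy_of_comp _ _ _ this).uncurry

lemma whiskerRight {f : X ⟶ Y} (hf : WEq f) (Z : SSet.{u}) : WEq (f ▷ Z) := by
  have : f ▷ Z = (β_ _ _).hom ≫ Z ◁ f ≫ (β_ _ _).hom := rfl
  rw [this]
  exact (of_iso _).comp ((hf.whiskerLeft Z).comp (of_iso _))

end WEq

end SSet

/-! ### Trivial cofibrations -/

namespace SSet

open CategoryTheory MonoidalCategory CartesianMonoidalCategory Simplicial HomotopicalAlgebra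
  Limits Opposite modelCategoryQuillen

/-- The vertex inclusion is the horn inclusion `Λ[1, 0] ⟶ Δ[1]`. -/
lemma anodyneExtensions_δ_one :
    anodyneExtensions (stdSimplex.δ (1 : Fin 2) : Δ[0] ⟶ (Δ[1] : SSet.{u})) := by
  intro E F p hp
  rw [← HomotopicalAlgebra.fibration_iff] at hp
  refine ⟨fun {u v} sq ↦ ?_⟩
  have hf : horn.IsCompatible (i := (0 : Fin 2)) (fun _ _ ↦ u) := trivial
  obtain ⟨φ, hφ, hφ'⟩ := hf.exists_lift p v (by
    intro j hj
    obtain rfl : j = 1 := by revert j; decide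
    exact sq.w)
  exact ⟨⟨⟨φ, hφ 1 (by simp), hφ'⟩⟩⟩

/-- The homotopy lifting extension property of a monomorphism relative to a fibration. -/
lemma exists_homotopy_lift_extension {A B E F : SSet.{u}} (i : A ⟶ B) [Mono i] (p : E ⟶ F)
    [Fibration p] (w : B ⟶ E) (h : A ⊗ Δ[1] ⟶ E) (k : B ⊗ Δ[1] ⟶ F)
    (h₁ : ι₀ ≫ h = i ≫ w) (h₂ : h ≫ p = i ▷ _ ≫ k) (h₃ : w ≫ p = ι₀ ≫ k) :
    ∃ L : B ⊗ Δ[1] ⟶ E, ι₀ ≫ L = w ∧ i ▷ _ ≫ L = h ∧ L ≫ p = k := by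
  let sq := Functor.PushoutObjObj.ofHasPushout (curriedTensor SSet) i
    (stdSimplex.δ (1 : Fin 2) : Δ[0] ⟶ (Δ[1] : SSet.{u}))
  have hsq := anodyneExtensions_pushoutObjObjι sq anodyneExtensions_δ_one p
    (by rwa [← HomotopicalAlgebra.fibration_iff])
  have hcomm : i ▷ Δ[0] ≫ fst _ _ ≫ w = A ◁ stdSimplex.δ (1 : Fin 2) ≫ h := by
    rw [whiskerLeft_δ_one, Category.assoc, h₁, whiskerRight_fst_assoc]
  let t : sq.pt ⟶ E := sq.isPushout.desc (fst _ _ ≫ w) h hcomm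
  have ht₁ : sq.inl ≫ t = fst _ _ ≫ w := sq.isPushout.inl_desc ..
  have ht₂ : sq.inr ≫ t = h := sq.isPushout.inr_desc ..
  have e₁ : sq.inl ≫ sq.ι = B ◁ stdSimplex.δ (1 : Fin 2) := sq.inl_ι
  have e₂ : sq.inr ≫ sq.ι = i ▷ _ := sq.inr_ι
  have comm : CommSq t sq.ι p k := ⟨by
    apply sq.isPushout.hom_ext
    · rw [reassoc_of% ht₁, reassoc_of% e₁, h₃, whiskerLeft_δ_one, Category.assoc]
    · rw [reassoc_of% ht₂, reassoc_of% e₂, h₂]⟩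
  have hl := comm.fac_left
  refine ⟨comm.lift, ?_, ?_, comm.fac_right⟩
  · apply fst_stdSimplex_zero_cancel
    rw [← ht₁]
    refine Eq.trans ?_ (congr_arg (sq.inl ≫ ·) hl)
    simp only [reassoc_of% e₁, whiskerLeft_δ_one, Category.assoc]
  · rw [← ht₂]
    refine Eq.trans ?_ (congr_arg (sq.inr ≫ ·) hl)
    simp only [reassoc_of% e₂]

/-- A fibration between Kan complexes which is a homotopy equivalence is a trivial fibration. -/
lemma rlp_monomorphisms_of_htpy_inverse {E F : SSet.{u}} [KanComplex E] [KanComplex F]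
    (p : E ⟶ F) [Fibration p] (s : F ⟶ E) (hps : Htpy (p ≫ s) (𝟙 E))
    (hsp : Htpy (s ≫ p) (𝟙 F)) : (MorphismProperty.monomorphisms SSet.{u}).rlp p := by
  -- replace `s` by a strict section
  obtain ⟨s', hs', hs's⟩ : ∃ s' : F ⟶ E, s' ≫ p = 𝟙 F ∧ Htpy s s' := by
    obtain ⟨k, hk₀, hk₁⟩ := hsp
    have : HasLiftingProperty (F ◁ (stdSimplex.δ (1 : Fin 2) : Δ[0] ⟶ (Δ[1] : SSet.{u}))) p :=
      anodyneExtensions_δ_one.whiskerLeft F p (by rwa [← HomotopicalAlgebra.fibration_iff])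
    have sq : CommSq (fst _ _ ≫ s)
        (F ◁ (stdSimplex.δ (1 : Fin 2) : Δ[0] ⟶ (Δ[1] : SSet.{u}))) p k :=
      ⟨by rw [whiskerLeft_δ_one, Category.assoc, Category.assoc, hk₀]⟩
    refine ⟨ι₁ ≫ sq.lift, by rw [Category.assoc, sq.fac_right, hk₁], sq.lift, ?_, rfl⟩
    apply fst_stdSimplex_zero_cancel
    refine Eq.trans ?_ sq.fac_left
    refine Eq.trans ?_ (congr_arg (· ≫ sq.lift) (whiskerLeft_δ_one F)).symm
    simp only [Category.assoc]
  obtain ⟨H, hH₀, hH₁⟩ : Htpy (p ≫ s') (𝟙 E) := (hs's.comp_left p).euclidean hps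
  -- make the homotopy vertical
  obtain ⟨V, hV₀, hV₁, hV⟩ := exists_homotopy_of_fibration p (H ≫ p ≫ s') H
    (by rw [reassoc_of% hH₀, hH₀, reassoc_of% hs']) (by simp [hs'])
  rw [reassoc_of% hH₁] at hV₀
  rw [hH₁] at hV₁
  simp only [Category.assoc, reassoc_of% hH₁, hs', Category.comp_id] at hV
  intro A B i (hi : Mono i)
  refine ⟨fun {a b} sq ↦ ?_⟩
  obtain ⟨L, hL₀, hL, hLp⟩ := exists_homotopy_lift_extension i p (b ≫ s') (a ▷ _ ≫ V)
    (fst _ _ ≫ b) (by rw [ι₀_comp_assoc, hV₀, reassoc_of% sq.w])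
    (by rw [Category.assoc, hV, whiskerRight_fst_assoc, whiskerRight_fst_assoc, sq.w])
    (by simp [hs'])
  refine ⟨⟨⟨ι₁ ≫ L, ?_, ?_⟩⟩⟩
  · rw [← Category.assoc, ← ι₁_comp, Category.assoc, hL, ι₁_comp_assoc, hV₁, Category.comp_id]
  · rw [Category.assoc, hLp, reassoc_of% ι₁_fst]

/-- Precomposition with a monic weak equivalence is a trivial fibration on mapping spaces into
Kan complexes. -/
lemma WEq.rlp_pre {A B : SSet.{u}} {i : A ⟶ B} [Mono i] (hi : WEq i) (K : SSet.{u})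
    [KanComplex K] :
    (MorphismProperty.monomorphisms SSet.{u}).rlp ((MonoidalClosed.pre i).app K) := by
  obtain ⟨g, hg⟩ := (hi.whiskerRight ((ihom A).obj K)).exists_extension K
    (MonoidalClosed.uncurry (𝟙 _))
  have h₁ : Htpy (MonoidalClosed.curry g ≫ (MonoidalClosed.pre i).app K) (𝟙 _) := by
    have := hg.curry
    rwa [MonoidalClosed.curry_uncurry, ← MonoidalClosed.uncurry_curry g,
      ← MonoidalClosed.uncurry_pre_app, MonoidalClosed.curry_uncurry] at this
  refine rlp_monomorphisms_of_htpy_inverse _ (MonoidalClosed.curry g) ?_ h₁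
  have := (hi.whiskerRight ((ihom B).obj K)).htpy_of_comp K
    (MonoidalClosed.uncurry ((MonoidalClosed.pre i).app K ≫ MonoidalClosed.curry g))
    (MonoidalClosed.uncurry (𝟙 _)) (by
      rw [← MonoidalClosed.uncurry_pre_app, ← MonoidalClosed.uncurry_pre_app, Category.assoc]
      refine Htpy.uncurry ?_
      simpa using h₁.comp_left ((MonoidalClosed.pre i).app K))
  simpa using this.curry

/-- By adjunction, `i` and `j` play symmetric roles in the lifting problems of their pushout-product
against the map from `K` to the point. -/
lemma hasLiftingProperty_pre_swap {A B C D K : SSet.{u}} (i : A ⟶ B) (j : C ⟶ D)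
    [HasLiftingProperty j ((MonoidalClosed.pre i).app K)] :
    HasLiftingProperty i ((MonoidalClosed.pre j).app K) := by
  refine ⟨fun {a b} sq ↦ ?_⟩
  have hw := congr_arg MonoidalClosed.uncurry sq.w
  rw [MonoidalClosed.uncurry_pre_app, MonoidalClosed.uncurry_natural_left] at hw
  let a' : D ⟶ (ihom A).obj K := MonoidalClosed.curry ((β_ _ _).hom ≫ MonoidalClosed.uncurry a)
  let b' : C ⟶ (ihom B).obj K := MonoidalClosed.curry ((β_ _ _).hom ≫ MonoidalClosed.uncurry b)
  have sq' : CommSq b' j ((MonoidalClosed.pre i).app K) a' := ⟨by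
    apply MonoidalClosed.uncurry_injective
    rw [MonoidalClosed.uncurry_pre_app, MonoidalClosed.uncurry_natural_left,
      MonoidalClosed.uncurry_curry, MonoidalClosed.uncurry_curry,
      BraidedCategory.braiding_naturality_left_assoc,
      BraidedCategory.braiding_naturality_right_assoc, hw]⟩
  have h₁ := congr_arg MonoidalClosed.uncurry sq'.fac_left
  have h₂ := congr_arg MonoidalClosed.uncurry sq'.fac_right
  rw [MonoidalClosed.uncurry_natural_left, MonoidalClosed.uncurry_curry] at h₁
  rw [MonoidalClosed.uncurry_pre_app, MonoidalClosed.uncurry_curry] at h₂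
  refine ⟨⟨⟨MonoidalClosed.curry ((β_ _ _).hom ≫ MonoidalClosed.uncurry sq'.lift), ?_, ?_⟩⟩⟩
  · apply MonoidalClosed.uncurry_injective
    rw [MonoidalClosed.uncurry_natural_left, MonoidalClosed.uncurry_curry,
      BraidedCategory.braiding_naturality_right_assoc, h₂, SymmetricCategory.symmetry_assoc]
  · apply MonoidalClosed.uncurry_injective
    rw [MonoidalClosed.uncurry_pre_app, MonoidalClosed.uncurry_curry,
      BraidedCategory.braiding_naturality_left_assoc, h₁, SymmetricCategory.symmetry_assoc]

/-- The maps of mapping spaces into Kan complexes induced by monomorphisms. -/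
inductive preMono : MorphismProperty SSet.{u} where
  | mk {C D : SSet.{u}} (j : C ⟶ D) [Mono j] (K : SSet.{u}) [KanComplex K] :
      preMono ((MonoidalClosed.pre j).app K)

/-- Together with `WEq.of_llp_preMono`: the monic weak equivalences are the monomorphisms with the
left lifting property against a class of maps. Their closure properties follow formally. -/
lemma WEq.llp_preMono {A B : SSet.{u}} {i : A ⟶ B} [Mono i] (hi : WEq i) :
    preMono.llp i := by
  rintro _ _ _ ⟨j, K⟩
  have := hi.rlp_pre K j (MorphismProperty.monomorphisms.infer_property j)
  exact hasLiftingProperty_pre_swap i j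

lemma stdSimplex_one_eq_of_mem_boundary {n : ℕ} (s : (Δ[1] : SSet.{u}) _⦋n⦌)
    (hs : s ∈ ∂Δ[1].obj _) (i j : Fin (n + 1)) : s i = s j := by
  rw [mem_boundary_iff_notMem_range] at hs
  obtain ⟨k, hk⟩ := hs
  have h : ∀ i, s i ≠ k := fun i hi ↦ hk ⟨i, hi⟩
  have key : ∀ a b k : Fin 2, a ≠ k → b ≠ k → a = b := by decide
  exact key _ _ k (h i) (h j)

open Classical in
/-- The map out of `B ⊗ ∂Δ[1]` given by two maps out of `B`. -/
noncomputable def descBoundary {B K : SSet.{u}} (f g : B ⟶ K) : B ⊗ (∂Δ[1] : SSet.{u}) ⟶ K where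
  app n := ↾fun x ↦
    if stdSimplex.asOrderHom x.2.1 0 = 0 then f.app n x.1 else g.app n x.1
  naturality n m θ := by
    ext ⟨x, s, hs⟩
    have h : stdSimplex.asOrderHom (Δ[1].map θ s) 0 = stdSimplex.asOrderHom s 0 :=
      stdSimplex_one_eq_of_mem_boundary (n := n.unop.len) s hs _ _
    change (if stdSimplex.asOrderHom (Δ[1].map θ s) 0 = 0 then f.app m (B.map θ x)
      else g.app m (B.map θ x)) = K.map θ (if stdSimplex.asOrderHom s 0 = 0 then f.app n x
      else g.app n x)
    rw [h]
    split_ifs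
    · exact NatTrans.naturality_apply f θ x
    · exact NatTrans.naturality_apply g θ x

/-- Lifting against the maps `preMono` given by the inclusions `∅ ⟶ Δ[0]` and `∂Δ[1] ⟶ Δ[1]` extends
maps and homotopies into Kan complexes. -/
lemma WEq.of_llp_preMono {A B : SSet.{u}} {i : A ⟶ B} (hi : preMono.llp i) : WEq i where
  exists_extension K _ g := by
    have := hi _ (preMono.mk ((⊥ : (Δ[0] : SSet.{u}).Subcomplex).ι) K)
    have := hasLiftingProperty_pre_swap (K := K) ((⊥ : (Δ[0] : SSet.{u}).Subcomplex).ι) i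
    have sq : CommSq (Subcomplex.isInitialBot.to _) ((⊥ : (Δ[0] : SSet.{u}).Subcomplex).ι)
      ((MonoidalClosed.pre i).app K) (MonoidalClosed.curry (fst A Δ[0] ≫ g)) :=
      ⟨Subcomplex.isInitialBot.hom_ext _ _⟩
    have h := congr_arg MonoidalClosed.uncurry sq.fac_right
    rw [MonoidalClosed.uncurry_pre_app, MonoidalClosed.uncurry_curry] at h
    refine ⟨lift (𝟙 B) (const (stdSimplex.obj₀Equiv.{u}.symm 0)) ≫
      MonoidalClosed.uncurry sq.lift, ?_⟩
    have : i ≫ lift (𝟙 B) (const (stdSimplex.obj₀Equiv.{u}.symm 0)) ≫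
      MonoidalClosed.uncurry sq.lift = g := by
      trans lift (𝟙 A) (const (stdSimplex.obj₀Equiv.{u}.symm 0)) ≫ i ▷ Δ[0] ≫
        MonoidalClosed.uncurry sq.lift
      · rfl
      · rw [h]; rfl
    rw [this]
    exact Htpy.refl g
  htpy_of_comp K _ f g := by
    rintro ⟨h, hf, hg⟩
    have := hi _ (preMono.mk (∂Δ[1] : (Δ[1] : SSet.{u}).Subcomplex).ι K)
    have := hasLiftingProperty_pre_swap (K := K) (∂Δ[1] : (Δ[1] : SSet.{u}).Subcomplex).ι i
    have sq : CommSq (MonoidalClosed.curry (descBoundary f g))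
        (∂Δ[1] : (Δ[1] : SSet.{u}).Subcomplex).ι
        ((MonoidalClosed.pre i).app K) (MonoidalClosed.curry h) := ⟨by
      apply MonoidalClosed.uncurry_injective
      rw [MonoidalClosed.uncurry_pre_app, MonoidalClosed.uncurry_curry,
        MonoidalClosed.uncurry_natural_left, MonoidalClosed.uncurry_curry]
      ext n ⟨x, s, hs⟩
      have hs' (k) : stdSimplex.asOrderHom s k = stdSimplex.asOrderHom s 0 :=
        stdSimplex_one_eq_of_mem_boundary (n := n.unop.len) s hs _ _
      change (if stdSimplex.asOrderHom s 0 = 0 then (i ≫ f).app n x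
        else (i ≫ g).app n x) = h.app n ⟨x, s⟩
      split_ifs with h₀
      · rw [← hf]
        refine congr_arg (fun t ↦ h.app n ⟨x, t⟩) ?_
        apply stdSimplex.objEquiv.injective
        ext k : 3
        exact ((hs' k).trans h₀).symm
      · rw [← hg]
        refine congr_arg (fun t ↦ h.app n ⟨x, t⟩) ?_
        apply stdSimplex.objEquiv.injective
        ext k : 3
        exact ((hs' k).trans (Fin.eq_one_of_ne_zero _ h₀)).symm⟩
    have e := congr_arg MonoidalClosed.uncurry sq.fac_left
    rw [MonoidalClosed.uncurry_natural_left, MonoidalClosed.uncurry_curry] at e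
    refine ⟨MonoidalClosed.uncurry sq.lift, ?_, ?_⟩
    · have h₀ : (stdSimplex.obj₀Equiv.{u} (n := 1)).symm 0 ∈ ∂Δ[1].obj _ := by
        rw [boundary_obj_eq_univ 0 1]; trivial
      trans lift (𝟙 B) (const (X := B) (Y := ∂Δ[1]) ⟨_, h₀⟩) ≫ descBoundary f g
      · exact congr_arg (lift (𝟙 B) (const (X := B) (Y := ∂Δ[1]) ⟨_, h₀⟩) ≫ ·) e
      · ext n x
        change (if (0 : Fin 2) = 0 then f.app n x else g.app n x) = _
        exact if_pos rfl
    · have h₁ : (stdSimplex.obj₀Equiv.{u} (n := 1)).symm 1 ∈ ∂Δ[1].obj _ := by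
        rw [boundary_obj_eq_univ 0 1]; trivial
      trans lift (𝟙 B) (const (X := B) (Y := ∂Δ[1]) ⟨_, h₁⟩) ≫ descBoundary f g
      · exact congr_arg (lift (𝟙 B) (const (X := B) (Y := ∂Δ[1]) ⟨_, h₁⟩) ≫ ·) e
      · ext n x
        change (if (1 : Fin 2) = 0 then f.app n x else g.app n x) = _
        exact if_neg (one_ne_zero (α := Fin 2))

/-- Trivial cofibrations of simplicial sets. They are the monic weak equivalences, see
`trivCof_iff`; the definition by a lifting property gives closure under pushouts and transfinite
compositions. -/
def trivCof : MorphismProperty SSet.{u} := .monomorphisms _ ⊓ preMono.llp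

lemma trivCof_iff {A B : SSet.{u}} (i : A ⟶ B) : trivCof i ↔ Mono i ∧ WEq i :=
  ⟨fun h ↦ ⟨h.1, .of_llp_preMono h.2⟩, fun ⟨_, h⟩ ↦ ⟨.infer_property i, h.llp_preMono⟩⟩

lemma trivCof.mono {A B : SSet.{u}} {i : A ⟶ B} (h : trivCof i) : Mono i := h.1
lemma trivCof.wEq {A B : SSet.{u}} {i : A ⟶ B} (h : trivCof i) : WEq i := ((trivCof_iff i).1 h).2

instance : trivCof.{u}.IsStableUnderCobaseChange := by
  dsimp only [trivCof]; infer_instance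

lemma trivCof.of_comp {A B C : SSet.{u}} {i : A ⟶ B} {j : B ⟶ C} [Mono j] (hi : trivCof i)
    (hij : trivCof (i ≫ j)) : trivCof j :=
  (trivCof_iff _).2 ⟨inferInstance, hi.wEq.of_comp_left hij.wEq⟩

lemma trivCof.whiskerRight {A B : SSet.{u}} {i : A ⟶ B} (hi : trivCof i) (C : SSet.{u}) :
    trivCof (i ▷ C) := by
  have := hi.mono
  have hi' (n) : Function.Injective (i.app n) :=
    (mono_iff_injective _).1 ((NatTrans.mono_iff_mono_app i).1 inferInstance n)
  have : Mono (i ▷ C) := by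
    rw [NatTrans.mono_iff_mono_app]
    intro n
    rw [mono_iff_injective]
    rintro ⟨x, y⟩ ⟨x', y'⟩ h
    exact Prod.ext (hi' n (congr_arg Prod.fst h)) (congr_arg Prod.snd h :)
  exact (trivCof_iff _).2 ⟨inferInstance, hi.wEq.whiskerRight C⟩

/-- The pushout-product of a trivial cofibration with a monomorphism. -/
lemma trivCof.unionProd {X Y : SSet.{u}} {A : X.Subcomplex} (hA : trivCof A.ι)
    (B : Y.Subcomplex) : trivCof (A.unionProd B).ι := by
  have h₁ : trivCof (Subcomplex.unionProd.ι₂ A B) :=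
    MorphismProperty.of_isPushout (Subcomplex.unionProd.isPushout A B).flip
      (hA.whiskerRight (B : SSet.{u}))
  refine h₁.of_comp ?_
  rw [Subcomplex.unionProd.ι₂_ι]
  exact hA.whiskerRight Y
end SSet

/-! ### Diagonals of bisimplicial sets -/

namespace SSet

open CategoryTheory MonoidalCategory CartesianMonoidalCategory Simplicial HomotopicalAlgebra
  Limits Opposite modelCategoryQuillen

/-- If `B` is the union of `A` and the image of `f`, and `f` is injective away from the preimage of
`A`, then `A ≤ B` is a pushout of the inclusion of this preimage. -/
lemma trivCof_homOfLE_of_range {Z W : SSet.{u}} (f : Z ⟶ W) {A B : W.Subcomplex} (hAB : A ≤ B)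
    (hfB : Subcomplex.range f ≤ B)
    (hB : ∀ (n) (w : W.obj n), w ∈ B.obj n → w ∈ A.obj n ∨ w ∈ Set.range (f.app n))
    (hf : ∀ (n) (z z' : Z.obj n), f.app n z = f.app n z' → f.app n z ∉ A.obj n → z = z')
    (h : trivCof (A.preimage f).ι) : trivCof (Subcomplex.homOfLE hAB) := by
  have sq : IsPushout (A.fromPreimage f) (A.preimage f).ι (Subcomplex.homOfLE hAB)
      (Subcomplex.lift f hfB) :=
    { w := rfl
      isColimit' := ⟨evaluationJointlyReflectsColimits _ (fun n ↦ by
        refine (isColimitMapCoconePushoutCoconeEquiv _ _).2 (IsPushout.isColimit ?_)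
        have : Mono (((evaluation _ _).obj n).map (Subcomplex.homOfLE hAB)) := by
          rw [mono_iff_injective]
          intro x y hxy
          exact Subtype.ext (congr_arg Subtype.val hxy :)
        refine Types.isPushout_of_isPullback_of_mono' ?_ ?_ ?_
        · rw [Types.isPullback_iff]
          refine ⟨rfl, fun x y hxy ↦ Subtype.ext hxy.2, fun x y hxy ↦ ?_⟩
          have hxy' : x.1 = f.app n y := congr_arg Subtype.val hxy
          exact ⟨⟨y, by change f.app n y ∈ A.obj n; rw [← hxy']; exact x.2⟩,
            Subtype.ext hxy'.symm, rfl⟩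
        · ext w
          simp only [Set.sup_eq_union, Set.mem_union, Set.mem_univ, iff_true]
          obtain hw | ⟨z, hz⟩ := hB n w.1 w.2
          · exact Or.inl ⟨⟨w.1, hw⟩, rfl⟩
          · exact Or.inr ⟨z, Subtype.ext hz⟩
        · intro z z' hz hz' hzz'
          exact hf n z z' (congr_arg Subtype.val hzz' :) (fun hA ↦ hz ⟨⟨z, hA⟩, rfl⟩))⟩ }
  exact MorphismProperty.of_isPushout sq h

/-- The transfinite composition of trivial cofibrations given by an exhaustive filtration by
subcomplexes. -/
lemma trivCof_ι_of_sequence {W : SSet.{u}} (A : ℕ →o W.Subcomplex) (htop : ⨆ n, A n = ⊤)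
    (h : ∀ n, trivCof (Subcomplex.homOfLE (A.monotone (Nat.le_succ n)))) :
    trivCof (A 0).ι := by
  have hmono : Mono (A 0).ι := inferInstance
  have hinst : preMono.{u}.llp.IsStableUnderTransfiniteCompositionOfShape ℕ := inferInstance
  refine ⟨.infer_property _, hinst.le _ ⟨?_⟩⟩
  exact
    { F := A.monotone.functor ⋙ Subcomplex.toSSetFunctor
      isoBot := Iso.refl _
      incl := { app _ := Subcomplex.ι _ }
      isColimit :=
        IsColimit.ofIsoColimit (isColimitOfPreserves (Subcomplex.toSSetFunctor)
          ((CompleteLattice.colimitCocone (A.monotone.functor)).isColimit))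
            (Cocone.ext (Subcomplex.eqToIso htop ≪≫ Subcomplex.topIso W))
      map_mem := fun n _ ↦ (h n).2 }

section latching

variable {X Y : SimplexCategoryᵒᵖ ⥤ SSet.{u}} (R : ∀ d, (Y.obj d).Subcomplex)

/-- The simplices of `Y_d` lying in `R_d` or degenerate, with respect to the outer simplicial
direction, along an operator which identifies two of the first `j + 1` vertices. -/
def latching (d j : ℕ) : (Y.obj (op ⦋d⦌)).Subcomplex where
  obj k := {y | y ∈ (R _).obj k ∨ ∃ (m : ℕ) (θ : ⦋d⦌ ⟶ ⦋m⦌) (a b : Fin (d + 1)),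
    a < b ∧ (b : ℕ) ≤ j ∧ θ.toOrderHom a = θ.toOrderHom b ∧ y ∈ Set.range ((Y.map θ.op).app k)}
  map {k l} α := by
    rintro y (h | ⟨m, θ, a, b, hab, hb, hθ, z, rfl⟩)
    · exact Or.inl ((R _).map α h)
    · exact Or.inr ⟨m, θ, a, b, hab, hb, hθ, (Y.obj _).map α z,
        NatTrans.naturality_apply (Y.map θ.op) α z⟩

lemma eq_σ_comp_δ_comp {d m : ℕ} (θ : ⦋d + 1⦌ ⟶ ⦋m⦌) (i : Fin (d + 1))
    (h : θ.toOrderHom i.castSucc = θ.toOrderHom i.succ) :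
    θ = SimplexCategory.σ i ≫ SimplexCategory.δ i.succ ≫ θ := by
  ext k : 3
  change θ.toOrderHom k = θ.toOrderHom (Fin.succAbove i.succ (Fin.predAbove i k))
  by_cases hk : k = i.succ
  · subst hk
    rw [Fin.predAbove_succ_self, Fin.succAbove_succ_self, h]
  · congr 1
    obtain hk | hk := lt_or_gt_of_ne hk
    · rw [Fin.predAbove_of_le_castSucc _ _ (Fin.le_castSucc_iff.2 hk), Fin.succAbove_of_castSucc_lt]
      · simp
      · simpa using hk
    · rw [Fin.predAbove_of_castSucc_lt _ _ (lt_trans (Fin.castSucc_lt_succ) hk),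
        Fin.succAbove_of_le_castSucc]
      · simp
      · rw [Fin.le_castSucc_iff]; simpa using hk

lemma latching_zero (d : ℕ) : latching R d 0 = R (op ⦋d⦌) := by
  ext k y
  refine ⟨?_, Or.inl⟩
  rintro (h | ⟨m, θ, a, b, hab, hb, -⟩)
  · exact h
  · have : (a : ℕ) < b := hab
    omega

lemma latching_mono (d : ℕ) {j j' : ℕ} (h : j ≤ j') : latching R d j ≤ latching R d j' := by
  rintro k y (hy | ⟨m, θ, a, b, hab, hb, hθ⟩)
  · exact Or.inl hy
  · exact Or.inr ⟨m, θ, a, b, hab, hb.trans h, hθ⟩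

lemma map_op_map_op_apply {a b c : SimplexCategory} (f : a ⟶ b) (g : b ⟶ c)
    {k : SimplexCategoryᵒᵖ} (y : (Y.obj (op c)).obj k) :
    (Y.map f.op).app k ((Y.map g.op).app k y) = (Y.map (f ≫ g).op).app k y := by
  rw [op_comp, Y.map_comp]
  rfl

lemma map_op_id_apply {a : SimplexCategory} {k : SimplexCategoryᵒᵖ}
    (y : (Y.obj (op a)).obj k) : (Y.map (𝟙 a).op).app k y = y := by
  rw [op_id, Y.map_id]
  rfl

variable (hR : ∀ ⦃d e⦄ (θ : d ⟶ e), R d ≤ (R e).preimage (Y.map θ))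

include hR in
/-- Pulling back along the degeneracy `σ j` turns the stage of the latching filtration of `Y_{d+1}`
before the image of `σ j` is added into the same stage for `Y_d`. -/
lemma latching_preimage_σ {d j : ℕ} (hj : j ≤ d) :
    (latching R (d + 1) j).preimage (Y.map (SimplexCategory.σ ⟨j, by omega⟩ : ⦋d + 1⦌ ⟶ ⦋d⦌).op) =
      latching R d j := by
  set i : Fin (d + 1) := ⟨j, by omega⟩ with hi
  have hσδ : SimplexCategory.δ i.succ ≫ SimplexCategory.σ i = 𝟙 _ :=
    SimplexCategory.δ_comp_σ_succ
  ext k y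
  constructor
  · rintro (h | ⟨m, θ, a, b, hab, hb, hθ, z, hz⟩)
    · left
      have h' := hR (SimplexCategory.δ i.succ).op _ h
      have e : (Y.map (SimplexCategory.δ i.succ).op).app k
          ((Y.map (SimplexCategory.σ i).op).app k y) = y := by
        rw [map_op_map_op_apply, hσδ, map_op_id_apply]
      rw [← e]
      exact h'
    · right
      have ha : (a : ℕ) < b := hab
      refine ⟨m, SimplexCategory.δ i.succ ≫ θ, ⟨a, by omega⟩, ⟨b, by omega⟩, hab, hb, ?_, z, ?_⟩
      · change θ.toOrderHom (Fin.succAbove i.succ ⟨a, _⟩) =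
          θ.toOrderHom (Fin.succAbove i.succ ⟨b, _⟩)
        rw [Fin.succAbove_of_castSucc_lt, Fin.succAbove_of_castSucc_lt]
        · exact hθ
        · simp only [Fin.lt_def, Fin.val_castSucc, Fin.val_succ, hi]; omega
        · simp only [Fin.lt_def, Fin.val_castSucc, Fin.val_succ, hi]; omega
      · rw [← map_op_map_op_apply, hz, map_op_map_op_apply, hσδ, map_op_id_apply]
  · rintro (h | ⟨m, θ, a, b, hab, hb, hθ, z, rfl⟩)
    · exact Or.inl (hR _ _ h)
    · refine Or.inr ⟨m, SimplexCategory.σ i ≫ θ, a.castSucc, b.castSucc, hab, hb, ?_, z, ?_⟩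
      · change θ.toOrderHom (Fin.predAbove i a.castSucc) =
          θ.toOrderHom (Fin.predAbove i b.castSucc)
        rw [Fin.predAbove_of_le_castSucc, Fin.predAbove_of_le_castSucc]
        · simpa using hθ
        · simp only [Fin.le_def, Fin.val_castSucc, hi]; omega
        · have : (a : ℕ) < b := hab
          simp only [Fin.le_def, Fin.val_castSucc, hi]; omega
      · exact (map_op_map_op_apply _ _ _).symm

include hR in
/-- The latching filtration adds the images of the degeneracies one at a time. Each of them is
glued along an earlier stage in a lower degree, by `latching_preimage_σ`. -/
lemma trivCof_latching (h : ∀ d, trivCof (R d).ι) (j : ℕ) :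
    ∀ d, trivCof (latching R d j).ι := by
  induction j with
  | zero =>
    intro d
    rw [latching_zero]
    exact h _
  | succ j ih =>
    intro d
    by_cases hj : d ≤ j
    · have : latching R d (j + 1) = latching R d j := by
        refine le_antisymm ?_ (latching_mono R d (Nat.le_succ j))
        rintro k y (hy | ⟨m, θ, a, b, hab, hb, hθ⟩)
        · exact Or.inl hy
        · exact Or.inr ⟨m, θ, a, b, hab, by omega, hθ⟩
      rw [this]
      exact ih d
    · obtain ⟨d, rfl⟩ : ∃ d', d = d' + 1 := ⟨d - 1, by omega⟩
      set i : Fin (d + 1) := ⟨j, by omega⟩ with hi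
      have hσδ : SimplexCategory.δ i.succ ≫ SimplexCategory.σ i = 𝟙 _ :=
        SimplexCategory.δ_comp_σ_succ
      have hinj (k) (z z') (hz : (Y.map (SimplexCategory.σ i).op).app k z =
          (Y.map (SimplexCategory.σ i).op).app k z') : z = z' := by
        have := congr_arg ((Y.map (SimplexCategory.δ i.succ).op).app k) hz
        rwa [map_op_map_op_apply, map_op_map_op_apply, hσδ, map_op_id_apply,
          map_op_id_apply] at this
      refine trivCof.of_comp (i := Subcomplex.homOfLE (latching_mono R _ (Nat.le_succ j)))
        ?_ (ih (d + 1))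
      refine trivCof_homOfLE_of_range (Y.map (SimplexCategory.σ i).op) _ ?_ ?_
        (fun k z z' hz _ ↦ hinj k z z' hz) ?_
      · rintro k _ ⟨z, rfl⟩
        refine Or.inr ⟨_, SimplexCategory.σ i, i.castSucc, i.succ, Fin.castSucc_lt_succ, le_rfl,
          ?_, z, rfl⟩
        change Fin.predAbove i i.castSucc = Fin.predAbove i i.succ
        simp
      · rintro k w (hw | ⟨m, θ, a, b, hab, hb, hθ, z, rfl⟩)
        · exact Or.inl (Or.inl hw)
        · by_cases hb' : (b : ℕ) ≤ j
          · exact Or.inl (Or.inr ⟨m, θ, a, b, hab, hb', hθ, z, rfl⟩)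
          · right
            have hbj : b = i.succ := Fin.ext (by simp [hi]; omega)
            have hai : a ≤ i.castSucc := by
              rw [Fin.le_castSucc_iff]
              exact hbj ▸ hab
            have e := eq_σ_comp_δ_comp θ i (le_antisymm
              (θ.toOrderHom.monotone (Fin.castSucc_lt_succ).le) (by
                rw [← hbj, ← hθ]
                exact θ.toOrderHom.monotone hai))
            refine ⟨(Y.map (SimplexCategory.δ i.succ ≫ θ).op).app k z, ?_⟩
            rw [map_op_map_op_apply, ← e]
      · rw [latching_preimage_σ R hR (by omega)]
        exact ih d

/-- A filtration of the diagonal of a bisimplicial set, starting from the diagonal of the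
bisimplicial subset `R`: stage `n` contains the simplices which come from an outer degree less
than `n`. -/
def diagFiltration (n : ℕ) : (bisimplicialDiagonal.obj Y).Subcomplex where
  obj k := {y | y ∈ (R k).obj k ∨
    ∃ (d : ℕ) (_ : d < n) (θ : k.unop ⟶ ⦋d⦌), y ∈ Set.range ((Y.map θ.op).app k)}
  map {k l} α := by
    rintro y (h | ⟨d, hd, θ, z, rfl⟩)
    · exact Or.inl ((R _).map α (hR α _ h))
    · refine Or.inr ⟨d, hd, α.unop ≫ θ, (Y.obj _).map α z, ?_⟩
      rw [op_comp, Y.map_comp]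
      exact NatTrans.naturality_apply (Y.map θ.op ≫ Y.map α) α z

/-- The canonical map `Y_n ⊗ Δ[n] ⟶ diag Y`. -/
def diagCell (Y : SimplexCategoryᵒᵖ ⥤ SSet.{u}) (n : ℕ) :
    Y.obj (op ⦋n⦌) ⊗ Δ[n] ⟶ bisimplicialDiagonal.obj Y where
  app k := ↾fun x ↦ (Y.map (stdSimplex.objEquiv x.2).op).app k x.1
  naturality k l α := by
    ext ⟨z, s⟩
    change (Y.map (α.unop ≫ stdSimplex.objEquiv s).op).app l ((Y.obj _).map α z) = 
      (Y.obj _).map α ((Y.map α).app k ((Y.map (stdSimplex.objEquiv s).op).app k z))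
    rw [op_comp, Y.map_comp]
    exact NatTrans.naturality_apply (Y.map (stdSimplex.objEquiv s).op ≫ Y.map α) α z

lemma diagFiltration_zero (i : X ⟶ Y) 
    (hR : ∀ ⦃d e⦄ (θ : d ⟶ e), Subcomplex.range (i.app d) ≤
      (Subcomplex.range (i.app e)).preimage (Y.map θ)) :
    diagFiltration (fun d ↦ Subcomplex.range (i.app d)) hR 0 =
      Subcomplex.range (bisimplicialDiagonal.map i) := by
  ext k y
  refine ⟨?_, Or.inl⟩
  rintro (h | ⟨d, hd, -⟩)
  · exact h
  · omega

lemma diagFiltration_mono : Monotone (diagFiltration R hR) := by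
  rintro n n' h k y (hy | ⟨d, hd, θ⟩)
  · exact Or.inl hy
  · exact Or.inr ⟨d, by omega, θ⟩

lemma iSup_diagFiltration : ⨆ n, diagFiltration R hR n = ⊤ := by
  refine le_antisymm le_top ?_
  rintro k y -
  refine (le_iSup (diagFiltration R hR) (k.unop.len + 1)) k ?_
  exact Or.inr ⟨k.unop.len, by omega, 𝟙 _, y, map_op_id_apply (a := k.unop) y⟩

lemma exists_of_not_surjective {k : SimplexCategory} {n : ℕ} (θ : k ⟶ ⦋n⦌)
    (h : ¬ Function.Surjective θ.toOrderHom) :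
    ∃ (d : ℕ) (_ : d < n) (θ' : k ⟶ ⦋d⦌) (δ : ⦋d⦌ ⟶ ⦋n⦌), θ = θ' ≫ δ := by
  obtain _ | n := n
  · exact (h (fun x ↦ ⟨0, Subsingleton.elim (α := Fin 1) _ _⟩)).elim
  · obtain ⟨i, θ', rfl⟩ := SimplexCategory.eq_comp_δ_of_not_surjective θ h
    exact ⟨n, by omega, θ', _, rfl⟩

lemma exists_of_not_injective {n m : ℕ} (θ : ⦋n⦌ ⟶ ⦋m⦌) 
    (h : ¬ Function.Injective θ.toOrderHom) :
    ∃ (d : ℕ) (_ : d < n) (σ : ⦋n⦌ ⟶ ⦋d⦌) (θ' : ⦋d⦌ ⟶ ⦋m⦌), θ = σ ≫ θ' := by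
  obtain _ | n := n
  · exact (h (fun _ _ _ ↦ Subsingleton.elim (α := Fin 1) _ _)).elim
  · obtain ⟨i, θ', rfl⟩ := SimplexCategory.eq_σ_comp_of_not_injective θ h
    exact ⟨n, by omega, _, θ', rfl⟩

lemma mem_latching_iff {n : ℕ} {k} (y : (Y.obj (op ⦋n⦌)).obj k) :
    y ∈ (latching R n n).obj k ↔ y ∈ (R _).obj k ∨
      ∃ (m : ℕ) (θ : ⦋n⦌ ⟶ ⦋m⦌), ¬ Function.Injective θ.toOrderHom ∧
        y ∈ Set.range ((Y.map θ.op).app k) := by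
  refine or_congr_right ⟨?_, ?_⟩
  · rintro ⟨m, θ, a, b, hab, -, hθ, hy⟩
    exact ⟨m, θ, fun h ↦ hab.ne (h hθ), hy⟩
  · rintro ⟨m, θ, hθ, hy⟩
    rw [Function.Injective] at hθ
    push Not at hθ
    obtain ⟨a, b, hab, hne⟩ := hθ
    obtain h | h := lt_or_gt_of_ne hne
    · exact ⟨m, θ, a, b, h, Nat.le_of_lt_succ b.2, hab, hy⟩
    · exact ⟨m, θ, b, a, h, Nat.le_of_lt_succ a.2, hab.symm, hy⟩

lemma mem_nonDegenerate_of_notMem_latching {n : ℕ} {k} (y : (Y.obj (op ⦋n⦌)).obj k)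
    (hy : y ∉ (latching R n n).obj k) :
    y ∈ SSet.nonDegenerate (Y.flip.obj k : SSet.{u}) n := by
  rintro ⟨m, hm, f, z, rfl⟩
  rw [mem_latching_iff R] at hy
  refine hy (Or.inr ⟨m, f, fun h ↦ ?_, z, rfl⟩)
  have := Fintype.card_le_of_injective _ h
  simp at this
  omega

/-- With `diagCell_injective_of_notMem`: stage `n + 1` of the filtration arises from stage `n` by
gluing `Y_n ⊗ Δ[n]` along the pushout-product of the latching inclusion with the boundary. -/
lemma preimage_diagCell (n : ℕ) :
    (diagFiltration R hR n).preimage (diagCell Y n) = (latching R n n).unionProd ∂Δ[n] := by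
  ext k ⟨z, s⟩
  obtain ⟨θ, rfl⟩ := stdSimplex.objEquiv.symm.surjective s
  refine Iff.trans ?_ (Subcomplex.mem_unionProd_iff (latching R n n) ∂Δ[n]
    (z, stdSimplex.objEquiv.symm θ)).symm
  change (Y.map θ.op).app k z ∈ (diagFiltration R hR n).obj k ↔ ¬ _ ∨ z ∈ (latching R n n).obj k
  rw [mem_latching_iff R]
  constructor
  · intro h
    by_cases hθ : Function.Surjective θ.toOrderHom
    · right
      have : Epi θ := SimplexCategory.epi_iff_surjective.2 hθ
      obtain ⟨⟨δ, hδ⟩⟩ := isSplitEpi_of_epi θ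
      have e : (Y.map δ.op).app k ((Y.map θ.op).app k z) = z := by
        rw [map_op_map_op_apply, hδ, map_op_id_apply]
      rw [← e]
      obtain h | ⟨d, hd, θ', z', hz'⟩ := h
      · exact Or.inl (hR δ.op _ h)
      · refine Or.inr ⟨d, δ ≫ θ', fun h' ↦ ?_, z', ?_⟩
        · have := Fintype.card_le_of_injective _ h'
          simp at this
          omega
        · rw [← hz', map_op_map_op_apply]
    · exact Or.inl hθ
  · rintro (h | h | ⟨m, ψ, hψ, z, rfl⟩)
    · obtain ⟨d, hd, θ', δ, rfl⟩ := exists_of_not_surjective θ h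
      refine Or.inr ⟨d, hd, θ', (Y.map δ.op).app k z, ?_⟩
      rw [op_comp, Y.map_comp]
      rfl
    · exact Or.inl (hR θ.op _ h)
    · obtain ⟨d, hd, σ, ψ, rfl⟩ := exists_of_not_injective ψ hψ
      refine Or.inr ⟨d, hd, θ ≫ σ, (Y.map ψ.op).app k z, ?_⟩
      rw [op_comp, op_comp, Y.map_comp, Y.map_comp]
      rfl

/-- In the outer direction, a simplex outside stage `n` has a unique presentation as a degeneracy of
a nondegenerate simplex. -/
lemma diagCell_injective_of_notMem {n : ℕ} {k : SimplexCategoryᵒᵖ}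
    (x x' : (Y.obj (op ⦋n⦌) ⊗ Δ[n] : SSet.{u}).obj k)
    (h : (diagCell Y n).app k x = (diagCell Y n).app k x')
    (hx : (diagCell Y n).app k x ∉ (diagFiltration R hR n).obj k) : x = x' := by
  have hx' := hx
  rw [h] at hx'
  replace hx : x ∉ ((diagFiltration R hR n).preimage (diagCell Y n)).obj k := hx
  replace hx' : x' ∉ ((diagFiltration R hR n).preimage (diagCell Y n)).obj k := hx'
  rw [preimage_diagCell] at hx hx'
  obtain ⟨z, s⟩ := x
  obtain ⟨z', s'⟩ := x'
  replace hx := fun h ↦ hx ((Subcomplex.mem_unionProd_iff _ _ _).2 h)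
  replace hx' := fun h ↦ hx' ((Subcomplex.mem_unionProd_iff _ _ _).2 h)
  obtain ⟨θ, rfl⟩ := stdSimplex.objEquiv.symm.surjective s
  obtain ⟨θ', rfl⟩ := stdSimplex.objEquiv.symm.surjective s'
  have hθ : Epi θ := SimplexCategory.epi_iff_surjective.2 (by
    by_contra hθ; exact hx (Or.inl hθ))
  have hz := mem_nonDegenerate_of_notMem_latching R z (fun hz ↦ hx (Or.inr hz))
  have hz' := mem_nonDegenerate_of_notMem_latching R z' (fun hz ↦ hx' (Or.inr hz))
  change (Y.map θ.op).app k z = (Y.map θ'.op).app k z' at h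
  induction k using Opposite.rec with | _ k
  induction k using SimplexCategory.rec with | _ k
  have e₁ := unique_nonDegenerate_simplex (Y.flip.obj _ : SSet.{u}) ((Y.map θ.op).app _ z) θ
    ⟨z, hz⟩ rfl θ' ⟨z', hz'⟩ h
  have e₂ := unique_nonDegenerate_map (Y.flip.obj _ : SSet.{u}) ((Y.map θ.op).app _ z) θ
    ⟨z, hz⟩ rfl θ' ⟨z', hz'⟩ h
  obtain rfl : z = z' := congr_arg Subtype.val e₁
  rw [e₂]

/-- If the inclusions of the levels of a bisimplicial subset are trivial cofibrations, then so is
the inclusion of its diagonal. -/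
lemma trivCof_diagFiltration (h : ∀ d, trivCof (R d).ι) :
    trivCof (diagFiltration R hR 0).ι := by
  refine trivCof_ι_of_sequence ⟨_, diagFiltration_mono R hR⟩ (iSup_diagFiltration R hR)
    (fun n ↦ trivCof_homOfLE_of_range (diagCell Y n) _ ?_ ?_ ?_ ?_)
  · rintro k _ ⟨⟨z, s⟩, rfl⟩
    exact Or.inr ⟨n, n.lt_succ_self, stdSimplex.objEquiv s, z, rfl⟩
  · rintro k w (hw | ⟨d, hd, θ, z, rfl⟩)
    · exact Or.inl (Or.inl hw)
    · obtain hd | rfl := (Nat.le_of_lt_succ hd).lt_or_eq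
      · exact Or.inl (Or.inr ⟨d, hd, θ, z, rfl⟩)
      · exact Or.inr ⟨(z, stdSimplex.objEquiv.symm θ), rfl⟩
  · intro k x x' hx hx'
    exact diagCell_injective_of_notMem R hR x x' hx hx'
  · dsimp only [OrderHom.coe_mk]
    rw [preimage_diagCell]
    exact (trivCof_latching R hR h n n).unionProd _

end latching

lemma wEq_bisimplicialDiagonal_map_of_trivCof {X Y : SimplexCategoryᵒᵖ ⥤ SSet.{u}} (i : X ⟶ Y)
    (hi : ∀ n, trivCof (i.app n)) : WEq (bisimplicialDiagonal.map i) := by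
  have hR : ∀ ⦃d e⦄ (θ : d ⟶ e), Subcomplex.range (i.app d) ≤
      (Subcomplex.range (i.app e)).preimage (Y.map θ) := by
    rintro d e θ k _ ⟨x, rfl⟩
    exact ⟨(X.map θ).app k x, ConcreteCategory.congr_hom (NatTrans.congr_app (i.naturality θ) k) x⟩
  have h := (trivCof_diagFiltration _ hR (fun d ↦ by
    have := (hi d).mono
    refine (trivCof_iff _).2 ⟨inferInstance, ?_⟩
    refine (WEq.of_isIso (Subcomplex.toRange (i.app d))).of_comp_left ?_
    exact (hi d).wEq)).wEq
  rw [diagFiltration_zero i hR] at h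
  have : Mono (bisimplicialDiagonal.map i) := by
    rw [NatTrans.mono_iff_mono_app]
    intro n
    have := (hi n).mono
    exact (NatTrans.mono_iff_mono_app (i.app n)).1 inferInstance n
  exact (WEq.of_isIso (Subcomplex.toRange (bisimplicialDiagonal.map i))).comp h

/-- The contraction of `Δ[1]` onto its last vertex, given by the supremum. -/
def stdSimplexOneContraction : (Δ[1] : SSet.{u}) ⊗ Δ[1] ⟶ Δ[1] where
  app k := ↾fun x ↦ stdSimplex.objEquiv.symm (SimplexCategory.Hom.mk
    (stdSimplex.asOrderHom x.1 ⊔ stdSimplex.asOrderHom x.2))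
  naturality k l α := rfl

lemma wEq_ι₁ (A : SSet.{u}) : WEq (ι₁ : A ⟶ A ⊗ Δ[1]) := by
  have h : Htpy (𝟙 (Δ[1] : SSet.{u})) (const (stdSimplex.obj₀Equiv.{u}.symm 1)) := by
    refine ⟨stdSimplexOneContraction, ?_, ?_⟩
    · ext k x
      apply stdSimplex.objEquiv.injective
      ext i : 3
      change max (stdSimplex.asOrderHom x i) 0 = stdSimplex.asOrderHom x i
      exact max_eq_left (Fin.zero_le _)
    · ext k x
      apply stdSimplex.objEquiv.injective
      ext i : 3
      change max (stdSimplex.asOrderHom x i) 1 = 1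
      exact max_eq_right (Fin.le_last _)
  refine WEq.of_htpy_inverse (fst _ _) (Or.inl (by rw [ι₁_fst]; exact Htpy.refl _)) (Or.inr ?_)
  have h' := h.whiskerLeft A
  rw [MonoidalCategory.whiskerLeft_id] at h'
  exact h'

/-- Levelwise weak equivalences of bisimplicial sets induce weak equivalences of diagonals. The
levelwise mapping cylinder reduces the claim to levelwise trivial cofibrations. -/
theorem wEq_bisimplicialDiagonal_map {X Y : SimplexCategoryᵒᵖ ⥤ SSet.{u}} (f : X ⟶ Y)
    (hf : ∀ n, WEq (f.app n)) : WEq (bisimplicialDiagonal.map f) := by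
  -- `C` is the levelwise cylinder of `X` and `P` the levelwise mapping cylinder of `f`, with its
  -- two inclusions `j` and `pushout.inr i₁ f` and its projection `r`
  let C : SimplexCategoryᵒᵖ ⥤ SSet.{u} := X ⋙ tensorRight Δ[1]
  let i₀ : X ⟶ C := { app n := ι₀ }
  let i₁ : X ⟶ C := { app n := ι₁ }
  let pr : C ⟶ X := { app n := fst _ _ }
  let P := pushout i₁ f
  have sq (n) : IsPushout ι₁ (f.app n) ((pushout.inl i₁ f).app n) ((pushout.inr i₁ f).app n) :=
    (IsPushout.of_hasPushout i₁ f).map ((evaluation _ _).obj n)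
  let j : X ⟶ P := i₀ ≫ pushout.inl i₁ f
  let r : P ⟶ Y := pushout.desc (pr ≫ f) (𝟙 Y) (by ext1; ext1 n; simp [i₁, pr, C])
  have hjr : j ≫ r = f := by
    simp only [j, r, Category.assoc, pushout.inl_desc]
    rfl
  have hι₁ (A : SSet.{u}) : trivCof (ι₁ : A ⟶ A ⊗ Δ[1]) := by
    have : Mono (ι₁ : A ⟶ A ⊗ Δ[1]) := (SplitMono.mk (fst _ _) (ι₁_fst A)).mono
    exact (trivCof_iff _).2 ⟨inferInstance, wEq_ι₁ A⟩
  have hinr (n) : trivCof ((pushout.inr i₁ f).app n) :=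
    MorphismProperty.of_isPushout (sq n).flip (hι₁ _)
  have hr (n) : WEq (r.app n) := by
    refine (hinr n).wEq.of_comp_left ?_
    rw [← NatTrans.comp_app, pushout.inr_desc]
    exact .of_isIso _
  have hj (n) : trivCof (j.app n) := by
    refine (trivCof_iff _).2 ⟨?_, (hr n).of_comp_right ?_⟩
    · rw [NatTrans.mono_iff_mono_app]
      intro k
      rw [mono_iff_injective]
      intro x y hxy
      have sq' := (sq n).map ((evaluation _ _).obj k)
      -- the cylinder embeds into the pushout away from its end, which is collapsed to `none`
      classical
      let φ : (C.obj n).obj k ⟶ Option ((C.obj n).obj k) := ↾fun z ↦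
        if z ∈ Set.range ((ι₁ : X.obj n ⟶ _).app k) then none else some z
      let ψ : (Y.obj n).obj k ⟶ Option ((C.obj n).obj k) := ↾fun _ ↦ none
      have hφ : ((evaluation _ _).obj k).map (ι₁ : X.obj n ⟶ _) ≫ φ =
          ((evaluation _ _).obj k).map (f.app n) ≫ ψ := by
        refine ConcreteCategory.hom_ext _ _ fun z ↦ ?_
        change (if (ι₁ : X.obj n ⟶ _).app k z ∈ Set.range ((ι₁ : X.obj n ⟶ _).app k) then none
          else some ((ι₁ : X.obj n ⟶ _).app k z)) = none
        exact if_pos ⟨z, rfl⟩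
      have hinl (z) : sq'.desc φ ψ hφ (((pushout.inl i₁ f).app n).app k z) = φ z :=
        ConcreteCategory.congr_hom (sq'.inl_desc φ ψ hφ) z
      have h₀ (z : (X.obj n).obj k) : φ ((ι₀ : X.obj n ⟶ _).app k z) =
          some ((ι₀ : X.obj n ⟶ _).app k z) := by
        refine if_neg ?_
        rintro ⟨z', hz'⟩
        have := congr_arg (fun t ↦ stdSimplex.asOrderHom (Prod.snd t) 0) hz'
        exact one_ne_zero (α := Fin 2) this
      have e := congr_arg (sq'.desc φ ψ hφ) hxy
      change sq'.desc φ ψ hφ (((pushout.inl i₁ f).app n).app k ((ι₀ : X.obj n ⟶ _).app k x)) =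
        sq'.desc φ ψ hφ (((pushout.inl i₁ f).app n).app k ((ι₀ : X.obj n ⟶ _).app k y)) at e
      rw [hinl, hinl, h₀, h₀] at e
      exact congr_arg Prod.fst (Option.some.inj e)
    · rw [← NatTrans.comp_app, hjr]
      exact hf n
  rw [← hjr, Functor.map_comp]
  refine (wEq_bisimplicialDiagonal_map_of_trivCof j hj).comp ?_
  refine (wEq_bisimplicialDiagonal_map_of_trivCof _ hinr).of_comp_left ?_
  rw [← Functor.map_comp, pushout.inr_desc]
  exact .of_isIso _

end SSet

/-! ### Points of the geometric realisation -/

namespace Geometric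

open Simplicial

/-- The topological simplex. -/
abbrev Simp (n : ℕ) : Type := stdSimplex ℝ (Fin (n + 1))

lemma map_apply {X Y : Type*} [Fintype X] [Fintype Y] [DecidableEq Y] (f : X → Y)
    (t : stdSimplex ℝ X) (y : Y) :
    stdSimplex.map f t y = ∑ x with f x = y, t x := by
  rw [stdSimplex.map_coe, FunOnFinite.linearMap_apply_apply]

/-- The point of the realisation given by a simplex and barycentric coordinates. -/
noncomputable def pt {X : SSet.{u}} {n : SimplexCategoryᵒᵖ} (x : X.obj n)
    (t : stdSimplex ℝ (Fin (n.unop.len + 1))) : SSet.toTop.obj X :=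
  TopCat.toSSetObjEquiv _ n ((sSetTopAdj.unit.app X).app n x) t

lemma continuous_pt {X : SSet.{u}} {n : SimplexCategoryᵒᵖ} (x : X.obj n) :
    Continuous (pt x) :=
  (TopCat.toSSetObjEquiv _ n ((sSetTopAdj.unit.app X).app n x)).continuous

lemma pt_map {X : SSet.{u}} {n m : SimplexCategoryᵒᵖ} (θ : n ⟶ m) (x : X.obj n)
    (t : stdSimplex ℝ (Fin (m.unop.len + 1))) :
    pt (X.map θ x) t = pt x (stdSimplex.map θ.unop.toOrderHom t) := by
  have h := NatTrans.naturality_apply (sSetTopAdj.unit.app X) θ x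
  exact congr_arg (fun z ↦ TopCat.toSSetObjEquiv _ m z t) h

lemma toTop_map_pt {X Y : SSet.{u}} (f : X ⟶ Y) {n : SimplexCategoryᵒᵖ} (x : X.obj n)
    (t : stdSimplex ℝ (Fin (n.unop.len + 1))) :
    SSet.toTop.map f (pt x t) = pt (f.app n x) t := by
  have h := ConcreteCategory.congr_hom (NatTrans.congr_app (sSetTopAdj.unit.naturality f) n) x
  exact congr_arg (fun z ↦ TopCat.toSSetObjEquiv _ n z t) h.symm

/-- The map out of the realisation adjoint to a map to the singular simplicial set. -/
noncomputable def desc {X : SSet.{u}} {Z : TopCat.{u}} (φ : X ⟶ TopCat.toSSet.obj Z) :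
    SSet.toTop.obj X ⟶ Z := (sSetTopAdj.homEquiv X Z).symm φ

lemma unit_desc {X : SSet.{u}} {Z : TopCat.{u}} (φ : X ⟶ TopCat.toSSet.obj Z) :
    sSetTopAdj.unit.app X ≫ TopCat.toSSet.map (desc φ) = φ := by
  exact (Adjunction.homEquiv_unit ..).symm.trans (Equiv.apply_symm_apply _ _)

lemma desc_pt {X : SSet.{u}} {Z : TopCat.{u}} (φ : X ⟶ TopCat.toSSet.obj Z)
    {n : SimplexCategoryᵒᵖ} (x : X.obj n) (t : stdSimplex ℝ (Fin (n.unop.len + 1))) :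
    desc φ (pt x t) = TopCat.toSSetObjEquiv _ n (φ.app n x) t := by
  have h := ConcreteCategory.congr_hom (NatTrans.congr_app (unit_desc φ) n) x
  exact congr_arg (fun z ↦ TopCat.toSSetObjEquiv _ n z t) h

lemma hom_ext {X : SSet.{u}} {Z : TopCat.{u}} {f g : SSet.toTop.obj X ⟶ Z}
    (h : ∀ (n : SimplexCategoryᵒᵖ) (x : X.obj n) (t), f (pt x t) = g (pt x t)) : f = g := by
  apply (sSetTopAdj.homEquiv X Z).injective
  ext n x
  apply (TopCat.toSSetObjEquiv _ n).injective
  ext t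
  exact h n x t

/-- The points of the form `pt x t` exhaust the realisation, because maps out of the realisation,
for instance to an indiscrete space, are determined on them. -/
lemma exists_pt {X : SSet.{u}} (p : SSet.toTop.obj X) :
    ∃ (n : SimplexCategoryᵒᵖ) (x : X.obj n) (t : _), p = pt x t := by
  by_contra hp
  let _ : TopologicalSpace (ULift.{u} Prop) := ⊤
  let f : SSet.toTop.obj X ⟶ TopCat.of (ULift.{u} Prop) := TopCat.ofHom
    ⟨fun q ↦ ⟨∃ (n : SimplexCategoryᵒᵖ) (x : X.obj n) (t : _), q = pt x t⟩, continuous_top⟩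
  let g : SSet.toTop.obj X ⟶ TopCat.of (ULift.{u} Prop) := TopCat.ofHom
    ⟨fun q ↦ ⟨True⟩, continuous_top⟩
  have h : f = g := hom_ext fun n x t ↦ congr_arg ULift.up (eq_true ⟨n, x, t, rfl⟩)
  have := congr_arg ULift.down (ConcreteCategory.congr_hom h p)
  exact hp (of_eq_true this)

/-- Every point of a simplex is in the interior of a face. -/
lemma exists_simp_interior {n : ℕ} (t : Simp n) :
    ∃ (k : ℕ) (ρ : Fin (k + 1) ↪o Fin (n + 1)) (t' : Simp k), (∀ i, 0 < t' i) ∧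
      stdSimplex.map ρ t' = t := by
  classical
  let S : Finset (Fin (n + 1)) := Finset.univ.filter (fun i ↦ t i ≠ 0)
  have hS : S.Nonempty := by
    by_contra h
    rw [Finset.not_nonempty_iff_eq_empty] at h
    have : ∑ i, t i = 0 := Finset.sum_eq_zero (fun i _ ↦ by
      by_contra hi
      have : i ∈ S := by simp [S, hi]
      simp [h] at this)
    simp at this
  obtain ⟨k, hk⟩ : ∃ k, S.card = k + 1 := ⟨S.card - 1, by have := hS.card_pos; omega⟩
  let ρ := S.orderEmbOfFin hk
  have hρ (j) (hj : j ∉ Set.range ρ) : t j = 0 := by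
    rw [Finset.range_orderEmbOfFin] at hj
    by_contra h
    exact hj (by simp [S, h])
  have hsum : ∑ i, t (ρ i) = 1 := by
    rw [← stdSimplex.sum_eq_one t]
    exact Fintype.sum_of_injective ρ ρ.injective _ _ hρ (fun _ ↦ rfl)
  refine ⟨k, ρ, ⟨fun i ↦ t (ρ i), fun i ↦ by simp, hsum⟩, fun i ↦ ?_, ?_⟩
  · have : ρ i ∈ S := Finset.orderEmbOfFin_mem S hk i
    exact lt_of_le_of_ne (by simp) (Finset.mem_filter.1 this).2.symm
  · ext j
    rw [map_apply]
    by_cases hj : j ∈ Set.range ρ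
    · obtain ⟨i, rfl⟩ := hj
      rw [Finset.sum_eq_single i]
      · rfl
      · intro b hb hbi
        exact (hbi (ρ.injective (Finset.mem_filter.1 hb).2)).elim
      · simp
    · rw [hρ j hj, Finset.sum_eq_zero]
      intro b hb
      exact (hj ⟨b, (Finset.mem_filter.1 hb).2⟩).elim

/-- Every point of the realisation is in the interior of a nondegenerate simplex. -/
lemma exists_pt_nonDegenerate {X : SSet.{u}} (p : SSet.toTop.obj X) :
    ∃ (n : ℕ) (x : X _⦋n⦌) (t : Simp n), x ∈ X.nonDegenerate n ∧ (∀ i, 0 < t i) ∧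
      p = pt x t := by
  classical
  obtain ⟨n, x, t, rfl⟩ := exists_pt p
  induction n using Opposite.rec with | _ n
  induction n using SimplexCategory.rec with | _ n
  obtain ⟨k, ρ, t', ht', ht⟩ := exists_simp_interior (n := n) t
  let ρ' : ⦋k⦌ ⟶ ⦋n⦌ := SimplexCategory.Hom.mk ⟨ρ, ρ.monotone⟩
  have e : pt x t = pt (X.map ρ'.op x) t' := by
    rw [pt_map, ← ht]
    rfl
  obtain ⟨m, f, hf, y, hy⟩ := X.exists_nonDegenerate (X.map ρ'.op x)
  refine ⟨m, y.1, stdSimplex.map f.toOrderHom t', y.2, fun i ↦ ?_, ?_⟩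
  · rw [SimplexCategory.epi_iff_surjective] at hf
    obtain ⟨j, hj⟩ := hf i
    rw [map_apply]
    exact Finset.sum_pos (fun _ _ ↦ ht' _) ⟨j, by simpa using hj⟩
  · rw [e, hy, pt_map]
    rfl

instance compactSpace_toTop_obj (X : SSet.{u}) [X.Finite] : CompactSpace (SSet.toTop.obj X) := by
  have h : (⋃ s : X.N, Set.range (pt s.simplex)) = (Set.univ : Set (SSet.toTop.obj X)) := by
    ext p
    simp only [Set.mem_iUnion, Set.mem_univ, iff_true]
    obtain ⟨n, x, t, hx, -, rfl⟩ := exists_pt_nonDegenerate p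
    exact ⟨SSet.N.mk x hx, t, rfl⟩
  rw [← isCompact_univ_iff, ← h]
  exact isCompact_iUnion fun s ↦ isCompact_range (continuous_pt _)

end Geometric

/-! ### The realisation of a product of simplices -/

namespace Geometric

open Simplicial

lemma map_apply_of_injective {X Y : Type*} [Fintype X] [Fintype Y] {f : X → Y}
    (hf : Function.Injective f) (t : stdSimplex ℝ X) (x : X) : stdSimplex.map f t (f x) = t x := by
  classical
  rw [map_apply, Finset.sum_eq_single x]
  · intro b hb hbx
    exact (hbx (hf (Finset.mem_filter.1 hb).2)).elim
  · simp

lemma map_apply_ne_zero_iff {X Y : Type*} [Fintype X] [Fintype Y] {f : X → Y}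
    {t : stdSimplex ℝ X} (ht : ∀ x, 0 < t x) (y : Y) :
    stdSimplex.map f t y ≠ 0 ↔ y ∈ Set.range f := by
  classical
  rw [map_apply]
  constructor
  · intro h
    obtain ⟨x, hx, -⟩ := Finset.exists_ne_zero_of_sum_ne_zero h
    exact ⟨x, (Finset.mem_filter.1 hx).2⟩
  · rintro ⟨x, rfl⟩
    exact (Finset.sum_pos (fun _ _ ↦ ht _) ⟨x, by simp⟩).ne'

/-- A point in the realisation of a poset determines the chain in whose interior it lies, and its
barycentric coordinates. -/
lemma eq_of_map_strictMono_eq {P : Type*} [PartialOrder P] [Fintype P] {k k' : ℕ}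
    {σ : Fin (k + 1) → P} {σ' : Fin (k' + 1) → P} (hσ : StrictMono σ) (hσ' : StrictMono σ')
    {t : Simp k} {t' : Simp k'} (ht : ∀ i, 0 < t i) (ht' : ∀ i, 0 < t' i)
    (h : stdSimplex.map σ t = stdSimplex.map σ' t') :
    (⟨k, σ, t⟩ : Σ k : ℕ, (Fin (k + 1) → P) × Simp k) = ⟨k', σ', t'⟩ := by
  have hr : Set.range σ = Set.range σ' := by
    ext y
    rw [← map_apply_ne_zero_iff ht, ← map_apply_ne_zero_iff ht', h]
  obtain rfl : k = k' := by
    have e := (Nat.card_congr (Equiv.ofInjective σ hσ.injective)).trans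
      ((congr_arg (fun s : Set P ↦ Nat.card s) hr).trans
        (Nat.card_congr (Equiv.ofInjective σ' hσ'.injective)).symm)
    simpa using e
  obtain rfl : σ = σ' := (hσ.range_inj hσ').1 hr
  obtain rfl : t = t' := by
    ext i
    rw [← map_apply_of_injective hσ.injective t, h, map_apply_of_injective hσ.injective]
  rfl

section coupling

variable {n m : ℕ}

lemma sum_fiber_le {A B : Type*} [Fintype A] [Fintype B] [DecidableEq B] (f : A → B)
    (w : stdSimplex ℝ A) (p : B → Prop) [DecidablePred p] :
    ∑ b with p b, stdSimplex.map f w b = ∑ a with p (f a), w a := by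
  simp only [map_apply]
  rw [Finset.sum_comm' (t' := Finset.univ.filter fun a ↦ p (f a)) (s' := fun a ↦ {f a})]
  · simp
  · intro b a
    simp only [Finset.mem_filter, Finset.mem_univ, true_and, Finset.mem_singleton]
    exact ⟨fun h ↦ ⟨h.2.symm, h.2 ▸ h.1⟩, fun h ↦ ⟨h.1 ▸ h.2, h.1.symm⟩⟩

/-- A distribution supported on a chain is determined by its marginals. -/
lemma eq_of_marginals_eq {w w' : stdSimplex ℝ (Fin (n + 1) × Fin (m + 1))}
    (hw : IsChain (· ≤ ·) {p | w p ≠ 0}) (hw' : IsChain (· ≤ ·) {p | w' p ≠ 0})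
    (h₁ : stdSimplex.map Prod.fst w = stdSimplex.map Prod.fst w')
    (h₂ : stdSimplex.map Prod.snd w = stdSimplex.map Prod.snd w') : w = w' := by
  classical
  -- the mass below `p` is the minimum of the masses below its coordinates
  have key (w : stdSimplex ℝ (Fin (n + 1) × Fin (m + 1)))
      (hw : IsChain (· ≤ ·) {p | w p ≠ 0}) (p : Fin (n + 1) × Fin (m + 1)) :
      ∑ q with q ≤ p, w q = min (∑ a with a ≤ p.1, stdSimplex.map Prod.fst w a)
        (∑ b with b ≤ p.2, stdSimplex.map Prod.snd w b) := by
    rw [sum_fiber_le Prod.fst w (· ≤ p.1), sum_fiber_le Prod.snd w (· ≤ p.2)]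
    have l₁ : ∑ q with q ≤ p, w q ≤ ∑ q with q.1 ≤ p.1, w q :=
      Finset.sum_le_sum_of_subset_of_nonneg
        (fun q hq ↦ by simp only [Finset.mem_filter, Finset.mem_univ, true_and] at hq ⊢; exact hq.1)
        (fun _ _ _ ↦ by simp)
    have l₂ : ∑ q with q ≤ p, w q ≤ ∑ q with q.2 ≤ p.2, w q :=
      Finset.sum_le_sum_of_subset_of_nonneg
        (fun q hq ↦ by simp only [Finset.mem_filter, Finset.mem_univ, true_and] at hq ⊢; exact hq.2)
        (fun _ _ _ ↦ by simp)
    -- one of the two strips meets the support only inside the other one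
    by_cases hs : ∀ q, w q ≠ 0 → q.1 ≤ p.1 → q.2 ≤ p.2
    · refine le_antisymm (le_min l₁ l₂) ((min_le_left _ _).trans (le_of_eq ?_))
      simp only [Finset.sum_filter]
      refine Finset.sum_congr rfl fun q _ ↦ ?_
      by_cases hq : w q = 0
      · simp [hq]
      · exact if_congr ⟨fun h ↦ ⟨h, hs q hq h⟩, fun h ↦ h.1⟩ rfl rfl
    · push Not at hs
      obtain ⟨r, hr, hr₁, hr₂⟩ := hs
      refine le_antisymm (le_min l₁ l₂) ((min_le_right _ _).trans (le_of_eq ?_))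
      simp only [Finset.sum_filter]
      refine Finset.sum_congr rfl fun q _ ↦ ?_
      by_cases hq : w q = 0
      · simp [hq]
      · refine if_congr ⟨fun h ↦ ⟨?_, h⟩, fun h ↦ h.2⟩ rfl rfl
        rcases hw.total hq hr with h' | h'
        · exact h'.1.trans hr₁
        · exact absurd (h'.2.trans h) (not_le.2 hr₂)
  ext p
  induction p using WellFoundedLT.induction with | _ p ih
  have e := key w hw p
  rw [h₁, h₂, ← key w' hw' p] at e
  have split (w : stdSimplex ℝ (Fin (n + 1) × Fin (m + 1))) :
      ∑ q with q ≤ p, w q = w p + ∑ q with q < p, w q := by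
    rw [← Finset.sum_insert (by simp)]
    congr 1
    ext q
    simp [le_iff_eq_or_lt]
  rw [split, split, Finset.sum_congr rfl (fun q hq ↦ ih q (Finset.mem_filter.1 hq).2)] at e
  exact add_right_cancel e

/-- Any two distributions are the marginals of a distribution supported on a chain. -/
lemma exists_chain_coupling (s : Simp n) (t : Simp m) :
    ∃ w : stdSimplex ℝ (Fin (n + 1) × Fin (m + 1)), IsChain (· ≤ ·) {p | w p ≠ 0} ∧
      stdSimplex.map Prod.fst w = s ∧ stdSimplex.map Prod.snd w = t := by
  classical
  -- `cum` is the cumulative distribution, and `W` the mixed difference of the minimum `F` of the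
  -- two cumulative distributions: `W (a, b)` is the length of the overlap of the interval `a` in the
  -- partition of `[0, 1]` given by `s` with the interval `b` in the partition given by `t`
  let cum {n : ℕ} (s : Simp n) (k : ℕ) : ℝ :=
    ∑ i ∈ Finset.range k, if h : i < n + 1 then s ⟨i, h⟩ else 0
  have cum_succ {n : ℕ} (s : Simp n) (a : Fin (n + 1)) : cum s (a + 1) = cum s a + s a := by
    simp only [cum, Finset.sum_range_succ]
    rw [dif_pos a.2]
  have cum_mono {n : ℕ} (s : Simp n) : Monotone (cum s) := monotone_nat_of_le_succ fun k ↦ by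
    simp only [cum, Finset.sum_range_succ]
    split_ifs <;> simp
  have cum_zero {n : ℕ} (s : Simp n) : cum s 0 = 0 := by simp [cum]
  have cum_top {n : ℕ} (s : Simp n) : cum s (n + 1) = 1 := by
    rw [← stdSimplex.sum_eq_one s]
    simp only [cum]
    rw [← Fin.sum_univ_eq_sum_range (fun i ↦ if h : i < n + 1 then s ⟨i, h⟩ else 0)]
    exact Finset.sum_congr rfl fun i _ ↦ dif_pos i.2
  let F (a b : ℕ) : ℝ := min (cum s a) (cum t b)
  let W (p : Fin (n + 1) × Fin (m + 1)) : ℝ :=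
    (F (p.1 + 1) (p.2 + 1) - F p.1 (p.2 + 1)) - (F (p.1 + 1) p.2 - F p.1 p.2)
  have hW (p) : 0 ≤ W p ∧
      (W p ≠ 0 → cum t p.2 < cum s (p.1 + 1) ∧ cum s p.1 < cum t (p.2 + 1)) := by
    have e₁ := cum_mono s (Nat.le_add_right p.1 1)
    have e₂ := cum_mono t (Nat.le_add_right p.2 1)
    simp only [W, F]
    generalize cum s (p.1 + 1) = q at *
    generalize cum s p.1 = p at *
    generalize cum t _ = y at *
    generalize cum t _ = x at *
    simp only [min_def]
    split_ifs <;> constructor <;> first | linarith | skip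
    all_goals
      intro h
      constructor <;> by_contra h' <;> apply h <;> linarith
  have hW₁ (a : Fin (n + 1)) : ∑ b, W (a, b) = s a := by
    simp only [W]
    rw [Fin.sum_univ_eq_sum_range (fun b ↦ (F (a + 1) (b + 1) - F a (b + 1)) -
      (F (a + 1) b - F a b)) (m + 1), Finset.sum_range_sub (fun b ↦ F (a + 1) b - F a b)]
    have := cum_succ s a
    have h1 := cum_mono s (show (a : ℕ) + 1 ≤ n + 1 by omega)
    have h2 := cum_mono s (show (a : ℕ) ≤ n + 1 by omega)
    have h3 := cum_mono s (show 0 ≤ (a : ℕ) + 1 by omega)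
    have h4 := cum_mono s (show 0 ≤ (a : ℕ) by omega)
    rw [cum_top] at h1 h2
    rw [cum_zero] at h3 h4
    simp only [F, cum_top, cum_zero]
    rw [min_eq_left h1, min_eq_left h2, min_eq_right h3, min_eq_right h4]
    linarith
  have hW₂ (b : Fin (m + 1)) : ∑ a, W (a, b) = t b := by
    have e (a : Fin (n + 1)) : W (a, b) =
      (F (a + 1) (b + 1) - F (a + 1) b) - (F a (b + 1) - F a b) := by simp only [W]; ring
    simp only [e]
    rw [Fin.sum_univ_eq_sum_range (fun a ↦ (F (a + 1) (b + 1) - F (a + 1) b) -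
      (F a (b + 1) - F a b)) (n + 1), Finset.sum_range_sub (fun a ↦ F a (b + 1) - F a b)]
    have := cum_succ t b
    have h1 := cum_mono t (show (b : ℕ) + 1 ≤ m + 1 by omega)
    have h2 := cum_mono t (show (b : ℕ) ≤ m + 1 by omega)
    have h3 := cum_mono t (show 0 ≤ (b : ℕ) + 1 by omega)
    have h4 := cum_mono t (show 0 ≤ (b : ℕ) by omega)
    rw [cum_top] at h1 h2
    rw [cum_zero] at h3 h4
    simp only [F, cum_top, cum_zero]
    rw [min_eq_right h1, min_eq_right h2, min_eq_left h3, min_eq_left h4]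
    linarith
  refine ⟨⟨W, fun p ↦ (hW p).1, ?_⟩, ?_, ?_, ?_⟩
  · rw [Fintype.sum_prod_type]
    simp only [hW₁, stdSimplex.sum_eq_one]
  · rintro ⟨a, b⟩ (hp : W (a, b) ≠ 0) ⟨a', b'⟩ (hq : W (a', b') ≠ 0) -
    obtain ⟨h₁, h₂⟩ := (hW _).2 hp
    obtain ⟨h₃, h₄⟩ := (hW _).2 hq
    -- two pairs of overlapping intervals cannot cross
    have cross {a a' : Fin (n + 1)} {b b' : Fin (m + 1)} (h : cum t b < cum s (a + 1))
        (h' : cum s a' < cum t (b' + 1)) (ha : a < a') (hb : b' < b) : False := by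
      have e₁ := cum_mono s (show (a : ℕ) + 1 ≤ a' from ha)
      have e₂ := cum_mono t (show (b' : ℕ) + 1 ≤ b from hb)
      linarith
    simp only [Prod.mk_le_mk]
    rcases lt_trichotomy a a' with ha | rfl | ha
    · exact Or.inl ⟨ha.le, not_lt.1 fun hb ↦ cross h₁ h₄ ha hb⟩
    · rcases le_total b b' with hb | hb
      · exact Or.inl ⟨le_rfl, hb⟩
      · exact Or.inr ⟨le_rfl, hb⟩
    · exact Or.inr ⟨ha.le, not_lt.1 fun hb ↦ cross h₃ h₂ ha hb⟩
  · ext a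
    rw [map_apply, ← hW₁ a]
    exact Finset.sum_nbij' (fun p ↦ p.2) (fun b ↦ (a, b)) (by simp) (by simp)
      (by rintro ⟨x, y⟩; simp; tauto) (by simp) (by rintro ⟨x, y⟩; simp; rintro rfl; rfl)
  · ext b
    rw [map_apply, ← hW₂ b]
    exact Finset.sum_nbij' (fun p ↦ p.1) (fun a ↦ (a, b)) (by simp) (by simp)
      (by rintro ⟨x, y⟩; simp; tauto) (by simp) (by rintro ⟨x, y⟩; simp; rintro rfl; rfl)

/-- A distribution supported on a chain of a poset is carried by a simplex of its nerve. -/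
lemma exists_map_eq_of_isChain {P : Type*} [PartialOrder P] [Fintype P] (w : stdSimplex ℝ P)
    (hw : IsChain (· ≤ ·) {p | w p ≠ 0}) :
    ∃ (k : ℕ) (σ : Fin (k + 1) →o P) (t : Simp k), stdSimplex.map σ t = w := by
  classical
  let S : Finset P := Finset.univ.filter (fun i ↦ w i ≠ 0)
  have hS : S.Nonempty := by
    by_contra h
    rw [Finset.not_nonempty_iff_eq_empty] at h
    have : ∑ i, w i = 0 := Finset.sum_eq_zero (fun i _ ↦ by
      by_contra hi
      have : i ∈ S := by simp [S, hi]
      simp [h] at this)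
    simp at this
  obtain ⟨k, hk⟩ : ∃ k, S.card = k + 1 := ⟨S.card - 1, by have := hS.card_pos; omega⟩
  let _ : LinearOrder S :=
    { (inferInstance : PartialOrder S) with
      le_total := fun a b ↦ hw.total (Finset.mem_filter.1 a.2).2 (Finset.mem_filter.1 b.2).2
      toDecidableLE := Classical.decRel _ }
  let e : Fin (k + 1) ≃o S := monoEquivOfFin S (by simpa using hk)
  have he : Function.Injective (fun i ↦ (e i).1) := Subtype.val_injective.comp e.injective
  have hρ (j) (hj : j ∉ Set.range (fun i ↦ (e i).1)) : w j = 0 := by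
    by_contra h
    exact hj ⟨e.symm ⟨j, by simp [S, h]⟩, by simp⟩
  have hsum : ∑ i, w (e i).1 = 1 := by
    rw [← stdSimplex.sum_eq_one w]
    exact Fintype.sum_of_injective _ he _ _ hρ (fun _ ↦ rfl)
  refine ⟨k, ⟨fun i ↦ (e i).1, fun i j h ↦ e.monotone h⟩,
    ⟨fun i ↦ w (e i).1, fun i ↦ by simp, hsum⟩, ?_⟩
  ext j
  by_cases hj : j ∈ Set.range (fun i ↦ (e i).1)
  · obtain ⟨i, rfl⟩ := hj
    exact map_apply_of_injective he _ i
  · rw [hρ j hj, map_apply, Finset.sum_eq_zero]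
    intro b hb
    exact (hj ⟨b, (Finset.mem_filter.1 hb).2⟩).elim

end coupling

section glue

variable {X : SSet.{u}} {Z : Type u} [TopologicalSpace Z]
  (f : ∀ (n : SimplexCategoryᵒᵖ) (x : X.obj n), C(stdSimplex ℝ (Fin (n.unop.len + 1)), Z))
  (hf : ∀ (n m : SimplexCategoryᵒᵖ) (θ : n ⟶ m) (x : X.obj n) (t : Simp m.unop.len),
    f m (X.map θ x) t = f n x (stdSimplex.map θ.unop.toOrderHom t))

/-- A compatible family of maps on topological simplices as a map to the singular simplicial set. -/
noncomputable def toSing : X ⟶ TopCat.toSSet.obj (TopCat.of Z) where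
  app n := TypeCat.ofHom fun x ↦ (TopCat.toSSetObjEquiv _ n).symm (f n x)
  naturality n m θ := by
    refine ConcreteCategory.hom_ext _ _ fun x ↦ ?_
    apply (TopCat.toSSetObjEquiv _ m).injective
    ext t
    exact hf _ _ θ x t

/-- The map out of the realisation glued from a compatible family of maps on simplices. -/
noncomputable def glue : C(SSet.toTop.obj X, Z) := (desc (toSing f hf)).hom

lemma glue_pt {n : SimplexCategoryᵒᵖ} (x : X.obj n) (t) : glue f hf (pt x t) = f n x t :=
  desc_pt _ _ _

end glue

lemma continuousMap_ext {X : SSet.{u}} {Z : Type u} [TopologicalSpace Z]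
    {f g : C(SSet.toTop.obj X, Z)}
    (h : ∀ (n : SimplexCategoryᵒᵖ) (x : X.obj n) (t), f (pt x t) = g (pt x t)) : f = g := by
  have := hom_ext (Z := TopCat.of Z) (f := TopCat.ofHom f) (g := TopCat.ofHom g) h
  exact congr_arg TopCat.Hom.hom this

section prod

variable (n m : ℕ)

/-- The affine map of simplices induced by a map of vertices, as a continuous map. -/
noncomputable def simpMap {A B : Type*} [Fintype A] [Fintype B] (f : A → B) :
    C(stdSimplex ℝ A, stdSimplex ℝ B) := ⟨stdSimplex.map f, stdSimplex.continuous_map f⟩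

lemma map_asOrderHom_map {n : SimplexCategory} {k l : SimplexCategoryᵒᵖ} (θ : k ⟶ l)
    (x : (SSet.stdSimplex.{u}.obj n).obj k) (t : Simp l.unop.len) :
    stdSimplex.map (SSet.stdSimplex.asOrderHom ((SSet.stdSimplex.{u}.obj n).map θ x)) t =
      stdSimplex.map (SSet.stdSimplex.asOrderHom x) (stdSimplex.map θ.unop.toOrderHom t) := by
  rw [stdSimplex.map_comp_apply]
  rfl

lemma map_asOrderHom_app {n n' : SimplexCategory} {k : SimplexCategoryᵒᵖ} (θ : n ⟶ n')
    (x : (SSet.stdSimplex.{u}.obj n).obj k) (t : Simp k.unop.len) :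
    stdSimplex.map (SSet.stdSimplex.asOrderHom ((SSet.stdSimplex.{u}.map θ).app k x)) t =
      stdSimplex.map θ.toOrderHom (stdSimplex.map (SSet.stdSimplex.asOrderHom x) t) := by
  rw [stdSimplex.map_comp_apply]
  rfl

/-- The map from a simplex of a product of simplices to the product of topological simplices. -/
noncomputable def prodSimpAux (k : SimplexCategoryᵒᵖ) (x : (Δ[n] ⊗ Δ[m] : SSet.{u}).obj k) :
    C(Simp k.unop.len, ULift.{u} (Simp n × Simp m)) :=
  ContinuousMap.comp (β := Simp n × Simp m) ⟨ULift.up, continuous_uliftUp⟩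
    ((simpMap (SSet.stdSimplex.asOrderHom x.1)).prodMk (simpMap (SSet.stdSimplex.asOrderHom x.2)))

lemma prodSimpAux_map (k l : SimplexCategoryᵒᵖ) (θ : k ⟶ l)
    (x : (Δ[n] ⊗ Δ[m] : SSet.{u}).obj k) (t : Simp l.unop.len) :
    prodSimpAux n m l ((Δ[n] ⊗ Δ[m] : SSet.{u}).map θ x) t =
      prodSimpAux n m k x (stdSimplex.map θ.unop.toOrderHom t) :=
  ULift.ext _ _ (Prod.ext (map_asOrderHom_map θ x.1 t) (map_asOrderHom_map θ x.2 t))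

/-- The comparison of the realisation of a product of simplices with the product of the topological
simplices. -/
noncomputable def prodSimp : C(SSet.toTop.obj (Δ[n] ⊗ Δ[m] : SSet.{u}), Simp n × Simp m) :=
  ContinuousMap.comp (β := ULift.{u} (Simp n × Simp m)) ⟨ULift.down, continuous_uliftDown⟩
    (glue (prodSimpAux n m) (prodSimpAux_map n m))

lemma prodSimp_pt {k : SimplexCategoryᵒᵖ} (x : (Δ[n] ⊗ Δ[m] : SSet.{u}).obj k) (t) :
    prodSimp n m (pt x t) = (stdSimplex.map (SSet.stdSimplex.asOrderHom x.1) t,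
      stdSimplex.map (SSet.stdSimplex.asOrderHom x.2) t) :=
  congr_arg ULift.down (glue_pt (prodSimpAux n m) (prodSimpAux_map n m) x t)

lemma map_fst_objEquiv {k : ℕ} (x : (Δ[n] ⊗ Δ[m] : SSet.{u}) _⦋k⦌) (t : Simp k) :
    stdSimplex.map Prod.fst (stdSimplex.map (SSet.prodStdSimplex.objEquiv x) t) =
      stdSimplex.map (SSet.stdSimplex.asOrderHom x.1) t :=
  (stdSimplex.map_comp_apply _ _ _).trans rfl

lemma map_snd_objEquiv {k : ℕ} (x : (Δ[n] ⊗ Δ[m] : SSet.{u}) _⦋k⦌) (t : Simp k) :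
    stdSimplex.map Prod.snd (stdSimplex.map (SSet.prodStdSimplex.objEquiv x) t) =
      stdSimplex.map (SSet.stdSimplex.asOrderHom x.2) t :=
  (stdSimplex.map_comp_apply _ _ _).trans rfl

/-- A point of the product of two simplices is a pair of distributions, and a point of the
realisation is a distribution supported on a chain; the comparison takes marginals. -/
lemma bijective_prodSimp : Function.Bijective (prodSimp.{u} n m) := by
  constructor
  · intro p p' h
    obtain ⟨k, x, t, hx, ht, rfl⟩ := exists_pt_nonDegenerate p
    obtain ⟨k', x', t', hx', ht', rfl⟩ := exists_pt_nonDegenerate p'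
    rw [prodSimp_pt, prodSimp_pt] at h
    rw [SSet.prodStdSimplex.nonDegenerate_iff_strictMono_objEquiv] at hx hx'
    have isChain {k : ℕ} (x : (Δ[n] ⊗ Δ[m] : SSet.{u}) _⦋k⦌) (t : Simp k) (ht : ∀ i, 0 < t i) :
        IsChain (· ≤ ·) {p | stdSimplex.map (SSet.prodStdSimplex.objEquiv x) t p ≠ 0} := by
      intro p hp q hq _
      rw [Set.mem_ofPred, map_apply_ne_zero_iff ht] at hp hq
      obtain ⟨i, rfl⟩ := hp
      obtain ⟨j, rfl⟩ := hq
      exact (le_total i j).imp (fun h ↦ (SSet.prodStdSimplex.objEquiv x).monotone h)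
        (fun h ↦ (SSet.prodStdSimplex.objEquiv x).monotone h)
    have e := eq_of_marginals_eq (isChain x t ht) (isChain x' t' ht')
      ((map_fst_objEquiv _ _ x t).trans
        ((congr_arg Prod.fst h).trans (map_fst_objEquiv _ _ x' t').symm))
      ((map_snd_objEquiv _ _ x t).trans
        ((congr_arg Prod.snd h).trans (map_snd_objEquiv _ _ x' t').symm))
    have e' := eq_of_map_strictMono_eq hx hx' ht ht' e
    obtain rfl : k = k' := congr_arg Sigma.fst e'
    have e'' := eq_of_heq (Sigma.mk.inj e').2
    obtain rfl : x = x' := SSet.prodStdSimplex.objEquiv.injective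
      (DFunLike.coe_injective (congr_arg Prod.fst e''))
    exact congr_arg (pt (n := op ⦋k⦌) x) (congr_arg Prod.snd e'')
  · rintro ⟨s, t⟩
    obtain ⟨w, hw, rfl, rfl⟩ := exists_chain_coupling s t
    obtain ⟨k, σ, t, rfl⟩ := exists_map_eq_of_isChain w hw
    refine ⟨pt (n := op ⦋k⦌) (SSet.prodStdSimplex.objEquiv.symm σ) t, ?_⟩
    rw [prodSimp_pt, ← map_fst_objEquiv, ← map_snd_objEquiv, Equiv.apply_symm_apply]

/-- The realisation of a product of simplices is the product of the topological simplices. -/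
noncomputable def prodSimpHomeo :
    SSet.toTop.obj (Δ[n] ⊗ Δ[m] : SSet.{u}) ≃ₜ Simp n × Simp m :=
  Continuous.homeoOfEquivCompactToT2 (f := Equiv.ofBijective _ (bijective_prodSimp n m))
    (prodSimp n m).continuous

lemma prodSimpHomeo_symm_diag (n : ℕ) (t : Simp n) :
    (prodSimpHomeo.{u} n n).symm (t, t) =
      pt (X := (Δ[n] ⊗ Δ[n] : SSet.{u})) (n := op ⦋n⦌)
        (SSet.stdSimplex.objEquiv.symm (𝟙 _), SSet.stdSimplex.objEquiv.symm (𝟙 _)) t := by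
  rw [Homeomorph.symm_apply_eq]
  refine Eq.symm ((prodSimp_pt n n (k := op ⦋n⦌) (SSet.stdSimplex.objEquiv.symm (𝟙 _),
    SSet.stdSimplex.objEquiv.symm (𝟙 _)) t).trans ?_)
  exact Prod.ext (stdSimplex.map_id_apply t) (stdSimplex.map_id_apply t)

end prod

/-! ### The realisation of a product -/

section product

variable {X Y : SSet.{u}}

/-- The comparison of the realisation of a product with the product of the realisations. -/
noncomputable def prodMap (z : SSet.toTop.obj (X ⊗ Y)) : SSet.toTop.obj X × SSet.toTop.obj Y :=
  (SSet.toTop.map (CartesianMonoidalCategory.fst X Y) z,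
    SSet.toTop.map (CartesianMonoidalCategory.snd X Y) z)

lemma prodMap_pt {n : SimplexCategoryᵒᵖ} (x : X.obj n) (y : Y.obj n) (t) :
    prodMap (pt (X := X ⊗ Y) (x, y) t) = (pt x t, pt y t) :=
  Prod.ext (toTop_map_pt _ _ _) (toTop_map_pt _ _ _)

/-- The product of a simplex of `X` and a simplex of `Y`. -/
noncomputable def prodCell {n m : SimplexCategoryᵒᵖ} (x : X.obj n) (y : Y.obj m) :
    C(Simp n.unop.len × Simp m.unop.len, SSet.toTop.obj (X ⊗ Y)) :=
  (SSet.toTop.map (SSet.yonedaEquiv.symm x ⊗ₘ SSet.yonedaEquiv.symm y)).hom.comp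
    ⟨_, (prodSimpHomeo n.unop.len m.unop.len).symm.continuous⟩

lemma toTop_map_prodSimpHomeo_symm {n m n' m' : SimplexCategory} (θ : n ⟶ n') (ψ : m ⟶ m')
    (t : Simp n.len) (s : Simp m.len) :
    SSet.toTop.map (SSet.stdSimplex.{u}.map θ ⊗ₘ SSet.stdSimplex.{u}.map ψ)
      ((prodSimpHomeo n.len m.len).symm (t, s)) =
    (prodSimpHomeo n'.len m'.len).symm (stdSimplex.map θ.toOrderHom t,
      stdSimplex.map ψ.toOrderHom s) := by
  obtain ⟨z, hz⟩ := (prodSimpHomeo.{u} n.len m.len).surjective (t, s)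
  rw [← hz, Homeomorph.symm_apply_apply, Homeomorph.eq_symm_apply]
  obtain ⟨k, x, r, rfl⟩ := exists_pt z
  have hz' := (prodSimp_pt n.len m.len x r).symm.trans hz
  rw [toTop_map_pt]
  refine (prodSimp_pt _ _ _ _).trans (Prod.ext ?_ ?_)
  · exact (map_asOrderHom_app θ x.1 r).trans (congr_arg _ (congr_arg Prod.fst hz'))
  · exact (map_asOrderHom_app ψ x.2 r).trans (congr_arg _ (congr_arg Prod.snd hz'))

lemma yonedaEquiv_symm_map {n n' : SimplexCategoryᵒᵖ} (θ : n ⟶ n') (x : X.obj n) :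
    SSet.yonedaEquiv.symm (X.map θ x) =
      SSet.stdSimplex.map θ.unop ≫ SSet.yonedaEquiv.symm x := by
  exact (SSet.yonedaEquiv_symm_naturality_left _ _).symm

lemma prodCell_map {n m n' m' : SimplexCategoryᵒᵖ} (θ : n ⟶ n') (ψ : m ⟶ m') (x : X.obj n)
    (y : Y.obj m) (t : Simp n'.unop.len) (s : Simp m'.unop.len) :
    prodCell (X.map θ x) (Y.map ψ y) (t, s) =
      prodCell x y (stdSimplex.map θ.unop.toOrderHom t, stdSimplex.map ψ.unop.toOrderHom s) := by
  have h := toTop_map_prodSimpHomeo_symm.{u} θ.unop ψ.unop t s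
  change SSet.toTop.map (SSet.yonedaEquiv.symm (X.map θ x) ⊗ₘ SSet.yonedaEquiv.symm (Y.map ψ y)) _ =
    SSet.toTop.map (SSet.yonedaEquiv.symm x ⊗ₘ SSet.yonedaEquiv.symm y) _
  rw [yonedaEquiv_symm_map, yonedaEquiv_symm_map, ← tensorHom_comp_tensorHom, Functor.map_comp]
  exact congr_arg _ h

lemma prodMap_prodCell {n m : SimplexCategoryᵒᵖ} (x : X.obj n) (y : Y.obj m) (t : Simp n.unop.len)
    (s : Simp m.unop.len) : prodMap (prodCell x y (t, s)) = (pt x t, pt y s) := by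
  obtain ⟨z, hz⟩ := (prodSimpHomeo.{u} n.unop.len m.unop.len).surjective (t, s)
  change prodMap (SSet.toTop.map (SSet.yonedaEquiv.symm x ⊗ₘ SSet.yonedaEquiv.symm y)
    ((prodSimpHomeo n.unop.len m.unop.len).symm (t, s))) = _
  rw [← hz, Homeomorph.symm_apply_apply]
  obtain ⟨k, w, r, rfl⟩ := exists_pt z
  have hz' := (prodSimp_pt _ _ w r).symm.trans hz
  rw [toTop_map_pt]
  refine (prodMap_pt (X := X) (Y := Y) (X.map (SSet.stdSimplex.objEquiv w.1).op x)
    (Y.map (SSet.stdSimplex.objEquiv w.2).op y) r).trans ?_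
  rw [pt_map, pt_map]
  exact Prod.ext (congr_arg (pt x) (congr_arg Prod.fst hz'))
    (congr_arg (pt y) (congr_arg Prod.snd hz'))

lemma prodCell_diag {n : SimplexCategoryᵒᵖ} (x : X.obj n) (y : Y.obj n) (t : Simp n.unop.len) :
    prodCell x y (t, t) = pt (X := X ⊗ Y) (n := n) (x, y) t := by
  change (SSet.toTop.map (SSet.yonedaEquiv.symm x ⊗ₘ SSet.yonedaEquiv.symm y)
    ((prodSimpHomeo n.unop.len n.unop.len).symm (t, t))) = _
  rw [prodSimpHomeo_symm_diag]
  refine (toTop_map_pt _ (n := n) _ _).trans ?_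
  refine congr_arg (fun z ↦ pt (X := X ⊗ Y) (n := n) z t) (Prod.ext ?_ ?_)
  · exact X.map_id_apply _ x
  · exact Y.map_id_apply _ y

lemma prodCell_map_left {n m n' : SimplexCategoryᵒᵖ} (θ : n ⟶ n') (x : X.obj n)
    (y : Y.obj m) (t : Simp n'.unop.len) (s : Simp m.unop.len) :
    prodCell (X.map θ x) y (t, s) = prodCell x y (stdSimplex.map θ.unop.toOrderHom t, s) := by
  have h := prodCell_map θ (𝟙 m) x y t s
  rw [Y.map_id_apply] at h
  exact h.trans (congr_arg (fun r ↦ prodCell x y (_, r)) (stdSimplex.map_id_apply s))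

lemma prodCell_map_right {n m m' : SimplexCategoryᵒᵖ} (ψ : m ⟶ m') (x : X.obj n)
    (y : Y.obj m) (t : Simp n.unop.len) (s : Simp m'.unop.len) :
    prodCell x (Y.map ψ y) (t, s) = prodCell x y (t, stdSimplex.map ψ.unop.toOrderHom s) := by
  have h := prodCell_map (𝟙 n) ψ x y t s
  rw [X.map_id_apply] at h
  exact h.trans (congr_arg (fun r ↦ prodCell x y (r, _)) (stdSimplex.map_id_apply t))

/-- The product of a simplex of `X` with the realisation of `Y`. -/
noncomputable def prodCellMap {n : SimplexCategoryᵒᵖ} (x : X.obj n) :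
    C(SSet.toTop.obj Y, C(Simp n.unop.len, SSet.toTop.obj (X ⊗ Y))) :=
  glue (fun m y ↦ ContinuousMap.curry ((prodCell x y).comp ContinuousMap.prodSwap))
    (fun _ _ θ y t ↦ ContinuousMap.ext fun s ↦ prodCell_map_right θ x y s t)

lemma prodCellMap_pt {n m : SimplexCategoryᵒᵖ} (x : X.obj n) (y : Y.obj m) (t : Simp n.unop.len)
    (s : Simp m.unop.len) : prodCellMap x (pt y s) t = prodCell x y (t, s) :=
  DFunLike.congr_fun (glue_pt (X := Y)
    (fun m y ↦ ContinuousMap.curry ((prodCell x y).comp ContinuousMap.prodSwap))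
    (fun _ _ θ y t ↦ ContinuousMap.ext fun s ↦ prodCell_map_right θ x y s t) y s) t

/-- A simplex of `X` as a family of maps from the realisation of `Y` to that of the product. -/
noncomputable def prodInvAux (n : SimplexCategoryᵒᵖ) (x : X.obj n) :
    C(Simp n.unop.len, C(SSet.toTop.obj Y, SSet.toTop.obj (X ⊗ Y))) :=
  ContinuousMap.curry ((ContinuousMap.uncurry (prodCellMap x)).comp ContinuousMap.prodSwap)

lemma prodInvAux_map (n m : SimplexCategoryᵒᵖ) (θ : n ⟶ m) (x : X.obj n) (t : Simp m.unop.len) :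
    prodInvAux (Y := Y) m (X.map θ x) t = prodInvAux n x (stdSimplex.map θ.unop.toOrderHom t) :=
  continuousMap_ext fun k y s ↦ (prodCellMap_pt (X.map θ x) y t s).trans
    ((prodCell_map_left θ x y t s).trans (prodCellMap_pt x y _ s).symm)

/-- The inverse of the comparison of the realisation of a product with the product of the
realisations, in curried form. -/
noncomputable def prodInv : C(SSet.toTop.obj X, C(SSet.toTop.obj Y, SSet.toTop.obj (X ⊗ Y))) :=
  glue prodInvAux prodInvAux_map

lemma prodInv_pt {n m : SimplexCategoryᵒᵖ} (x : X.obj n) (y : Y.obj m) (t : Simp n.unop.len)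
    (s : Simp m.unop.len) : prodInv (pt x t) (pt y s) = prodCell x y (t, s) :=
  (DFunLike.congr_fun (glue_pt prodInvAux prodInvAux_map x t) (pt y s)).trans
    (prodCellMap_pt x y t s)

lemma prodMap_prodInv (a : SSet.toTop.obj X) (b : SSet.toTop.obj Y) :
    prodMap (prodInv a b) = (a, b) := by
  obtain ⟨n, x, t, rfl⟩ := exists_pt a
  obtain ⟨m, y, s, rfl⟩ := exists_pt b
  rw [prodInv_pt, prodMap_prodCell]

lemma prodInv_prodMap (z : SSet.toTop.obj (X ⊗ Y)) : prodInv (prodMap z).1 (prodMap z).2 = z := by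
  obtain ⟨n, ⟨x, y⟩, t, rfl⟩ := exists_pt z
  rw [prodMap_pt]
  exact (prodInv_pt x y t t).trans (prodCell_diag x y t)

lemma bijective_prodMap : Function.Bijective (prodMap (X := X) (Y := Y)) :=
  Function.bijective_iff_has_inverse.2 ⟨fun p ↦ prodInv p.1 p.2, prodInv_prodMap,
    fun p ↦ prodMap_prodInv p.1 p.2⟩

lemma continuous_prodMap : Continuous (prodMap (X := X) (Y := Y)) :=
  (SSet.toTop.map (CartesianMonoidalCategory.fst X Y)).hom.continuous.prodMk
    (SSet.toTop.map (CartesianMonoidalCategory.snd X Y)).hom.continuous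

/-- The inverse comparison is continuous on maps out of locally compact spaces. -/
lemma continuous_prodInv_comp {K : Type*} [TopologicalSpace K] [LocallyCompactSpace K]
    {f : K → SSet.toTop.obj X} {g : K → SSet.toTop.obj Y} (hf : Continuous f) (hg : Continuous g) :
    Continuous (fun k ↦ prodInv (f k) (g k)) := by
  let φ : C(K, C(K, SSet.toTop.obj (X ⊗ Y))) :=
    ⟨fun k ↦ (prodInv (f k)).comp ⟨g, hg⟩,
      (ContinuousMap.continuous_precomp _).comp (prodInv.continuous.comp hf)⟩
  exact (ContinuousMap.uncurry φ).continuous.comp (continuous_id.prodMk continuous_id)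

end product

end Geometric

namespace Geometric

open Simplicial

/-! ### The singular simplicial set is a Kan complex -/

section horn

/-- The comparison of the realisation of a simplex with the topological simplex, before lifting
universes. -/
noncomputable def simpTopAux (N : ℕ) : C(SSet.toTop.obj (Δ[N] : SSet.{u}), ULift.{u} (Simp N)) :=
  glue (fun k x ↦ ContinuousMap.comp (β := Simp N) ⟨ULift.up, continuous_uliftUp⟩
    (simpMap (SSet.stdSimplex.asOrderHom x)))
    (fun k l θ x t ↦ ULift.ext _ _ (map_asOrderHom_map θ x t))

/-- The comparison of the realisation of a simplex with the topological simplex. -/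
noncomputable def simpTop (N : ℕ) : C(SSet.toTop.obj (Δ[N] : SSet.{u}), Simp N) :=
  ContinuousMap.comp (β := ULift.{u} (Simp N)) ⟨ULift.down, continuous_uliftDown⟩ (simpTopAux N)

lemma simpTop_pt {N : ℕ} {k : SimplexCategoryᵒᵖ} (x : (Δ[N] : SSet.{u}).obj k)
    (t : Simp k.unop.len) :
    simpTop N (pt x t) = stdSimplex.map (SSet.stdSimplex.asOrderHom x) t :=
  congr_arg ULift.down (glue_pt (X := (Δ[N] : SSet.{u}))
    (fun k x ↦ ContinuousMap.comp (β := Simp N) ⟨ULift.up, continuous_uliftUp⟩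
    (simpMap (SSet.stdSimplex.asOrderHom x)))
    (fun k l θ x t ↦ ULift.ext _ _ (map_asOrderHom_map θ x t)) x t)

/-- The support of a point determines the nondegenerate simplex in whose interior it lies. -/
lemma simpTop_subcomplex_injective {N : ℕ} (A : (Δ[N] : SSet.{u}).Subcomplex) :
    Function.Injective (fun p ↦ simpTop N (SSet.toTop.map A.ι p)) := by
  intro p p' h
  obtain ⟨k, x, t, hx, ht, rfl⟩ := exists_pt_nonDegenerate p
  obtain ⟨k', x', t', hx', ht', rfl⟩ := exists_pt_nonDegenerate p'
  have h' : stdSimplex.map (SSet.stdSimplex.asOrderHom x.1) t =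
      stdSimplex.map (SSet.stdSimplex.asOrderHom x'.1) t' := by
    rw [← simpTop_pt, ← simpTop_pt]
    simp only [toTop_map_pt] at h
    exact h
  have mono {k : ℕ} {x : (A : SSet.{u}) _⦋k⦌} (hx : x ∈ SSet.nonDegenerate A k) :=
    (SSet.stdSimplex.mem_nonDegenerate_iff_strictMono _).1
      ((SSet.Subcomplex.mem_nonDegenerate_iff A x).1 hx)
  have e' := eq_of_map_strictMono_eq (mono hx) (mono hx') ht ht' h'
  obtain rfl : k = k' := congr_arg Sigma.fst e'
  have e'' := eq_of_heq (Sigma.mk.inj e').2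
  obtain rfl : x = x' := Subtype.ext (SSet.stdSimplex.objEquiv.injective
    (SimplexCategory.Hom.ext _ _ (DFunLike.coe_injective (congr_arg Prod.fst e''))))
  exact congr_arg (pt (n := op ⦋k⦌) x) (congr_arg Prod.snd e'')

variable {n : ℕ} (i : Fin (n + 2))

lemma range_simpTop_horn :
    Set.range (fun p : SSet.toTop.obj (Λ[n + 1, i] : SSet.{u}) ↦
      simpTop (n + 1) (SSet.toTop.map (Λ[n + 1, i] : SSet.Subcomplex _).ι p)) =
      {x | ∃ j, j ≠ i ∧ x j = 0} := by
  ext x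
  constructor
  · rintro ⟨p, rfl⟩
    obtain ⟨k, y, t, rfl⟩ := exists_pt p
    induction k using Opposite.rec with | _ k
    induction k using SimplexCategory.rec with | _ k
    obtain ⟨j, hj, hj'⟩ := (SSet.mem_horn_iff_notMem_range y.1 i).1 y.2
    refine ⟨j, hj, ?_⟩
    simp only [toTop_map_pt]
    refine (congr_arg (fun z : Simp (n + 1) ↦ z j) (simpTop_pt _ _)).trans ?_
    classical
    rw [map_apply]
    exact Finset.sum_eq_zero fun l hl ↦ (hj' ⟨l, (Finset.mem_filter.1 hl).2⟩).elim
  · rintro ⟨j, hj, hx⟩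
    obtain ⟨k, ρ, t, ht, rfl⟩ := exists_simp_interior x
    have hjρ : j ∉ Set.range ρ := fun h ↦ (map_apply_ne_zero_iff ht j).2 h hx
    let y : (Δ[n + 1] : SSet.{u}) _⦋k⦌ :=
      SSet.stdSimplex.objEquiv.symm (SimplexCategory.Hom.mk ⟨ρ, ρ.monotone⟩)
    have hy : y ∈ (SSet.horn (n + 1) i).obj _ :=
      (SSet.mem_horn_iff_notMem_range y i).2 ⟨j, hj, hjρ⟩
    refine ⟨pt (X := SSet.horn (n + 1) i) (n := op ⦋k⦌) ⟨y, hy⟩ t, ?_⟩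
    exact (congr_arg (simpTop (n + 1)) (toTop_map_pt _ _ _)).trans (simpTop_pt y t)

/-- The smallest barycentric coordinate on the complement of the vertex `i`. -/
noncomputable def hornMin (x : Simp (n + 1)) : ℝ :=
  (Finset.univ.erase i).inf' ⟨i + 1, by simp⟩ (fun j ↦ x j)

lemma hornMin_le (x : Simp (n + 1)) {j : Fin (n + 2)} (hj : j ≠ i) : hornMin i x ≤ x j :=
  Finset.inf'_le _ (by simp [hj])

lemma hornMin_nonneg (x : Simp (n + 1)) : 0 ≤ hornMin i x :=
  Finset.le_inf' _ _ fun _ _ ↦ by simp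

lemma exists_hornMin_eq (x : Simp (n + 1)) : ∃ j, j ≠ i ∧ hornMin i x = x j := by
  obtain ⟨j, hj, h⟩ := Finset.exists_mem_eq_inf' (s := Finset.univ.erase i) ⟨i + 1, by simp⟩
    (fun j ↦ x j)
  exact ⟨j, Finset.ne_of_mem_erase hj, h⟩

/-- The retraction of the topological simplex onto a horn, projecting along the line from the
barycentre of the opposite face to the vertex `i`. -/
noncomputable def hornRetraction (x : Simp (n + 1)) : Simp (n + 1) :=
  ⟨fun j ↦ x j - hornMin i x + if j = i then (n + 2) * hornMin i x else 0, fun j ↦ by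
    have := hornMin_nonneg i x
    dsimp only
    split_ifs with h
    · have : 0 ≤ x j := by simp
      nlinarith
    · have := hornMin_le i x h
      linarith, by
    rw [Finset.sum_add_distrib, Finset.sum_sub_distrib, stdSimplex.sum_eq_one]
    simp
    ring⟩

lemma continuous_hornRetraction : Continuous (hornRetraction i) := by
  have h (j) : Continuous (fun x : Simp (n + 1) ↦ x j) :=
    (continuous_apply j).comp continuous_subtype_val
  have h' : Continuous (hornMin i) := Continuous.finset_inf'_apply _ fun j _ ↦ h j
  refine Continuous.subtype_mk (continuous_pi fun j ↦ ?_) _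
  refine ((h j).sub h').add ?_
  split_ifs
  · exact continuous_const.mul h'
  · exact continuous_const

lemma hornRetraction_mem (x : Simp (n + 1)) : ∃ j, j ≠ i ∧ hornRetraction i x j = 0 := by
  obtain ⟨j, hj, h⟩ := exists_hornMin_eq i x
  refine ⟨j, hj, ?_⟩
  change x j - hornMin i x + (if j = i then _ else _) = 0
  rw [if_neg hj, h]
  simp

lemma hornRetraction_eq_self {x : Simp (n + 1)} (hx : ∃ j, j ≠ i ∧ x j = 0) :
    hornRetraction i x = x := by
  obtain ⟨j, hj, h⟩ := hx
  have h' : hornMin i x = 0 :=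
    le_antisymm (h ▸ hornMin_le i x hj) (hornMin_nonneg i x)
  ext k
  change x k - hornMin i x + (if k = i then _ else _) = x k
  rw [h']
  simp

/-- The realisation of a horn is a retract of the realisation of the simplex: being compact, it is
homeomorphic to its image in the topological simplex. -/
lemma exists_retraction_horn : ∃ ρ : SSet.toTop.obj (Δ[n + 1] : SSet.{u}) ⟶
    SSet.toTop.obj (Λ[n + 1, i] : SSet.{u}),
      SSet.toTop.map (Λ[n + 1, i] : SSet.Subcomplex _).ι ≫ ρ = 𝟙 _ := by
  let J (p : SSet.toTop.obj (Λ[n + 1, i] : SSet.{u})) : Simp (n + 1) :=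
      simpTop (n + 1) (SSet.toTop.map (Λ[n + 1, i] : SSet.Subcomplex _).ι p)
  have hJc : Continuous J :=
    (simpTop (n + 1)).continuous.comp
      (SSet.toTop.map (Λ[n + 1, i] : SSet.Subcomplex _).ι).hom.continuous
  have hJ : Topology.IsClosedEmbedding J :=
    hJc.isClosedEmbedding (simpTop_subcomplex_injective _)
  have hr (p : SSet.toTop.obj (Δ[n + 1] : SSet.{u})) :
      hornRetraction i (simpTop (n + 1) p) ∈ Set.range J := by
    rw [range_simpTop_horn]
    exact hornRetraction_mem i _
  let ρ : SSet.toTop.obj (Δ[n + 1] : SSet.{u}) → SSet.toTop.obj (Λ[n + 1, i] : SSet.{u}) :=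
    fun p ↦ hJ.isEmbedding.toHomeomorph.symm ⟨_, hr p⟩
  have hρ (p) : J (ρ p) = hornRetraction i (simpTop (n + 1) p) :=
    congr_arg Subtype.val (hJ.isEmbedding.toHomeomorph.apply_symm_apply ⟨_, hr p⟩)
  have hρc : Continuous ρ := hJ.isEmbedding.toHomeomorph.symm.continuous.comp
    (((continuous_hornRetraction i).comp (simpTop (n + 1)).continuous).subtype_mk _)
  refine ⟨TopCat.ofHom ⟨ρ, hρc⟩, ?_⟩
  ext p
  apply hJ.injective
  refine (hρ _).trans (hornRetraction_eq_self i ?_)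
  have : J p ∈ Set.range J := ⟨p, rfl⟩
  rw [range_simpTop_horn] at this
  exact this

end horn

lemma desc_comp {X : SSet.{u}} {Z W : TopCat.{u}} (φ : X ⟶ TopCat.toSSet.obj Z) (g : Z ⟶ W) :
    desc (φ ≫ TopCat.toSSet.map g) = desc φ ≫ g :=
  Adjunction.homEquiv_naturality_right_symm _ _ _

lemma comp_desc {X Y : SSet.{u}} {Z : TopCat.{u}} (f : X ⟶ Y) (φ : Y ⟶ TopCat.toSSet.obj Z) :
    desc (f ≫ φ) = SSet.toTop.map f ≫ desc φ :=
  Adjunction.homEquiv_naturality_left_symm _ _ _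

lemma desc_unit (X : SSet.{u}) : desc (sSetTopAdj.unit.app X) = 𝟙 _ := by
  refine (sSetTopAdj.homEquiv _ _).injective ?_
  exact (Equiv.apply_symm_apply _ _).trans (sSetTopAdj.homEquiv_id X).symm

open SSet.modelCategoryQuillen in
instance kanComplex_toSSet (Z : TopCat.{u}) : SSet.KanComplex (TopCat.toSSet.obj Z) := by
  refine (HomotopicalAlgebra.isFibrant_iff _).2 ⟨?_⟩
  rw [SSet.modelCategoryQuillen.fibrations_eq]
  intro _ _ _ hf
  simp only [SSet.modelCategoryQuillen.J, MorphismProperty.iSup_iff] at hf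
  obtain ⟨n, ⟨i⟩⟩ := hf
  refine ⟨fun {t _} _ ↦ ?_⟩
  obtain ⟨ρ, hρ⟩ := exists_retraction_horn.{u} i
  have extend {A B : SSet.{u}} (i : A ⟶ B) (ρ : SSet.toTop.obj B ⟶ SSet.toTop.obj A)
      (hρ : SSet.toTop.map i ≫ ρ = 𝟙 _) (t : A ⟶ TopCat.toSSet.obj Z) :
      i ≫ sSetTopAdj.unit.app B ≫ TopCat.toSSet.map (ρ ≫ desc t) = t := by
    have h := sSetTopAdj.unit.naturality i
    dsimp at h
    rw [reassoc_of% h, ← Functor.map_comp, reassoc_of% hρ, unit_desc]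
  exact ⟨⟨{
    l := sSetTopAdj.unit.app _ ≫ TopCat.toSSet.map (ρ ≫ desc t)
    fac_left := extend _ ρ hρ t
    fac_right := by subsingleton }⟩⟩

/-! ### Weak equivalences realise to homotopy equivalences -/

open SSet in
/-- The path of points of the realisation of the interval. -/
noncomputable def intervalPath : C(unitInterval, SSet.toTop.obj (Δ[1] : SSet.{u})) :=
  ⟨fun s ↦ pt (X := (Δ[1] : SSet.{u})) (n := op ⦋1⦌) (stdSimplex.objEquiv.symm (𝟙 _))
    (stdSimplexHomeomorphUnitInterval.symm s),
    (continuous_pt _).comp stdSimplexHomeomorphUnitInterval.symm.continuous⟩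

lemma simp_eq_vertex {n : ℕ} (t : Simp n) (i : Fin (n + 1)) (h : t i = 1) :
    t = stdSimplex.vertex i := by
  classical
  have hs := stdSimplex.sum_eq_one t
  rw [← Finset.add_sum_erase _ _ (Finset.mem_univ i), h] at hs
  have hs' : ∑ j ∈ Finset.univ.erase i, t j = 0 := by linarith
  rw [Finset.sum_eq_zero_iff_of_nonneg (fun _ _ ↦ by simp)] at hs'
  ext j
  by_cases hj : j = i
  · subst hj
    rw [h]
    simp [stdSimplex.vertex]
  · rw [hs' j (by simp [hj])]
    simp [stdSimplex.vertex, hj]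

lemma map_const {m n : ℕ} (t : Simp m) (i : Fin (n + 1)) :
    stdSimplex.map (fun _ : Fin (m + 1) ↦ i) t = stdSimplex.vertex i := by
  classical
  refine simp_eq_vertex _ i ?_
  rw [map_apply]
  simp

open SSet in
lemma pt_stdSimplex {m : ℕ} {n : SimplexCategoryᵒᵖ} (c : (Δ[m] : SSet.{u}).obj n)
    (t : Simp n.unop.len) :
    pt c t = pt (X := (Δ[m] : SSet.{u})) (n := op ⦋m⦌) (stdSimplex.objEquiv.symm (𝟙 _))
      (stdSimplex.map (stdSimplex.asOrderHom c) t) := by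
  refine Eq.trans ?_ (pt_map (stdSimplex.objEquiv c).op _ t)
  congr 1
  exact stdSimplex.objEquiv.injective (Category.comp_id _).symm

lemma intervalPath_zero {n : SimplexCategoryᵒᵖ} (t : Simp n.unop.len) {X : SSet.{u}} (x : X.obj n) :
    intervalPath.{u} 0 = pt (SSet.ι₀.app n x).2 t := by
  rw [pt_stdSimplex]
  refine congr_arg (pt (X := (Δ[1] : SSet.{u})) (n := op ⦋1⦌) _) ?_
  rw [Homeomorph.symm_apply_eq]
  refine Eq.trans ?_ (congr_arg _ (map_const t (0 : Fin 2)).symm)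
  exact stdSimplexHomeomorphUnitInterval_zero.symm

lemma intervalPath_one {n : SimplexCategoryᵒᵖ} (t : Simp n.unop.len) {X : SSet.{u}} (x : X.obj n) :
    intervalPath.{u} 1 = pt (SSet.ι₁.app n x).2 t := by
  rw [pt_stdSimplex]
  refine congr_arg (pt (X := (Δ[1] : SSet.{u})) (n := op ⦋1⦌) _) ?_
  rw [Homeomorph.symm_apply_eq]
  refine Eq.trans ?_ (congr_arg _ (map_const t (1 : Fin 2)).symm)
  exact stdSimplexHomeomorphUnitInterval_one.symm

/-- A simplicial homotopy realises to a homotopy. -/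
lemma homotopic_of_htpy {X Y : SSet.{u}} {f g : X ⟶ Y} (h : SSet.Htpy f g) :
    (SSet.toTop.map f).hom.Homotopic (SSet.toTop.map g).hom := by
  obtain ⟨h, rfl, rfl⟩ := h
  let φ : C(SSet.toTop.obj X, C(unitInterval, SSet.toTop.obj (X ⊗ Δ[1]))) :=
    ⟨fun p ↦ (prodInv p).comp intervalPath,
      (ContinuousMap.continuous_precomp _).comp prodInv.continuous⟩
  refine ⟨⟨⟨fun z ↦ SSet.toTop.map h (prodInv z.2 (intervalPath z.1)), ?_⟩,
    fun p ↦ ?_, fun p ↦ ?_⟩⟩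
  · exact (SSet.toTop.map h).hom.continuous.comp
      ((ContinuousMap.uncurry φ).continuous.comp continuous_swap)
  · obtain ⟨n, x, t, rfl⟩ := exists_pt p
    change SSet.toTop.map h (prodInv (pt x t) (intervalPath 0)) =
      SSet.toTop.map (SSet.ι₀ ≫ h) (pt x t)
    rw [intervalPath_zero t x, prodInv_pt, prodCell_diag, toTop_map_pt]
    exact toTop_map_pt _ _ _
  · obtain ⟨n, x, t, rfl⟩ := exists_pt p
    change SSet.toTop.map h (prodInv (pt x t) (intervalPath 1)) =
      SSet.toTop.map (SSet.ι₁ ≫ h) (pt x t)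
    rw [intervalPath_one t x, prodInv_pt, prodCell_diag, toTop_map_pt]
    exact toTop_map_pt _ _ _

lemma desc_homotopic {X : SSet.{u}} {Z : TopCat.{u}} {φ ψ : X ⟶ TopCat.toSSet.obj Z}
    (h : SSet.Htpy φ ψ) : (desc φ).hom.Homotopic (desc ψ).hom := by
  have e (φ : X ⟶ TopCat.toSSet.obj Z) : desc φ = SSet.toTop.map φ ≫ desc (𝟙 _) := by
    rw [← comp_desc, Category.comp_id]
  rw [e, e]
  exact ContinuousMap.Homotopic.comp (.refl _) (homotopic_of_htpy h)

/-- A weak equivalence of simplicial sets realises to a homotopy equivalence: since singular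
simplicial sets are Kan complexes, the unit `X ⟶ Sing |X|` extends along `f`, up to homotopy, and
the extension is adjoint to a homotopy inverse. -/
theorem isHomotopyEquivalence_of_wEq {X Y : SSet.{u}} {f : X ⟶ Y} (hf : SSet.WEq f) :
    IsHomotopyEquivalence (SSet.toTop.map f) := by
  obtain ⟨r, hr⟩ :=
    hf.exists_extension (TopCat.toSSet.obj (SSet.toTop.obj X)) (sSetTopAdj.unit.app X)
  have h₁ := desc_homotopic hr
  have h₂ := desc_homotopic (hf.htpy_of_comp (TopCat.toSSet.obj (SSet.toTop.obj Y))
    (r ≫ TopCat.toSSet.map (SSet.toTop.map f)) (sSetTopAdj.unit.app Y) (by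
      have e := sSetTopAdj.unit.naturality f
      dsimp at e
      rw [e, ← Category.assoc]
      exact hr.comp_right _))
  rw [comp_desc, desc_unit] at h₁
  rw [desc_comp, desc_unit] at h₂
  exact ⟨⟨(SSet.toTop.map f).hom, (desc r).hom, h₁, h₂⟩, rfl⟩

end Geometric

/-! ### Nerves of functors and natural transformations -/

namespace SSet

open Simplicial CartesianMonoidalCategory

section nerve

variable {C D : Type u} [SmallCategory C] [SmallCategory D]

/-- A natural transformation induces a homotopy of maps of nerves. -/
lemma htpy_nerveMap {F G : C ⥤ D} (α : F ⟶ G) : Htpy (nerveMap F) (nerveMap G) := by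
  let H : Fin 2 × C ⥤ D := Functor.uncurry.obj (ComposableArrows.mk₁ α)
  let h : nerve C ⊗ Δ[1] ⟶ nerve D :=
    { app n := TypeCat.ofHom fun x ↦
        (Functor.prod' (stdSimplex.asOrderHom x.2).monotone.functor x.1) ⋙ H
      naturality n m θ := rfl }
  refine ⟨h, ?_, ?_⟩
  · ext n x
    refine CategoryTheory.Functor.hext (fun i ↦ rfl) fun i j f ↦ heq_of_eq ?_
    exact Category.id_comp (F.map (x.map f))
  · ext n x
    refine CategoryTheory.Functor.hext (fun i ↦ rfl) fun i j f ↦ heq_of_eq ?_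
    exact Category.id_comp (G.map (x.map f))

/-- A functor with an inverse up to natural transformations, in either direction, induces a weak
equivalence of nerves. -/
lemma wEq_nerveMap_of_natTrans {F : C ⥤ D} (G : D ⥤ C)
    (h : Nonempty (F ⋙ G ⟶ 𝟭 C) ∨ Nonempty (𝟭 C ⟶ F ⋙ G))
    (h' : Nonempty (G ⋙ F ⟶ 𝟭 D) ∨ Nonempty (𝟭 D ⟶ G ⋙ F)) : WEq (nerveMap F) :=
  WEq.of_htpy_inverse (nerveMap G)
    (h.imp (fun ⟨α⟩ ↦ htpy_nerveMap α) (fun ⟨α⟩ ↦ htpy_nerveMap α))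
    (h'.imp (fun ⟨α⟩ ↦ htpy_nerveMap α) (fun ⟨α⟩ ↦ htpy_nerveMap α))

lemma wEq_nerveMap_of_isEquivalence (F : C ⥤ D) [F.IsEquivalence] : WEq (nerveMap F) :=
  wEq_nerveMap_of_natTrans F.inv (.inl ⟨F.asEquivalence.unitInv⟩)
    (.inl ⟨F.asEquivalence.counit⟩)

end nerve

end SSet

/-! ### Double functors which are weak equivalences in one direction -/

namespace DoubleCat

/-- The transpose of a double category, with horizontal and vertical morphisms exchanged. -/
def transpose (C : DoubleCat.{u}) : DoubleCat.{u} where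
  Obj := C.Obj
  horCat := inferInstanceAs (Category C.VCat)
  Ver a b := a ⟶ b
  vid a := 𝟙 a
  vcomp p q := p ≫ q
  vid_vcomp p := Category.id_comp p
  vcomp_vid p := Category.comp_id p
  vassoc p q r := Category.assoc p q r
  Sq f p q g := C.Sq p f g q
  hid p := C.sqVid p
  hcomp α β := C.sqVcomp α β
  sqVid f := C.hid f
  sqVcomp α β := C.hcomp α β
  hid_hcomp α := C.sqVid_sqVcomp α
  hcomp_hid α := C.sqVcomp_sqVid α
  hassoc α β γ := C.sqVassoc α β γ
  sqVid_sqVcomp α := C.hid_hcomp α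
  sqVcomp_sqVid α := C.hcomp_hid α
  sqVassoc α β γ := C.hassoc α β γ
  sqVid_id a := (C.sqVid_id a).symm
  sqVid_comp f g := C.hid_vcomp f g
  hid_vcomp p q := C.sqVid_comp p q
  interchange α β γ δ := (C.interchange α γ β δ).symm

/-- A string of horizontal composites of strings of 2-cells, read in the other direction. -/
def transposeString (C : DoubleCat.{u}) {n k : ℕ} (F : ComposableArrows (VNerveObj C n) k) :
    ComposableArrows (VNerveObj C.transpose k) n where
  obj i := ⟨{ obj a := (F.obj a).pt i
              map h := VNerveHom.app (F.map h) i
              map_id a := congr_arg (fun s : VNerveHom _ _ ↦ s.app i) (F.map_id a)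
              map_comp h h' := congr_arg (fun s : VNerveHom _ _ ↦ s.app i) (F.map_comp h h') }⟩
  map {i j} h :=
    { app a := (F.obj a).ver h
      sq h' := VNerveHom.sq (F.map h') h
      sq_id a := congr_arg_heq (fun s : VNerveHom _ _ ↦ s.sq h) (F.map_id a)
      sq_comp h₁ h₂ := congr_arg_heq (fun s : VNerveHom _ _ ↦ s.sq h) (F.map_comp h₁ h₂) }
  map_id i := VNerveHom.ext (fun a ↦ (F.obj a).ver_id i) (fun h ↦ VNerveHom.sq_id (F.map h) i)
  map_comp h h' := VNerveHom.ext (fun a ↦ (F.obj a).ver_comp h h')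
    (fun t ↦ VNerveHom.sq_comp (F.map t) h h')

/-- The diagonals of the double nerves of a double category and of its transpose agree. -/
def diagonalTransposeIso (C : DoubleCat.{u}) :
    bisimplicialDiagonal.obj C.doubleNerve ≅ bisimplicialDiagonal.obj C.transpose.doubleNerve where
  hom := { app n := TypeCat.ofHom fun F ↦ C.transposeString F
           naturality n m θ := rfl }
  inv := { app n := TypeCat.ofHom fun F ↦ C.transpose.transposeString F
           naturality n m θ := rfl }
  hom_inv_id := rfl
  inv_hom_id := rfl

end DoubleCat

namespace DoubleFunctor

variable {C D : DoubleCat.{u}} (Φ : DoubleFunctor C D)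

/-- The transpose of a double functor. -/
def transpose : DoubleFunctor C.transpose D.transpose where
  hor := Φ.vFunctor
  ver p := Φ.hor.map p
  ver_vid a := Φ.hor.map_id a
  ver_vcomp p q := Φ.hor.map_comp p q
  sq α := Φ.sq α
  sq_hid p := Φ.sq_sqVid p
  sq_hcomp α β := Φ.sq_sqVcomp α β
  sq_sqVid f := Φ.sq_hid f
  sq_sqVcomp α β := Φ.sq_hcomp α β

/-- The map of diagonals of double nerves induced by a double functor. -/
def diagonalMap : bisimplicialDiagonal.obj C.doubleNerve ⟶ bisimplicialDiagonal.obj D.doubleNerve :=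
  bisimplicialDiagonal.map Φ.doubleNerveMap

/-- It suffices that a double functor induces weak equivalences of the nerves of the categories of
vertical strings of each length. -/
lemma wEq_diagonalMap (h : ∀ n, SSet.WEq (nerveMap (Φ.vNerveFunctor n))) :
    SSet.WEq Φ.diagonalMap :=
  SSet.wEq_bisimplicialDiagonal_map _ fun n ↦ h n.unop.len

lemma diagonalMap_transpose :
    C.diagonalTransposeIso.hom ≫ Φ.transpose.diagonalMap =
      Φ.diagonalMap ≫ D.diagonalTransposeIso.hom := rfl

/-- The roles of the horizontal and the vertical direction may be exchanged. -/
lemma wEq_diagonalMap_of_transpose (h : SSet.WEq Φ.transpose.diagonalMap) :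
    SSet.WEq Φ.diagonalMap := by
  refine SSet.WEq.of_comp_right (g := D.diagonalTransposeIso.hom) (.of_isIso _) ?_
  rw [← diagonalMap_transpose]
  exact (SSet.WEq.of_isIso _).comp h

lemma isHomotopyEquivalence_realisationMap (h : SSet.WEq Φ.diagonalMap) :
    IsHomotopyEquivalence Φ.realisationMap :=
  Geometric.isHomotopyEquivalence_of_wEq h

end DoubleFunctor

/-! ### Strings of 2-cells in `𝓜 × X` and `𝓜 ⋉ X` -/

open DoubleCat

/-- The morphism from `0` to `i` in a linear order with least element `0`. -/
abbrev from0 {n : ℕ} (i : Fin (n + 1)) : (0 : Fin (n + 1)) ⟶ i := homOfLE (Fin.zero_le i)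

namespace LaxSq

variable {M : Type u} [Category.{v} M] [MonoidalCategory M] {X : Type w} [Category.{wt} X]
  [MonoidalLeftAction M X]

lemma hom_heq {x x' y y' : X} {f f' : x ⟶ x'} {p p' : LaxVer M x y} {q q' : LaxVer M x' y'}
    {g g' : y ⟶ y'} {α : LaxSq f p q g} {β : LaxSq f' p' q' g'} (hf : f = f') (hp : p = p')
    (hq : q = q') (hg : g = g') (h : HEq α β) : HEq α.hom β.hom := by
  subst hf hp hq hg
  obtain rfl := eq_of_heq h
  rfl

end LaxSq

namespace StrictSq

variable {M : Type u} [Category.{v} M] [MonoidalCategory M] {X : Type w} [Category.{wt} X]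
  [MonoidalLeftAction M X]

lemma hom_heq {x x' y y' : X} {f f' : x ⟶ x'} {p p' : StrictVer M x y} {q q' : StrictVer M x' y'}
    {g g' : y ⟶ y'} {α : StrictSq f p q g} {β : StrictSq f' p' q' g'} (hf : f = f') (hp : p = p')
    (hq : q = q') (hg : g = g') (h : HEq α β) : HEq α.hom β.hom := by
  subst hf hp hq hg
  obtain rfl := eq_of_heq h
  rfl

end StrictSq

section action

variable {M X : Type u} [SmallCategory M] [MonoidalCategory M] [SmallCategory X]
  [MonoidalLeftAction M X]

lemma StrictVer.eqToHom_comm (m : M) {x y z t : X} (h : x = y) (h' : m ⊙ₗ y = z) (h'' : m ⊙ₗ x = t)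
    (h''' : t = z) : m ⊴ₗ eqToHom h ≫ eqToHom h' = eqToHom h'' ≫ eqToHom h''' := by
  rw [StrictVer.actionHomRight_eqToHom, eqToHom_trans, eqToHom_trans]

lemma actionHom_id_id (m : M) (x : X) : 𝟙 m ⊙ₗₘ 𝟙 x = 𝟙 (m ⊙ₗ x) := by simp

lemma LaxVer.hom_comm_of_eq_comp [StrictAction M X] {x y z : X} {p : LaxVer M x y}
    {q : LaxVer M y z} {r : LaxVer M x z} (h : r = p.comp q) (e) :
    q.obj ⊴ₗ p.hom ≫ q.hom = eqToHom e ≫ r.hom := by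
  subst h
  simp only [LaxVer.comp, StrictAction.actionAssocIso_eq, eqToIso.hom]
  exact (Category.id_comp _).symm.trans
    ((congr_arg (· ≫ _) (eqToHom_trans e _).symm).trans (Category.assoc _ _ _))

lemma actionHom_actionHom_of_heq [StrictAction M X] {m m' n n' k k' : M} {α : m ⟶ m'} {β : n ⟶ n'}
    {γ : k ⟶ k'} (hk : k = n ⊗ m) (hk' : k' = n' ⊗ m') (h : HEq γ (β ⊗ₘ α)) {x y : X} (f : x ⟶ y)
    (e e') : (β ⊙ₗₘ (α ⊙ₗₘ f)) ≫ eqToHom e = eqToHom e' ≫ (γ ⊙ₗₘ f) := by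
  subst hk hk'
  obtain rfl := eq_of_heq h
  have e₂ := MonoidalLeftAction.actionAssocIso_hom_naturality β α f
  rw [StrictAction.actionAssocIso_eq, StrictAction.actionAssocIso_eq, eqToIso.hom,
    eqToIso.hom] at e₂
  rw [← cancel_epi (eqToHom (StrictAction.tensor_act _ _ _)), ← reassoc_of% e₂]
  simp

end action

namespace LaxString

variable {M X : Type u} [SmallCategory M] [MonoidalCategory M] [StrictMonoidal M]
  [SmallCategory X] [MonoidalLeftAction M X] {n : ℕ}

section

variable (F : VNerveObj (laxActionDoubleCat M X) n)

/-- The objects in a string in `𝓜 ⋉ X`. -/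
def pt (i : Fin (n + 1)) : X := F.pt i

/-- The vertical morphisms in a string in `𝓜 ⋉ X`. -/
def ver {i j : Fin (n + 1)} (h : i ⟶ j) : LaxVer M (pt F i) (pt F j) := F.ver h

lemma ver_id (i : Fin (n + 1)) : ver F (𝟙 i) = LaxVer.id M (pt F i) := F.ver_id i

lemma ver_comp {i j k : Fin (n + 1)} (h : i ⟶ j) (h' : j ⟶ k) :
    ver F (h ≫ h') = (ver F h).comp (ver F h') := F.ver_comp h h'

lemma obj_comp {i j k : Fin (n + 1)} (h : i ⟶ j) (h' : j ⟶ k) :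
    (ver F (h ≫ h')).obj = (ver F h').obj ⊗ (ver F h).obj :=
  congr_arg LaxVer.obj (ver_comp F h h')

variable {F} {G : VNerveObj (laxActionDoubleCat M X) n} (s : F ⟶ G)

/-- The horizontal morphisms in a string of 2-cells of `𝓜 ⋉ X`. -/
def app (i : Fin (n + 1)) : pt F i ⟶ pt G i := VNerveHom.app s i

/-- The 2-cells in a string of 2-cells of `𝓜 ⋉ X`. -/
def sq {i j : Fin (n + 1)} (h : i ⟶ j) : LaxSq (app s i) (ver F h) (ver G h) (app s j) :=
  VNerveHom.sq s h

lemma sq_comp_heq {i j k : Fin (n + 1)} (h : i ⟶ j) (h' : j ⟶ k) :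
    HEq (sq s (h ≫ h')).hom ((sq s h').hom ⊗ₘ (sq s h).hom) :=
  LaxSq.hom_heq rfl (ver_comp F h h') (ver_comp G h h') rfl (VNerveHom.sq_comp s h h')

lemma sq_id_heq (i : Fin (n + 1)) : HEq (sq s (𝟙 i)).hom (𝟙 (𝟙_ M)) :=
  LaxSq.hom_heq rfl (ver_id F i) (ver_id G i) rfl (VNerveHom.sq_id s i)

/-- Construction of strings of 2-cells of `𝓜 ⋉ X`. -/
def mkHom (app : ∀ i, pt F i ⟶ pt G i)
    (sq : ∀ {i j : Fin (n + 1)} (h : i ⟶ j), LaxSq (app i) (ver F h) (ver G h) (app j))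
    (sq_id : ∀ i, HEq (sq (𝟙 i)).hom (𝟙 (𝟙_ M)))
    (sq_comp : ∀ {i j k : Fin (n + 1)} (h : i ⟶ j) (h' : j ⟶ k),
      HEq (sq (h ≫ h')).hom ((sq h').hom ⊗ₘ (sq h).hom)) : F ⟶ G where
  app i := app i
  sq h := sq h
  sq_id i := LaxSq.heq_of_hom rfl (ver_id F i) (ver_id G i) rfl (sq_id i)
  sq_comp h h' := LaxSq.heq_of_hom rfl (ver_comp F h h') (ver_comp G h h') rfl (sq_comp h h')

lemma hom_ext {s t : F ⟶ G} (h : ∀ i, app s i = app t i)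
    (h' : ∀ {i j : Fin (n + 1)} (f : i ⟶ j), (sq s f).hom = (sq t f).hom) : s = t :=
  VNerveHom.ext h (fun f ↦ LaxSq.heq_of_hom (h _) rfl rfl (h _) (heq_of_eq (h' f)))

end

end LaxString

namespace StrictString

variable {M X : Type u} [SmallCategory M] [MonoidalCategory M] [StrictMonoidal M]
  [SmallCategory X] [MonoidalLeftAction M X] [StrictAction M X] {n : ℕ}

section

variable (F : VNerveObj (strictActionDoubleCat M X) n)

/-- The objects in a string in `𝓜 × X`. -/
def pt (i : Fin (n + 1)) : X := F.pt i

/-- The vertical morphisms in a string in `𝓜 × X`. -/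
def ver {i j : Fin (n + 1)} (h : i ⟶ j) : StrictVer M (pt F i) (pt F j) := F.ver h

lemma ver_id (i : Fin (n + 1)) : ver F (𝟙 i) = StrictVer.id M (pt F i) := F.ver_id i

lemma ver_comp {i j k : Fin (n + 1)} (h : i ⟶ j) (h' : j ⟶ k) :
    ver F (h ≫ h') = (ver F h).comp (ver F h') := F.ver_comp h h'

lemma obj_comp {i j k : Fin (n + 1)} (h : i ⟶ j) (h' : j ⟶ k) :
    (ver F (h ≫ h')).obj = (ver F h').obj ⊗ (ver F h).obj :=
  congr_arg StrictVer.obj (ver_comp F h h')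

/-- Construction of strings in `𝓜 × X`. -/
def mk (pt : Fin (n + 1) → X) (ver : ∀ {i j : Fin (n + 1)} (h : i ⟶ j), StrictVer M (pt i) (pt j))
    (ver_id : ∀ i, (ver (𝟙 i)).obj = 𝟙_ M)
    (ver_comp : ∀ {i j k : Fin (n + 1)} (h : i ⟶ j) (h' : j ⟶ k),
      (ver (h ≫ h')).obj = (ver h').obj ⊗ (ver h).obj) :
    VNerveObj (strictActionDoubleCat M X) n :=
  let chain : Fin (n + 1) ⥤ (strictActionDoubleCat M X).VCat :=
    { obj := fun i ↦ show (strictActionDoubleCat M X).Obj from pt i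
      map := fun h ↦ ver h
      map_id := fun i ↦ StrictVer.ext_obj (ver_id i)
      map_comp := fun h h' ↦ StrictVer.ext_obj (ver_comp h h') }
  ⟨chain⟩

variable {F} {G : VNerveObj (strictActionDoubleCat M X) n} (s : F ⟶ G)

/-- The horizontal morphisms in a string of 2-cells of `𝓜 × X`. -/
def app (i : Fin (n + 1)) : pt F i ⟶ pt G i := VNerveHom.app s i

/-- The 2-cells in a string of 2-cells of `𝓜 × X`. -/
def sq {i j : Fin (n + 1)} (h : i ⟶ j) : StrictSq (app s i) (ver F h) (ver G h) (app s j) :=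
  VNerveHom.sq s h

lemma sq_comp_heq {i j k : Fin (n + 1)} (h : i ⟶ j) (h' : j ⟶ k) :
    HEq (sq s (h ≫ h')).hom ((sq s h').hom ⊗ₘ (sq s h).hom) :=
  StrictSq.hom_heq rfl (ver_comp F h h') (ver_comp G h h') rfl (VNerveHom.sq_comp s h h')

lemma sq_id_heq (i : Fin (n + 1)) : HEq (sq s (𝟙 i)).hom (𝟙 (𝟙_ M)) :=
  StrictSq.hom_heq rfl (ver_id F i) (ver_id G i) rfl (VNerveHom.sq_id s i)

/-- Construction of strings of 2-cells of `𝓜 × X`. -/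
def mkHom (app : ∀ i, pt F i ⟶ pt G i)
    (sq : ∀ {i j : Fin (n + 1)} (h : i ⟶ j), StrictSq (app i) (ver F h) (ver G h) (app j))
    (sq_id : ∀ i, HEq (sq (𝟙 i)).hom (𝟙 (𝟙_ M)))
    (sq_comp : ∀ {i j k : Fin (n + 1)} (h : i ⟶ j) (h' : j ⟶ k),
      HEq (sq (h ≫ h')).hom ((sq h').hom ⊗ₘ (sq h).hom)) : F ⟶ G where
  app i := app i
  sq h := sq h
  sq_id i := StrictSq.heq_of_hom rfl (ver_id F i) (ver_id G i) rfl (sq_id i)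
  sq_comp h h' := StrictSq.heq_of_hom rfl (ver_comp F h h') (ver_comp G h h') rfl (sq_comp h h')

lemma hom_ext {s t : F ⟶ G} (h : ∀ i, app s i = app t i)
    (h' : ∀ {i j : Fin (n + 1)} (f : i ⟶ j), (sq s f).hom = (sq t f).hom) : s = t :=
  VNerveHom.ext h (fun f ↦ StrictSq.heq_of_hom (h _) rfl rfl (h _) (heq_of_eq (h' f)))

end

end StrictString

/-! ### The comparison of `𝓜 × X` and `𝓜 ⋉ X` -/

namespace LaxString

variable {M X : Type u} [SmallCategory M] [MonoidalCategory M] [StrictMonoidal M]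
  [SmallCategory X] [MonoidalLeftAction M X] [StrictAction M X] {n : ℕ}
  (F : VNerveObj (laxActionDoubleCat M X) n)

/-- The vertical morphisms of the rectification of a string in `𝓜 ⋉ X`. -/
def rver {i j : Fin (n + 1)} (h : i ⟶ j) :
    StrictVer M ((ver F (from0 i)).obj ⊙ₗ pt F 0) ((ver F (from0 j)).obj ⊙ₗ pt F 0) :=
  ⟨(ver F h).obj, by rw [← StrictAction.tensor_act, ← obj_comp F (from0 i) h]; rfl⟩

/-- The rectification of a string in `𝓜 ⋉ X`: its objects are the translates of the first one. -/
def robj : VNerveObj (strictActionDoubleCat M X) n :=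
  StrictString.mk _ (fun h ↦ rver F h) (fun i ↦ congr_arg LaxVer.obj (ver_id F i))
    (fun h h' ↦ obj_comp F h h')

lemma rver_comm {i j : Fin (n + 1)} (h : i ⟶ j) :
    (ver F h).obj ⊴ₗ (ver F (from0 i)).hom ≫ (ver F h).hom =
      eqToHom (rver F h).eq ≫ (ver F (from0 j)).hom :=
  LaxVer.hom_comm_of_eq_comp (ver_comp F (from0 i) h) _

variable {F} {G : VNerveObj (laxActionDoubleCat M X) n} (s : F ⟶ G)

/-- The 2-cells of the rectification of a string of 2-cells. -/
def rsq {i j : Fin (n + 1)} (h : i ⟶ j) :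
    StrictSq ((sq s (from0 i)).hom ⊙ₗₘ app s 0) (rver F h) (rver G h)
      ((sq s (from0 j)).hom ⊙ₗₘ app s 0) where
  hom := (sq s h).hom
  comm := actionHom_actionHom_of_heq (obj_comp F (from0 i) h) (obj_comp G (from0 i) h)
    (sq_comp_heq s (from0 i) h) (app s 0) _ _

variable (M X n) in
/-- The rectification of strings in `𝓜 ⋉ X`. -/
def rectify : VNerveObj (laxActionDoubleCat M X) n ⥤ VNerveObj (strictActionDoubleCat M X) n where
  obj F := robj F
  map s := StrictString.mkHom (fun i ↦ (sq s (from0 i)).hom ⊙ₗₘ app s 0) (fun h ↦ rsq s h)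
    (fun i ↦ sq_id_heq s i) (fun h h' ↦ sq_comp_heq s h h')
  map_id F := StrictString.hom_ext
    (fun i ↦ actionHom_id_id (M := M) (X := X) _ _) (fun h ↦ rfl)
  map_comp s t := StrictString.hom_ext
    (fun i ↦ MonoidalLeftAction.actionHom_comp (C := M) (D := X) _ _ _ _) (fun h ↦ rfl)

variable (M X n) in
/-- The comparison of a string in `𝓜 ⋉ X` with its rectification. -/
def rectifyCompare : rectify M X n ⋙ (strictToLax M X).vNerveFunctor n ⟶ 𝟭 _ where
  app F := mkHom (F := (rectify M X n ⋙ (strictToLax M X).vNerveFunctor n).obj F) (G := F)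
    (fun i ↦ (ver F (from0 i)).hom)
    (fun {i j} h ↦ ⟨𝟙 (ver F h).obj,
      (congr_arg (· ≫ _) (MonoidalLeftAction.id_actionHom _ _)).trans (rver_comm F h)⟩)
    (fun i ↦ by
      have e := congr_arg LaxVer.obj (ver_id F i)
      change HEq (𝟙 (ver F (𝟙 i)).obj) _
      rw [e]; rfl)
    (fun h h' ↦ by
      change HEq (𝟙 (ver F (h ≫ h')).obj) (𝟙 (ver F h').obj ⊗ₘ 𝟙 (ver F h).obj)
      rw [id_tensorHom_id, obj_comp])
  naturality F G s := hom_ext (fun i ↦ (sq s (from0 i)).comm)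
    (fun h ↦ (Category.comp_id (sq s h).hom).trans (Category.id_comp (sq s h).hom).symm)

variable (M X n) in
/-- The comparison of a string in `𝓜 × X` with its rectification. -/
def rectifyCompare' : (strictToLax M X).vNerveFunctor n ⋙ rectify M X n ⟶ 𝟭 _ where
  app F := StrictString.mkHom
    (F := ((strictToLax M X).vNerveFunctor n ⋙ rectify M X n).obj F) (G := F)
    (fun i ↦ eqToHom (StrictString.ver F (from0 i)).eq)
    (fun {i j} h ↦ ⟨𝟙 (StrictString.ver F h).obj,
      (congr_arg (· ≫ _) (MonoidalLeftAction.id_actionHom _ _)).trans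
        (StrictVer.eqToHom_comm _ _ _ _ _)⟩)
    (fun i ↦ by
      have e := congr_arg StrictVer.obj (StrictString.ver_id F i)
      change HEq (𝟙 (StrictString.ver F (𝟙 i)).obj) _
      rw [e]; rfl)
    (fun h h' ↦ by
      change HEq (𝟙 (StrictString.ver F (h ≫ h')).obj)
        (𝟙 (StrictString.ver F h').obj ⊗ₘ 𝟙 (StrictString.ver F h).obj)
      rw [id_tensorHom_id, StrictString.obj_comp])
  naturality F G s := StrictString.hom_ext (fun i ↦ (StrictString.sq s (from0 i)).comm)
    (fun h ↦ (Category.comp_id (StrictString.sq s h).hom).trans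
      (Category.id_comp (StrictString.sq s h).hom).symm)

variable (M X) in
/-- Up to natural transformations, rectification is inverse to `Φ` on strings of each vertical
length. -/
lemma wEq_strictToLax : SSet.WEq (strictToLax M X).diagonalMap :=
  DoubleFunctor.wEq_diagonalMap _ fun n ↦ SSet.wEq_nerveMap_of_natTrans (rectify M X n)
    (.inl ⟨rectifyCompare' M X n⟩) (.inl ⟨rectifyCompare M X n⟩)

end LaxString

/-! ### Strings of 2-cells in a strict 2-category -/

namespace IdSq

variable {B : Type u} [Bicategory.{w, v} B]

/-- The underlying 2-cell of a square with identity horizontal sides. -/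
def cell {a c : B} {p q : a ⟶ c} : {f : a = a} → {g : c = c} → IdSq f p q g → (p ⟶ q)
  | _, _, .mk η => η

lemma mk_cell {a c : B} {p q : a ⟶ c} (α : IdSq rfl p q rfl) : IdSq.mk α.cell = α := by
  cases α; rfl

end IdSq

/-- Objects of the category of strings of `l` horizontally composable 2-cells of a strict
2-category: a string of identity horizontal morphisms is an object. -/
structure CellString (B : Type u) (l : ℕ) : Type u where
  pt : B

namespace CellString

open Bicategory

section

variable {B : Type u} [Bicategory.{u, u} B] [Bicategory.Strict B] {l : ℕ}

variable (l) in
/-- The string of identity horizontal morphisms of an object. -/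
def const (b : B) : VNerveObj (strictBicategoryDoubleCat B).transpose l :=
  ⟨(Functor.const _).obj (show (strictBicategoryDoubleCat B).Obj from ⟨b⟩)⟩

instance : Category.{u} (CellString B l) where
  Hom x y := const l x.pt ⟶ const l y.pt
  id x := 𝟙 (const l x.pt)
  comp s t := CategoryStruct.comp (obj := VNerveObj (strictBicategoryDoubleCat B).transpose l) s t
  id_comp s := Category.id_comp (obj := VNerveObj (strictBicategoryDoubleCat B).transpose l) s
  comp_id s := Category.comp_id (obj := VNerveObj (strictBicategoryDoubleCat B).transpose l) s
  assoc s t r := Category.assoc (obj := VNerveObj (strictBicategoryDoubleCat B).transpose l) s t r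

variable (B l) in
/-- The inclusion of the strings of 2-cells between constant strings. -/
def toVNerve : CellString B l ⥤ VNerveObj (strictBicategoryDoubleCat B).transpose l where
  obj x := const l x.pt
  map s := s

instance : (toVNerve B l).Faithful where map_injective h := h
instance : (toVNerve B l).Full where map_surjective s := ⟨s, rfl⟩

lemma eq_const (F : VNerveObj (strictBicategoryDoubleCat B).transpose l) :
    ∃ b, const l b = F := by
  obtain ⟨F⟩ := F
  let F' : Fin (l + 1) ⥤ Discrete B := F
  refine ⟨(F'.obj 0).as, ?_⟩
  have : (Functor.const _).obj (F'.obj 0) = F' := by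
    refine CategoryTheory.Functor.hext (fun i ↦ ?_) fun i j h ↦ ?_
    · exact Discrete.ext (Discrete.eq_of_hom (F'.map (from0 i)))
    · have e (k) : F'.obj 0 = F'.obj k := Discrete.ext (Discrete.eq_of_hom (F'.map (from0 k)))
      have key {a b c : Discrete B} (h₁ : a = b) (h₂ : a = c) (f : b ⟶ c) : HEq (𝟙 a) f := by
        subst h₁ h₂
        exact heq_of_eq (Subsingleton.elim _ _)
      exact key (e i) (e j) _
  exact congr_arg VNerveObj.mk this

instance : (toVNerve B l).EssSurj where
  mem_essImage F := by
    obtain ⟨b, hb⟩ := eq_const F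
    exact ⟨⟨b⟩, ⟨eqToIso hb⟩⟩

instance : (toVNerve B l).IsEquivalence where

variable {x y z : CellString B l}

/-- The 1-cells in a string of 2-cells. -/
def app (s : x ⟶ y) (i : Fin (l + 1)) : x.pt ⟶ y.pt := VNerveHom.app s i

/-- The 2-cells in a string of 2-cells, and their composites. -/
def cell (s : x ⟶ y) {i j : Fin (l + 1)} (h : i ⟶ j) : app s i ⟶ app s j :=
  IdSq.cell (B := B) (VNerveHom.sq s h)

/-- Construction of strings of 2-cells. -/
def mkHom (app : Fin (l + 1) → (x.pt ⟶ y.pt)) (cell : ∀ {i j : Fin (l + 1)} (h : i ⟶ j),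
    app i ⟶ app j) (cell_id : ∀ i, cell (𝟙 i) = 𝟙 _)
    (cell_comp : ∀ {i j k : Fin (l + 1)} (h : i ⟶ j) (h' : j ⟶ k),
      cell (h ≫ h') = cell h ≫ cell h') : x ⟶ y :=
  { app i := app i
    sq h := IdSq.mk (cell h)
    sq_id i := heq_of_eq (congr_arg IdSq.mk (cell_id i))
    sq_comp h h' := heq_of_eq (congr_arg IdSq.mk (cell_comp h h')) : VNerveHom _ _}

lemma hom_ext {s t : x ⟶ y} (h : ∀ i, app s i = app t i)
    (h' : ∀ {i j : Fin (l + 1)} (f : i ⟶ j), HEq (cell s f) (cell t f)) : s = t := by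
  refine VNerveHom.ext h fun f ↦ ?_
  exact ((heq_of_eq (IdSq.mk_cell (B := B) _).symm).trans
    (IdSq.heq_of_eq (B := B) (h _) (h _) (h' f))).trans (heq_of_eq (IdSq.mk_cell (B := B) _))

end

end CellString

/-! ### The comparison of `Q(M, X)` and `𝓜 ⋉ X` -/

/-- The morphism from `i` to the last element. -/
abbrev toLast {n : ℕ} (i : Fin (n + 1)) : i ⟶ Fin.last n := homOfLE (Fin.le_last i)

lemma LaxVer.ext_heq {M : Type u} [Category.{v} M] [MonoidalCategory M] {X : Type w}
    [Category.{wt} X] [MonoidalLeftAction M X] {x y : X} {p q : LaxVer M x y}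
    (h : p.obj = q.obj) (h' : HEq p.hom q.hom) : p = q := by
  obtain ⟨m, φ⟩ := p
  obtain ⟨n, ψ⟩ := q
  obtain rfl : m = n := h
  obtain rfl := eq_of_heq h'
  rfl

lemma ActionQ.Cell.heq_of_hom {M : Type u} [Category.{v} M] [MonoidalCategory M] {X : Type w}
    [Category.{wt} X] [MonoidalLeftAction M X] {x y : X} {p q p' q' : LaxVer M x y}
    {α : p ⟶ q} {β : p' ⟶ q'} (hp : p = p') (hq : q = q')
    (h : HEq (ActionQ.Cell.hom α) (ActionQ.Cell.hom β)) : HEq α β := by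
  subst hp hq
  exact heq_of_eq (ActionQ.Cell.ext_hom (eq_of_heq h))

/-- Strings of horizontally composable 2-cells of `𝓜 ⋉ X`. -/
abbrev LaxRow (M X : Type u) [SmallCategory M] [MonoidalCategory M] [StrictMonoidal M]
    [SmallCategory X] [MonoidalLeftAction M X] (l : ℕ) :=
  VNerveObj (laxActionDoubleCat M X).transpose l

namespace LaxRow

variable {M X : Type u} [SmallCategory M] [MonoidalCategory M] [StrictMonoidal M]
  [SmallCategory X] [MonoidalLeftAction M X] {l : ℕ}

section

variable (F : LaxRow M X l)

/-- The objects in a string of horizontal morphisms. -/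
def pt (i : Fin (l + 1)) : X := F.chain.obj i

/-- The morphisms in a string of horizontal morphisms. -/
def hor {i j : Fin (l + 1)} (h : i ⟶ j) : pt F i ⟶ pt F j := F.chain.map h

lemma hor_id (i : Fin (l + 1)) : hor F (𝟙 i) = 𝟙 (pt F i) := F.chain.map_id i

lemma hor_comp {i j k : Fin (l + 1)} (h : i ⟶ j) (h' : j ⟶ k) :
    hor F (h ≫ h') = hor F h ≫ hor F h' := F.chain.map_comp h h'

variable {F} {G H : LaxRow M X l} (s : F ⟶ G) (t : G ⟶ H)

/-- The vertical morphisms in a string of 2-cells. -/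
def ver (i : Fin (l + 1)) : LaxVer M (pt F i) (pt G i) := VNerveHom.app s i

/-- The 2-cells in a string of 2-cells. -/
def sq {i j : Fin (l + 1)} (h : i ⟶ j) : LaxSq (hor F h) (ver s i) (ver s j) (hor G h) :=
  VNerveHom.sq s h

lemma sq_id (i : Fin (l + 1)) : (sq s (𝟙 i)).hom = 𝟙 (ver s i).obj :=
  eq_of_heq (LaxSq.hom_heq (hor_id F i) rfl rfl (hor_id G i) (VNerveHom.sq_id s i))

lemma sq_comp {i j k : Fin (l + 1)} (h : i ⟶ j) (h' : j ⟶ k) :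
    (sq s (h ≫ h')).hom = (sq s h).hom ≫ (sq s h').hom :=
  eq_of_heq (LaxSq.hom_heq (hor_comp F h h') rfl rfl (hor_comp G h h') (VNerveHom.sq_comp s h h'))

/-- Construction of strings of 2-cells. -/
def mkHom (ver : ∀ i, LaxVer M (pt F i) (pt G i))
    (sq : ∀ {i j : Fin (l + 1)} (h : i ⟶ j), LaxSq (hor F h) (ver i) (ver j) (hor G h))
    (sq_id : ∀ i, (sq (𝟙 i)).hom = 𝟙 (ver i).obj)
    (sq_comp : ∀ {i j k : Fin (l + 1)} (h : i ⟶ j) (h' : j ⟶ k),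
      (sq (h ≫ h')).hom = (sq h).hom ≫ (sq h').hom) : F ⟶ G :=
  { app i := ver i
    sq h := sq h
    sq_id i := LaxSq.heq_of_hom (hor_id F i) rfl rfl (hor_id G i) (heq_of_eq (sq_id i))
    sq_comp h h' := LaxSq.heq_of_hom (hor_comp F h h') rfl rfl (hor_comp G h h')
      (heq_of_eq (sq_comp h h')) : VNerveHom _ _ }

lemma hom_ext {s t : F ⟶ G} (h : ∀ i, ver s i = ver t i)
    (h' : ∀ {i j : Fin (l + 1)} (f : i ⟶ j), HEq (sq s f).hom (sq t f).hom) : s = t :=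
  VNerveHom.ext h (fun f ↦ LaxSq.heq_of_hom rfl (h _) (h _) rfl (h' f))

/-- The 1-cells of the collapse of a string of 2-cells to its last column. -/
def lastVer (i : Fin (l + 1)) : LaxVer M (pt F (Fin.last l)) (pt G (Fin.last l)) :=
  ⟨(ver s i).obj, (sq s (toLast i)).hom ⊵ₗ _ ≫ (ver s (Fin.last l)).hom⟩

/-- The 2-cells of the collapse of a string of 2-cells to its last column. -/
def lastCell {i j : Fin (l + 1)} (h : i ⟶ j) : lastVer s i ⟶ lastVer s j :=
  (⟨(sq s h).hom, by
    have e := sq_comp s h (toLast j)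
    change (sq s (toLast i)).hom = _ at e
    simp [lastVer, e]⟩ : ActionQ.Cell _ _)

lemma lastVer_comp (i : Fin (l + 1)) :
    lastVer (s ≫ t) i = (lastVer s i).comp (lastVer t i) := by
  have e {m m' n n' : M} {x y z : X} (α : m ⟶ m') (β : n ⟶ n') (φ : m' ⊙ₗ x ⟶ y)
      (ψ : n' ⊙ₗ y ⟶ z) : (β ⊗ₘ α) ⊵ₗ x ≫ (αₗ n' m' x).hom ≫ n' ⊴ₗ φ ≫ ψ =
        (αₗ n m x).hom ≫ n ⊴ₗ (α ⊵ₗ x ≫ φ) ≫ β ⊵ₗ y ≫ ψ := by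
    have h := MonoidalLeftAction.actionAssocIso_hom_naturality β α (𝟙 x)
    rw [MonoidalLeftAction.actionHom_id, MonoidalLeftAction.actionHom_id] at h
    have h' := (MonoidalLeftAction.actionHom_def β φ).symm.trans
      (MonoidalLeftAction.actionHom_def' β φ)
    rw [reassoc_of% h, MonoidalLeftAction.actionHom_def', Category.assoc, reassoc_of% h']
    simp only [MonoidalLeftAction.actionHomRight_comp, Category.assoc]
  exact LaxVer.ext_heq rfl (heq_of_eq (e (sq s (toLast i)).hom (sq t (toLast i)).hom
    (ver s (Fin.last l)).hom (ver t (Fin.last l)).hom))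

lemma tensorHom_eq_comp {a b c d : M} (α : a ⟶ b) (β : c ⟶ d) :
    β ⊗ₘ α = (𝟙 c ⊗ₘ α) ≫ (β ⊗ₘ 𝟙 b) := by
  rw [tensorHom_comp_tensorHom, Category.id_comp, Category.comp_id]

lemma lastVer_id (i : Fin (l + 1)) : lastVer (𝟙 F) i = LaxVer.id M (pt F (Fin.last l)) :=
  LaxVer.ext_heq rfl (heq_of_eq ((congr_arg (· ≫ _)
    (MonoidalLeftAction.id_actionHomLeft (𝟙_ M) (pt F (Fin.last l)))).trans (Category.id_comp _)))

variable (M X l) in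
/-- The collapse of strings of 2-cells of `𝓜 ⋉ X` to their last column. -/
def collapse : LaxRow M X l ⥤ CellString (ActionQ M X) l where
  obj F := ⟨⟨pt F (Fin.last l)⟩⟩
  map s := CellString.mkHom (lastVer s) (fun h ↦ lastCell s h)
    (fun i ↦ ActionQ.Cell.ext_hom (sq_id s i)) (fun h h' ↦ ActionQ.Cell.ext_hom (sq_comp s h h'))
  map_id F := CellString.hom_ext (fun i ↦ lastVer_id (F := F) i)
    (fun f ↦ ActionQ.Cell.heq_of_hom (lastVer_id (F := F) _) (lastVer_id (F := F) _) HEq.rfl)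
  map_comp s t := CellString.hom_ext (fun i ↦ lastVer_comp s t i)
    (fun {i j} f ↦ ActionQ.Cell.heq_of_hom (lastVer_comp s t i) (lastVer_comp s t j)
      (heq_of_eq (tensorHom_eq_comp (sq s f).hom (sq t f).hom)))

variable (M X l) in
/-- The inclusion of strings of 2-cells of `Q(M, X)` into strings of 2-cells of `𝓜 ⋉ X`. -/
def inclusion : CellString (ActionQ M X) l ⥤ LaxRow M X l :=
  CellString.toVNerve (ActionQ M X) l ⋙ (qInclusion M X).transpose.vNerveFunctor l

lemma comp_unit {x y z : X} (p : LaxVer M x y) (g : y ⟶ z) :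
    p.comp ⟨𝟙_ M, (λₗ y).hom ≫ g⟩ = ⟨p.obj, p.hom ≫ g⟩ := by
  refine LaxVer.ext_of_eq (StrictMonoidal.unit_tensor p.obj) ?_
  have h := MonoidalLeftAction.leftUnitor_actionHom p.obj x
  rw [StrictMonoidal.leftUnitor_eq, eqToIso.hom, LaxVer.eqToHom_actionHomLeft] at h
  simp [LaxVer.comp, h]

lemma unit_comp {x y z : X} (f : x ⟶ y) (q : LaxVer M y z) :
    LaxVer.comp ⟨𝟙_ M, (λₗ x).hom ≫ f⟩ q = ⟨q.obj, q.obj ⊴ₗ f ≫ q.hom⟩ := by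
  refine LaxVer.ext_of_eq (StrictMonoidal.tensor_unit q.obj) ?_
  have h := MonoidalLeftAction.rightUnitor_actionHom q.obj x
  rw [StrictMonoidal.rightUnitor_eq, eqToIso.hom, LaxVer.eqToHom_actionHomLeft] at h
  simp [LaxVer.comp, h]

lemma unit_comm {x y z : X} {f : x ⟶ y} {g : y ⟶ z} {k : x ⟶ z} (h : k = f ≫ g) :
    (𝟙 (𝟙_ M) ⊙ₗₘ f) ≫ (λₗ y).hom ≫ g = ((λₗ x).hom ≫ k) ≫ 𝟙 z := by
  subst h; simp

lemma comp_unit_eq_unit_comp {x x' y y' : X} {f : x ⟶ x'} {g : y ⟶ y'} {p : LaxVer M x y}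
    {q : LaxVer M x' y'} (α : LaxSq f p q g) :
    p.comp ⟨𝟙_ M, (λₗ y).hom ≫ g⟩ =
      LaxVer.comp ⟨𝟙_ M, (λₗ x).hom ≫ f⟩ ⟨p.obj, α.hom ⊵ₗ _ ≫ q.hom⟩ := by
  rw [comp_unit, unit_comp, ← α.comm, MonoidalLeftAction.actionHom_def', Category.assoc]

variable (M X l) in
/-- A string of 2-cells of `𝓜 ⋉ X` maps to the collapsed string. -/
def toCollapse : 𝟭 (LaxRow M X l) ⟶ collapse M X l ⋙ inclusion M X l where
  app F := mkHom (F := F) (G := (inclusion M X l).obj ((collapse M X l).obj F))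
    (fun i ↦ ⟨𝟙_ M, (λₗ (pt F i)).hom ≫ hor F (toLast i)⟩)
    (fun {i j} h ↦ ⟨𝟙 _, unit_comm (hor_comp F h (toLast j))⟩) (fun i ↦ rfl)
    (fun h h' ↦ (Category.comp_id _).symm)
  naturality F G s :=
    hom_ext (fun i ↦ comp_unit_eq_unit_comp (sq s (toLast i)))
      (fun {i j} h ↦ (id_unit_tensorHom_heq (sq s h).hom).trans
        (tensorHom_id_unit_heq (sq s h).hom).symm)

lemma idSqToLaxSq_hom {a c : ActionQ M X} {p q : a ⟶ c} (α : IdSq rfl p q rfl) :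
    (ActionQ.idSqToLaxSq α).hom = ActionQ.Cell.hom α.cell := by
  cases α; rfl

variable (M X l) in
/-- The collapse of a string of 2-cells of `Q(M, X)` is the string itself. -/
def collapseInclusion : inclusion M X l ⋙ collapse M X l ⟶ 𝟭 _ where
  app x := 𝟙 x
  naturality x y s := by
    refine (Category.comp_id _).trans (Eq.trans ?_ (Category.id_comp _).symm)
    have e (i) : lastVer ((inclusion M X l).map s) i = CellString.app s i :=
      LaxVer.ext_heq rfl (heq_of_eq ((congr_arg (fun a ↦ a ⊵ₗ _ ≫ _)
        (idSqToLaxSq_hom (M := M) (X := X) _)).trans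
          (ActionQ.Cell.comm (CellString.cell s (toLast i)))))
    exact CellString.hom_ext e fun h ↦ ActionQ.Cell.heq_of_hom (e _) (e _)
      (heq_of_eq (idSqToLaxSq_hom (M := M) (X := X) _))

variable (M X) in
/-- Up to natural transformations, the collapse to the last column is inverse to the inclusion on
strings of each horizontal length. -/
lemma wEq_qInclusion : SSet.WEq (qInclusion M X).diagonalMap := by
  refine DoubleFunctor.wEq_diagonalMap_of_transpose _ (DoubleFunctor.wEq_diagonalMap _ fun l ↦ ?_)
  have h := SSet.wEq_nerveMap_of_natTrans (F := inclusion M X l) (collapse M X l)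
    (.inl ⟨collapseInclusion M X l⟩) (.inr ⟨toCollapse M X l⟩)
  exact SSet.WEq.of_comp_left (SSet.wEq_nerveMap_of_isEquivalence (CellString.toVNerve _ l)) h

end

end LaxRow

/-! ### The bar construction as the realisation of a bisimplicial set -/

namespace Geometric

open Simplicial Topology

/-- A retraction of Euclidean space onto the simplex. -/
noncomputable def simpRetraction (n : ℕ) (x : Fin (n + 1) → ℝ) : Simp n :=
  ⟨fun i ↦ (max (x i) 0 + max (1 - ∑ j, max (x j) 0) 0 / (n + 1)) / max 1 (∑ j, max (x j) 0),
    fun i ↦ by positivity, by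
      rw [← Finset.sum_div, Finset.sum_add_distrib, Finset.sum_const, Finset.card_univ,
        Fintype.card_fin, nsmul_eq_mul, div_eq_one_iff_eq (by positivity)]
      push_cast
      rw [mul_div_cancel₀ _ (by positivity)]
      rcases le_total (∑ j, max (x j) 0) 1 with h | h
      · rw [max_eq_left (by linarith), max_eq_left h]; ring
      · rw [max_eq_right (by linarith), max_eq_right h]; ring⟩

lemma continuous_simpRetraction (n : ℕ) : Continuous (simpRetraction n) := by
  refine Continuous.subtype_mk (continuous_pi fun i ↦ Continuous.div ?_ ?_ fun x ↦ ?_) _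
  · fun_prop
  · fun_prop
  · positivity

lemma simpRetraction_coe (n : ℕ) (t : Simp n) : simpRetraction n t = t := by
  ext i
  have h (i) : max (t i) 0 = t i := max_eq_left (by simp)
  have hs : ∑ j, t j = 1 := stdSimplex.sum_eq_one t
  change (max (t i) 0 + max (1 - ∑ j, max (t j) 0) 0 / (n + 1)) / max 1 (∑ j, max (t j) 0) = t i
  simp only [h, hs]
  simp

instance deltaGeneratedSpace_simp (n : ℕ) : DeltaGeneratedSpace (Simp n) :=
  (IsQuotientMap.of_inverse (g := simpRetraction n) (f := Subtype.val) continuous_subtype_val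
    (continuous_simpRetraction n) (simpRetraction_coe n)).isGeneratedBy

section naturality

variable {X X' Y Y' : SSet.{u}}

lemma prodMap_tensorHom (f : X ⟶ X') (g : Y ⟶ Y') (z : SSet.toTop.obj (X ⊗ Y)) :
    prodMap (SSet.toTop.map (f ⊗ₘ g) z) =
      (SSet.toTop.map f (prodMap z).1, SSet.toTop.map g (prodMap z).2) := by
  obtain ⟨n, ⟨x, y⟩, t, rfl⟩ := exists_pt z
  have e := prodMap_pt x y t
  refine (congr_arg prodMap (toTop_map_pt (f ⊗ₘ g) _ t)).trans ((prodMap_pt _ _ _).trans ?_)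
  exact Prod.ext ((toTop_map_pt f x t).symm.trans (congr_arg (fun z ↦ SSet.toTop.map f z.1) e.symm))
    ((toTop_map_pt g y t).symm.trans (congr_arg (fun z ↦ SSet.toTop.map g z.2) e.symm))

lemma toTop_map_prodInv (f : X ⟶ X') (g : Y ⟶ Y') (a : SSet.toTop.obj X) (b : SSet.toTop.obj Y) :
    SSet.toTop.map (f ⊗ₘ g) (prodInv a b) = prodInv (SSet.toTop.map f a) (SSet.toTop.map g b) := by
  apply bijective_prodMap.1
  rw [prodMap_tensorHom, prodMap_prodInv, prodMap_prodInv]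

end naturality

section topBar

variable (V : SimplexCategoryᵒᵖ ⥤ SSet.{u})

/-- The fundamental simplex. -/
abbrev fund (n : ℕ) : (Δ[n] : SSet.{u}).obj (op ⦋n⦌) := SSet.stdSimplex.objEquiv.symm (𝟙 ⦋n⦌)

/-- The canonical map `|V_n| × Δ^n → |diag V|`, in curried form. -/
noncomputable def levelCell (n : ℕ) :
    C(SSet.toTop.obj (V.obj (op ⦋n⦌)), C(Simp n, SSet.toTop.obj (bisimplicialDiagonal.obj V))) :=
  ⟨fun z ↦ ((SSet.toTop.map (SSet.diagCell V n)).hom.comp (prodInv z)).comp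
      ⟨pt (fund n), continuous_pt _⟩,
    (ContinuousMap.continuous_precomp _).comp
      ((ContinuousMap.continuous_postcomp _).comp prodInv.continuous)⟩

lemma levelCell_apply (n : ℕ) (z : SSet.toTop.obj (V.obj (op ⦋n⦌))) (t : Simp n) :
    levelCell V n z t = SSet.toTop.map (SSet.diagCell V n) (prodInv z (pt (fund n) t)) := rfl

lemma pt_fund_map {n k : ℕ} (θ : ⦋k⦌ ⟶ ⦋n⦌) (t : Simp k) :
    pt (fund.{u} n) (stdSimplex.map θ.toOrderHom t) =
      SSet.toTop.map (SSet.stdSimplex.map θ) (pt (fund.{u} k) t) := by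
  have e : (Δ[n] : SSet.{u}).map θ.op (fund n) =
    (SSet.stdSimplex.map θ).app (op ⦋k⦌) (fund k) := rfl
  rw [toTop_map_pt, ← e]
  exact (pt_map θ.op (fund.{u} n) t).symm

lemma diagCell_naturality {n k : ℕ} (θ : ⦋k⦌ ⟶ ⦋n⦌) :
    (𝟙 (V.obj (op ⦋n⦌)) ⊗ₘ SSet.stdSimplex.map θ) ≫ SSet.diagCell V n =
      (V.map θ.op ⊗ₘ 𝟙 (SSet.stdSimplex.obj ⦋k⦌)) ≫ SSet.diagCell V k := by
  ext m ⟨x, a⟩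
  change (V.map (SSet.stdSimplex.objEquiv a ≫ θ).op).app m x =
    (V.map (SSet.stdSimplex.objEquiv a).op).app m ((V.map θ.op).app m x)
  rw [op_comp, V.map_comp]
  rfl

lemma levelCell_map {n k : ℕ} (θ : ⦋k⦌ ⟶ ⦋n⦌) (z : SSet.toTop.obj (V.obj (op ⦋n⦌))) (t : Simp k) :
    levelCell V n z (stdSimplex.map θ.toOrderHom t) =
      levelCell V k (SSet.toTop.map (V.map θ.op) z) t := by
  rw [levelCell_apply, levelCell_apply, pt_fund_map]
  have h₁ := toTop_map_prodInv (𝟙 (V.obj (op ⦋n⦌))) (SSet.stdSimplex.map θ) z (pt (fund k) t)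
  have h₂ := toTop_map_prodInv (V.map θ.op) (𝟙 (SSet.stdSimplex.obj ⦋k⦌)) z (pt (fund k) t)
  rw [SSet.toTop.map_id] at h₁ h₂
  have h := ConcreteCategory.congr_hom (congr_arg SSet.toTop.map (diagCell_naturality V θ))
    (prodInv z (pt (fund k) t))
  rw [SSet.toTop.map_comp, SSet.toTop.map_comp] at h
  exact ((congr_arg (SSet.toTop.map (SSet.diagCell V n)) h₁).symm.trans h).trans
    (congr_arg (SSet.toTop.map (SSet.diagCell V k)) h₂)

lemma levelCell_pt {n : ℕ} (x : (V.obj (op ⦋n⦌)).obj (op ⦋n⦌)) (t : Simp n) :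
    levelCell V n (pt x t) t = pt (X := bisimplicialDiagonal.obj V) (n := op ⦋n⦌) x t := by
  have h := prodInv_prodMap (pt (X := V.obj (op ⦋n⦌) ⊗ Δ[n]) (n := op ⦋n⦌) (x, fund n) t)
  rw [prodMap_pt] at h
  rw [levelCell_apply]
  refine (congr_arg (SSet.toTop.map (SSet.diagCell V n)) h).trans ((toTop_map_pt _ _ _).trans ?_)
  refine congr_arg (fun x ↦ pt (X := bisimplicialDiagonal.obj V) (n := op ⦋n⦌) x t) ?_
  change (V.map (𝟙 ⦋n⦌).op).app _ x = x
  rw [op_id, V.map_id]; rfl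

/-- An identification of the realisations of the levels of a bisimplicial set with the levels of
the bar construction of a monoid acting on a space, in the convenient category: the bijections need
not be homeomorphisms for the product topology, only their inverses are continuous on the maps out
of Euclidean spaces. -/
structure LevelModel (V : SimplexCategoryᵒᵖ ⥤ SSet.{u}) {G Y : Type u} [TopologicalSpace G]
    [TopologicalSpace Y] (one : G) (mul : G → G → G) (act : G → Y → Y) where
  toFun (n : ℕ) : SSet.toTop.obj (V.obj (op ⦋n⦌)) → (Fin n → G) × Y
  invFun (n : ℕ) : (Fin n → G) × Y → SSet.toTop.obj (V.obj (op ⦋n⦌))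
  left_inv (n : ℕ) : Function.LeftInverse (invFun n) (toFun n)
  right_inv (n : ℕ) : Function.RightInverse (invFun n) (toFun n)
  continuous_toFun (n : ℕ) : Continuous (toFun n)
  continuous_invFun (n d : ℕ) (f : C(Fin d → ℝ, (Fin n → G) × Y)) :
    Continuous fun r ↦ invFun n (f r)
  map_toFun {n k : ℕ} (θ : ⦋k⦌ ⟶ ⦋n⦌) (z : SSet.toTop.obj (V.obj (op ⦋n⦌))) :
    (WithGeneratedByTopology.equiv.symm (toFun k (SSet.toTop.map (V.map θ.op) z)) :
      TopBar.Level G Y k) =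
      TopBar.pull one mul act θ.toOrderHom (WithGeneratedByTopology.equiv.symm (toFun n z))

variable {V} {G Y : Type u} [TopologicalSpace G] [TopologicalSpace Y] {one : G} {mul : G → G → G}
  {act : G → Y → Y} (D : LevelModel V one mul act)

/-- The point of the bar construction given by points of a level and of the simplex. -/
def barPt (one : G) (mul : G → G → G) (act : G → Y → Y) {n : ℕ} (e : TopBar.Level G Y n)
    (t : Simp n) : TopBar one mul act := Quot.mk _ ⟨n, e, t⟩

lemma continuous_barPt {n : ℕ} : Continuous (fun p : TopBar.Level G Y n × Simp n ↦
    barPt one mul act p.1 p.2) :=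
  continuous_quot_mk.comp
    (continuous_sigmaMk (σ := fun n : ℕ ↦ TopBar.Level G Y n × stdSimplex ℝ (Fin (n + 1))))

lemma barPt_map {n k : ℕ} (θ : ⦋k⦌ ⟶ ⦋n⦌) (z : SSet.toTop.obj (V.obj (op ⦋n⦌))) (t : Simp k) :
    barPt one mul act
        (WithGeneratedByTopology.equiv.symm (D.toFun k (SSet.toTop.map (V.map θ.op) z))) t =
      barPt one mul act (WithGeneratedByTopology.equiv.symm (D.toFun n z))
        (stdSimplex.map θ.toOrderHom t) :=
  (Quot.sound ⟨θ.toOrderHom, (D.map_toFun θ z).symm, rfl⟩ : Quot.mk (TopBar.Rel one mul act)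
    ⟨n, _, stdSimplex.map θ.toOrderHom t⟩ = Quot.mk _ ⟨k, _, t⟩).symm

/-- The simplices of the bar construction given by the simplices of the diagonal. -/
noncomputable def toTopBarAux (n : SimplexCategoryᵒᵖ) (x : (bisimplicialDiagonal.obj V).obj n) :
    C(Simp n.unop.len, TopBar one mul act) where
  toFun t := barPt one mul act (WithGeneratedByTopology.equiv.symm
    (D.toFun n.unop.len (pt (X := V.obj (op ⦋n.unop.len⦌)) (n := n) x t))) t
  continuous_toFun := continuous_barPt.comp
    (((IsGeneratedBy.equiv_symm_comp_continuous_iff (X := fun k : ℕ ↦ Fin k → ℝ) _).2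
    ((D.continuous_toFun _).comp (continuous_pt _))).prodMk continuous_id)

lemma toTopBarAux_map (n m : SimplexCategoryᵒᵖ) (θ : n ⟶ m)
    (x : (bisimplicialDiagonal.obj V).obj n) (t : Simp m.unop.len) :
    toTopBarAux D m ((bisimplicialDiagonal.obj V).map θ x) t =
      toTopBarAux D n x (stdSimplex.map θ.unop.toOrderHom t) := by
  have e : pt (X := V.obj (op ⦋m.unop.len⦌)) (n := m) ((bisimplicialDiagonal.obj V).map θ x) t =
      SSet.toTop.map (V.map θ) (pt (X := V.obj (op ⦋n.unop.len⦌)) (n := n) x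
        (stdSimplex.map θ.unop.toOrderHom t)) := by
    exact (pt_map θ ((V.map θ).app n x) t).trans (toTop_map_pt _ _ _).symm
  exact (congr_arg (fun z ↦ barPt one mul act (WithGeneratedByTopology.equiv.symm
    (D.toFun m.unop.len z)) t) e).trans (barPt_map D θ.unop _ t)

/-- The map from the realisation of the diagonal to the bar construction. -/
noncomputable def toTopBar : C(SSet.toTop.obj (bisimplicialDiagonal.obj V), TopBar one mul act) :=
  glue (toTopBarAux D) (toTopBarAux_map D)

lemma toTopBar_pt {n : ℕ} (x : (V.obj (op ⦋n⦌)).obj (op ⦋n⦌)) (t : Simp n) :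
    toTopBar D (pt (X := bisimplicialDiagonal.obj V) (n := op ⦋n⦌) x t) =
      barPt one mul act (WithGeneratedByTopology.equiv.symm (D.toFun n (pt x t))) t :=
  (glue_pt (X := bisimplicialDiagonal.obj V) (toTopBarAux D) (toTopBarAux_map D) (n := op ⦋n⦌)
    x t).trans (by exact rfl)

lemma toTopBar_levelCell {n : ℕ} (z : SSet.toTop.obj (V.obj (op ⦋n⦌))) (t : Simp n) :
    toTopBar D (levelCell V n z t) =
      barPt one mul act (WithGeneratedByTopology.equiv.symm (D.toFun n z)) t := by
  obtain ⟨w, hw⟩ := bijective_prodMap.2 (z, pt (fund n) t)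
  have h₁ : prodInv z (pt (fund n) t) = w := by
    have := prodInv_prodMap w
    rwa [hw] at this
  rw [levelCell_apply, h₁]
  obtain ⟨m, ⟨x, a⟩, s, rfl⟩ := exists_pt w
  rw [prodMap_pt] at hw
  obtain ⟨rfl, ha⟩ := Prod.mk.inj hw
  have hs : stdSimplex.map (SSet.stdSimplex.objEquiv a).toOrderHom s = t := by
    have e := congr_arg (simpTop n) ha
    rw [simpTop_pt, simpTop_pt] at e
    exact e.trans (stdSimplex.map_id_apply t)
  subst hs
  induction m using Opposite.rec with | _ m
  induction m using SimplexCategory.rec with | _ m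
  have e := barPt_map (mul := mul) (act := act) (one := one) D (SSet.stdSimplex.objEquiv a)
    (pt x s) s
  rw [toTop_map_pt] at e
  have e₂ : (SSet.diagCell V n).app (op ⦋m⦌) (x, a) =
    (V.map (SSet.stdSimplex.objEquiv a).op).app (op ⦋m⦌) x := rfl
  have e₃ := toTop_map_pt (SSet.diagCell V n) (n := op ⦋m⦌) (x, a) s
  exact (congr_arg (toTopBar D) (e₃.trans (congr_arg
    (fun y ↦ pt (X := bisimplicialDiagonal.obj V) (n := op ⦋m⦌) y s) e₂))).trans
    ((toTopBar_pt D _ s).trans e)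

lemma levelCell_invFun_pull {n k : ℕ} (θ : Fin (k + 1) →o Fin (n + 1)) (e : TopBar.Level G Y n)
    (t : Simp k) :
    levelCell V n (D.invFun n (WithGeneratedByTopology.equiv e)) (stdSimplex.map θ t) =
      levelCell V k (D.invFun k (WithGeneratedByTopology.equiv
        (TopBar.pull one mul act θ e))) t := by
  obtain ⟨z, rfl⟩ := WithGeneratedByTopology.equiv.symm.surjective e
  obtain ⟨z, rfl⟩ := (D.right_inv n).surjective z
  have e₁ := D.map_toFun (SimplexCategory.Hom.mk θ) z
  change _ = TopBar.pull one mul act θ _ at e₁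
  rw [← e₁, Equiv.apply_symm_apply, Equiv.apply_symm_apply, D.left_inv, D.left_inv]
  exact levelCell_map V (SimplexCategory.Hom.mk θ) z t

/-- The map from the bar construction to the realisation of the diagonal. -/
noncomputable def ofTopBar (p : TopBar one mul act) :
    SSet.toTop.obj (bisimplicialDiagonal.obj V) :=
  Quot.lift (fun q ↦ levelCell V q.1 (D.invFun q.1 (WithGeneratedByTopology.equiv q.2.1)) q.2.2)
    (by
      rintro ⟨n, e, s⟩ ⟨k, e', t⟩ ⟨θ, he, hs⟩
      dsimp only at he hs θ ⊢
      rw [← he, hs]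
      exact levelCell_invFun_pull D θ e t) p

lemma ofTopBar_barPt {n : ℕ} (z : SSet.toTop.obj (V.obj (op ⦋n⦌))) (t : Simp n) :
    ofTopBar D (barPt one mul act (WithGeneratedByTopology.equiv.symm (D.toFun n z)) t) =
      levelCell V n z t := by
  change levelCell V n (D.invFun n (D.toFun n z)) t = _
  rw [D.left_inv]

lemma continuous_ofTopBar : Continuous (ofTopBar D) := by
  refine continuous_quot_lift _ (continuous_sigma fun n ↦ ?_)
  let f : C(TopBar.Level G Y n, C(Simp n, SSet.toTop.obj (bisimplicialDiagonal.obj V))) :=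
    ⟨fun e ↦ levelCell V n (D.invFun n (WithGeneratedByTopology.equiv e)),
      (levelCell V n).continuous.comp
        ((WithGeneratedByTopology.continuous_from_iff _).2 fun d f ↦ D.continuous_invFun n d f)⟩
  exact (ContinuousMap.uncurry f).continuous

/-- If the realisations of the levels of a bisimplicial set are the levels of the bar construction
of a monoid acting on a space, in the convenient category, then the realisation of the diagonal is
the bar construction. -/
noncomputable def topBarHomeo :
    TopBar one mul act ≃ₜ SSet.toTop.obj (bisimplicialDiagonal.obj V) where
  toFun := ofTopBar D
  invFun := toTopBar D
  left_inv p := by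
    obtain ⟨⟨n, e, t⟩, rfl⟩ := Quot.exists_rep p
    obtain ⟨z, rfl⟩ := WithGeneratedByTopology.equiv.symm.surjective e
    obtain ⟨z, rfl⟩ := (D.right_inv n).surjective z
    exact (congr_arg (toTopBar D) (ofTopBar_barPt D z t)).trans
      (toTopBar_levelCell D z t)
  right_inv p := by
    obtain ⟨n, x, t, rfl⟩ := exists_pt p
    induction n using Opposite.rec with | _ n
    induction n using SimplexCategory.rec with | _ n
    exact (congr_arg (ofTopBar D) (toTopBar_pt D x t)).trans
      ((ofTopBar_barPt D _ t).trans (levelCell_pt V x t))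
  continuous_toFun := continuous_ofTopBar D
  continuous_invFun := (toTopBar D).continuous

end topBar

end Geometric

namespace Geometric

open Simplicial

section power

variable (A B : SSet.{u})

/-- The simplicial set `A ⊗ (A ⊗ ⋯ (A ⊗ B))`. -/
def power (n : ℕ) : SSet.{u} :=
  Nat.rec B (fun _ P ↦ A ⊗ P) n

/-- The components of a simplex of `A ⊗ (A ⊗ ⋯ (A ⊗ B))`. -/
def powerSimplex (k : SimplexCategoryᵒᵖ) (n : ℕ) :
    (power A B n).obj k → (Fin n → A.obj k) × B.obj k :=
  n.rec (fun x ↦ (Fin.elim0, x)) fun n ih (x : A.obj k × (power A B n).obj k) ↦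
    (Fin.cons x.1 (ih x.2).1, (ih x.2).2)

lemma bijective_powerSimplex (k : SimplexCategoryᵒᵖ) (n : ℕ) :
    Function.Bijective (powerSimplex A B k n) := by
  induction n with
  | zero => exact ⟨fun x y h ↦ congr_arg Prod.snd h,
      fun p ↦ ⟨p.2, Prod.ext (Subsingleton.elim _ _) rfl⟩⟩
  | succ n ih =>
    refine ⟨fun x y h ↦ ?_, fun p ↦ ?_⟩
    · change A.obj k × (power A B n).obj k at x y
      obtain ⟨h₁, h₂⟩ := Prod.mk.inj h
      obtain ⟨h₃, h₄⟩ := Fin.cons_inj.1 h₁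
      exact Prod.ext h₃ (ih.1 (Prod.ext h₄ h₂))
    · obtain ⟨x, hx⟩ := ih.2 (Fin.tail p.1, p.2)
      refine ⟨show A.obj k × (power A B n).obj k from (p.1 0, x), ?_⟩
      change (Fin.cons (p.1 0) (powerSimplex A B k n x).1, (powerSimplex A B k n x).2) = p
      rw [hx]
      exact Prod.ext (Fin.cons_self_tail _) rfl

/-- The comparison of the realisation of a power with the power of realisations. -/
noncomputable def powerMap (n : ℕ) :
    SSet.toTop.obj (power A B n) → (Fin n → SSet.toTop.obj A) × SSet.toTop.obj B :=
  n.rec (fun z ↦ (Fin.elim0, z)) fun n ih z ↦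
    (Fin.cons (prodMap (X := A) (Y := power A B n) z).1
      (ih (prodMap (X := A) (Y := power A B n) z).2).1,
      (ih (prodMap (X := A) (Y := power A B n) z).2).2)

lemma powerMap_succ {n : ℕ} {z : SSet.toTop.obj (power A B (n + 1))} {a : SSet.toTop.obj A}
    {w : SSet.toTop.obj (power A B n)} (h : prodMap (X := A) (Y := power A B n) z = (a, w)) :
    powerMap A B (n + 1) z =
      ((Fin.cons a (powerMap A B n w).1 : Fin (n + 1) → SSet.toTop.obj A), (powerMap A B n w).2) :=
  congr_arg (fun p : SSet.toTop.obj A × SSet.toTop.obj (power A B n) ↦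
    ((Fin.cons p.1 (powerMap A B n p.2).1 : Fin (n + 1) → SSet.toTop.obj A),
    (powerMap A B n p.2).2)) h

/-- The inverse of the comparison of the realisation of a power with the power of realisations. -/
noncomputable def powerInv (n : ℕ) :
    (Fin n → SSet.toTop.obj A) × SSet.toTop.obj B → SSet.toTop.obj (power A B n) :=
  n.rec (fun p ↦ p.2) fun n ih p ↦
    prodInv (X := A) (Y := power A B n) (p.1 0) (ih (Fin.tail p.1, p.2))

lemma powerInv_powerMap (n : ℕ) : Function.LeftInverse (powerInv A B n) (powerMap A B n) := by
  induction n with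
  | zero => exact fun _ ↦ rfl
  | succ n ih =>
    intro z
    have h := prodInv_prodMap (X := A) (Y := power A B n) z
    refine Eq.trans ?_ h
    exact congr_arg (prodInv (X := A) (Y := power A B n) _) (ih _)

lemma powerMap_powerInv (n : ℕ) : Function.RightInverse (powerInv A B n) (powerMap A B n) := by
  induction n with
  | zero => exact fun p ↦ Prod.ext (Subsingleton.elim _ _) rfl
  | succ n ih =>
    intro p
    have h := prodMap_prodInv (X := A) (Y := power A B n) (p.1 0)
      (powerInv A B n (Fin.tail p.1, p.2))
    have h' := ih (Fin.tail p.1, p.2)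
    refine (powerMap_succ A B h).trans ?_
    rw [h']
    exact Prod.ext (Fin.cons_self_tail _) rfl

lemma continuous_powerMap (n : ℕ) : Continuous (powerMap A B n) := by
  induction n with
  | zero => exact continuous_const.prodMk continuous_id
  | succ n ih =>
    have h := continuous_prodMap (X := A) (Y := power A B n)
    have h' := ih.comp (continuous_snd.comp h)
    exact (Continuous.finCons (continuous_fst.comp h) (continuous_fst.comp h')).prodMk
      (continuous_snd.comp h')

lemma continuous_powerInv_comp {K : Type*} [TopologicalSpace K] [LocallyCompactSpace K] (n : ℕ)
    {f : K → (Fin n → SSet.toTop.obj A) × SSet.toTop.obj B} (hf : Continuous f) :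
    Continuous (fun r ↦ powerInv A B n (f r)) := by
  induction n with
  | zero => exact continuous_snd.comp hf
  | succ n ih =>
    exact continuous_prodInv_comp (X := A) (Y := power A B n)
      ((continuous_apply 0).comp (continuous_fst.comp hf))
      (ih (f := fun r ↦ (Fin.tail (f r).1, (f r).2))
        ((continuous_pi fun i ↦ (continuous_apply _).comp (continuous_fst.comp hf)).prodMk
          (continuous_snd.comp hf)))

variable {A B} {Z : SSet.{u}}

/-- The map to a power with given components. -/
def powerLift {n : ℕ} (e : Fin n → (Z ⟶ A)) (b : Z ⟶ B) : Z ⟶ power A B n :=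
  n.rec (motive := fun n ↦ (Fin n → (Z ⟶ A)) → (Z ⟶ power A B n)) (fun _ ↦ b)
    (fun n ih e ↦ CartesianMonoidalCategory.lift (Y := power A B n) (e 0) (ih fun i ↦ e i.succ)) e

lemma powerSimplex_powerLift {n : ℕ} (e : Fin n → (Z ⟶ A)) (b : Z ⟶ B) (k : SimplexCategoryᵒᵖ)
    (x : Z.obj k) :
    powerSimplex A B k n ((powerLift e b).app k x) = (fun j ↦ (e j).app k x, b.app k x) := by
  induction n with
  | zero => exact Prod.ext (Subsingleton.elim _ _) rfl
  | succ n ih =>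
    have h := ih (fun i ↦ e i.succ)
    change (Fin.cons (α := fun _ ↦ A.obj k) ((e 0).app k x)
      (powerSimplex A B k n ((powerLift (fun i ↦ e i.succ) b).app k x)).1,
      (powerSimplex A B k n ((powerLift (fun i ↦ e i.succ) b).app k x)).2) = _
    rw [h]
    refine Prod.ext (funext fun j ↦ ?_) rfl
    cases j using Fin.cases <;> rfl

lemma powerMap_powerLift {n : ℕ} (e : Fin n → (Z ⟶ A)) (b : Z ⟶ B) (z : SSet.toTop.obj Z) :
    powerMap A B n (SSet.toTop.map (powerLift e b) z) =
      (fun j ↦ SSet.toTop.map (e j) z, SSet.toTop.map b z) := by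
  induction n with
  | zero => exact Prod.ext (Subsingleton.elim _ _) rfl
  | succ n ih =>
    have h := ih (fun i ↦ e i.succ)
    have h₀ : prodMap (X := A) (Y := power A B n) (SSet.toTop.map (powerLift e b) z) =
        (SSet.toTop.map (e 0) z, SSet.toTop.map (powerLift (fun i ↦ e i.succ) b) z) := by
      have e₁ := CartesianMonoidalCategory.lift_fst (e 0) (powerLift (fun i ↦ e i.succ) b)
      have e₂ := CartesianMonoidalCategory.lift_snd (e 0) (powerLift (fun i ↦ e i.succ) b)
      have e₁' := ConcreteCategory.congr_hom (congr_arg SSet.toTop.map e₁) z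
      have e₂' := ConcreteCategory.congr_hom (congr_arg SSet.toTop.map e₂) z
      rw [SSet.toTop.map_comp] at e₁' e₂'
      exact Prod.ext e₁' e₂'
    refine (powerMap_succ A B h₀).trans ?_
    rw [h]
    refine Prod.ext (funext fun j ↦ ?_) rfl
    cases j using Fin.cases <;> rfl

lemma isIso_of_bijective {Z W : SSet.{u}} (f : Z ⟶ W)
    (h : ∀ k, Function.Bijective (fun x : Z.obj k ↦ f.app k x)) : IsIso f := by
  rw [NatTrans.isIso_iff_isIso_app]
  intro k
  rw [isIso_iff_bijective]
  exact h k

lemma isIso_powerLift {n : ℕ} (e : Fin n → (Z ⟶ A)) (b : Z ⟶ B)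
    (h : ∀ k, Function.Bijective
      (fun x : Z.obj k ↦ ((fun j ↦ (e j).app k x, b.app k x) : (Fin n → A.obj k) × B.obj k))) :
    IsIso (powerLift e b) :=
  isIso_of_bijective _ fun k ↦
    (Function.Bijective.of_comp_iff' (bijective_powerSimplex A B k n) _).1
    (by
      convert h k using 1
      exact funext fun x ↦ powerSimplex_powerLift e b k x)

end power

lemma segment_succ {G : Type u} (one : G) (mul : G → G → G) {n : ℕ} (g : Fin n → G)
    {a : Fin (n + 1)} {b : Fin n} (h : a ≤ b.castSucc) :
    TopBar.segment one mul g a b.succ = mul (g b) (TopBar.segment one mul g a b.castSucc) := by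
  have e : ((List.finRange n).filter fun i ↦ a ≤ i.castSucc ∧ i.castSucc < b.succ) =
      ((List.finRange n).filter fun i ↦ a ≤ i.castSucc ∧ i.castSucc < b.castSucc) ++ [b] := by
    have hs := List.pairwise_lt_finRange n
    refine List.Pairwise.eq_of_mem_iff (r := (· < ·)) (hs.filter _)
      (List.pairwise_append.2 ⟨hs.filter _, List.pairwise_singleton _ _, fun i hi j hj ↦ ?_⟩) ?_
    · obtain rfl := List.mem_singleton.1 hj
      simpa using (of_decide_eq_true (List.mem_filter.1 hi).2).2
    · intro i
      simp only [List.mem_filter, List.mem_finRange, true_and, List.mem_append, List.mem_singleton,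
        decide_eq_true_eq, Fin.castSucc_lt_castSucc_iff, Fin.castSucc_lt_succ_iff]
      constructor
      · rintro ⟨h₁, h₂⟩
        exact h₂.lt_or_eq.imp (fun h₃ ↦ ⟨h₁, h₃⟩) id
      · rintro (⟨h₁, h₂⟩ | rfl)
        · exact ⟨h₁, h₂.le⟩
        · exact ⟨h, le_rfl⟩
  rw [TopBar.segment, TopBar.segment, e, List.foldl_append]
  rfl

lemma segment_self {G : Type u} (one : G) (mul : G → G → G) {n : ℕ} (g : Fin n → G)
    (a : Fin (n + 1)) : TopBar.segment one mul g a a = one := by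
  have e : ((List.finRange n).filter fun i ↦ a ≤ i.castSucc ∧ i.castSucc < a) = [] := by
    rw [List.filter_eq_nil_iff]
    intro i _
    simp
  rw [TopBar.segment, e]
  rfl

/-- A presentation of a bisimplicial set as a bar construction: its levels are the products
`A^n × B`, by means of compatible maps `edge i j` to `A` and `vert i` to `B`, which multiply as the
elements of a monoid acting on a space. -/
structure BarPresentation (V : SimplexCategoryᵒᵖ ⥤ SSet.{u}) (A B : SSet.{u}) {Y : Type u}
    [TopologicalSpace Y] (y : SSet.toTop.obj B ≃ₜ Y) (one : SSet.toTop.obj A)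
    (mul : SSet.toTop.obj A → SSet.toTop.obj A → SSet.toTop.obj A)
    (act : SSet.toTop.obj A → Y → Y) where
  edge {n : ℕ} {i j : Fin (n + 1)} (h : i ≤ j) : V.obj (op ⦋n⦌) ⟶ A
  vert {n : ℕ} (i : Fin (n + 1)) : V.obj (op ⦋n⦌) ⟶ B
  map_edge {n k : ℕ} (θ : ⦋k⦌ ⟶ ⦋n⦌) {i j : Fin (k + 1)} (h : i ≤ j) :
    V.map θ.op ≫ edge h = edge (θ.toOrderHom.monotone h)
  map_vert {n k : ℕ} (θ : ⦋k⦌ ⟶ ⦋n⦌) (i : Fin (k + 1)) :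
    V.map θ.op ≫ vert i = vert (θ.toOrderHom i)
  bijective (n : ℕ) (k : SimplexCategoryᵒᵖ) : Function.Bijective
    (fun x : (V.obj (op ⦋n⦌)).obj k ↦
      ((fun j : Fin n ↦ (edge (Fin.castSucc_lt_succ (i := j)).le).app k x, (vert 0).app k x) :
        (Fin n → A.obj k) × B.obj k))
  edge_self {n : ℕ} (i : Fin (n + 1)) (z) : SSet.toTop.map (edge (le_refl i)) z = one
  edge_mul {n : ℕ} {i j k : Fin (n + 1)} (h : i ≤ j) (h' : j ≤ k) (z) :
    SSet.toTop.map (edge (h.trans h')) z =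
      mul (SSet.toTop.map (edge h') z) (SSet.toTop.map (edge h) z)
  vert_act {n : ℕ} (i : Fin (n + 1)) (z) :
    y (SSet.toTop.map (vert i) z) =
      act (SSet.toTop.map (edge (Fin.zero_le i)) z) (y (SSet.toTop.map (vert 0) z))

namespace BarPresentation

variable {V : SimplexCategoryᵒᵖ ⥤ SSet.{u}} {A B : SSet.{u}} {Y : Type u}
    [TopologicalSpace Y] {y : SSet.toTop.obj B ≃ₜ Y} {one : SSet.toTop.obj A}
    {mul : SSet.toTop.obj A → SSet.toTop.obj A → SSet.toTop.obj A}
    {act : SSet.toTop.obj A → Y → Y} (D : BarPresentation V A B y one mul act)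

lemma segment_edge {n : ℕ} (z : SSet.toTop.obj (V.obj (op ⦋n⦌))) {a b : Fin (n + 1)} (h : a ≤ b) :
    TopBar.segment one mul
      (fun j : Fin n ↦ SSet.toTop.map (D.edge (Fin.castSucc_lt_succ (i := j)).le) z) a b =
      SSet.toTop.map (D.edge h) z := by
  induction b using Fin.induction with
  | zero =>
    obtain rfl : a = 0 := le_antisymm h (Fin.zero_le _)
    rw [segment_self, D.edge_self]
  | succ b ih =>
    rcases h.eq_or_lt with rfl | h'
    · rw [segment_self, D.edge_self]
    · have h'' : a ≤ b.castSucc := Fin.le_castSucc_iff.2 h'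
      rw [segment_succ _ _ _ h'', ih h'', ← D.edge_mul]

/-- The map `V_n ⟶ A^n × B`. -/
noncomputable def levelLift (n : ℕ) : V.obj (op ⦋n⦌) ⟶ power A B n :=
  powerLift (fun j : Fin n ↦ D.edge (Fin.castSucc_lt_succ (i := j)).le) (D.vert 0)

lemma isIso_levelLift (n : ℕ) : IsIso (D.levelLift n) := isIso_powerLift _ _ (D.bijective n)

/-- The homeomorphism of the realisations of `V_n` and `A^n × B`. -/
noncomputable def levelHomeo (n : ℕ) :
    SSet.toTop.obj (V.obj (op ⦋n⦌)) ≃ₜ SSet.toTop.obj (power A B n) :=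
  have := D.isIso_levelLift n
  TopCat.homeoOfIso (SSet.toTop.mapIso (asIso (D.levelLift n)))

lemma powerMap_levelHomeo (n : ℕ) (z : SSet.toTop.obj (V.obj (op ⦋n⦌))) :
    powerMap A B n (D.levelHomeo n z) =
      (fun j ↦ SSet.toTop.map (D.edge (Fin.castSucc_lt_succ (i := j)).le) z,
        SSet.toTop.map (D.vert 0) z) :=
  powerMap_powerLift _ _ z

/-- The identification of the levels of a bar construction given by a presentation. -/
noncomputable def levelModel : LevelModel V one mul act where
  toFun n z := ((powerMap A B n (D.levelHomeo n z)).1, y (powerMap A B n (D.levelHomeo n z)).2)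
  invFun n p := (D.levelHomeo n).symm (powerInv A B n (p.1, y.symm p.2))
  left_inv n z := by
    simp only [Homeomorph.symm_apply_apply, Prod.mk.eta]
    rw [powerInv_powerMap, Homeomorph.symm_apply_apply]
  right_inv n p := by
    dsimp only
    rw [Homeomorph.apply_symm_apply, powerMap_powerInv]
    exact Prod.ext rfl (y.apply_symm_apply _)
  continuous_toFun n := by
    have h := (continuous_powerMap A B n).comp (D.levelHomeo n).continuous
    exact (continuous_fst.comp h).prodMk (y.continuous.comp (continuous_snd.comp h))
  continuous_invFun n d f := (D.levelHomeo n).symm.continuous.comp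
    (continuous_powerInv_comp A B n ((continuous_fst.comp f.continuous).prodMk
      (y.symm.continuous.comp (continuous_snd.comp f.continuous))))
  map_toFun {n k} θ z := by
    have hE {i j : Fin (k + 1)} (h : i ≤ j) :
        SSet.toTop.map (D.edge h) (SSet.toTop.map (V.map θ.op) z) =
        SSet.toTop.map (D.edge (θ.toOrderHom.monotone h)) z := by
      rw [← D.map_edge θ h, SSet.toTop.map_comp]; rfl
    have hV (i : Fin (k + 1)) : SSet.toTop.map (D.vert i) (SSet.toTop.map (V.map θ.op) z) =
        SSet.toTop.map (D.vert (θ.toOrderHom i)) z := by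
      rw [← D.map_vert θ i, SSet.toTop.map_comp]; rfl
    rw [powerMap_levelHomeo, powerMap_levelHomeo]
    refine congr_arg Topology.WithGeneratedByTopology.equiv.symm (Prod.ext (funext fun j ↦ ?_) ?_)
    · exact (hE _).trans (D.segment_edge z
        (θ.toOrderHom.monotone (Fin.castSucc_lt_succ (i := j)).le)).symm
    · refine (congr_arg y (hV 0)).trans ((D.vert_act _ z).trans ?_)
      exact congr_arg (fun a ↦ act a _) (D.segment_edge z (Fin.zero_le _)).symm

end BarPresentation

end Geometric

/-! ### Homotopy quotients and classifying spaces as realisations of double categories -/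

namespace Geometric

open Simplicial

section nerve

variable (C D : Type u) [SmallCategory C] [SmallCategory D]

/-- The comparison of the nerve of a product with the product of nerves. -/
def nerveProd : nerve (C × D) ⟶ nerve C ⊗ nerve D :=
  CartesianMonoidalCategory.lift (nerveMap (CategoryTheory.Prod.fst C D))
    (nerveMap (CategoryTheory.Prod.snd C D))

lemma isIso_nerveProd : IsIso (nerveProd C D) :=
  isIso_of_bijective _ fun k ↦ by
    refine Function.bijective_iff_has_inverse.2
      ⟨fun p : ComposableArrows C k.unop.len × ComposableArrows D k.unop.len ↦
        Functor.prod' p.1 p.2, fun _ ↦ rfl, fun _ ↦ rfl⟩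

lemma prodComparison_eq (z : catRealisation (C × D)) :
    prodComparison C D z = prodMap (SSet.toTop.map (nerveProd C D) z) := by
  have e₁ := CartesianMonoidalCategory.lift_fst (nerveMap (CategoryTheory.Prod.fst C D))
    (nerveMap (CategoryTheory.Prod.snd C D))
  have e₂ := CartesianMonoidalCategory.lift_snd (nerveMap (CategoryTheory.Prod.fst C D))
    (nerveMap (CategoryTheory.Prod.snd C D))
  have e₁' := ConcreteCategory.congr_hom (congr_arg SSet.toTop.map e₁) z
  have e₂' := ConcreteCategory.congr_hom (congr_arg SSet.toTop.map e₂) z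
  rw [SSet.toTop.map_comp] at e₁' e₂'
  exact Prod.ext e₁'.symm e₂'.symm

lemma injective_prodComparison : Function.Injective (prodComparison C D) := by
  have := isIso_nerveProd C D
  intro z w h
  rw [prodComparison_eq, prodComparison_eq] at h
  exact (TopCat.homeoOfIso (SSet.toTop.mapIso (asIso (nerveProd C D)))).injective
    (bijective_prodMap.1 h)

variable {C D} {E : Type u} [SmallCategory E]

lemma prodComparison_nerveMap (F : E ⥤ C) (G : E ⥤ D) (z : catRealisation E) :
    prodComparison C D (SSet.toTop.map (nerveMap (F.prod' G)) z) =
      (SSet.toTop.map (nerveMap F) z, SSet.toTop.map (nerveMap G) z) := by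
  have e₁ : nerveMap (F.prod' G) ≫ nerveMap (CategoryTheory.Prod.fst C D) = nerveMap F := rfl
  have e₂ : nerveMap (F.prod' G) ≫ nerveMap (CategoryTheory.Prod.snd C D) = nerveMap G := rfl
  have e₁' := ConcreteCategory.congr_hom (congr_arg SSet.toTop.map e₁) z
  have e₂' := ConcreteCategory.congr_hom (congr_arg SSet.toTop.map e₂) z
  rw [SSet.toTop.map_comp] at e₁' e₂'
  exact Prod.ext e₁' e₂'

lemma toTop_map_nerveMap_comp (F : E ⥤ C) (G : C ⥤ D) (z : catRealisation E) :
    SSet.toTop.map (nerveMap (F ⋙ G)) z =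
      SSet.toTop.map (nerveMap G) (SSet.toTop.map (nerveMap F) z) := by
  have e : nerveMap (F ⋙ G) = nerveMap F ≫ nerveMap G := rfl
  rw [e, SSet.toTop.map_comp]; rfl

variable {M X : Type u} [SmallCategory M] [MonoidalCategory M] [SmallCategory X]

lemma realisationAct_nerveMap [MonoidalLeftAction M X] (F : E ⥤ M) (G : E ⥤ X)
    (z : catRealisation E) :
    realisationAct M X (SSet.toTop.map (nerveMap F) z) (SSet.toTop.map (nerveMap G) z) =
      SSet.toTop.map (nerveMap (F.prod' G ⋙ actionFunctor M X)) z := by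
  rw [toTop_map_nerveMap_comp, realisationAct, ← prodComparison_nerveMap,
    (injective_prodComparison M X).extend_apply]

lemma realisationMul_nerveMap (F G : E ⥤ M) (z : catRealisation E) :
    realisationMul M (SSet.toTop.map (nerveMap F) z) (SSet.toTop.map (nerveMap G) z) =
      SSet.toTop.map (nerveMap (F.prod' G ⋙ tensor M)) z := by
  rw [toTop_map_nerveMap_comp, realisationMul, ← prodComparison_nerveMap,
    (injective_prodComparison M M).extend_apply]

lemma toTop_map_nerveMap_const (c : C) (z : catRealisation E) :
    SSet.toTop.map (nerveMap ((Functor.const E).obj c)) z =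
      pt (X := nerve C) (n := op ⦋0⦌) (ComposableArrows.mk₀ c) (stdSimplex.vertex 0) := by
  obtain ⟨n, x, t, rfl⟩ := exists_pt z
  rw [toTop_map_pt]
  induction n using Opposite.rec with | _ n
  let θ : n ⟶ ⦋0⦌ := SimplexCategory.Hom.mk ⟨fun _ ↦ 0, fun _ _ _ ↦ le_rfl⟩
  have e : (nerveMap ((Functor.const E).obj c)).app (op n) x =
      (nerve C).map θ.op (ComposableArrows.mk₀ c) := rfl
  rw [e]
  refine (pt_map θ.op (X := nerve C) (n := op ⦋0⦌) (ComposableArrows.mk₀ c) t).trans ?_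
  refine congr_arg (pt (X := nerve C) (n := op ⦋0⦌) (ComposableArrows.mk₀ c)) ?_
  exact Subsingleton.elim (α := stdSimplex ℝ (Fin 1)) _ _

end nerve

/-! ### Strings of labelled morphisms -/

section labelled

variable {W : Type u} [Category.{u} W] {A B : Type u} {e : ∀ {x y : W}, (x ⟶ y) → A}
  (he : ∀ x : W, Function.Bijective (fun p : Σ y, x ⟶ y ↦ e p.2))

include he in
lemma eq_and_heq_of_label_eq {x x' y y' : W} (f : x ⟶ y) (f' : x' ⟶ y') (hx : x = x')
    (h : e f = e f') : y = y' ∧ HEq f f' := by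
  subst hx
  have := (he x).1 (a₁ := ⟨y, f⟩) (a₂ := ⟨y', f'⟩) h
  cases this
  exact ⟨rfl, HEq.rfl⟩

include he in
/-- A string of morphisms in a category is given by an object and the labels of the morphisms, if
the morphisms out of each object are uniquely determined by arbitrary labels. -/
lemma bijective_labels {b : W → B} (hb : Function.Bijective b) (n : ℕ) :
    Function.Bijective (fun F : ComposableArrows W n ↦
      (((fun j : Fin n ↦ e (F.map (homOfLE (Fin.castSucc_lt_succ (i := j)).le))), b (F.obj 0)) :
        (Fin n → A) × B)) := by
  constructor
  · intro F G h
    obtain ⟨h₁, h₂⟩ := Prod.mk.inj h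
    have h₁ (j) := congr_fun h₁ j
    have key : ∀ i, F.obj i = G.obj i := by
      intro i
      induction i using Fin.induction with
      | zero => exact hb.1 h₂
      | succ i ih => exact (eq_and_heq_of_label_eq he _ _ ih (h₁ i)).1
    refine ComposableArrows.ext key fun i hi ↦ ?_
    exact eq_conj_of_heq _ _ (eq_and_heq_of_label_eq he _ _ (key _) (h₁ ⟨i, hi⟩)).2
  · rintro ⟨g, y⟩
    obtain ⟨x, rfl⟩ := hb.2 y
    choose c hc using fun x ↦ (he x).2
    let obj : Fin (n + 1) → W := fun i ↦ Fin.induction (motive := fun _ ↦ W) x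
      (fun i z ↦ (c z (g i)).1) i
    let F := ComposableArrows.mkOfObjOfMapSucc obj fun i ↦ (c (obj i.castSucc) (g i)).2
    refine ⟨F, Prod.ext (funext fun j ↦ ?_) rfl⟩
    have := ComposableArrows.mkOfObjOfMapSucc_map_succ obj
      (fun i ↦ (c (obj i.castSucc) (g i)).2) j.1 j.2
    exact (congr_arg (fun f ↦ e f) this).trans (hc _ _)

end labelled

end Geometric

/-! ### Rows of 2-cells in `𝓜 × X` -/

/-- Strings of horizontally composable 2-cells of `𝓜 × X`. -/
abbrev StrictRow (M X : Type u) [SmallCategory M] [MonoidalCategory M] [StrictMonoidal M]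
    [SmallCategory X] [MonoidalLeftAction M X] [StrictAction M X] (l : ℕ) :=
  VNerveObj (strictActionDoubleCat M X).transpose l

namespace StrictRow

variable {M X : Type u} [SmallCategory M] [MonoidalCategory M] [StrictMonoidal M]
  [SmallCategory X] [MonoidalLeftAction M X] [StrictAction M X] {l : ℕ}

section

variable (F : StrictRow M X l)

/-- The objects in a string of horizontal morphisms. -/
def pt (i : Fin (l + 1)) : X := F.chain.obj i

/-- The morphisms in a string of horizontal morphisms. -/
def hor {i j : Fin (l + 1)} (h : i ⟶ j) : pt F i ⟶ pt F j := F.chain.map h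

lemma hor_id (i : Fin (l + 1)) : hor F (𝟙 i) = 𝟙 (pt F i) := F.chain.map_id i

lemma hor_comp {i j k : Fin (l + 1)} (h : i ⟶ j) (h' : j ⟶ k) :
    hor F (h ≫ h') = hor F h ≫ hor F h' := F.chain.map_comp h h'

variable (M) in
/-- The string of horizontal morphisms given by a string of morphisms of `X`. -/
def ofChain (E : ComposableArrows X l) : StrictRow M X l :=
  let chain : Fin (l + 1) ⥤ (strictActionDoubleCat M X).transpose.VCat :=
    { obj := fun i ↦ show (strictActionDoubleCat M X).Obj from E.obj i
      map := fun h ↦ E.map h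
      map_id := fun i ↦ E.map_id i
      map_comp := fun h h' ↦ E.map_comp h h' }
  ⟨chain⟩

/-- The string of morphisms of `X` underlying a string of horizontal morphisms. -/
def toChain : ComposableArrows X l where
  obj i := pt F i
  map h := hor F h
  map_id i := hor_id F i
  map_comp h h' := hor_comp F h h'

lemma bijective_toChain : Function.Bijective (toChain (M := M) (X := X) (l := l)) :=
  Function.bijective_iff_has_inverse.2 ⟨ofChain M, fun _ ↦ rfl, fun _ ↦ rfl⟩

variable {F} {G H : StrictRow M X l} (s : F ⟶ G) (t : G ⟶ H)

/-- The vertical morphisms in a string of 2-cells. -/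
def ver (i : Fin (l + 1)) : StrictVer M (pt F i) (pt G i) := VNerveHom.app s i

/-- The 2-cells in a string of 2-cells. -/
def sq {i j : Fin (l + 1)} (h : i ⟶ j) : StrictSq (hor F h) (ver s i) (ver s j) (hor G h) :=
  VNerveHom.sq s h

lemma sq_id (i : Fin (l + 1)) : (sq s (𝟙 i)).hom = 𝟙 (ver s i).obj :=
  eq_of_heq (StrictSq.hom_heq (hor_id F i) rfl rfl (hor_id G i) (VNerveHom.sq_id s i))

lemma sq_comp {i j k : Fin (l + 1)} (h : i ⟶ j) (h' : j ⟶ k) :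
    (sq s (h ≫ h')).hom = (sq s h).hom ≫ (sq s h').hom :=
  eq_of_heq
    (StrictSq.hom_heq (hor_comp F h h') rfl rfl (hor_comp G h h') (VNerveHom.sq_comp s h h'))

/-- Construction of strings of 2-cells. -/
def mkHom (ver : ∀ i, StrictVer M (pt F i) (pt G i))
    (sq : ∀ {i j : Fin (l + 1)} (h : i ⟶ j), StrictSq (hor F h) (ver i) (ver j) (hor G h))
    (sq_id : ∀ i, (sq (𝟙 i)).hom = 𝟙 (ver i).obj)
    (sq_comp : ∀ {i j k : Fin (l + 1)} (h : i ⟶ j) (h' : j ⟶ k),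
      (sq (h ≫ h')).hom = (sq h).hom ≫ (sq h').hom) : F ⟶ G :=
  { app i := ver i
    sq h := sq h
    sq_id i := StrictSq.heq_of_hom (hor_id F i) rfl rfl (hor_id G i) (heq_of_eq (sq_id i))
    sq_comp h h' := StrictSq.heq_of_hom (hor_comp F h h') rfl rfl (hor_comp G h h')
      (heq_of_eq (sq_comp h h')) : VNerveHom _ _ }

lemma hom_ext {s t : F ⟶ G} (h : ∀ i, ver s i = ver t i)
    (h' : ∀ {i j : Fin (l + 1)} (f : i ⟶ j), HEq (sq s f).hom (sq t f).hom) : s = t :=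
  VNerveHom.ext h (fun f ↦ StrictSq.heq_of_hom rfl (h _) (h _) rfl (h' f))

/-- The string of morphisms of `M` in a string of 2-cells. -/
def label : ComposableArrows M l where
  obj i := (ver s i).obj
  map h := (sq s h).hom
  map_id i := sq_id s i
  map_comp h h' := sq_comp s h h'

end

variable (F : StrictRow M X l)

/-- The translate of a string of morphisms of `X` by a string of morphisms of `M`. -/
def translate (E : ComposableArrows M l) : StrictRow M X l :=
  ofChain M (E.prod' (toChain F) ⋙ actionFunctor M X)

/-- The string of 2-cells from a string of morphisms of `X` to its translate. -/
def toTranslate (E : ComposableArrows M l) : F ⟶ translate F E :=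
  mkHom (G := translate F E) (fun i ↦ ⟨E.obj i, rfl⟩)
    (fun h ↦ ⟨E.map h, (Category.comp_id _).trans (Category.id_comp _).symm⟩)
    (fun i ↦ E.map_id i) (fun h h' ↦ E.map_comp h h')

lemma translate_label {G : StrictRow M X l} (s : F ⟶ G) : translate F (label s) = G := by
  apply bijective_toChain.1
  refine CategoryTheory.Functor.hext (fun i ↦ (ver s i).eq) fun i j h ↦ ?_
  exact heq_of_comp_eqToHom _ _ (sq s h).comm

lemma bijective_label : Function.Bijective (fun p : Σ G, F ⟶ G ↦ label p.2) := by
  refine ⟨?_, fun E ↦ ⟨⟨_, toTranslate F E⟩, rfl⟩⟩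
  rintro ⟨G, s⟩ ⟨G', s'⟩ (h : label s = label s')
  obtain rfl : G = G' := by rw [← translate_label F s, ← translate_label F s', h]
  refine congr_arg (Sigma.mk G) (hom_ext (fun i ↦ StrictVer.ext_obj ?_) fun {i j} f ↦ ?_)
  · exact congr_arg (fun E : ComposableArrows M l ↦ E.obj i) h
  · exact congr_arg_heq (fun E : ComposableArrows M l ↦ E.map f) h

end StrictRow

namespace StrictString

variable (M X : Type u) [SmallCategory M] [MonoidalCategory M] [StrictMonoidal M]
  [SmallCategory X] [MonoidalLeftAction M X] [StrictAction M X] {n : ℕ}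

/-- The elements of `M` in strings of vertical morphisms of `𝓜 × X`. -/
def edgeFunctor {i j : Fin (n + 1)} (h : i ⟶ j) : VNerveObj (strictActionDoubleCat M X) n ⥤ M where
  obj F := (ver F h).obj
  map s := (sq s h).hom
  map_id _ := rfl
  map_comp _ _ := rfl

/-- The objects of `X` in strings of vertical morphisms of `𝓜 × X`. -/
def ptFunctor (i : Fin (n + 1)) : VNerveObj (strictActionDoubleCat M X) n ⥤ X where
  obj F := pt F i
  map s := app s i
  map_id _ := rfl
  map_comp _ _ := rfl

lemma edgeFunctor_id (i : Fin (n + 1)) :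
    edgeFunctor M X (𝟙 i) = (Functor.const _).obj (𝟙_ M) :=
  CategoryTheory.Functor.hext (fun F ↦ congr_arg StrictVer.obj (ver_id F i))
    (fun _ _ s ↦ sq_id_heq s i)

lemma edgeFunctor_comp {i j k : Fin (n + 1)} (h : i ⟶ j) (h' : j ⟶ k) :
    edgeFunctor M X (h ≫ h') = (edgeFunctor M X h').prod' (edgeFunctor M X h) ⋙ tensor M :=
  CategoryTheory.Functor.hext (fun F ↦ obj_comp F h h') (fun _ _ s ↦ sq_comp_heq s h h')

lemma ptFunctor_eq {i j : Fin (n + 1)} (h : i ⟶ j) :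
    ptFunctor M X j = (edgeFunctor M X h).prod' (ptFunctor M X i) ⋙ actionFunctor M X :=
  CategoryTheory.Functor.hext (fun F ↦ (ver F h).eq.symm)
    (fun _ _ s ↦ (heq_of_comp_eqToHom _ _ (sq s h).comm).symm)

/-- The homotopy quotient is the realisation of the double category `𝓜 × X`. -/
noncomputable def barPresentation : Geometric.BarPresentation
    (strictActionDoubleCat M X).doubleNerve (nerve M) (nerve X) (Homeomorph.refl _)
    (realisationOne M) (realisationMul M) (realisationAct M X) where
  edge h := nerveMap (edgeFunctor M X (homOfLE h))
  vert i := nerveMap (ptFunctor M X i)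
  map_edge θ _ _ h := rfl
  map_vert θ i := rfl
  bijective n k := by
    have h₁ := Geometric.bijective_labels (W := StrictRow M X k.unop.len)
      (e := StrictRow.label) StrictRow.bijective_label StrictRow.bijective_toChain n
    have h₂ : Function.Bijective ((strictActionDoubleCat M X).transposeString (n := n)
      (k := k.unop.len)) := Function.bijective_iff_has_inverse.2
        ⟨(strictActionDoubleCat M X).transpose.transposeString, fun _ ↦ rfl, fun _ ↦ rfl⟩
    exact h₁.comp h₂
  edge_self i z := by
    have e := edgeFunctor_id M X i
    exact (congr_arg (fun F ↦ SSet.toTop.map (nerveMap F) z) e).trans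
      (Geometric.toTop_map_nerveMap_const _ z)
  edge_mul h h' z := by
    have e := edgeFunctor_comp M X (homOfLE h) (homOfLE h')
    exact (congr_arg (fun F ↦ SSet.toTop.map (nerveMap F) z) e).trans
      (Geometric.realisationMul_nerveMap _ _ z).symm
  vert_act i z := by
    have e := ptFunctor_eq M X (homOfLE (Fin.zero_le i))
    exact (congr_arg (fun F ↦ SSet.toTop.map (nerveMap F) z) e).trans
      (Geometric.realisationAct_nerveMap _ _ z).symm

/-- The homotopy quotient is the realisation of the double category `𝓜 × X`. -/
noncomputable def homotopyQuotientHomeo :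
    HomotopyQuotient M X ≃ₜ (strictActionDoubleCat M X).realisation :=
  Geometric.topBarHomeo (barPresentation M X).levelModel

end StrictString

/-! ### Rows and strings of 2-cells in the bar construction -/

namespace BarRow

variable {M : Type u} [SmallCategory M] [MonoidalCategory M] [StrictMonoidal M] {l : ℕ}
  {F G : VNerveObj (barDoubleCat M).transpose l}

/-- The string of morphisms of `M` in a string of 2-cells. -/
def label (s : F ⟶ G) : ComposableArrows M l where
  obj i := show M from VNerveHom.app s i
  map h := show (show M from VNerveHom.app s _) ⟶ VNerveHom.app s _ from VNerveHom.sq s h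
  map_id i := eq_of_heq (VNerveHom.sq_id s i)
  map_comp h h' := eq_of_heq (VNerveHom.sq_comp s h h')

/-- The string of 2-cells given by a string of morphisms of `M`. -/
def ofLabel (F G : VNerveObj (barDoubleCat M).transpose l) (E : ComposableArrows M l) : F ⟶ G :=
  { app i := E.obj i
    sq h := E.map h
    sq_id i := heq_of_eq (E.map_id i)
    sq_comp h h' := heq_of_eq (E.map_comp h h') : VNerveHom _ _ }

instance : Unique (ComposableArrows (Discrete PUnit.{u + 1}) l) where
  default := (Functor.const _).obj ⟨PUnit.unit⟩
  uniq F := CategoryTheory.Functor.hext (fun _ ↦ rfl)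
    fun i j h ↦ heq_of_eq (Subsingleton.elim (α := (_ : Discrete PUnit) ⟶ _) _ _)

/-- The trivial string of horizontal morphisms. -/
def toChain (F : VNerveObj (barDoubleCat M).transpose l) :
    ComposableArrows (Discrete PUnit.{u + 1}) l := F.chain

lemma bijective_toChain : Function.Bijective (toChain (M := M) (l := l)) :=
  Function.bijective_iff_has_inverse.2 ⟨fun E ↦ ⟨E⟩, fun _ ↦ rfl, fun _ ↦ rfl⟩

lemma bijective_label (F : VNerveObj (barDoubleCat M).transpose l) :
    Function.Bijective (fun p : Σ G, F ⟶ G ↦ label p.2) := by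
  refine ⟨?_, fun E ↦ ⟨⟨F, ofLabel F F E⟩, rfl⟩⟩
  rintro ⟨G, s⟩ ⟨G', s'⟩ h
  obtain rfl : G = G' := bijective_toChain.1 (Subsingleton.elim _ _)
  exact congr_arg (fun E ↦ Sigma.mk G (ofLabel F G E)) h

end BarRow

namespace BarString

variable (M : Type u) [SmallCategory M] [MonoidalCategory M] [StrictMonoidal M] {n : ℕ}

/-- The elements of `M` in strings of vertical morphisms of the bar construction. -/
def edgeFunctor {i j : Fin (n + 1)} (h : i ⟶ j) : VNerveObj (barDoubleCat M) n ⥤ M where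
  obj F := F.ver h
  map s := VNerveHom.sq s h
  map_id _ := rfl
  map_comp _ _ := rfl

/-- The trivial objects in strings of vertical morphisms of the bar construction. -/
def ptFunctor (i : Fin (n + 1)) : VNerveObj (barDoubleCat M) n ⥤ Discrete PUnit.{u + 1} where
  obj F := F.pt i
  map s := VNerveHom.app s i
  map_id _ := rfl
  map_comp _ _ := rfl

lemma edgeFunctor_id (i : Fin (n + 1)) :
    edgeFunctor M (𝟙 i) = (Functor.const _).obj (𝟙_ M) :=
  CategoryTheory.Functor.hext (fun F ↦ F.ver_id i) (fun _ _ s ↦ VNerveHom.sq_id s i)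

lemma edgeFunctor_comp {i j k : Fin (n + 1)} (h : i ⟶ j) (h' : j ⟶ k) :
    edgeFunctor M (h ≫ h') = (edgeFunctor M h).prod' (edgeFunctor M h') ⋙ tensor M :=
  CategoryTheory.Functor.hext (fun F ↦ F.ver_comp h h') (fun _ _ s ↦ VNerveHom.sq_comp s h h')

/-- The realisation of a category with one morphism is a point. -/
noncomputable def pointHomeo : catRealisation (Discrete PUnit.{u + 1}) ≃ₜ PUnit.{u + 1} :=
  { toFun _ := PUnit.unit
    invFun _ := Geometric.pt (X := nerve (Discrete PUnit.{u + 1})) (n := op (SimplexCategory.mk 0))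
      (ComposableArrows.mk₀ ⟨PUnit.unit⟩) (stdSimplex.vertex 0)
    left_inv z := by
      refine (Geometric.toTop_map_nerveMap_const _ z).symm.trans ?_
      have e : nerveMap ((Functor.const (Discrete PUnit.{u + 1})).obj (Discrete.mk PUnit.unit)) =
        𝟙 (nerve (Discrete PUnit.{u + 1})) := rfl
      rw [e, SSet.toTop.map_id]; rfl
    right_inv _ := rfl
    continuous_toFun := continuous_const
    continuous_invFun := continuous_const }

/-- The classifying space is the realisation of the bar construction. -/
noncomputable def barPresentation : Geometric.BarPresentation
    (barDoubleCat M).doubleNerve (nerve M) (nerve (Discrete PUnit.{u + 1})) pointHomeo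
    (realisationOne M) (fun a b ↦ realisationMul M b a) (fun _ y ↦ y) where
  edge h := nerveMap (edgeFunctor M (homOfLE h))
  vert i := nerveMap (ptFunctor M i)
  map_edge θ _ _ h := rfl
  map_vert θ i := rfl
  bijective n k := by
    have h₁ := Geometric.bijective_labels (W := VNerveObj (barDoubleCat M).transpose k.unop.len)
      (e := BarRow.label) BarRow.bijective_label BarRow.bijective_toChain n
    have h₂ : Function.Bijective ((barDoubleCat M).transposeString (n := n)
      (k := k.unop.len)) := Function.bijective_iff_has_inverse.2
        ⟨(barDoubleCat M).transpose.transposeString, fun _ ↦ rfl, fun _ ↦ rfl⟩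
    exact h₁.comp h₂
  edge_self i z := by
    have e := edgeFunctor_id M i
    exact (congr_arg (fun F ↦ SSet.toTop.map (nerveMap F) z) e).trans
      (Geometric.toTop_map_nerveMap_const _ z)
  edge_mul h h' z := by
    have e := edgeFunctor_comp M (homOfLE h) (homOfLE h')
    exact (congr_arg (fun F ↦ SSet.toTop.map (nerveMap F) z) e).trans
      (Geometric.realisationMul_nerveMap _ _ z).symm
  vert_act i z := Subsingleton.elim _ _

/-- The classifying space is the realisation of the bar construction. -/
noncomputable def classifyingSpaceHomeo : ClassifyingSpace M ≃ₜ barRealisation M :=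
  Geometric.topBarHomeo (barPresentation M).levelModel

end BarString

/-! ### Two-sided actions of monoids -/

/-- The objects of the category of a two-sided action of monoids `L` and `R` on `X`. -/
structure BiAct (L X R : Type u) : Type u where
  pt : X

/-- The objects of the category of the left action of `L` on `X`, when `R` acts from the right. -/
structure BiActHor (L X R : Type u) : Type u where
  pt : X

namespace BiAct

section

variable {L X R : Type u} [Monoid L] [Monoid R] [MulAction L X] [MulAction Rᵐᵒᵖ X]
  [SMulCommClass L Rᵐᵒᵖ X]

/-- The category of a two-sided action: the morphisms `x ⟶ y` are the pairs `(a, b)` with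
`a x b = y`. -/
instance : Category.{u} (BiAct L X R) where
  Hom x y := {p : L × R // p.1 • (MulOpposite.op p.2 • x.pt) = y.pt}
  id x := ⟨(1, 1), by simp⟩
  comp p q := ⟨(q.1.1 * p.1.1, p.1.2 * q.1.2), by
    obtain ⟨⟨a, b⟩, hp⟩ := p
    obtain ⟨⟨c, d⟩, hq⟩ := q
    refine Eq.trans ?_ ((congr_arg (fun t ↦ c • (MulOpposite.op d • t)) hp).trans hq)
    change (c * a) • (MulOpposite.op (b * d) • _) = _
    rw [MulOpposite.op_mul, mul_smul, mul_smul, smul_comm a]⟩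
  id_comp p := Subtype.ext (Prod.ext (mul_one _) (one_mul _))
  comp_id p := Subtype.ext (Prod.ext (one_mul _) (mul_one _))
  assoc p q r := Subtype.ext (Prod.ext (mul_assoc _ _ _).symm (mul_assoc _ _ _))

instance : Category.{u} (BiActHor L X R) where
  Hom x y := {a : L // a • x.pt = y.pt}
  id x := ⟨1, one_smul _ _⟩
  comp a b := ⟨b.1 * a.1, by rw [mul_smul, a.2, b.2]⟩
  id_comp a := Subtype.ext (mul_one _)
  comp_id a := Subtype.ext (one_mul _)
  assoc a b c := Subtype.ext (mul_assoc _ _ _).symm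

/-- The boundary condition on the 2-cells of the double category of a two-sided action. -/
abbrev IsSq {x y z t : BiActHor L X R} (f : x ⟶ y) (p : {b : R // MulOpposite.op b • x.pt = z.pt})
    (q : {b : R // MulOpposite.op b • y.pt = t.pt}) (g : z ⟶ t) : Prop :=
  f.1 = g.1 ∧ p.1 = q.1

lemma sq_heq {x y z t x' y' z' t' : BiActHor L X R} {f : x ⟶ y}
    {p : {b : R // MulOpposite.op b • x.pt = z.pt}} {q : {b : R // MulOpposite.op b • y.pt = t.pt}}
    {g : z ⟶ t} {f' : x' ⟶ y'} {p' : {b : R // MulOpposite.op b • x'.pt = z'.pt}}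
    {q' : {b : R // MulOpposite.op b • y'.pt = t'.pt}} {g' : z' ⟶ t'}
    (h : IsSq f p q g ↔ IsSq f' p' q' g')
    (α : {_u : PUnit.{u + 1} // IsSq f p q g}) (β : {_u : PUnit.{u + 1} // IsSq f' p' q' g'}) :
    HEq α β := by
  have : IsSq f p q g = IsSq f' p' q' g' := propext h
  obtain ⟨⟨⟩, hα⟩ := α
  obtain ⟨⟨⟩, hβ⟩ := β
  congr!

variable (L X R) in
/-- The double category of a two-sided action: the horizontal morphisms are given by the left
action, the vertical ones by the right action, and there is one 2-cell for every pair of a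
horizontal and a vertical morphism with the same source. -/
def doubleCat : DoubleCat.{u} where
  Obj := BiActHor L X R
  Ver x y := {b : R // MulOpposite.op b • x.pt = y.pt}
  vid x := ⟨1, by simp⟩
  vcomp p q := ⟨p.1 * q.1, by rw [MulOpposite.op_mul, mul_smul, p.2, q.2]⟩
  vid_vcomp p := Subtype.ext (one_mul _)
  vcomp_vid p := Subtype.ext (mul_one _)
  vassoc p q r := Subtype.ext (mul_assoc _ _ _)
  Sq f p q g := {_u : PUnit.{u + 1} // IsSq f p q g}
  hid p := ⟨⟨⟩, rfl, rfl⟩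
  hcomp α β := ⟨⟨⟩, congr_arg₂ (· * ·) β.2.1 α.2.1, α.2.2.trans β.2.2⟩
  sqVid f := ⟨⟨⟩, rfl, rfl⟩
  sqVcomp α β := ⟨⟨⟩, α.2.1.trans β.2.1, congr_arg₂ (· * ·) α.2.2 β.2.2⟩
  hid_hcomp α := sq_heq (by rw [Category.id_comp, Category.id_comp]) _ _
  hcomp_hid α := sq_heq (by rw [Category.comp_id, Category.comp_id]) _ _
  hassoc α β γ := sq_heq (by rw [Category.assoc, Category.assoc]) _ _
  sqVid_sqVcomp α := sq_heq (by simp [IsSq]) _ _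
  sqVcomp_sqVid α := sq_heq (by simp [IsSq]) _ _
  sqVassoc α β γ := sq_heq (by simp [IsSq, mul_assoc]) _ _
  sqVid_id x := rfl
  sqVid_comp f g := rfl
  hid_vcomp p q := rfl
  interchange α β γ δ := rfl

variable {n : ℕ}

/-- The objects in a string of vertical morphisms. -/
def objAt (F : VNerveObj (doubleCat L X R) n) (i : Fin (n + 1)) : X := BiActHor.pt (F.pt i)

/-- The elements of `R` in a string of vertical morphisms. -/
def right (F : VNerveObj (doubleCat L X R) n) {i j : Fin (n + 1)} (h : i ⟶ j) : R :=
  Subtype.val (F.ver h)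

lemma right_smul (F : VNerveObj (doubleCat L X R) n) {i j : Fin (n + 1)} (h : i ⟶ j) :
    MulOpposite.op (right F h) • objAt F i = objAt F j := Subtype.property (F.ver h)

lemma right_id (F : VNerveObj (doubleCat L X R) n) (i : Fin (n + 1)) : right F (𝟙 i) = 1 :=
  congr_arg Subtype.val (F.ver_id i)

lemma right_comp (F : VNerveObj (doubleCat L X R) n) {i j k : Fin (n + 1)} (h : i ⟶ j)
    (h' : j ⟶ k) : right F (h ≫ h') = right F h * right F h' :=
  congr_arg Subtype.val (F.ver_comp h h')

variable {F G H : VNerveObj (doubleCat L X R) n} (s : F ⟶ G) (t : G ⟶ H)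

/-- The elements of `L` in a string of 2-cells. -/
def left (i : Fin (n + 1)) : L := Subtype.val (VNerveHom.app s i)

lemma left_smul (i : Fin (n + 1)) : left s i • objAt F i = objAt G i :=
  Subtype.property (VNerveHom.app s i)

lemma left_eq {i j : Fin (n + 1)} (h : i ⟶ j) : left s i = left s j := (VNerveHom.sq s h).2.1

include s in
lemma right_eq {i j : Fin (n + 1)} (h : i ⟶ j) : right F h = right G h := (VNerveHom.sq s h).2.2

lemma hom_ext {s t : F ⟶ G} (h : left s 0 = left t 0) : s = t :=
  VNerveHom.ext (fun i ↦ Subtype.ext (by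
      exact (left_eq s (from0 i)).symm.trans (h.trans (left_eq t (from0 i))))) (fun _ ↦ sq_heq (by
        exact iff_of_true (VNerveHom.sq s _).2 (VNerveHom.sq t _).2) _ _)

/-- Construction of strings of 2-cells. -/
def mkHom (a : L) (h : ∀ i, a • objAt F i = objAt G i)
    (h' : ∀ {i j : Fin (n + 1)} (f : i ⟶ j), right F f = right G f) : F ⟶ G :=
  { app i := (⟨a, h i⟩ : {a : L // a • objAt F i = objAt G i})
    sq f := ⟨⟨⟩, rfl, h' f⟩
    sq_id i := by
      refine sq_heq ?_ _ ((doubleCat L X R).sqVid _)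
      exact iff_of_true ⟨rfl, h' (𝟙 i)⟩ ⟨rfl, rfl⟩
    sq_comp f g := by
      refine sq_heq ?_ _ ((doubleCat L X R).sqVcomp _ _)
      exact iff_of_true ⟨rfl, h' (f ≫ g)⟩ ⟨rfl, congr_arg₂ (· * ·) (h' f) (h' g)⟩ : VNerveHom F G }

/-- Construction of strings of vertical morphisms. -/
def mkString (pt : Fin (n + 1) → X) (right : ∀ {i j : Fin (n + 1)} (h : i ⟶ j), R)
    (smul : ∀ {i j : Fin (n + 1)} (h : i ⟶ j), MulOpposite.op (right h) • pt i = pt j)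
    (id : ∀ i, right (𝟙 i) = 1)
    (comp : ∀ {i j k : Fin (n + 1)} (h : i ⟶ j) (h' : j ⟶ k),
      right (h ≫ h') = right h * right h') : VNerveObj (doubleCat L X R) n :=
  let chain : Fin (n + 1) ⥤ (doubleCat L X R).VCat :=
    { obj := fun i ↦ show (doubleCat L X R).Obj from ⟨pt i⟩
      map := fun h ↦ ⟨right h, smul h⟩
      map_id := fun i ↦ Subtype.ext (id i)
      map_comp := fun h h' ↦ Subtype.ext (comp h h') }
  ⟨chain⟩

/-- The diagonal of a grid of 2-cells. -/
def diagString (S : ComposableArrows (VNerveObj (doubleCat L X R) n) n) :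
    ComposableArrows (BiAct L X R) n where
  obj i := ⟨objAt (S.obj i) i⟩
  map {i j} h := ⟨(left (S.map h) j, right (S.obj i) h), by
    change left (S.map h) j • (_ • objAt (S.obj i) i) = objAt (S.obj j) j
    rw [right_smul, left_smul]⟩
  map_id i := Subtype.ext (Prod.ext (congr_arg (fun s ↦ left s i) (S.map_id i)) (right_id _ i))
  map_comp {i j k} h h' := Subtype.ext (Prod.ext
    ((congr_arg (fun s ↦ left s k) (S.map_comp h h')).trans
      (congr_arg (left (S.map h') k * ·) (left_eq (S.map h) h').symm))
    ((right_comp (S.obj i) h h').trans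
      (congr_arg (right (S.obj i) h * ·) (right_eq (S.map h) h'))))

lemma ver_bijective (x : (doubleCat L X R).VCat) :
    Function.Bijective (fun p : Σ y, x ⟶ y ↦ (Subtype.val (p := fun b : R ↦
      MulOpposite.op b • BiActHor.pt x = BiActHor.pt p.1) p.2)) := by
  refine ⟨?_, fun b ↦ ⟨⟨⟨MulOpposite.op b • BiActHor.pt x⟩, ⟨b, rfl⟩⟩, rfl⟩⟩
  rintro ⟨⟨y⟩, ⟨b, hb⟩⟩ ⟨⟨y'⟩, ⟨b', hb'⟩⟩ h
  obtain rfl : b = b' := h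
  obtain rfl : y = y' := hb.symm.trans hb'
  rfl

lemma hom_bijective (x : BiAct L X R) :
    Function.Bijective (fun p : Σ y, x ⟶ y ↦ (Subtype.val (p := fun b : L × R ↦
      b.1 • (MulOpposite.op b.2 • BiAct.pt x) = BiAct.pt p.1) p.2)) := by
  refine ⟨?_, fun b ↦ ⟨⟨⟨_⟩, ⟨b, rfl⟩⟩, rfl⟩⟩
  rintro ⟨⟨y⟩, ⟨b, hb⟩⟩ ⟨⟨y'⟩, ⟨b', hb'⟩⟩ h
  obtain rfl : b = b' := h
  obtain rfl : y = y' := hb.symm.trans hb'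
  rfl

lemma bijective_pt : Function.Bijective (fun x : (doubleCat L X R).VCat ↦ BiActHor.pt x) :=
  ⟨fun ⟨_⟩ ⟨_⟩ h ↦ congr_arg BiActHor.mk h, fun x ↦ ⟨⟨x⟩, rfl⟩⟩

lemma bijective_objects (n : ℕ) : Function.Bijective (fun F : VNerveObj (doubleCat L X R) n ↦
    (((fun j : Fin n ↦ right F (homOfLE (Fin.castSucc_lt_succ (i := j)).le)), objAt F 0) :
      (Fin n → R) × X)) :=
  (Geometric.bijective_labels (e := fun {x y : (doubleCat L X R).VCat} f ↦
      Subtype.val (p := fun b : R ↦ MulOpposite.op b • BiActHor.pt x = BiActHor.pt y) f)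
      ver_bijective bijective_pt n).comp
    (Function.bijective_iff_has_inverse.2 ⟨VNerveObj.mk, fun _ ↦ rfl, fun _ ↦ rfl⟩ :
      Function.Bijective VNerveObj.chain)

/-- The translate of a string of vertical morphisms by an element of `L`. -/
def translate (F : VNerveObj (doubleCat L X R) n) (a : L) : VNerveObj (doubleCat L X R) n :=
  mkString (fun i ↦ a • objAt F i) (fun h ↦ right F h) (fun h ↦ by rw [← smul_comm, right_smul])
    (right_id F) (right_comp F)

lemma translate_left : translate F (left s 0) = G := by
  apply (bijective_objects n).1
  exact Prod.ext (funext fun j ↦ right_eq s (homOfLE (Fin.castSucc_lt_succ (i := j)).le))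
    (left_smul s 0)

lemma left_bijective (F : VNerveObj (doubleCat L X R) n) :
    Function.Bijective (fun p : Σ G, F ⟶ G ↦ left p.2 0) := by
  refine ⟨?_, fun a ↦ ⟨⟨translate F a, mkHom (G := translate F a) a (fun i ↦ rfl)
    (fun f ↦ rfl)⟩, rfl⟩⟩
  rintro ⟨G, s⟩ ⟨G', s'⟩ (h : left s 0 = left s' 0)
  obtain rfl : G = G' := by rw [← translate_left s, ← translate_left s', h]
  exact congr_arg (Sigma.mk G) (hom_ext h)

/-- A grid of 2-cells is determined by a corner and by the elements of `L` and `R` along its sides,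
which are also the elements along its diagonal. -/
lemma bijective_diagString (n : ℕ) : Function.Bijective (diagString (L := L) (X := X) (R := R)
    (n := n)) := by
  have h₁ := Geometric.bijective_labels (W := VNerveObj (doubleCat L X R) n)
    (e := fun s ↦ left s 0) left_bijective (bijective_objects n) n
  have h₂ := Geometric.bijective_labels (e := fun {x y : BiAct L X R} f ↦
      Subtype.val (p := fun b : L × R ↦ b.1 • (MulOpposite.op b.2 • BiAct.pt x) = BiAct.pt y) f)
      (b := BiAct.pt) hom_bijective
      ⟨fun ⟨_⟩ ⟨_⟩ h ↦ congr_arg BiAct.mk h, fun x ↦ ⟨⟨x⟩, rfl⟩⟩ n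
  let c : (Fin n → L) × ((Fin n → R) × X) → (Fin n → L × R) × X :=
    fun p ↦ (fun j ↦ (p.1 j, p.2.1 j), p.2.2)
  have hc : Function.Bijective c := Function.bijective_iff_has_inverse.2
    ⟨fun p ↦ (fun j ↦ (p.1 j).1, fun j ↦ (p.1 j).2, p.2), fun _ ↦ rfl, fun _ ↦ rfl⟩
  refine (Function.Bijective.of_comp_iff' h₂ _).1 ?_
  convert hc.comp h₁ using 1
  funext S
  refine Prod.ext (funext fun j ↦ Prod.ext ?_ ?_) rfl
  · exact (left_eq (S.map _) (from0 _)).symm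
  · exact (right_eq (S.map (from0 _)) _).symm

variable (L X R) in
/-- The isomorphism of the diagonal of the double nerve of a two-sided action with the nerve of its
category. -/
def diagonalIso : bisimplicialDiagonal.obj (doubleCat L X R).doubleNerve ⟶ nerve (BiAct L X R) where
  app n := TypeCat.ofHom fun S ↦ diagString S
  naturality n m θ := rfl

instance : IsIso (diagonalIso L X R) := Geometric.isIso_of_bijective _ fun k ↦
  bijective_diagString k.unop.len

end

section terminal

variable (T : Type u) [Monoid T]

/-- The projection from the two-sided action of a monoid on itself to the action of the right
factor on a point. -/
def proj : BiAct T T T ⥤ BiAct PUnit.{u + 1} PUnit.{u + 1} T where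
  obj _ := ⟨⟨⟩⟩
  map p := ⟨(⟨⟩, p.1.2), rfl⟩
  map_id _ := rfl
  map_comp _ _ := rfl

/-- The double functor underlying the projection from the two-sided action of a monoid on itself to
the action of the right factor on a point. -/
def doubleProj : DoubleFunctor (doubleCat T T T) (doubleCat PUnit.{u + 1} PUnit.{u + 1} T) where
  hor :=
    { obj _ := ⟨⟨⟩⟩
      map f := ⟨⟨⟩, rfl⟩
      map_id _ := rfl
      map_comp _ _ := rfl }
  ver p := ⟨p.1, rfl⟩
  ver_vid _ := rfl
  ver_vcomp _ _ := rfl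
  sq α := ⟨⟨⟩, rfl, α.2.2⟩
  sq_hid _ := HEq.rfl
  sq_hcomp _ _ := HEq.rfl
  sq_sqVid _ := HEq.rfl
  sq_sqVcomp _ _ := HEq.rfl

/-- The strings of right multiplications starting with the unit. -/
def fromUnit (n : ℕ) : VNerveObj (doubleCat PUnit.{u + 1} PUnit.{u + 1} T) n ⥤
    VNerveObj (doubleCat T T T) n where
  obj F := mkString (fun i ↦ right F (from0 i)) (fun h ↦ right F h)
    (fun h ↦ (right_comp F (from0 _) h).symm) (right_id F) (right_comp F)
  map s := mkHom 1 (fun i ↦ (one_smul _ _).trans (right_eq s _)) (fun f ↦ right_eq s f)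
  map_id F := hom_ext rfl
  map_comp s t := hom_ext (one_mul _).symm

/-- In the double category of the two-sided action of `T` on itself, the strings of right
multiplications of each length form the category of the left action of `T` on itself, multiplied by
a discrete set. It contracts to the strings starting with the unit, which is initial for left
multiplication. -/
lemma wEq_nerveMap_proj : SSet.WEq (nerveMap (proj T)) := by
  have h : SSet.WEq (doubleProj T).diagonalMap := by
    refine (doubleProj T).wEq_diagonalMap fun n ↦
      SSet.wEq_nerveMap_of_natTrans (fromUnit T n) (.inl ⟨?_⟩) (.inl ⟨?_⟩)
    · exact
        { app F := mkHom (F := ((doubleProj T).vNerveFunctor n ⋙ fromUnit T n).obj F) (objAt F 0)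
            (fun i ↦ right_smul F (from0 i)) (fun f ↦ rfl)
          naturality F G s := hom_ext ((mul_one _).trans (left_smul s 0).symm) }
    · exact
        { app F := mkHom (F := (fromUnit T n ⋙ (doubleProj T).vNerveFunctor n).obj F) ⟨⟩
            (fun i ↦ rfl) (fun f ↦ rfl)
          naturality F G s := hom_ext rfl }
  have e : diagonalIso T T T ≫ nerveMap (proj T) =
    (doubleProj T).diagonalMap ≫ diagonalIso PUnit.{u + 1} PUnit.{u + 1} T := rfl
  refine SSet.WEq.of_comp_left (.of_isIso (diagonalIso T T T)) ?_
  rw [e]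
  exact h.comp (.of_isIso _)

end terminal

end BiAct

/-! ### The bar construction and the two-sided action of a monoidal category on itself -/

namespace TwoSided

variable (M : Type u) [SmallCategory M] [MonoidalCategory M] [StrictMonoidal M] (l : ℕ)

/-- Strings of morphisms of a strict monoidal category form a monoid under the tensor product. -/
instance : Monoid (ComposableArrows M l) where
  mul E E' := E.prod' E' ⋙ tensor M
  one := (Functor.const _).obj (𝟙_ M)
  mul_assoc E E' E'' := CategoryTheory.Functor.hext (fun i ↦ StrictMonoidal.tensor_assoc _ _ _)
    (fun i j h ↦ tensorHom_assoc_heq _ _ _)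
  one_mul E := CategoryTheory.Functor.hext (fun i ↦ StrictMonoidal.unit_tensor _)
    (fun i j h ↦ id_unit_tensorHom_heq _)
  mul_one E := CategoryTheory.Functor.hext (fun i ↦ StrictMonoidal.tensor_unit _)
    (fun i j h ↦ tensorHom_id_unit_heq _)

/-- The rows of 2-cells of the two-sided action of `M` on itself are given by the two-sided action
of the monoid of strings of morphisms on itself. -/
def rowFunctor : StrictRow (M × Mᴹᵒᵖ) M l ⥤
    BiAct (ComposableArrows M l) (ComposableArrows M l) (ComposableArrows M l) where
  obj F := ⟨StrictRow.toChain F⟩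
  map {F G} s := ⟨(StrictRow.label s ⋙ CategoryTheory.Prod.fst M Mᴹᵒᵖ,
    StrictRow.label s ⋙ CategoryTheory.Prod.snd M Mᴹᵒᵖ ⋙ unmopFunctor M),
    congr_arg StrictRow.toChain (StrictRow.translate_label F s)⟩
  map_id F := rfl
  map_comp s t := rfl

instance : (rowFunctor M l).Faithful where
  map_injective {F G s t} h := by
    have h₁ := congr_arg (fun p ↦ p.1.1) h
    have h₂ := congr_arg (fun p ↦ p.1.2) h
    have e : StrictRow.label s = StrictRow.label t :=
      congr_arg₂ (fun (E E' : ComposableArrows M l) ↦ Functor.prod' E (E' ⋙ mopFunctor M)) h₁ h₂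
    have := (StrictRow.bijective_label F).1 (a₁ := ⟨G, s⟩) (a₂ := ⟨G, t⟩) e
    exact eq_of_heq (Sigma.mk.inj this).2

instance : (rowFunctor M l).Full where
  map_surjective {F G} p := by
    obtain ⟨⟨G', s⟩, hs⟩ := (StrictRow.bijective_label F).2
      (Functor.prod' p.1.1 (p.1.2 ⋙ mopFunctor M))
    obtain rfl : G' = G := by
      rw [← StrictRow.translate_label F s]
      exact StrictRow.bijective_toChain.1
        ((congr_arg (fun E ↦ StrictRow.toChain (StrictRow.translate F E)) hs).trans p.2)
    refine ⟨s, Subtype.ext (Prod.ext ?_ ?_)⟩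
    · exact congr_arg (fun E ↦ E ⋙ CategoryTheory.Prod.fst M Mᴹᵒᵖ) hs
    · exact congr_arg (fun E ↦ E ⋙ CategoryTheory.Prod.snd M Mᴹᵒᵖ ⋙ unmopFunctor M) hs

instance : (rowFunctor M l).EssSurj where
  mem_essImage x := by
    obtain ⟨F, hF⟩ := StrictRow.bijective_toChain (M := M × Mᴹᵒᵖ) (X := M) (l := l) |>.2 x.pt
    exact ⟨F, ⟨eqToIso (congr_arg BiAct.mk hF)⟩⟩

instance : (rowFunctor M l).IsEquivalence where

/-- The rows of 2-cells of the bar construction are given by the monoid of strings of morphisms. -/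
def barRowFunctor : VNerveObj (barDoubleCat M).transpose l ⥤
    BiAct PUnit.{u + 1} PUnit.{u + 1} (ComposableArrows M l) where
  obj F := ⟨⟨⟩⟩
  map s := ⟨(⟨⟩, BarRow.label s), rfl⟩
  map_id F := rfl
  map_comp s t := rfl

instance : (barRowFunctor M l).Faithful where
  map_injective {F G s t} h := by
    have h' : BarRow.label s = BarRow.label t := congr_arg (fun p ↦ p.1.2) h
    exact congr_arg (BarRow.ofLabel F G) h'

instance : (barRowFunctor M l).Full where
  map_surjective {F G} p := ⟨BarRow.ofLabel F G p.1.2, rfl⟩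

instance : (barRowFunctor M l).EssSurj where
  mem_essImage x := ⟨⟨(Functor.const _).obj (show (barDoubleCat M).Obj from ⟨⟨⟩⟩)⟩, ⟨Iso.refl _⟩⟩

instance : (barRowFunctor M l).IsEquivalence where

/-- The double functor from the two-sided action of `M` on itself to the bar construction, which
forgets the left factors. -/
def toBar : DoubleFunctor (strictActionDoubleCat (M × Mᴹᵒᵖ) M) (barDoubleCat M) where
  hor := (Functor.const M).obj (show Discrete PUnit.{u + 1} from ⟨⟨⟩⟩)
  ver p := (StrictVer.obj p).2.unmop
  ver_vid _ := rfl
  ver_vcomp _ _ := rfl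
  sq α := (StrictSq.hom α).2.unmop
  sq_hid _ := HEq.rfl
  sq_hcomp _ _ := HEq.rfl
  sq_sqVid _ := HEq.rfl
  sq_sqVcomp _ _ := HEq.rfl

/-- For strings of 2-cells of a fixed horizontal length `l`, the two-sided action of `M` on itself
becomes the two-sided action of the monoid of strings of `l` morphisms of `M` on itself. -/
lemma wEq_toBar : SSet.WEq (toBar M).diagonalMap := by
  refine DoubleFunctor.wEq_diagonalMap_of_transpose _ (DoubleFunctor.wEq_diagonalMap _ fun l ↦ ?_)
  refine SSet.WEq.of_comp_right (g := nerveMap (barRowFunctor M l))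
    (SSet.wEq_nerveMap_of_isEquivalence _) ?_
  have e : nerveMap ((toBar M).transpose.vNerveFunctor l) ≫ nerveMap (barRowFunctor M l) =
    nerveMap (rowFunctor M l) ≫ nerveMap (BiAct.proj (ComposableArrows M l)) := rfl
  rw [e]
  exact (SSet.wEq_nerveMap_of_isEquivalence _).comp (BiAct.wEq_nerveMap_proj _)

end TwoSided

/-! ### The comparison theorems for small categories -/

section

variable (M X : Type u) [SmallCategory M] [MonoidalCategory M] [StrictMonoidal M]
  [SmallCategory X] [MonoidalLeftAction M X]

lemma isHomotopyEquivalence_qInclusion :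
    IsHomotopyEquivalence (qInclusion M X).realisationMap :=
  (qInclusion M X).isHomotopyEquivalence_realisationMap (LaxRow.wEq_qInclusion M X)

variable [StrictAction M X]

lemma isHomotopyEquivalence_strictToLax :
    IsHomotopyEquivalence (strictToLax M X).realisationMap :=
  (strictToLax M X).isHomotopyEquivalence_realisationMap (LaxString.wEq_strictToLax M X)

lemma nonempty_homotopyEquiv_actionQ : Nonempty (ContinuousMap.HomotopyEquiv
    (strictActionDoubleCat M X).realisation (twoCatRealisation (ActionQ M X))) := by
  obtain ⟨e, -⟩ := isHomotopyEquivalence_strictToLax M X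
  obtain ⟨e', -⟩ := isHomotopyEquivalence_qInclusion M X
  exact ⟨e.trans e'.symm⟩

lemma nonempty_homotopyEquiv_homotopyQuotient : Nonempty (ContinuousMap.HomotopyEquiv
    (HomotopyQuotient M X) (twoCatRealisation (ActionQ M X))) := by
  obtain ⟨e⟩ := nonempty_homotopyEquiv_actionQ M X
  exact ⟨(StrictString.homotopyQuotientHomeo M X).toHomotopyEquiv.trans e⟩

lemma nonempty_homotopyEquiv_barRealisation : Nonempty (ContinuousMap.HomotopyEquiv
    (barRealisation M) (twoCatRealisation (QTwo M))) := by
  obtain ⟨e, -⟩ := (TwoSided.toBar M).isHomotopyEquivalence_realisationMap (TwoSided.wEq_toBar M)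
  obtain ⟨e'⟩ := nonempty_homotopyEquiv_actionQ (M × Mᴹᵒᵖ) M
  exact ⟨e.symm.trans e'⟩

lemma nonempty_homotopyEquiv_classifyingSpace : Nonempty (ContinuousMap.HomotopyEquiv
    (ClassifyingSpace M) (twoCatRealisation (QTwo M))) := by
  obtain ⟨e⟩ := nonempty_homotopyEquiv_barRealisation M
  exact ⟨(BarString.classifyingSpaceHomeo M).toHomotopyEquiv.trans e⟩

end

/-! ### Strict 2-functors inducing weak equivalences -/

namespace DoubleCat

lemma sqVid_heq {C : DoubleCat.{u}} {a b : C.Obj} {f f' : a ⟶ b} (h : f = f') :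
    HEq (C.sqVid f) (C.sqVid f') := by
  subst h; rfl

lemma sqVcomp_heq {C : DoubleCat.{u}} {a b c d e k : C.Obj} {f f' : a ⟶ b} {p : C.Ver a c}
    {q : C.Ver b d} {g g' : c ⟶ d} {r : C.Ver c e} {s : C.Ver d k} {h h' : e ⟶ k}
    {α : C.Sq f p q g} {α' : C.Sq f' p q g'} {β : C.Sq g r s h} {β' : C.Sq g' r s h'}
    (hf : f = f') (hg : g = g') (hh : h = h') (hα : HEq α α') (hβ : HEq β β') :
    HEq (C.sqVcomp α β) (C.sqVcomp α' β') := by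
  subst hf hg hh
  obtain rfl := eq_of_heq hα
  obtain rfl := eq_of_heq hβ
  rfl

end DoubleCat

namespace DoubleFunctor

variable {C D : DoubleCat.{u}} (Φ : DoubleFunctor C D) {n : ℕ}

section

variable (h₁ : ∀ a b, Function.Bijective (Φ.hor.map (X := a) (Y := b)))
  (h₂ : ∀ {a b c d : C.Obj} (f : a ⟶ b) (p : C.Ver a c) (q : C.Ver b d) (g : c ⟶ d),
    Function.Bijective (Φ.sq (f := f) (p := p) (q := q) (g := g)))

include h₂

lemma heq_of_sq_heq {a b c d : C.Obj} {f f' : a ⟶ b} {p p' : C.Ver a c} {q q' : C.Ver b d}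
    {g g' : c ⟶ d} {α : C.Sq f p q g} {α' : C.Sq f' p' q' g'} (hf : f = f') (hp : p = p')
    (hq : q = q') (hg : g = g') (h : HEq (Φ.sq α) (Φ.sq α')) : HEq α α' := by
  subst hf hp hq hg
  exact heq_of_eq ((h₂ _ _ _ _).1 (eq_of_heq h))

lemma exists_sq_heq {a b c d : C.Obj} {f : a ⟶ b} {p : C.Ver a c} {q : C.Ver b d} {g : c ⟶ d}
    {f' : Φ.hor.obj a ⟶ Φ.hor.obj b} {g' : Φ.hor.obj c ⟶ Φ.hor.obj d} (hf : Φ.hor.map f = f')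
    (hg : Φ.hor.map g = g') (β : D.Sq f' (Φ.ver p) (Φ.ver q) g') :
    ∃ α : C.Sq f p q g, HEq (Φ.sq α) β := by
  subst hf hg
  obtain ⟨α, rfl⟩ := (h₂ f p q g).2 β
  exact ⟨α, HEq.rfl⟩

include h₁

lemma faithful_vNerveFunctor : (Φ.vNerveFunctor n).Faithful where
  map_injective {F G s t} h := by
    have e (i) : VNerveHom.app s i = VNerveHom.app t i :=
      (h₁ _ _).1 (congr_arg (fun r : VNerveHom _ _ ↦ r.app i) h)
    exact VNerveHom.ext e fun f ↦ Φ.heq_of_sq_heq h₂ (e _) rfl rfl (e _)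
      (congr_arg_heq (fun r : VNerveHom _ _ ↦ r.sq f) h)

lemma full_vNerveFunctor : (Φ.vNerveFunctor n).Full where
  map_surjective {F G} t := by
    choose app happ using fun i ↦ (h₁ (F.pt i) (G.pt i)).2 (VNerveHom.app t i)
    choose sq hsq using fun (i j : Fin (n + 1)) (f : i ⟶ j) ↦
      Φ.exists_sq_heq h₂ (happ i) (happ j) (VNerveHom.sq t f)
    let s : VNerveHom F G :=
      { app := app
        sq := fun {i j} f ↦ sq i j f
        sq_id := fun i ↦ Φ.heq_of_sq_heq h₂ rfl (F.ver_id i) (G.ver_id i) rfl <|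
          (hsq i i (𝟙 i)).trans <| (VNerveHom.sq_id t i).trans <|
            (sqVid_heq (happ i)).symm.trans (Φ.sq_sqVid (app i)).symm
        sq_comp := fun {i j k} f g ↦ Φ.heq_of_sq_heq h₂ rfl (F.ver_comp f g) (G.ver_comp f g) rfl <|
          (hsq i k (f ≫ g)).trans <| (VNerveHom.sq_comp t f g).trans <|
            (sqVcomp_heq (happ i) (happ j) (happ k) (hsq i j f) (hsq j k g)).symm.trans
              (Φ.sq_sqVcomp (sq i j f) (sq j k g)).symm }
    exact ⟨s, VNerveHom.ext happ fun {i j} f ↦ hsq i j f⟩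

end

lemma exists_comp_eq {C D : Type*} [Category C] [Category D] (K : C ⥤ D)
    (h : Function.Surjective K.obj) [K.Full] (G : ComposableArrows D n) :
    ∃ F : ComposableArrows C n, F ⋙ K = G := by
  choose obj hobj using fun i ↦ h (G.obj i)
  choose f hf using fun i : Fin n ↦ K.map_surjective
    (eqToHom (hobj i.castSucc) ≫ G.map (homOfLE (Fin.castSucc_lt_succ (i := i)).le) ≫
      eqToHom (hobj i.succ).symm)
  refine ⟨ComposableArrows.mkOfObjOfMapSucc obj f, ComposableArrows.ext hobj fun i hi ↦ ?_⟩
  refine (congr_arg K.map (ComposableArrows.mkOfObjOfMapSucc_map_succ obj f i hi)).trans ?_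
  exact hf ⟨i, hi⟩

end DoubleFunctor

/-- A strict 2-functor between strict 2-categories. -/
structure TwoFunctor (A B : Type u) [Bicategory.{u, u} A] [Bicategory.{u, u} B] where
  obj : A → B
  map {a b : A} : (a ⟶ b) → (obj a ⟶ obj b)
  map₂ {a b : A} {p q : a ⟶ b} : (p ⟶ q) → (map p ⟶ map q)
  map_id (a : A) : map (𝟙 a) = 𝟙 (obj a)
  map_comp {a b c : A} (p : a ⟶ b) (q : b ⟶ c) : map (p ≫ q) = map p ≫ map q
  map₂_id {a b : A} (p : a ⟶ b) : map₂ (𝟙 p) = 𝟙 (map p)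
  map₂_comp {a b : A} {p q r : a ⟶ b} (α : p ⟶ q) (β : q ⟶ r) :
    map₂ (α ≫ β) = map₂ α ≫ map₂ β
  map₂_vcomp {a b c : A} {p q : a ⟶ b} {r s : b ⟶ c} (α : p ⟶ q) (β : r ⟶ s) :
    HEq (map₂ (Bicategory.whiskerRight α r ≫ Bicategory.whiskerLeft q β))
      (Bicategory.whiskerRight (map₂ α) (map r) ≫ Bicategory.whiskerLeft (map q) (map₂ β))

namespace TwoFunctor

variable {A B : Type u} [Bicategory.{u, u} A] [Bicategory.{u, u} B] (T : TwoFunctor A B)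

/-- The action of a strict 2-functor on the associated double categories. -/
def mapSq : {a b c d : A} → {f : a = b} → {p : a ⟶ c} → {q : b ⟶ d} → {g : c = d} →
    IdSq f p q g → IdSq (congr_arg T.obj f) (T.map p) (T.map q) (congr_arg T.obj g)
  | _, _, _, _, _, _, _, _, .mk η => .mk (T.map₂ η)

lemma mapSq_bijective {a b c d : A} {f : a = b} {p : a ⟶ c} {q : b ⟶ d} {g : c = d}
    (h : ∀ {a b : A} (p q : a ⟶ b), Function.Bijective (T.map₂ (p := p) (q := q))) :
    Function.Bijective (T.mapSq (f := f) (p := p) (q := q) (g := g)) := by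
  subst f g
  refine ⟨fun α β e ↦ ?_, fun α ↦ ?_⟩
  · rw [← IdSq.mk_cell α, ← IdSq.mk_cell β] at e ⊢
    exact congr_arg IdSq.mk ((h _ _).1 (congr_arg IdSq.cell e))
  · obtain ⟨η, hη⟩ := (h _ _).2 α.cell
    exact ⟨.mk η, (congr_arg IdSq.mk hη).trans (IdSq.mk_cell α)⟩

lemma mapSq_hcomp {a b e c d k : A} {f : a = b} {f' : b = e} {p : a ⟶ c} {q : b ⟶ d}
    {r : e ⟶ k} {g : c = d} {g' : d = k} (α : IdSq f p q g) (β : IdSq f' q r g') :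
    T.mapSq (α.hcomp β) = (T.mapSq α).hcomp (T.mapSq β) := by
  cases α; cases β
  exact congr_arg IdSq.mk (T.map₂_comp _ _)

lemma mapSq_vid {a b : A} (f : a = b) :
    HEq (T.mapSq (IdSq.vid f)) (IdSq.vid (congr_arg T.obj f)) := by
  subst f
  refine IdSq.heq_of_eq (T.map_id a) (T.map_id a) ?_
  rw [T.map₂_id, T.map_id]

lemma mapSq_vcomp {a b c d e k : A} {f : a = b} {p : a ⟶ c} {q : b ⟶ d} {g : c = d}
    {p' : c ⟶ e} {q' : d ⟶ k} {h : e = k} (α : IdSq f p q g) (β : IdSq g p' q' h) :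
    HEq (T.mapSq (α.vcomp β)) ((T.mapSq α).vcomp (T.mapSq β)) := by
  cases α; cases β
  exact IdSq.heq_of_eq (T.map_comp _ _) (T.map_comp _ _) (T.map₂_vcomp _ _)

variable [Bicategory.Strict A] [Bicategory.Strict B]

/-- The double functor given by a strict 2-functor. -/
def toDoubleFunctor :
    DoubleFunctor (strictBicategoryDoubleCat A) (strictBicategoryDoubleCat B) where
  hor :=
    { obj a := (⟨T.obj a.as⟩ : Discrete B)
      map f := Discrete.eqToHom (congr_arg T.obj (Discrete.eq_of_hom f))
      map_id _ := rfl
      map_comp _ _ := Subsingleton.elim (α := (_ : Discrete B) ⟶ _) _ _ }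
  ver p := T.map p
  ver_vid a := T.map_id a.as
  ver_vcomp p q := T.map_comp p q
  sq α := T.mapSq α
  sq_hid p := heq_of_eq (congr_arg IdSq.mk (T.map₂_id p))
  sq_hcomp α β := heq_of_eq (T.mapSq_hcomp α β)
  sq_sqVid f := T.mapSq_vid (Discrete.eq_of_hom f)
  sq_sqVcomp α β := T.mapSq_vcomp α β

/-- The functors on vertical strings of each length are equivalences of categories. -/
lemma wEq_of_bijective (h₀ : Function.Bijective T.obj)
    (h₁ : ∀ a b : A, Function.Surjective (T.map (a := a) (b := b)))
    (h₂ : ∀ {a b : A} (p q : a ⟶ b), Function.Bijective (T.map₂ (p := p) (q := q))) :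
    SSet.WEq T.toDoubleFunctor.diagonalMap := by
  refine DoubleFunctor.wEq_diagonalMap _ fun n ↦ ?_
  have e₁ (a b : Discrete A) :
      Function.Bijective (T.toDoubleFunctor.hor.map (X := a) (Y := b)) := by
    refine ⟨fun f g _ ↦ Subsingleton.elim (α := ((a : Discrete A) ⟶ b)) f g, fun f ↦
      ⟨Discrete.eqToHom (h₀.1 (Discrete.eq_of_hom f)),
        Subsingleton.elim (α := (_ : Discrete B) ⟶ _) _ _⟩⟩
  have e₂ {a b c d : Discrete A} (f : a ⟶ b) (p : a.as ⟶ c.as) (q : b.as ⟶ d.as) (g : c ⟶ d) :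
      Function.Bijective (T.toDoubleFunctor.sq (f := f) (p := p) (q := q) (g := g)) :=
    T.mapSq_bijective h₂
  have := T.toDoubleFunctor.faithful_vNerveFunctor (n := n) e₁ e₂
  have := T.toDoubleFunctor.full_vNerveFunctor (n := n) e₁ e₂
  have : T.toDoubleFunctor.vFunctor.Full := ⟨fun f ↦ h₁ _ _ f⟩
  have : (T.toDoubleFunctor.vNerveFunctor n).EssSurj := ⟨fun ⟨G⟩ ↦ by
    obtain ⟨F, rfl⟩ := DoubleFunctor.exists_comp_eq T.toDoubleFunctor.vFunctor
      (fun x ↦ by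
        obtain ⟨a, ha⟩ := h₀.2 (show Discrete B from x).as
        exact ⟨(⟨a⟩ : Discrete A), congr_arg Discrete.mk ha⟩) G
    exact ⟨⟨F⟩, ⟨Iso.refl _⟩⟩⟩
  have : (T.toDoubleFunctor.vNerveFunctor n).IsEquivalence := { }
  exact SSet.wEq_nerveMap_of_isEquivalence _

/-- The functors on horizontal strings of each length are equivalences of categories. -/
lemma wEq_of_surjective (h₀ : Function.Surjective T.obj)
    (h₁ : ∀ a b : A, Function.Bijective (T.map (a := a) (b := b)))
    (h₂ : ∀ {a b : A} (p q : a ⟶ b), Function.Bijective (T.map₂ (p := p) (q := q))) :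
    SSet.WEq T.toDoubleFunctor.diagonalMap := by
  refine DoubleFunctor.wEq_diagonalMap_of_transpose _ (DoubleFunctor.wEq_diagonalMap _ fun n ↦ ?_)
  have e₁ (a b) : Function.Bijective (T.toDoubleFunctor.transpose.hor.map (X := a) (Y := b)) :=
    h₁ _ _
  have e₂ {a b c d : Discrete A} (f : a.as ⟶ b.as) (p : a ⟶ c) (q : b ⟶ d) (g : c.as ⟶ d.as) :
      Function.Bijective (T.toDoubleFunctor.transpose.sq (f := f) (p := p) (q := q) (g := g)) :=
    T.mapSq_bijective h₂
  have := T.toDoubleFunctor.transpose.faithful_vNerveFunctor (n := n) e₁ e₂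
  have := T.toDoubleFunctor.transpose.full_vNerveFunctor (n := n) e₁ e₂
  have : (T.toDoubleFunctor.transpose.vNerveFunctor n).EssSurj := ⟨fun G ↦ by
    obtain ⟨b, rfl⟩ := CellString.eq_const G
    obtain ⟨a, rfl⟩ := h₀ b
    exact ⟨CellString.const n a, ⟨Iso.refl _⟩⟩⟩
  have : (T.toDoubleFunctor.transpose.vNerveFunctor n).IsEquivalence := { }
  exact SSet.wEq_nerveMap_of_isEquivalence _

end TwoFunctor

/-- The objects of the pullback of a 2-category along a map on objects. -/
structure PullbackTwoCat {A B : Type u} (P : A → B) : Type u where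
  pt : A

namespace PullbackTwoCat

open Bicategory

variable {A B : Type u} [Bicategory.{u, u} B] (P : A → B)

instance : Bicategory.{u, u} (PullbackTwoCat P) where
  Hom x y := P x.pt ⟶ P y.pt
  id x := 𝟙 (P x.pt)
  comp p q := CategoryStruct.comp (obj := B) p q
  homCategory x y := Bicategory.homCategory (P x.pt) (P y.pt)
  whiskerLeft p _ _ β := whiskerLeft (B := B) p β
  whiskerRight α q := whiskerRight (B := B) α q
  associator p q r := associator (B := B) p q r
  leftUnitor p := leftUnitor (B := B) p
  rightUnitor p := rightUnitor (B := B) p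
  whiskerLeft_id p q := whiskerLeft_id (B := B) p q
  whiskerLeft_comp p _ _ _ α β := whiskerLeft_comp (B := B) p α β
  id_whiskerLeft α := id_whiskerLeft (B := B) α
  comp_whiskerLeft p q _ _ α := comp_whiskerLeft (B := B) p q α
  id_whiskerRight p q := id_whiskerRight (B := B) p q
  comp_whiskerRight α β q := comp_whiskerRight (B := B) α β q
  whiskerRight_id α := whiskerRight_id (B := B) α
  whiskerRight_comp α q r := whiskerRight_comp (B := B) α q r
  whisker_assoc p _ _ α r := Bicategory.whisker_assoc (B := B) p α r
  whisker_exchange α β := whisker_exchange (B := B) α β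
  pentagon p q r s := pentagon (B := B) p q r s
  triangle p q := triangle (B := B) p q

variable [Bicategory.Strict B]

instance : Bicategory.Strict (PullbackTwoCat P) where
  id_comp p := Strict.id_comp (B := B) p
  comp_id p := Strict.comp_id (B := B) p
  assoc p q r := Strict.assoc (B := B) p q r
  leftUnitor_eqToIso p := Strict.leftUnitor_eqToIso (B := B) p
  rightUnitor_eqToIso p := Strict.rightUnitor_eqToIso (B := B) p
  associator_eqToIso p q r := Strict.associator_eqToIso (B := B) p q r

/-- The projection from the pullback of a 2-category. -/
def forget : TwoFunctor (PullbackTwoCat P) B where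
  obj x := P x.pt
  map p := p
  map₂ α := α
  map_id _ := rfl
  map_comp _ _ := rfl
  map₂_id _ := rfl
  map₂_comp _ _ := rfl
  map₂_vcomp _ _ := HEq.rfl

variable {P} in
lemma wEq_forget (h : Function.Surjective P) :
    SSet.WEq (forget P).toDoubleFunctor.diagonalMap :=
  (forget P).wEq_of_surjective (fun b ↦ (h b).imp' mk fun _ ↦ id)
    (fun _ _ ↦ Function.bijective_id) (fun _ _ ↦ Function.bijective_id)

end PullbackTwoCat

namespace TwoFunctor

variable {A B : Type u} [Bicategory.{u, u} A] [Bicategory.{u, u} B] (T : TwoFunctor A B)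

/-- The factorisation of a strict 2-functor through the pullback along its map on objects. -/
def toPullback : TwoFunctor A (PullbackTwoCat T.obj) where
  obj a := ⟨a⟩
  map p := T.map p
  map₂ α := T.map₂ α
  map_id a := T.map_id a
  map_comp p q := T.map_comp p q
  map₂_id p := T.map₂_id p
  map₂_comp α β := T.map₂_comp α β
  map₂_vcomp α β := T.map₂_vcomp α β

variable [Bicategory.Strict A] [Bicategory.Strict B]

/-- A strict 2-functor which is surjective on objects, full on morphisms and fully faithful on
2-cells is a homotopy equivalence. It factors through the pullback of the target along the map on
objects; the first factor is bijective on objects and the second one on morphisms. -/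
lemma nonempty_homotopyEquiv (h₀ : Function.Surjective T.obj)
    (h₁ : ∀ a b : A, Function.Surjective (T.map (a := a) (b := b)))
    (h₂ : ∀ {a b : A} (p q : a ⟶ b), Function.Bijective (T.map₂ (p := p) (q := q))) :
    Nonempty (ContinuousMap.HomotopyEquiv (twoCatRealisation A) (twoCatRealisation B)) := by
  obtain ⟨e, -⟩ := DoubleFunctor.isHomotopyEquivalence_realisationMap _
    (T.toPullback.wEq_of_bijective ⟨fun _ _ h ↦ congr_arg PullbackTwoCat.pt h, fun a ↦ ⟨a.pt, rfl⟩⟩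
      h₁ h₂)
  obtain ⟨e', -⟩ := DoubleFunctor.isHomotopyEquivalence_realisationMap _
    (PullbackTwoCat.wEq_forget h₀)
  exact ⟨e.trans e'⟩

end TwoFunctor

/-! ### Pasting of squares in a bicategory -/

namespace CategoryTheory.Bicategory

variable {C : Type*} [Bicategory C]

section paste

variable {a b c d a' b' c' d' : C} {e₁ : a ⟶ a'} {e₂ : b ⟶ b'} {e₃ : c ⟶ c'} {e₄ : d ⟶ d'}

/-- The pasting of two squares, with comparison 2-cells for the composites of the horizontal
sides. -/
def paste {f : a ⟶ b} {g : b ⟶ c} {h : a ⟶ c} {f' : a' ⟶ b'} {g' : b' ⟶ c'} {h' : a' ⟶ c'}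
    (m : h ⟶ f ≫ g) (θ : f ≫ e₂ ⟶ e₁ ≫ f') (η : g ≫ e₃ ⟶ e₂ ≫ g') (m' : f' ≫ g' ⟶ h') :
    h ≫ e₃ ⟶ e₁ ≫ h' :=
  m ▷ e₃ ≫ (α_ f g e₃).hom ≫ f ◁ η ≫ (α_ f e₂ g').inv ≫ θ ▷ g' ≫ (α_ e₁ f' g').hom ≫ e₁ ◁ m'

lemma paste_whiskerLeft {f : a ⟶ b} {g k : b ⟶ c} {h l : a ⟶ c} {f' : a' ⟶ b'}
    {g' k' : b' ⟶ c'} {h' l' : a' ⟶ c'} {m : h ⟶ f ≫ g} {n : l ⟶ f ≫ k}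
    {θ : f ≫ e₂ ⟶ e₁ ≫ f'} {η : g ≫ e₃ ⟶ e₂ ≫ g'} {κ : k ≫ e₃ ⟶ e₂ ≫ k'}
    {m' : f' ≫ g' ⟶ h'} {n' : f' ≫ k' ⟶ l'} {α : g ⟶ k} {α' : g' ⟶ k'} {β : h ⟶ l} {β' : h' ⟶ l'}
    (hα : α ▷ e₃ ≫ κ = η ≫ e₂ ◁ α') (hβ : β ≫ n = m ≫ f ◁ α)
    (hβ' : m' ≫ β' = f' ◁ α' ≫ n') :
    β ▷ e₃ ≫ paste n θ κ n' = paste m θ η m' ≫ e₁ ◁ β' := by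
  have h₁ : β ▷ e₃ ≫ n ▷ e₃ = m ▷ e₃ ≫ (f ◁ α) ▷ e₃ := by
    rw [← comp_whiskerRight, hβ, comp_whiskerRight]
  have h₂ : e₁ ◁ m' ≫ e₁ ◁ β' = e₁ ◁ f' ◁ α' ≫ e₁ ◁ n' := by
    rw [← whiskerLeft_comp, hβ', whiskerLeft_comp]
  have h₃ : f ◁ α ▷ e₃ ≫ f ◁ κ = f ◁ η ≫ f ◁ e₂ ◁ α' := by
    rw [← whiskerLeft_comp, hα, whiskerLeft_comp]
  simp only [paste, Category.assoc, h₂]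
  rw [reassoc_of% h₁, Bicategory.whisker_assoc]
  simp only [Category.assoc, Iso.inv_hom_id_assoc]
  rw [reassoc_of% h₃]
  have h₄ : f ◁ e₂ ◁ α' ≫ (α_ f e₂ k').inv ≫ θ ▷ k' ≫ (α_ e₁ f' k').hom =
      (α_ f e₂ g').inv ≫ θ ▷ g' ≫ (α_ e₁ f' g').hom ≫ e₁ ◁ f' ◁ α' := by
    rw [associator_inv_naturality_right_assoc, whisker_exchange_assoc,
      associator_naturality_right]
  rw [reassoc_of% h₄]

lemma paste_whiskerRight {f k : a ⟶ b} {g : b ⟶ c} {h l : a ⟶ c} {f' k' : a' ⟶ b'}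
    {g' : b' ⟶ c'} {h' l' : a' ⟶ c'} {m : h ⟶ f ≫ g} {n : l ⟶ k ≫ g}
    {θ : f ≫ e₂ ⟶ e₁ ≫ f'} {κ : k ≫ e₂ ⟶ e₁ ≫ k'} {η : g ≫ e₃ ⟶ e₂ ≫ g'}
    {m' : f' ≫ g' ⟶ h'} {n' : k' ≫ g' ⟶ l'} {α : f ⟶ k} {α' : f' ⟶ k'} {β : h ⟶ l} {β' : h' ⟶ l'}
    (hα : α ▷ e₂ ≫ κ = θ ≫ e₁ ◁ α') (hβ : β ≫ n = m ≫ α ▷ g)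
    (hβ' : m' ≫ β' = α' ▷ g' ≫ n') :
    β ▷ e₃ ≫ paste n κ η n' = paste m θ η m' ≫ e₁ ◁ β' := by
  have h₁ : β ▷ e₃ ≫ n ▷ e₃ = m ▷ e₃ ≫ (α ▷ g) ▷ e₃ := by
    rw [← comp_whiskerRight, hβ, comp_whiskerRight]
  have h₂ : e₁ ◁ m' ≫ e₁ ◁ β' = e₁ ◁ α' ▷ g' ≫ e₁ ◁ n' := by
    rw [← whiskerLeft_comp, hβ', whiskerLeft_comp]
  have h₃ : (α ▷ e₂) ▷ g' ≫ κ ▷ g' = θ ▷ g' ≫ (e₁ ◁ α') ▷ g' := by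
    rw [← comp_whiskerRight, hα, comp_whiskerRight]
  have h₄ : (α ▷ g) ▷ e₃ ≫ (α_ k g e₃).hom ≫ k ◁ η ≫ (α_ k e₂ g').inv =
      (α_ f g e₃).hom ≫ f ◁ η ≫ (α_ f e₂ g').inv ≫ (α ▷ e₂) ▷ g' := by
    rw [associator_naturality_left_assoc, ← whisker_exchange_assoc, associator_inv_naturality_left]
  simp only [paste, Category.assoc, h₂]
  rw [reassoc_of% h₁, reassoc_of% h₄, reassoc_of% h₃, Bicategory.whisker_assoc]
  simp only [Category.assoc, Iso.inv_hom_id_assoc]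

/-- Pasting of squares is associative and, by the two lemmas on `pasteId`, unital, with respect to
compatible comparison 2-cells. -/
lemma paste_assoc {f : a ⟶ b} {g : b ⟶ c} {h : c ⟶ d} {fg : a ⟶ c} {gh : b ⟶ d} {k l : a ⟶ d}
    {f' : a' ⟶ b'} {g' : b' ⟶ c'} {h' : c' ⟶ d'} {fg' : a' ⟶ c'} {gh' : b' ⟶ d'}
    {k' l' : a' ⟶ d'} {m₁ : fg ⟶ f ≫ g} {m₂ : gh ⟶ g ≫ h} {m₃ : k ⟶ fg ≫ h} {m₄ : l ⟶ f ≫ gh}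
    {m₁' : f' ≫ g' ⟶ fg'} {m₂' : g' ≫ h' ⟶ gh'} {m₃' : fg' ≫ h' ⟶ k'} {m₄' : f' ≫ gh' ⟶ l'}
    {θ : f ≫ e₂ ⟶ e₁ ≫ f'} {η : g ≫ e₃ ⟶ e₂ ≫ g'} {κ : h ≫ e₄ ⟶ e₃ ≫ h'} {β : k ⟶ l}
    {β' : k' ⟶ l'}
    (hβ : β ≫ m₄ ≫ f ◁ m₂ = m₃ ≫ m₁ ▷ h ≫ (α_ f g h).hom)
    (hβ' : m₁' ▷ h' ≫ m₃' ≫ β' = (α_ f' g' h').hom ≫ f' ◁ m₂' ≫ m₄') :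
    β ▷ e₄ ≫ paste m₄ θ (paste m₂ η κ m₂') m₄' =
      paste m₃ (paste m₁ θ η m₁') κ m₃' ≫ e₁ ◁ β' := by
  have h₁ : β ▷ e₄ ≫ m₄ ▷ e₄ ≫ (f ◁ m₂) ▷ e₄ =
      m₃ ▷ e₄ ≫ (m₁ ▷ h) ▷ e₄ ≫ (α_ f g h).hom ▷ e₄ := by
    simp only [← comp_whiskerRight, hβ]
  have h₂ : e₁ ◁ m₁' ▷ h' ≫ e₁ ◁ m₃' ≫ e₁ ◁ β' =
      e₁ ◁ (α_ f' g' h').hom ≫ e₁ ◁ f' ◁ m₂' ≫ e₁ ◁ m₄' := by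
    simp only [← whiskerLeft_comp, hβ']
  calc β ▷ e₄ ≫ paste m₄ θ (paste m₂ η κ m₂') m₄'
      = (β ▷ e₄ ≫ m₄ ▷ e₄ ≫ (f ◁ m₂) ▷ e₄) ⊗≫ f ◁ g ◁ κ ⊗≫ f ◁ η ▷ h' ⊗≫
          ((f ≫ e₂) ◁ m₂' ≫ θ ▷ gh') ⊗≫ e₁ ◁ m₄' := by
        simp only [paste]; bicategory
    _ = (m₃ ▷ e₄ ≫ (m₁ ▷ h) ▷ e₄ ≫ (α_ f g h).hom ▷ e₄) ⊗≫ f ◁ g ◁ κ ⊗≫ f ◁ η ▷ h' ⊗≫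
          (θ ▷ (g' ≫ h') ≫ (e₁ ≫ f') ◁ m₂') ⊗≫ e₁ ◁ m₄' := by
        rw [h₁, whisker_exchange]
    _ = m₃ ▷ e₄ ⊗≫ (m₁ ▷ (h ≫ e₄) ≫ (f ≫ g) ◁ κ) ⊗≫ f ◁ η ▷ h' ⊗≫ θ ▷ g' ▷ h' ⊗≫
          (e₁ ◁ (α_ f' g' h').hom ≫ e₁ ◁ f' ◁ m₂' ≫ e₁ ◁ m₄') := by
        bicategory
    _ = m₃ ▷ e₄ ⊗≫ (fg ◁ κ ≫ m₁ ▷ (e₃ ≫ h')) ⊗≫ f ◁ η ▷ h' ⊗≫ θ ▷ g' ▷ h' ⊗≫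
          (e₁ ◁ m₁' ▷ h' ≫ e₁ ◁ m₃' ≫ e₁ ◁ β') := by
        rw [← h₂, whisker_exchange]
    _ = paste m₃ (paste m₁ θ η m₁') κ m₃' ≫ e₁ ◁ β' := by
        simp only [paste]; bicategory

variable (e₁) in
/-- The identity square, with comparison 2-cells for the identities of the horizontal sides. -/
def pasteId {i : a ⟶ a} {i' : a' ⟶ a'} (m : i ⟶ 𝟙 a) (m' : 𝟙 a' ⟶ i') : i ≫ e₁ ⟶ e₁ ≫ i' :=
  m ▷ e₁ ≫ (leftUnitor e₁).hom ≫ (rightUnitor e₁).inv ≫ e₁ ◁ m'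

lemma pasteId_paste {i : a ⟶ a} {i' : a' ⟶ a'} {f h : a ⟶ b} {f' h' : a' ⟶ b'}
    {m : i ⟶ 𝟙 a} {m' : 𝟙 a' ⟶ i'} {n : h ⟶ i ≫ f} {n' : i' ≫ f' ⟶ h'}
    {θ : f ≫ e₂ ⟶ e₁ ≫ f'} {β : h ⟶ f} {β' : h' ⟶ f'} (hβ : β = n ≫ m ▷ f ≫ (leftUnitor f).hom)
    (hβ' : m' ▷ f' ≫ n' ≫ β' = (leftUnitor f').hom) :
    β ▷ e₂ ≫ θ = paste n (pasteId e₁ m m') θ n' ≫ e₁ ◁ β' := by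
  have h₂ : e₁ ◁ m' ▷ f' ≫ e₁ ◁ n' ≫ e₁ ◁ β' = e₁ ◁ (leftUnitor f').hom := by
    simp only [← whiskerLeft_comp, hβ']
  calc β ▷ e₂ ≫ θ = n ▷ e₂ ⊗≫ (m ▷ (f ≫ e₂) ≫ 𝟙 a ◁ θ) ⊗≫ e₁ ◁ (leftUnitor f').hom := by
        rw [hβ]; bicategory
    _ = n ▷ e₂ ⊗≫ (i ◁ θ ≫ m ▷ (e₁ ≫ f')) ⊗≫ (e₁ ◁ m' ▷ f' ≫ e₁ ◁ n' ≫ e₁ ◁ β') := by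
        rw [← whisker_exchange, h₂]
    _ = paste n (pasteId e₁ m m') θ n' ≫ e₁ ◁ β' := by
        simp only [paste, pasteId]; bicategory

lemma paste_pasteId {i : b ⟶ b} {i' : b' ⟶ b'} {f h : a ⟶ b} {f' h' : a' ⟶ b'}
    {m : i ⟶ 𝟙 b} {m' : 𝟙 b' ⟶ i'} {n : h ⟶ f ≫ i} {n' : f' ≫ i' ⟶ h'}
    {θ : f ≫ e₂ ⟶ e₁ ≫ f'} {β : h ⟶ f} {β' : h' ⟶ f'} (hβ : β = n ≫ f ◁ m ≫ (rightUnitor f).hom)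
    (hβ' : f' ◁ m' ≫ n' ≫ β' = (rightUnitor f').hom) :
    β ▷ e₂ ≫ θ = paste n θ (pasteId e₂ m m') n' ≫ e₁ ◁ β' := by
  have h₂ : e₁ ◁ f' ◁ m' ≫ e₁ ◁ n' ≫ e₁ ◁ β' = e₁ ◁ (rightUnitor f').hom := by
    simp only [← whiskerLeft_comp, hβ']
  calc β ▷ e₂ ≫ θ = n ▷ e₂ ⊗≫ f ◁ m ▷ e₂ ⊗≫ θ ▷ 𝟙 b' ⊗≫ e₁ ◁ (rightUnitor f').hom := by
        rw [hβ]; bicategory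
    _ = n ▷ e₂ ⊗≫ f ◁ m ▷ e₂ ⊗≫ (θ ▷ 𝟙 b' ≫ (e₁ ≫ f') ◁ m') ⊗≫ (e₁ ◁ n' ≫ e₁ ◁ β') := by
        rw [← h₂]; bicategory
    _ = n ▷ e₂ ⊗≫ f ◁ m ▷ e₂ ⊗≫ ((f ≫ e₂) ◁ m' ≫ θ ▷ i') ⊗≫ (e₁ ◁ n' ≫ e₁ ◁ β') := by
        rw [whisker_exchange]
    _ = paste n θ (pasteId e₂ m m') n' ≫ e₁ ◁ β' := by
        simp only [paste, pasteId]; bicategory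

end paste

section equivalence

variable {a b c : C} (e : a ≌ b)

instance : (precomp c e.hom).IsEquivalence :=
  (CategoryTheory.Equivalence.mk (precomp c e.hom) (precomp c e.inv)
    (NatIso.ofComponents (fun f ↦ (leftUnitor f).symm ≪≫ whiskerRightIso e.counit.symm f ≪≫
      associator _ _ _) (fun {f g} η ↦ by
        change η ≫ (leftUnitor g).inv ≫ e.counit.inv ▷ g ≫ (associator _ _ _).hom =
          ((leftUnitor f).inv ≫ e.counit.inv ▷ f ≫ (associator _ _ _).hom) ≫ e.inv ◁ e.hom ◁ η
        rw [leftUnitor_inv_naturality_assoc, whisker_exchange_assoc, associator_naturality_right]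
        simp only [Category.assoc]))
    (NatIso.ofComponents (fun f ↦ (associator _ _ _).symm ≪≫ whiskerRightIso e.unit.symm f ≪≫
      leftUnitor f) (fun {f g} η ↦ by
        change e.hom ◁ e.inv ◁ η ≫ (associator _ _ _).inv ≫ e.unit.inv ▷ g ≫ (leftUnitor g).hom =
          ((associator _ _ _).inv ≫ e.unit.inv ▷ f ≫ (leftUnitor f).hom) ≫ η
        rw [associator_inv_naturality_right_assoc, whisker_exchange_assoc,
          leftUnitor_naturality]
        simp only [Category.assoc]))).isEquivalence_functor

instance : (postcomp c e.hom).IsEquivalence :=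
  (CategoryTheory.Equivalence.mk (postcomp c e.hom) (postcomp c e.inv)
    (NatIso.ofComponents (fun f ↦ (rightUnitor f).symm ≪≫ whiskerLeftIso f e.unit ≪≫
      (associator _ _ _).symm) (fun {f g} η ↦ by
        change η ≫ (rightUnitor g).inv ≫ g ◁ e.unit.hom ≫ (associator _ _ _).inv =
          ((rightUnitor f).inv ≫ f ◁ e.unit.hom ≫ (associator _ _ _).inv) ≫ (η ▷ e.hom) ▷ e.inv
        rw [rightUnitor_inv_naturality_assoc, ← whisker_exchange_assoc,
          associator_inv_naturality_left]
        simp only [Category.assoc]))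
    (NatIso.ofComponents (fun f ↦ associator _ _ _ ≪≫ whiskerLeftIso f e.counit ≪≫
      rightUnitor f) (fun {f g} η ↦ by
        change (η ▷ e.inv) ▷ e.hom ≫ (associator _ _ _).hom ≫ g ◁ e.counit.hom ≫
          (rightUnitor g).hom =
          ((associator _ _ _).hom ≫ f ◁ e.counit.hom ≫ (rightUnitor f).hom) ≫ η
        rw [associator_naturality_left_assoc, ← whisker_exchange_assoc, rightUnitor_naturality]
        simp only [Category.assoc]))).isEquivalence_functor

end equivalence

end CategoryTheory.Bicategory

/-! ### The comparison of two 2-categories over a common bicategory -/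

open Bicategory in
/-- The objects of the comparison 2-category of two pseudofunctors `F` and `G` to a common
bicategory: the pairs of objects whose images are equivalent. -/
structure Comparison {B B' : Type u} [Bicategory.{u, u} B] [Bicategory.{u, u} B'] {C : Type*}
    [Bicategory C] (F : Pseudofunctor B C) (G : Pseudofunctor B' C) : Type u where
  fst : B
  snd : B'
  nonempty : Nonempty (Bicategory.Equivalence (F.obj fst) (G.obj snd))

namespace Comparison

open Bicategory

section

variable {B B' : Type u} [Bicategory.{u, u} B] [Bicategory.{u, u} B'] {C : Type wt}
  [Bicategory.{v, w} C] {F : Pseudofunctor B C} {G : Pseudofunctor B' C}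

/-- A chosen equivalence between the images of a pair of objects. -/
noncomputable def equiv (o : Comparison F G) : Bicategory.Equivalence (F.obj o.fst) (G.obj o.snd) :=
  o.nonempty.some

/-- The underlying morphism of the chosen equivalence. -/
noncomputable abbrev e (o : Comparison F G) : F.obj o.fst ⟶ G.obj o.snd := o.equiv.hom

/-- An invertible square comparing the images of a pair of morphisms. -/
abbrev Square {o₁ o₂ : Comparison F G} (p : o₁.fst ⟶ o₂.fst) (p' : o₁.snd ⟶ o₂.snd) :=
  F.map p ≫ o₂.e ≅ o₁.e ≫ G.map p'

/-- The compatibility of a pair of 2-cells with squares. -/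
def Compat {o₁ o₂ : Comparison F G} {p q : o₁.fst ⟶ o₂.fst} {p' q' : o₁.snd ⟶ o₂.snd}
    (α : p ⟶ q) (α' : p' ⟶ q') (θ : Square p p') (η : Square q q') : Prop :=
  F.map₂ α ▷ o₂.e ≫ η.hom = θ.hom ≫ o₁.e ◁ G.map₂ α'

section squares

variable {o₁ o₂ o₃ o₄ : Comparison F G}

/-- The identity square. -/
noncomputable def squareId (o : Comparison F G) : Square (𝟙 o.fst) (𝟙 o.snd) :=
  whiskerRightIso (F.mapId o.fst) o.e ≪≫ leftUnitor o.e ≪≫ (rightUnitor o.e).symm ≪≫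
    whiskerLeftIso o.e (G.mapId o.snd).symm

/-- The composite of two squares. -/
noncomputable def squareComp {p : o₁.fst ⟶ o₂.fst} {p' : o₁.snd ⟶ o₂.snd} {q : o₂.fst ⟶ o₃.fst}
    {q' : o₂.snd ⟶ o₃.snd} (θ : Square p p') (η : Square q q') : Square (p ≫ q) (p' ≫ q') :=
  whiskerRightIso (F.mapComp p q) o₃.e ≪≫ Bicategory.associator _ _ _ ≪≫
    whiskerLeftIso (F.map p) η ≪≫ (Bicategory.associator _ _ _).symm ≪≫
    whiskerRightIso θ (G.map q') ≪≫ Bicategory.associator _ _ _ ≪≫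
    whiskerLeftIso o₁.e (G.mapComp p' q').symm

variable {p q r : o₁.fst ⟶ o₂.fst} {p' q' r' : o₁.snd ⟶ o₂.snd}

lemma compat_id (θ : Square p p') : Compat (𝟙 p) (𝟙 p') θ θ := by
  simp [Compat]

lemma Compat.comp {α : p ⟶ q} {α' : p' ⟶ q'} {β : q ⟶ r} {β' : q' ⟶ r'} {θ : Square p p'}
    {η : Square q q'} {κ : Square r r'} (h : Compat α α' θ η) (h' : Compat β β' η κ) :
    Compat (α ≫ β) (α' ≫ β') θ κ := by
  unfold Compat at *
  rw [F.map₂_comp, G.map₂_comp, Bicategory.comp_whiskerRight, Category.assoc, h', reassoc_of% h,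
    Bicategory.whiskerLeft_comp]

lemma Compat.inv {α : p ≅ q} {α' : p' ≅ q'} {θ : Square p p'} {η : Square q q'}
    (h : Compat α.hom α'.hom θ η) : Compat α.inv α'.inv η θ := by
  have h₁ : F.map₂ α.inv ▷ o₂.e ≫ F.map₂ α.hom ▷ o₂.e = 𝟙 _ := by
    rw [← Bicategory.comp_whiskerRight, ← F.map₂_comp, α.inv_hom_id, F.map₂_id,
      Bicategory.id_whiskerRight]
  have h₂ : o₁.e ◁ G.map₂ α'.hom ≫ o₁.e ◁ G.map₂ α'.inv = 𝟙 _ := by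
    rw [← Bicategory.whiskerLeft_comp, ← G.map₂_comp, α'.hom_inv_id, G.map₂_id,
      Bicategory.whiskerLeft_id]
  unfold Compat at *
  calc F.map₂ α.inv ▷ o₂.e ≫ θ.hom
      = F.map₂ α.inv ▷ o₂.e ≫ (θ.hom ≫ o₁.e ◁ G.map₂ α'.hom) ≫ o₁.e ◁ G.map₂ α'.inv := by
        rw [Category.assoc, h₂, Category.comp_id]
    _ = η.hom ≫ o₁.e ◁ G.map₂ α'.inv := by
        rw [← h, Category.assoc, reassoc_of% h₁]

lemma Compat.whiskerLeft {s t : o₂.fst ⟶ o₃.fst} {s' t' : o₂.snd ⟶ o₃.snd} (θ : Square p p')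
    {β : s ⟶ t} {β' : s' ⟶ t'} {η : Square s s'} {κ : Square t t'} (h : Compat β β' η κ) :
    Compat (p ◁ β) (p' ◁ β') (squareComp θ η) (squareComp θ κ) :=
  paste_whiskerLeft h (by simp) (by simp)

lemma Compat.whiskerRight {α : p ⟶ q} {α' : p' ⟶ q'} {θ : Square p p'} {η : Square q q'}
    (h : Compat α α' θ η) {s : o₂.fst ⟶ o₃.fst} {s' : o₂.snd ⟶ o₃.snd} (κ : Square s s') :
    Compat (α ▷ s) (α' ▷ s') (squareComp θ κ) (squareComp η κ) :=
  paste_whiskerRight h (by simp) (by simp)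

lemma compat_associator (θ : Square p p') {s : o₂.fst ⟶ o₃.fst} {s' : o₂.snd ⟶ o₃.snd}
    (η : Square s s') {t : o₃.fst ⟶ o₄.fst} {t' : o₃.snd ⟶ o₄.snd} (κ : Square t t') :
    Compat (Bicategory.associator p s t).hom (Bicategory.associator p' s' t').hom
      (squareComp (squareComp θ η) κ) (squareComp θ (squareComp η κ)) :=
  paste_assoc (by simp) (by simp)

lemma compat_leftUnitor (θ : Square p p') :
    Compat (leftUnitor p).hom (leftUnitor p').hom (squareComp (squareId o₁) θ) θ :=
  pasteId_paste (by simp) (by simp)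

lemma compat_rightUnitor (θ : Square p p') :
    Compat (rightUnitor p).hom (rightUnitor p').hom (squareComp θ (squareId o₂)) θ :=
  paste_pasteId (by simp) (by simp)

end squares

variable [∀ x y : C, LocallySmall.{u} (x ⟶ y)]

instance {x y : C} (f g : x ⟶ y) : Small.{u} (f ≅ g) :=
  small_of_injective (β := f ⟶ g) (f := Iso.hom) fun _ _ h ↦ Iso.ext h

/-- The morphisms of the comparison 2-category: pairs of morphisms with an invertible square. -/
structure Hom (o₁ o₂ : Comparison F G) : Type u where
  fst : o₁.fst ⟶ o₂.fst
  snd : o₁.snd ⟶ o₂.snd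
  square : Shrink.{u} (Square fst snd)

namespace Hom

variable {o₁ o₂ o₃ : Comparison F G}

/-- The invertible square of a morphism. -/
noncomputable def iso (f : Hom o₁ o₂) : Square f.fst f.snd := (equivShrink _).symm f.square

/-- The morphism given by an invertible square. -/
noncomputable def ofSquare {p : o₁.fst ⟶ o₂.fst} {p' : o₁.snd ⟶ o₂.snd} (θ : Square p p') :
    Hom o₁ o₂ := ⟨p, p', equivShrink _ θ⟩

lemma iso_ofSquare {p : o₁.fst ⟶ o₂.fst} {p' : o₁.snd ⟶ o₂.snd} (θ : Square p p') :
    (ofSquare θ).iso = θ := Equiv.symm_apply_apply _ _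

lemma ext_of_compat {f g : Hom o₁ o₂} (h : f.fst = g.fst) (h' : f.snd = g.snd)
    (H : Compat (eqToHom h) (eqToHom h') f.iso g.iso) : f = g := by
  obtain ⟨p, p', θ⟩ := f
  obtain ⟨q, q', η⟩ := g
  dsimp only at h h'
  subst h h'
  have : (equivShrink _).symm θ = (equivShrink _).symm η := by
    apply Iso.ext
    simpa [Compat, iso] using H.symm
  rw [(equivShrink _).symm.injective this]

end Hom

/-- The 2-cells of the comparison 2-category: compatible pairs of 2-cells. -/
structure Cell {o₁ o₂ : Comparison F G} (f g : Hom o₁ o₂) : Type u where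
  fst : f.fst ⟶ g.fst
  snd : f.snd ⟶ g.snd
  compat : Compat fst snd f.iso g.iso

variable {o₁ o₂ o₃ o₄ : Comparison F G}

lemma Cell.ext' {f g : Hom o₁ o₂} {α β : Cell f g} (h : α.fst = β.fst) (h' : α.snd = β.snd) :
    α = β := by
  cases α; cases β; cases h; cases h'; rfl

instance : Category.{u} (Hom o₁ o₂) where
  Hom f g := Cell f g
  id f := ⟨𝟙 f.fst, 𝟙 f.snd, compat_id f.iso⟩
  comp α β := ⟨α.fst ≫ β.fst, α.snd ≫ β.snd, α.compat.comp β.compat⟩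
  id_comp α := Cell.ext' (Category.id_comp _) (Category.id_comp _)
  comp_id α := Cell.ext' (Category.comp_id _) (Category.comp_id _)
  assoc α β γ := Cell.ext' (Category.assoc _ _ _) (Category.assoc _ _ _)

/-- Construction of invertible 2-cells. -/
def mkIso {f g : Hom o₁ o₂} (α : f.fst ≅ g.fst) (α' : f.snd ≅ g.snd)
    (h : Compat α.hom α'.hom f.iso g.iso) : f ≅ g where
  hom := (⟨α.hom, α'.hom, h⟩ : Cell f g)
  inv := (⟨α.inv, α'.inv, h.inv⟩ : Cell g f)
  hom_inv_id := Cell.ext' α.hom_inv_id α'.hom_inv_id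
  inv_hom_id := Cell.ext' α.inv_hom_id α'.inv_hom_id

/-- The identity morphisms. -/
noncomputable def id (o : Comparison F G) : Hom o o := .ofSquare (squareId o)

/-- The composition of morphisms. -/
noncomputable def comp (f : Hom o₁ o₂) (g : Hom o₂ o₃) : Hom o₁ o₃ :=
  .ofSquare (squareComp f.iso g.iso)

lemma iso_id (o : Comparison F G) : (id o).iso = squareId o := Hom.iso_ofSquare _

lemma iso_comp (f : Hom o₁ o₂) (g : Hom o₂ o₃) : (comp f g).iso = squareComp f.iso g.iso :=
  Hom.iso_ofSquare _

lemma associator_compat (f : Hom o₁ o₂) (g : Hom o₂ o₃) (h : Hom o₃ o₄) :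
    Compat (Bicategory.associator f.fst g.fst h.fst).hom
        (Bicategory.associator f.snd g.snd h.snd).hom
      (comp (comp f g) h).iso (comp f (comp g h)).iso := by
  have e₁ : (comp (comp f g) h).iso = squareComp (squareComp f.iso g.iso) h.iso :=
    (iso_comp _ _).trans (congr_arg (squareComp · h.iso) (iso_comp f g))
  have e₂ : (comp f (comp g h)).iso = squareComp f.iso (squareComp g.iso h.iso) :=
    (iso_comp _ _).trans (congr_arg (squareComp f.iso ·) (iso_comp g h))
  exact (congr_arg₂ (Compat _ _) e₁ e₂).mpr (compat_associator _ _ _)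

lemma leftUnitor_compat (f : Hom o₁ o₂) :
    Compat (leftUnitor f.fst).hom (leftUnitor f.snd).hom (comp (id o₁) f).iso f.iso := by
  have e₁ : (comp (id o₁) f).iso = squareComp (squareId o₁) f.iso :=
    (iso_comp _ _).trans (congr_arg (squareComp · f.iso) (iso_id o₁))
  exact (congr_arg (Compat _ _ · _) e₁).mpr (compat_leftUnitor _)

lemma rightUnitor_compat (f : Hom o₁ o₂) :
    Compat (rightUnitor f.fst).hom (rightUnitor f.snd).hom (comp f (id o₂)).iso f.iso := by
  have e₁ : (comp f (id o₂)).iso = squareComp f.iso (squareId o₂) :=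
    (iso_comp _ _).trans (congr_arg (squareComp f.iso ·) (iso_id o₂))
  exact (congr_arg (Compat _ _ · _) e₁).mpr (compat_rightUnitor _)

/-- Whiskering of 2-cells. -/
noncomputable def whiskerL (f : Hom o₁ o₂) {g h : Hom o₂ o₃} (β : g ⟶ h) : comp f g ⟶ comp f h :=
  (⟨f.fst ◁ Cell.fst β, f.snd ◁ Cell.snd β, (congr_arg₂ (Compat _ _) (iso_comp _ _)
    (iso_comp _ _)).mpr (Compat.whiskerLeft f.iso (Cell.compat β))⟩ : Cell _ _)

/-- Whiskering of 2-cells. -/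
noncomputable def whiskerR {f g : Hom o₁ o₂} (α : f ⟶ g) (h : Hom o₂ o₃) : comp f h ⟶ comp g h :=
  (⟨Cell.fst α ▷ h.fst, Cell.snd α ▷ h.snd, (congr_arg₂ (Compat _ _) (iso_comp _ _)
    (iso_comp _ _)).mpr ((Cell.compat α).whiskerRight h.iso)⟩ : Cell _ _)

noncomputable instance : Bicategory.{u, u} (Comparison F G) where
  Hom := Hom
  id := id
  comp := comp
  whiskerLeft f _ _ β := whiskerL f β
  whiskerRight α h := whiskerR α h
  associator f g h := mkIso (Bicategory.associator f.fst g.fst h.fst)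
    (Bicategory.associator f.snd g.snd h.snd)
    (associator_compat f g h)
  leftUnitor f := mkIso (leftUnitor f.fst) (leftUnitor f.snd) (leftUnitor_compat f)
  rightUnitor f := mkIso (rightUnitor f.fst) (rightUnitor f.snd) (rightUnitor_compat f)
  whiskerLeft_id f g := Cell.ext' (Bicategory.whiskerLeft_id _ _) (Bicategory.whiskerLeft_id _ _)
  whiskerLeft_comp f _ _ _ α β :=
    Cell.ext' (Bicategory.whiskerLeft_comp _ _ _) (Bicategory.whiskerLeft_comp _ _ _)
  id_whiskerLeft α := Cell.ext' (Bicategory.id_whiskerLeft _) (Bicategory.id_whiskerLeft _)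
  comp_whiskerLeft f g _ _ α :=
    Cell.ext' (Bicategory.comp_whiskerLeft _ _ _) (Bicategory.comp_whiskerLeft _ _ _)
  id_whiskerRight f g := Cell.ext' (Bicategory.id_whiskerRight _ _) (Bicategory.id_whiskerRight _ _)
  comp_whiskerRight α β g :=
    Cell.ext' (Bicategory.comp_whiskerRight _ _ _) (Bicategory.comp_whiskerRight _ _ _)
  whiskerRight_id α := Cell.ext' (Bicategory.whiskerRight_id _) (Bicategory.whiskerRight_id _)
  whiskerRight_comp α f g :=
    Cell.ext' (Bicategory.whiskerRight_comp _ _ _) (Bicategory.whiskerRight_comp _ _ _)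
  whisker_assoc f _ _ α g := Cell.ext' (Bicategory.whisker_assoc _ _ _)
    (Bicategory.whisker_assoc _ _ _)
  whisker_exchange α β :=
    Cell.ext' (Bicategory.whisker_exchange _ _) (Bicategory.whisker_exchange _ _)
  pentagon f g h i := Cell.ext' (Bicategory.pentagon _ _ _ _) (Bicategory.pentagon _ _ _ _)
  triangle f g := Cell.ext' (Bicategory.triangle _ _) (Bicategory.triangle _ _)

variable [Bicategory.Strict B] [Bicategory.Strict B']

lemma mkIso_eq_eqToIso {f g : Hom o₁ o₂} {α : f.fst ≅ g.fst} {α' : f.snd ≅ g.snd}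
    {h : Compat α.hom α'.hom f.iso g.iso} (e : f.fst = g.fst) (e' : f.snd = g.snd)
    (hα : α = eqToIso e) (hα' : α' = eqToIso e') :
    ∃ e : f = g, mkIso α α' h = eqToIso e := by
  subst hα hα'
  obtain rfl : f = g := Hom.ext_of_compat e e' h
  exact ⟨rfl, Iso.ext (Cell.ext' rfl rfl)⟩

/-- Strictness of the comparison 2-category: its unitors and associators are equalities, because they
are so in both factors. -/
lemma exists_leftUnitor (f : Hom o₁ o₂) : ∃ e : comp (id o₁) f = f,
    mkIso (leftUnitor f.fst) (leftUnitor f.snd) (leftUnitor_compat f) = eqToIso e :=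
  mkIso_eq_eqToIso (Strict.id_comp _) (Strict.id_comp _) (Strict.leftUnitor_eqToIso _)
    (Strict.leftUnitor_eqToIso _)

lemma exists_rightUnitor (f : Hom o₁ o₂) : ∃ e : comp f (id o₂) = f,
    mkIso (rightUnitor f.fst) (rightUnitor f.snd) (rightUnitor_compat f) = eqToIso e :=
  mkIso_eq_eqToIso (Strict.comp_id _) (Strict.comp_id _) (Strict.rightUnitor_eqToIso _)
    (Strict.rightUnitor_eqToIso _)

lemma exists_associator (f : Hom o₁ o₂) (g : Hom o₂ o₃) (h : Hom o₃ o₄) :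
    ∃ e : comp (comp f g) h = comp f (comp g h), mkIso (Bicategory.associator f.fst g.fst h.fst)
      (Bicategory.associator f.snd g.snd h.snd) (associator_compat f g h) = eqToIso e :=
  mkIso_eq_eqToIso (Strict.assoc _ _ _) (Strict.assoc _ _ _) (Strict.associator_eqToIso _ _ _)
    (Strict.associator_eqToIso _ _ _)

instance : Bicategory.Strict (Comparison F G) where
  id_comp f := (exists_leftUnitor f).choose
  comp_id f := (exists_rightUnitor f).choose
  assoc f g h := (exists_associator f g h).choose
  leftUnitor_eqToIso f := (exists_leftUnitor f).choose_spec
  rightUnitor_eqToIso f := (exists_rightUnitor f).choose_spec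
  associator_eqToIso f g h := (exists_associator f g h).choose_spec

variable (F G)

/-- The first projection of the comparison 2-category. -/
noncomputable def fstFunctor : TwoFunctor (Comparison F G) B where
  obj o := o.fst
  map f := Hom.fst f
  map₂ α := Cell.fst α
  map_id _ := rfl
  map_comp _ _ := rfl
  map₂_id _ := rfl
  map₂_comp _ _ := rfl
  map₂_vcomp _ _ := HEq.rfl

/-- The second projection of the comparison 2-category. -/
noncomputable def sndFunctor : TwoFunctor (Comparison F G) B' where
  obj o := o.snd
  map f := Hom.snd f
  map₂ α := Cell.snd α
  map_id _ := rfl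
  map_comp _ _ := rfl
  map₂_id _ := rfl
  map₂_comp _ _ := rfl
  map₂_vcomp _ _ := HEq.rfl

variable {F G} (hF : IsBiequivalence F) (hG : IsBiequivalence G)

include hG in
/-- If `G` is a biequivalence, then the first projection is surjective on objects, full on morphisms
and fully faithful on 2-cells, because composition with an equivalence is an equivalence of
hom-categories. -/
lemma nonempty_homotopyEquiv_fst : Nonempty (ContinuousMap.HomotopyEquiv
    (twoCatRealisation (Comparison F G)) (twoCatRealisation B)) := by
  have K (o₁ o₂ : Comparison F G) : (G.mapFunctor o₁.snd o₂.snd ⋙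
      precomp (G.obj o₂.snd) o₁.equiv.hom).IsEquivalence := by
    have := hG.1 o₁.snd o₂.snd
    infer_instance
  refine (fstFunctor F G).nonempty_homotopyEquiv (fun b ↦ ?_) (fun o₁ o₂ p ↦ ?_) ?_
  · obtain ⟨b', ⟨e⟩⟩ := hG.2 (F.obj b)
    exact ⟨⟨b, b', ⟨.mkOfAdjointifyCounit e.counit.symm e.unit.symm⟩⟩, rfl⟩
  · have := K o₁ o₂
    obtain ⟨p', ⟨θ⟩⟩ := Functor.EssSurj.mem_essImage (F := G.mapFunctor o₁.snd o₂.snd ⋙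
      precomp (G.obj o₂.snd) o₁.equiv.hom) (F.map p ≫ o₂.e)
    exact ⟨Hom.ofSquare (p := p) (p' := p') θ.symm, rfl⟩
  · intro o₁ o₂ f g
    have := K o₁ o₂
    refine ⟨fun α β h ↦ Cell.ext' h ((G.mapFunctor o₁.snd o₂.snd ⋙
      precomp (G.obj o₂.snd) o₁.equiv.hom).map_injective ?_), fun α ↦ ?_⟩
    · refine (cancel_epi (Hom.iso f).hom).1 ?_
      refine (Cell.compat α).symm.trans (Eq.trans ?_ (Cell.compat β))
      exact congr_arg (fun γ ↦ F.map₂ γ ▷ o₂.e ≫ (Hom.iso g).hom) h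
    · obtain ⟨α', h⟩ := (G.mapFunctor o₁.snd o₂.snd ⋙
        precomp (G.obj o₂.snd) o₁.equiv.hom).map_surjective
          ((Hom.iso f).inv ≫ F.map₂ α ▷ o₂.e ≫ (Hom.iso g).hom)
      exact ⟨(⟨α, α', (Iso.inv_comp_eq _).1 h.symm⟩ : Cell _ _), rfl⟩

include hF in
lemma nonempty_homotopyEquiv_snd : Nonempty (ContinuousMap.HomotopyEquiv
    (twoCatRealisation (Comparison F G)) (twoCatRealisation B')) := by
  have K (o₁ o₂ : Comparison F G) : (F.mapFunctor o₁.fst o₂.fst ⋙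
      postcomp (F.obj o₁.fst) o₂.equiv.hom).IsEquivalence := by
    have := hF.1 o₁.fst o₂.fst
    infer_instance
  refine (sndFunctor F G).nonempty_homotopyEquiv (fun b ↦ ?_) (fun o₁ o₂ p ↦ ?_) ?_
  · obtain ⟨b', e⟩ := hF.2 (G.obj b)
    exact ⟨⟨b', b, e⟩, rfl⟩
  · have := K o₁ o₂
    obtain ⟨p', ⟨θ⟩⟩ := Functor.EssSurj.mem_essImage (F := F.mapFunctor o₁.fst o₂.fst ⋙
      postcomp (F.obj o₁.fst) o₂.equiv.hom) (o₁.e ≫ G.map p)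
    exact ⟨Hom.ofSquare (p := p') (p' := p) θ, rfl⟩
  · intro o₁ o₂ f g
    have := K o₁ o₂
    refine ⟨fun α β h ↦ Cell.ext' ((F.mapFunctor o₁.fst o₂.fst ⋙
      postcomp (F.obj o₁.fst) o₂.equiv.hom).map_injective ?_) h, fun α ↦ ?_⟩
    · refine (cancel_mono (Hom.iso g).hom).1 ?_
      refine (Cell.compat α).trans (Eq.trans ?_ (Cell.compat β).symm)
      exact congr_arg (fun γ ↦ (Hom.iso f).hom ≫ o₁.e ◁ G.map₂ γ) h
    · obtain ⟨α', h⟩ := (F.mapFunctor o₁.fst o₂.fst ⋙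
        postcomp (F.obj o₁.fst) o₂.equiv.hom).map_surjective
          (((Hom.iso f).hom ≫ o₁.e ◁ G.map₂ α) ≫ (Hom.iso g).inv)
      exact ⟨(⟨α', α, (Iso.eq_comp_inv _).1 h⟩ : Cell _ _), rfl⟩

include hF hG in
/-- Small strict 2-categories with biequivalences to a common bicategory have homotopy equivalent
realisations. -/
lemma nonempty_homotopyEquiv :
    Nonempty (ContinuousMap.HomotopyEquiv (twoCatRealisation B) (twoCatRealisation B')) := by
  obtain ⟨e⟩ := nonempty_homotopyEquiv_fst (F := F) hG
  obtain ⟨e'⟩ := nonempty_homotopyEquiv_snd (G := G) hF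
  exact ⟨e.symm.trans e'⟩

end

end Comparison

/-! ### Functoriality of the action Q-construction -/

section

universe u' v' w' wt'

open Functor.LaxMonoidal Functor.OplaxMonoidal MonoidalLeftAction

/-- A functor `Y ⥤ X` which is equivariant, up to coherent isomorphism, along a monoidal functor
`Ψ : N ⥤ M`. -/
structure EquivariantFunctor {N : Type u'} [Category.{v'} N] [MonoidalCategory N] {M : Type u}
    [Category.{v} M] [MonoidalCategory M] (Ψ : N ⥤ M) [Ψ.Monoidal] (Y : Type w')
    [Category.{wt'} Y] [MonoidalLeftAction N Y] (X : Type w) [Category.{wt} X]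
    [MonoidalLeftAction M X] where
  functor : Y ⥤ X
  str (n : N) (y : Y) : Ψ.obj n ⊙ₗ functor.obj y ≅ functor.obj (n ⊙ₗ y)
  naturality_left {n n' : N} (f : n ⟶ n') (y : Y) :
    Ψ.map f ⊵ₗ functor.obj y ≫ (str n' y).hom = (str n y).hom ≫ functor.map (f ⊵ₗ y)
  naturality_right (n : N) {y y' : Y} (g : y ⟶ y') :
    Ψ.obj n ⊴ₗ functor.map g ≫ (str n y').hom = (str n y).hom ≫ functor.map (n ⊴ₗ g)
  unit (y : Y) : ε Ψ ⊵ₗ functor.obj y ≫ (str (𝟙_ N) y).hom ≫ functor.map (λₗ y).hom =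
    (λₗ (functor.obj y)).hom
  assoc (n n' : N) (y : Y) :
    μ Ψ n n' ⊵ₗ functor.obj y ≫ (str (n ⊗ n') y).hom ≫ functor.map (αₗ n n' y).hom =
      (αₗ (Ψ.obj n) (Ψ.obj n') (functor.obj y)).hom ≫ Ψ.obj n ⊴ₗ (str n' y).hom ≫
        (str n (n' ⊙ₗ y)).hom

namespace ActionQ

variable {M : Type u} [Category.{v} M] [MonoidalCategory M] {X : Type w} [Category.{wt} X]
  [MonoidalLeftAction M X]

/-- A 2-cell of `Q(M, X)` is invertible if the underlying morphism of `M` is. -/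
def Cell.mkIso {x y : X} {p q : LaxVer M x y} (e : p.obj ≅ q.obj)
    (h : e.hom ⊵ₗ x ≫ q.hom = p.hom) : p ≅ q where
  hom := (⟨e.hom, h⟩ : Cell p q)
  inv := (⟨e.inv, by rw [← h, inv_hom_actionHomLeft_assoc]⟩ : Cell q p)
  hom_inv_id := Cell.ext_hom e.hom_inv_id
  inv_hom_id := Cell.ext_hom e.inv_hom_id

variable [StrictMonoidal M] {x y z t : X}

lemma assoc_hom (p : LaxVer M x y) (q : LaxVer M y z) (r : LaxVer M z t) :
    Cell.hom (eqToHom (p.assoc q r)) = (α_ r.obj q.obj p.obj).inv := by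
  rw [eqToHom_hom, StrictMonoidal.associator_eq, eqToIso.inv]; rfl

lemma id_comp_hom (p : LaxVer M x y) :
    Cell.hom (eqToHom p.id_comp) = (ρ_ p.obj).hom := by
  rw [eqToHom_hom, StrictMonoidal.rightUnitor_eq, eqToIso.hom]; rfl

lemma comp_id_hom (p : LaxVer M x y) :
    Cell.hom (eqToHom p.comp_id) = (λ_ p.obj).hom := by
  rw [eqToHom_hom, StrictMonoidal.leftUnitor_eq, eqToIso.hom]; rfl

/-- The 1-cell `(e, f)` of `Q(M, X)` given by a morphism `f` of `X`. -/
def ofHom (f : x ⟶ y) : LaxVer M x y := ⟨𝟙_ M, (λₗ x).hom ≫ f⟩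

lemma ofHom_comp_ofHom (f : x ⟶ y) (g : y ⟶ x) (h : f ≫ g = 𝟙 x) :
    (ofHom (M := M) f).comp (ofHom g) = LaxVer.id M x := by
  refine Eq.trans ?_ (LaxVer.comp_id (LaxVer.id M x))
  refine LaxVer.ext_of_eq rfl ?_
  change (αₗ (𝟙_ M) (𝟙_ M) x).hom ≫ 𝟙_ M ⊴ₗ ((λₗ x).hom ≫ f) ≫ (λₗ y).hom ≫ g =
    𝟙 _ ≫ (αₗ (𝟙_ M) (𝟙_ M) x).hom ≫ 𝟙_ M ⊴ₗ (λₗ x).hom ≫ (λₗ x).hom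
  simp [h]

/-- Isomorphic objects of `X` are equivalent in `Q(M, X)`. -/
def equivalenceOfIso (e : x ≅ y) :
    Bicategory.Equivalence (⟨x⟩ : ActionQ M X) ⟨y⟩ :=
  Bicategory.Equivalence.mkOfAdjointifyCounit (f := ofHom e.hom) (g := ofHom e.inv)
    (eqToIso (ofHom_comp_ofHom e.hom e.inv e.hom_inv_id).symm)
    (eqToIso (ofHom_comp_ofHom e.inv e.hom e.inv_hom_id))

end ActionQ

namespace EquivariantFunctor

variable {N : Type u'} [Category.{v'} N] [MonoidalCategory N] {M : Type u}
    [Category.{v} M] [MonoidalCategory M] {Ψ : N ⥤ M} [Ψ.Monoidal] {Y : Type w'}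
    [Category.{wt'} Y] [MonoidalLeftAction N Y] {X : Type w} [Category.{wt} X]
    [MonoidalLeftAction M X] (K : EquivariantFunctor Ψ Y X)

/-- The image of a 1-cell under an equivariant functor. -/
def mapVer {x y : Y} (p : LaxVer N x y) : LaxVer M (K.functor.obj x) (K.functor.obj y) :=
  ⟨Ψ.obj p.obj, (K.str p.obj x).hom ≫ K.functor.map p.hom⟩

/-- The functor on hom-categories induced by an equivariant functor. -/
def homFunctor (x y : Y) : LaxVer N x y ⥤ LaxVer M (K.functor.obj x) (K.functor.obj y) where
  obj p := K.mapVer p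
  map {p q} α := (⟨Ψ.map (ActionQ.Cell.hom α), by
    simp only [mapVer]
    rw [reassoc_of% K.naturality_left, ← K.functor.map_comp, ActionQ.Cell.comm]⟩ :
    ActionQ.Cell (K.mapVer p) (K.mapVer q))
  map_id p := ActionQ.Cell.ext_hom (Ψ.map_id _)
  map_comp α β := ActionQ.Cell.ext_hom (Ψ.map_comp _ _)

/-- The comparison of identity 1-cells. -/
def mapIdIso (x : Y) : K.mapVer (LaxVer.id N x) ≅ LaxVer.id M (K.functor.obj x) :=
  ActionQ.Cell.mkIso (Functor.Monoidal.εIso Ψ).symm (by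
    simp only [mapVer, LaxVer.id, Iso.symm_hom]
    rw [← K.unit, ← comp_actionHomLeft_assoc]
    simp)

/-- The comparison of composite 1-cells. -/
def mapCompIso {x y z : Y} (p : LaxVer N x y) (q : LaxVer N y z) :
    K.mapVer (p.comp q) ≅ (K.mapVer p).comp (K.mapVer q) :=
  ActionQ.Cell.mkIso (Functor.Monoidal.μIso Ψ _ _).symm (by
    simp only [mapVer, LaxVer.comp, Iso.symm_hom, Functor.map_comp, actionHomRight_comp,
      Category.assoc]
    rw [reassoc_of% K.naturality_right, ← reassoc_of% K.assoc, ← comp_actionHomLeft_assoc]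
    simp)

/-- A 2-cell between images is a morphism between objects in the image of `Ψ`, and a 1-cell between
images lifts because its object and its morphism do, up to isomorphism. -/
lemma homFunctor_isEquivalence [Ψ.IsEquivalence] [K.functor.Full] [K.functor.Faithful] (x y : Y) :
    (K.homFunctor x y).IsEquivalence where
  faithful := ⟨fun {p q α β} h ↦ ActionQ.Cell.ext_hom
    (Ψ.map_injective (congr_arg ActionQ.Cell.hom h))⟩
  full := ⟨fun {p q} β ↦ by
    obtain ⟨f, hf⟩ := Ψ.map_surjective (ActionQ.Cell.hom β)
    refine ⟨(⟨f, K.functor.map_injective ?_⟩ : ActionQ.Cell p q), ActionQ.Cell.ext_hom hf⟩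
    have h := ActionQ.Cell.comm β
    rw [← hf] at h
    change Ψ.map f ⊵ₗ K.functor.obj x ≫ (K.str q.obj x).hom ≫ K.functor.map q.hom =
      (K.str p.obj x).hom ≫ K.functor.map p.hom at h
    rw [reassoc_of% K.naturality_left, Iso.cancel_iso_hom_left] at h
    rw [Functor.map_comp, h]⟩
  essSurj := ⟨fun p ↦ by
    refine ⟨⟨Ψ.objPreimage p.obj, K.functor.preimage ((K.str _ x).inv ≫
      (Ψ.objObjPreimageIso p.obj).hom ⊵ₗ K.functor.obj x ≫ p.hom)⟩,
      ⟨ActionQ.Cell.mkIso (Ψ.objObjPreimageIso p.obj) ?_⟩⟩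
    change _ = (K.str _ x).hom ≫ K.functor.map (K.functor.preimage _)
    rw [Functor.map_preimage, Iso.hom_inv_id_assoc]
    rfl⟩

variable [StrictMonoidal N] [StrictMonoidal M]

/-- An equivariant functor induces a pseudofunctor of action Q-constructions. -/
def toPseudofunctor : Pseudofunctor (ActionQ N Y) (ActionQ M X) where
  obj a := ⟨K.functor.obj a.pt⟩
  map {a b} p := K.mapVer p
  map₂ {a b _ _} α := (K.homFunctor a.pt b.pt).map α
  map₂_id p := (K.homFunctor _ _).map_id p
  map₂_comp α β := (K.homFunctor _ _).map_comp α β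
  mapId a := K.mapIdIso a.pt
  mapComp p q := K.mapCompIso p q
  map₂_whisker_left {a b c} p q r η := ActionQ.Cell.ext_hom (by
    change Ψ.map (ActionQ.Cell.hom η ⊗ₘ 𝟙 p.obj) = δ Ψ q.obj p.obj ≫
      (Ψ.map (ActionQ.Cell.hom η) ⊗ₘ 𝟙 (Ψ.obj p.obj)) ≫ μ Ψ r.obj p.obj
    simp)
  map₂_whisker_right {a b c p q} η r := ActionQ.Cell.ext_hom (by
    change Ψ.map (𝟙 r.obj ⊗ₘ ActionQ.Cell.hom η) = δ Ψ r.obj p.obj ≫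
      (𝟙 (Ψ.obj r.obj) ⊗ₘ Ψ.map (ActionQ.Cell.hom η)) ≫ μ Ψ r.obj q.obj
    simp)
  map₂_associator p q r := ActionQ.Cell.ext_hom (by
    refine (congr_arg Ψ.map (ActionQ.assoc_hom p q r)).trans ?_
    change _ = δ Ψ r.obj (q.obj ⊗ p.obj) ≫ (𝟙 (Ψ.obj r.obj) ⊗ₘ δ Ψ q.obj p.obj) ≫
      ActionQ.Cell.hom (eqToHom (LaxVer.assoc (K.mapVer p) (K.mapVer q) (K.mapVer r))) ≫
      (μ Ψ r.obj q.obj ⊗ₘ 𝟙 (Ψ.obj p.obj)) ≫ μ Ψ (r.obj ⊗ q.obj) p.obj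
    have h := Functor.Monoidal.map_associator_inv Ψ r.obj q.obj p.obj
    rw [← id_tensorHom, ← tensorHom_id] at h
    rw [ActionQ.assoc_hom]
    exact h)
  map₂_left_unitor p := ActionQ.Cell.ext_hom (by
    refine (congr_arg Ψ.map (ActionQ.id_comp_hom p)).trans ?_
    change _ = δ Ψ p.obj (𝟙_ N) ≫ (𝟙 (Ψ.obj p.obj) ⊗ₘ η Ψ) ≫
      ActionQ.Cell.hom (eqToHom (LaxVer.id_comp (K.mapVer p)))
    rw [ActionQ.id_comp_hom, id_tensorHom]
    exact Functor.Monoidal.map_rightUnitor Ψ p.obj)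
  map₂_right_unitor p := ActionQ.Cell.ext_hom (by
    refine (congr_arg Ψ.map (ActionQ.comp_id_hom p)).trans ?_
    change _ = δ Ψ (𝟙_ N) p.obj ≫ (η Ψ ⊗ₘ 𝟙 (Ψ.obj p.obj)) ≫
      ActionQ.Cell.hom (eqToHom (LaxVer.comp_id (K.mapVer p)))
    rw [ActionQ.comp_id_hom, tensorHom_id]
    exact Functor.Monoidal.map_leftUnitor Ψ p.obj)

/-- An equivariant equivalence along a monoidal equivalence induces a biequivalence. -/
lemma isBiequivalence_toPseudofunctor [Ψ.IsEquivalence] [K.functor.IsEquivalence] :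
    IsBiequivalence K.toPseudofunctor :=
  ⟨fun a b ↦ K.homFunctor_isEquivalence a.pt b.pt, fun c ↦
    ⟨⟨K.functor.objPreimage c.pt⟩,
      ⟨ActionQ.equivalenceOfIso (K.functor.objObjPreimageIso c.pt)⟩⟩⟩

end EquivariantFunctor

end

/-! ### Functoriality of the two-sided Q-construction -/

section

universe u' v'

open Functor.LaxMonoidal MonoidalLeftAction

variable {N : Type u'} [Category.{v'} N] [MonoidalCategory N] {M : Type u} [Category.{v} M]
  [MonoidalCategory M] (F : N ⥤ M)

/-- The functor of monoidal opposites given by a functor. -/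
def mopMap : Nᴹᵒᵖ ⥤ Mᴹᵒᵖ where
  obj a := .mop (F.obj a.unmop)
  map f := (F.map f.unmop).mop

instance [F.IsEquivalence] : (mopMap F).IsEquivalence where
  faithful := ⟨fun h ↦ Quiver.Hom.unmop_inj (F.map_injective (congr_arg Quiver.Hom.unmop h))⟩
  full := ⟨fun f ↦ ⟨(F.preimage f.unmop).mop, Quiver.Hom.unmop_inj (F.map_preimage f.unmop)⟩⟩
  essSurj := ⟨fun a ↦ ⟨.mop (F.objPreimage a.unmop), ⟨(F.objObjPreimageIso a.unmop).mop⟩⟩⟩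

variable [F.Monoidal]

instance : (mopMap F).Monoidal :=
  Functor.CoreMonoidal.toMonoidal
    { εIso := (Functor.Monoidal.εIso F).mop
      μIso a b := (Functor.Monoidal.μIso F b.unmop a.unmop).mop
      μIso_hom_natural_left f a := Quiver.Hom.unmop_inj (μ_natural_right F a.unmop f.unmop)
      μIso_hom_natural_right a f := Quiver.Hom.unmop_inj (μ_natural_left F f.unmop a.unmop)
      associativity a b c := Quiver.Hom.unmop_inj
        (associativity_inv F c.unmop b.unmop a.unmop)
      left_unitality a := Quiver.Hom.unmop_inj (right_unitality F a.unmop)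
      right_unitality a := Quiver.Hom.unmop_inj (left_unitality F a.unmop) }

/-- The multiplication of a monoidal functor is compatible with the associativity constraint of the
two-sided action. -/
lemma map_twoSidedAssoc (a b m b' a' : N) :
    (μ F a b ⊗ₘ (𝟙 (F.obj m) ⊗ₘ μ F b' a')) ≫ (F.obj (a ⊗ b) ◁ μ F m (b' ⊗ a') ≫
        μ F (a ⊗ b) (m ⊗ (b' ⊗ a'))) ≫ F.map (twoSidedAssoc N a b m b' a').hom =
      (twoSidedAssoc M (F.obj a) (F.obj b) (F.obj m) (F.obj b') (F.obj a')).hom ≫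
        (𝟙 (F.obj a) ⊗ₘ ((F.obj b ◁ μ F m b' ≫ μ F b (m ⊗ b')) ⊗ₘ 𝟙 (F.obj a'))) ≫
          F.obj a ◁ μ F (b ⊗ (m ⊗ b')) a' ≫ μ F a ((b ⊗ (m ⊗ b')) ⊗ a') := by
  simp only [twoSidedAssoc, Iso.trans_hom, whiskerLeftIso_hom, Iso.symm_hom, F.map_comp,
    Functor.Monoidal.map_associator, Functor.Monoidal.map_whiskerLeft,
    Functor.Monoidal.map_associator_inv, Category.assoc, MonoidalCategory.whiskerLeft_comp,
    Functor.Monoidal.μ_δ_assoc, Functor.Monoidal.whiskerLeft_μ_δ_assoc,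
    MonoidalCategory.tensorHom_def, MonoidalCategory.comp_whiskerRight,
    MonoidalCategory.id_whiskerRight, Category.id_comp, MonoidalCategory.whisker_exchange_assoc,
    Functor.Monoidal.whiskerRight_μ_δ_assoc, MonoidalCategory.whiskerLeft_id,
    MonoidalCategory.associator_naturality_right_assoc]
  simp only [← MonoidalCategory.whiskerLeft_comp_assoc, Functor.Monoidal.μ_δ,
    Functor.Monoidal.μ_δ_assoc, MonoidalCategory.whiskerLeft_id, Category.id_comp]
  simp

/-- The multiplication of a monoidal functor is natural for the two-sided action. -/
lemma map_twoSided_naturality {a b c a' b' c' : N} (f : a ⟶ a') (g : b ⟶ b') (h : c ⟶ c') :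
    (F.map f ⊗ₘ (F.map g ⊗ₘ F.map h)) ≫ F.obj a' ◁ μ F b' c' ≫ μ F a' (b' ⊗ c') =
      (F.obj a ◁ μ F b c ≫ μ F a (b ⊗ c)) ≫ F.map (f ⊗ₘ (g ⊗ₘ h)) := by
  rw [Category.assoc, ← μ_natural, tensorHom_comp_whiskerLeft_assoc, μ_natural,
    whiskerLeft_comp_tensorHom_assoc]

/-- A monoidal functor `F` is equivariant for the two-sided actions. -/
def twoSidedEquivariant : EquivariantFunctor (F.prod (mopMap F)) N M where
  functor := F
  str n y := whiskerLeftIso _ (Functor.Monoidal.μIso F _ _) ≪≫ Functor.Monoidal.μIso F _ _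
  naturality_left {n n'} f y := by
    have h := map_twoSided_naturality F f.1 (𝟙 y) f.2.unmop
    rw [F.map_id] at h
    exact h
  naturality_right n {y y'} g := by
    have h := map_twoSided_naturality F (𝟙 n.1) g (𝟙 n.2.unmop)
    rw [F.map_id, F.map_id] at h
    exact h
  unit y := by
    change (ε F ⊗ₘ (𝟙 (F.obj y) ⊗ₘ ε F)) ≫
      (F.obj (𝟙_ N) ◁ μ F y (𝟙_ N) ≫ μ F (𝟙_ N) (y ⊗ 𝟙_ N)) ≫ F.map ((λ_ _).hom ≫ (ρ_ _).hom) =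
      (λ_ _).hom ≫ (ρ_ _).hom
    simp only [F.map_comp, Functor.Monoidal.map_leftUnitor, Functor.Monoidal.map_rightUnitor,
      Category.assoc, Functor.Monoidal.μ_δ_assoc, MonoidalCategory.tensorHom_def,
      MonoidalCategory.id_whiskerRight, Category.id_comp, MonoidalCategory.whisker_exchange_assoc,
      Functor.Monoidal.whiskerRight_ε_η_assoc, MonoidalCategory.leftUnitor_naturality_assoc,
      Functor.Monoidal.whiskerLeft_ε_η_assoc]
  assoc n n' y := map_twoSidedAssoc F n.1 n'.1 y n'.2.unmop n.2.unmop

instance [F.IsEquivalence] : (twoSidedEquivariant F).functor.IsEquivalence :=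
  inferInstanceAs F.IsEquivalence

instance [F.IsEquivalence] : (F.prod (mopMap F)).IsEquivalence :=
  (F.asEquivalence.prod (mopMap F).asEquivalence).isEquivalence_functor

variable [StrictMonoidal N] [StrictMonoidal M]

/-- A monoidal equivalence induces a biequivalence of two-sided Q-constructions. -/
lemma exists_isBiequivalence_qTwo [F.IsEquivalence] :
    ∃ G : Pseudofunctor (QTwo N) (QTwo M), IsBiequivalence G :=
  ⟨_, (twoSidedEquivariant F).isBiequivalence_toPseudofunctor⟩

end

/-! ### Small models of essentially small strict monoidal categories -/

section

variable {M : Type w} [Category.{v} M] [MonoidalCategory M] [StrictMonoidal M]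

/-- In a strict monoidal category, an associator between prescribed values of the products is an
equality morphism. -/
lemma eqToHom_eq_associator {x y z s t p q : M} (h₁ : x ⊗ y = s) (h₂ : s ⊗ z = p)
    (h₃ : y ⊗ z = t) (h₄ : x ⊗ t = q) (h : p = q) :
    eqToHom h = (((eqToIso h₂).symm ≪≫ ((eqToIso h₁).symm ⊗ᵢ Iso.refl z)) ≪≫ α_ x y z ≪≫
      (Iso.refl x ⊗ᵢ eqToIso h₃) ≪≫ eqToIso h₄).hom := by
  subst h₁ h₂ h₃ h₄
  simp [StrictMonoidal.associator_eq]

lemma eqToHom_eq_leftUnitor {x p : M} (h₁ : 𝟙_ M ⊗ x = p) (h : p = x) :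
    eqToHom h = (((eqToIso h₁).symm ≪≫ ((Iso.refl (𝟙_ M)).symm ⊗ᵢ Iso.refl x)) ≪≫ λ_ x).hom := by
  subst h₁
  simp [StrictMonoidal.leftUnitor_eq]

lemma eqToHom_eq_rightUnitor {x p : M} (h₁ : x ⊗ 𝟙_ M = p) (h : p = x) :
    eqToHom h = (((eqToIso h₁).symm ≪≫ (Iso.refl x ⊗ᵢ (Iso.refl (𝟙_ M)).symm)) ≪≫ ρ_ x).hom := by
  subst h₁
  simp [StrictMonoidal.rightUnitor_eq]

end

/-- The objects of a small strict model of an essentially small strict monoidal category: the words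
in a small set of representatives of the objects. -/
structure WordModel (M : Type w) [Category.{v} M] [EssentiallySmall.{u} M] : Type u where
  word : List (SmallModel.{u} M)

namespace WordModel

variable {M : Type w} [Category.{v} M] [MonoidalCategory M] [EssentiallySmall.{u} M]

/-- The object of `M` represented by a word: the product of its letters. -/
noncomputable def eval (l : List (SmallModel.{u} M)) : M :=
  l.foldr (fun s x ↦ (equivSmallModel.{u} M).inverse.obj s ⊗ x) (𝟙_ M)

lemma eval_append [StrictMonoidal M] (l l' : List (SmallModel.{u} M)) :
    eval l ⊗ eval l' = eval (l ++ l') := by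
  induction l with
  | nil => exact StrictMonoidal.unit_tensor _
  | cons s l ih =>
    refine (StrictMonoidal.tensor_assoc _ _ _).trans ?_
    exact congr_arg (_ ⊗ ·) ih

/-- The morphisms between two words are those of the represented objects, made small. -/
noncomputable instance : SmallCategory (WordModel.{u} M) where
  Hom a b := Shrink.{u} (eval a.word ⟶ eval b.word)
  id a := equivShrink _ (𝟙 _)
  comp f g := equivShrink _ ((equivShrink _).symm f ≫ (equivShrink _).symm g)
  id_comp f := by simp
  comp_id f := by simp
  assoc f g h := by simp

variable (M) in
/-- The functor from words to `M` sending a word to the product of its letters. -/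
noncomputable def evalFunctor : WordModel.{u} M ⥤ M where
  obj a := eval a.word
  map f := (equivShrink _).symm f
  map_id a := (equivShrink _).symm_apply_apply _
  map_comp f g := (equivShrink _).symm_apply_apply _

/-- A morphism of `M` between the objects represented by two words. -/
noncomputable def homMk {a b : WordModel.{u} M} (f : eval a.word ⟶ eval b.word) : a ⟶ b :=
  equivShrink _ f

@[simp] lemma evalFunctor_map_homMk {a b : WordModel.{u} M} (f : eval a.word ⟶ eval b.word) :
    (evalFunctor M).map (homMk f) = f :=
  (equivShrink _).symm_apply_apply f

instance : (evalFunctor.{u} M).Faithful := ⟨fun h ↦ (equivShrink _).symm.injective h⟩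

instance : (evalFunctor.{u} M).Full := ⟨fun f ↦ ⟨homMk f, evalFunctor_map_homMk f⟩⟩

instance : (evalFunctor.{u} M).EssSurj :=
  ⟨fun x ↦ ⟨⟨[(equivSmallModel.{u} M).functor.obj x]⟩,
    ⟨ρ_ _ ≪≫ ((equivSmallModel.{u} M).unitIso.app x).symm⟩⟩⟩

instance : (evalFunctor.{u} M).IsEquivalence where

variable [StrictMonoidal M]

/-- Concatenation of words represents the product. -/
noncomputable def evalIso (a b : WordModel.{u} M) :
    eval a.word ⊗ eval b.word ≅ eval (a.word ++ b.word) :=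
  eqToIso (eval_append _ _)

noncomputable instance : MonoidalCategoryStruct (WordModel.{u} M) where
  tensorObj a b := ⟨a.word ++ b.word⟩
  tensorUnit := ⟨[]⟩
  whiskerLeft a b c f := homMk ((evalIso a b).inv ≫ eval a.word ◁ (evalFunctor M).map f ≫
    (evalIso a c).hom)
  whiskerRight {a b} f c := homMk ((evalIso a c).inv ≫ (evalFunctor M).map f ▷ eval c.word ≫
    (evalIso b c).hom)
  tensorHom {a b c d} f g := homMk ((evalIso a c).inv ≫
    ((evalFunctor M).map f ⊗ₘ (evalFunctor M).map g) ≫ (evalIso b d).hom)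
  associator a b c := eqToIso (congr_arg mk (List.append_assoc _ _ _))
  leftUnitor a := eqToIso rfl
  rightUnitor a := eqToIso (congr_arg mk (List.append_nil _))

variable (M) in
/-- The functor from words to `M` preserves the monoidal operations. -/
noncomputable def inducingData : Monoidal.InducingFunctorData (evalFunctor.{u} M) where
  μIso a b := evalIso a b
  εIso := Iso.refl _
  whiskerLeft_eq a _ _ f := evalFunctor_map_homMk _
  whiskerRight_eq f a := evalFunctor_map_homMk _
  tensorHom_eq f g := evalFunctor_map_homMk _
  associator_eq a b c :=
    (eqToHom_map (evalFunctor M) (congr_arg mk (List.append_assoc a.word b.word c.word))).trans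
      (eqToHom_eq_associator (eval_append a.word b.word) (eval_append _ c.word)
        (eval_append b.word c.word) (eval_append a.word _) _)
  leftUnitor_eq a :=
    (eqToHom_map (evalFunctor M) (rfl : (⟨[] ++ a.word⟩ : WordModel.{u} M) = a)).trans
      (eqToHom_eq_leftUnitor (eval_append [] a.word) _)
  rightUnitor_eq a :=
    (eqToHom_map (evalFunctor M) (congr_arg mk (List.append_nil a.word))).trans
      (eqToHom_eq_rightUnitor (eval_append a.word []) _)

noncomputable instance : MonoidalCategory (WordModel.{u} M) :=
  Monoidal.induced (evalFunctor M) (inducingData M)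

noncomputable instance : (evalFunctor.{u} M).Monoidal :=
  Monoidal.fromInducedMonoidal (evalFunctor M) (inducingData M)

instance : StrictMonoidal (WordModel.{u} M) where
  tensor_assoc a b c := congr_arg mk (List.append_assoc _ _ _)
  unit_tensor a := rfl
  tensor_unit a := congr_arg mk (List.append_nil _)
  associator_eq a b c := rfl
  leftUnitor_eq a := rfl
  rightUnitor_eq a := rfl

end WordModel

lemma isMonoidalModel_wordModel (M : Type w) [Category.{v} M] [MonoidalCategory M]
    [StrictMonoidal M] [EssentiallySmall.{u} M] : IsMonoidalModel (WordModel.{u} M) M :=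
  ⟨WordModel.evalFunctor M, ⟨inferInstance⟩, inferInstance⟩

instance {C : Type u} [Category.{v} C] [LocallySmall.{wt} C] : LocallySmall.{wt} Cᴹᵒᵖ where
  hom_small a b := small_of_injective (β := a.unmop ⟶ b.unmop)
    (f := Quiver.Hom.unmop) Quiver.Hom.unmop_inj

instance {M : Type w} [Category.{v} M] [MonoidalCategory M] [StrictMonoidal M]
    [LocallySmall.{u} M] (x y : QTwo M) : LocallySmall.{u} (x ⟶ y) where
  hom_small p q := small_of_injective (β := (p.obj.1 ⟶ q.obj.1) × (p.obj.2 ⟶ q.obj.2))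
    (f := fun α ↦ ActionQ.Cell.hom α) (fun _ _ h ↦ ActionQ.Cell.ext_hom h)

lemma isTwoCatModel_qTwo_wordModel (M : Type w) [Category.{v} M] [MonoidalCategory M]
    [StrictMonoidal M] [EssentiallySmall.{u} M] :
    IsTwoCatModel (QTwo (WordModel.{u} M)) (QTwo M) :=
  exists_isBiequivalence_qTwo (WordModel.evalFunctor M)

/-- Two small 2-categories equivalent to the two-sided Q-construction have homotopy equivalent
realisations; applied to the two-sided Q-construction of a small model of `M`. -/
lemma nonempty_homotopyEquiv_of_models {M : Type w} [Category.{v} M] [MonoidalCategory M]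
    [StrictMonoidal M] [EssentiallySmall.{u} M] {M' : Type u} [SmallCategory M']
    [MonoidalCategory M'] [StrictMonoidal M'] {B : Type u} [Bicategory.{u, u} B]
    [Bicategory.Strict B] (hM : IsMonoidalModel M' M) (hB : IsTwoCatModel B (QTwo M)) :
    Nonempty (ContinuousMap.HomotopyEquiv (twoCatRealisation (QTwo M')) (twoCatRealisation B)) := by
  obtain ⟨F, ⟨_⟩, _⟩ := hM
  obtain ⟨G, hG⟩ := exists_isBiequivalence_qTwo F
  obtain ⟨H, hH⟩ := hB
  exact Comparison.nonempty_homotopyEquiv hG hH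

theorem mainTheorem7 :
    (∀ (M X : Type u) [SmallCategory M] [MonoidalCategory M] [StrictMonoidal M]
      [SmallCategory X] [MonoidalLeftAction M X] [StrictAction M X],
      IsHomotopyEquivalence (strictToLax M X).realisationMap ∧
      IsHomotopyEquivalence (qInclusion M X).realisationMap ∧
      Nonempty (ContinuousMap.HomotopyEquiv (HomotopyQuotient M X)
        (twoCatRealisation (ActionQ M X)))) ∧
    (∀ (M : Type u) [SmallCategory M] [MonoidalCategory M] [StrictMonoidal M],
      Nonempty (ContinuousMap.HomotopyEquiv (ClassifyingSpace M) (twoCatRealisation (QTwo M))) ∧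
      Nonempty (ContinuousMap.HomotopyEquiv (barRealisation M) (twoCatRealisation (QTwo M)))) ∧
    (∀ (M : Type w) [Category.{v} M] [MonoidalCategory M] [StrictMonoidal M]
      [EssentiallySmall.{u} M],
      (∃ (M' : Type u) (_ : SmallCategory M') (_ : MonoidalCategory M') (_ : StrictMonoidal M'),
        IsMonoidalModel M' M) ∧
      (∃ (B : Type u) (_ : Bicategory.{u, u} B) (_ : Bicategory.Strict B),
        IsTwoCatModel B (QTwo M)) ∧
      ∀ (M' : Type u) [SmallCategory M'] [MonoidalCategory M'] [StrictMonoidal M']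
        (B : Type u) [Bicategory.{u, u} B] [Bicategory.Strict B],
        IsMonoidalModel M' M → IsTwoCatModel B (QTwo M) →
        Nonempty (ContinuousMap.HomotopyEquiv (ClassifyingSpace M') (twoCatRealisation B)) ∧
        Nonempty (ContinuousMap.HomotopyEquiv (barRealisation M') (twoCatRealisation B))) := by
  refine ⟨fun M X _ _ _ _ _ _ ↦ ⟨isHomotopyEquivalence_strictToLax M X,
    isHomotopyEquivalence_qInclusion M X, nonempty_homotopyEquiv_homotopyQuotient M X⟩,
    fun M _ _ _ ↦ ⟨nonempty_homotopyEquiv_classifyingSpace M,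
      nonempty_homotopyEquiv_barRealisation M⟩, fun M _ _ _ _ ↦ ?_⟩
  exact ⟨⟨WordModel.{u} M, inferInstance, inferInstance, inferInstance,
      isMonoidalModel_wordModel M⟩,
    ⟨QTwo (WordModel.{u} M), inferInstance, inferInstance, isTwoCatModel_qTwo_wordModel M⟩,
    fun M' _ _ _ B _ _ hM hB ↦ by
      obtain ⟨e⟩ := nonempty_homotopyEquiv_of_models hM hB
      obtain ⟨f⟩ := nonempty_homotopyEquiv_classifyingSpace M'
      obtain ⟨g⟩ := nonempty_homotopyEquiv_barRealisation M'
      exact ⟨⟨f.trans e⟩, ⟨g.trans e⟩⟩⟩
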